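/- For a rooted tree $S$ let $n_S$ be its number of nodes and $l_S$ its number of leaves. Each node carries a label, and for a node $v$ let $\mathrm{path}(v)$ be the sequence of nodes from the root to $v$. The tree path subsequence problem asks, for two rooted labeled trees $P$ and $T$, to determine all pairs $(x,y)$ of a leaf $x$ of $P$ and a leaf $y$ of $T$ such that the label sequence of $\mathrm{path}(x)$ is a (not necessarily contiguous) subsequence of the label sequence of $\mathrm{path}(y)$. The model is the unit-cost word RAM with word size $w$ and the instructions addition, subtraction, multiplication, bitwise and/or/xor, shifts, comparisons, loads and stores. Initially the memory holds $n_P$, $n_T$ and, for each of the two trees, the array of parent pointers (nodes are numbered arbitrarily) and the array of labels; labels are non-negative integers that fit in a word. The answer is written to a write-only output, which does not count as space, as a packed table: a directory that assigns to each leaf $x$ of $P$ a position (word index and bit index), and then for each leaf $y$ of $T$ a bit vector, stored in a fixed number of words, whose bit at the position of $x$ is $1$ if and only if $\mathrm{path}(x)$ is a subsequence of $\mathrm{path}(y)$. Theorem. There are a program and a constant $\kappa$ such that for every $d$ there is a constant $C$ with the following property. For all rooted labeled trees $P$ and $T$ and every word size $w$ with $2^w\ge\kappa(n_P+n_T)$,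 if all labels are less than $2^w$ and at most $(n_P+n_T)^d$, then the program solves the tree path subsequence problem for $P$ and $T$ using only $\kappa(n_P+n_T)$ words of memory (including the input), in time at most $$C\cdot\min\left\{\; l_Pn_T+n_P,\quad n_Pl_T+n_T,\quad \frac{n_Pn_T}{\max(1,\log_2 n_T)}+n_T+n_P\log_2 n_P\;\right\}.$$ In particular, this holds for word size $w=\Theta(\log n_T)$ with arbitrary word-sized labels, whenever the words are long enough to address the linear memory. -/

import Mathlib

/-! ### Rooted labeled trees and the tree path subsequence problem -/

/-- A rooted tree with node set `Fin n` whose nodes carry labels from `ℕ`. The numbering of the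
nodes is arbitrary. The root is its own parent, and every node reaches the root by following
parent pointers (hence `n ≥ 1`, and no other node is its own parent). -/
structure LabeledTree (n : ℕ) where
  root : Fin n
  parent : Fin n → Fin n
  parent_root : parent root = root
  reaches_root : ∀ v, ∃ k, parent^[k] v = root
  label : Fin n → ℕ

namespace LabeledTree

variable {n : ℕ} (t : LabeledTree n)

/-- The number of edges between `v` and the root. -/
def depth (v : Fin n) : ℕ := Nat.find (t.reaches_root v)

/-- `path(v)`: the nodes on the path from the root to `v`, the root first. -/
def path (v : Fin n) : List (Fin n) :=
  ((List.range (t.depth v + 1)).map fun k => t.parent^[k] v).reverse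

/-- The sequence of labels along `path(v)`. -/
def pathLabels (v : Fin n) : List ℕ := (t.path v).map t.label

/-- The nodes without children. -/
def leaves : Finset (Fin n) :=
  Finset.univ.filter fun v => ∀ u, u ≠ t.root → t.parent u ≠ v

/-- The number of leaves. -/
def numLeaves : ℕ := t.leaves.card

/-- A tree as it is stored in memory: the array of parent pointers (the root points to itself),
followed by the array of labels. -/
def words : List ℕ := List.ofFn (fun v => (t.parent v : ℕ)) ++ List.ofFn t.label

end LabeledTree

/-- The root-to-`x` path of `P` is a subsequence of the root-to-`y` path of `T`: it can be
obtained from it by removing nodes. -/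
def PathSubseq {nP nT : ℕ} (P : LabeledTree nP) (T : LabeledTree nT)
    (x : Fin nP) (y : Fin nT) : Prop :=
  List.Sublist (P.pathLabels x) (T.pathLabels y)

/-- `out` is a complete report of the pairs `(x, y)`, `x` a leaf of `P` and `y` a leaf of `T`, such
that `path(x)` is a subsequence of `path(y)`. Because there may be more such pairs than the
running time allows to list one by one, the report consists of packed bit vectors:
* two header words: the number `m` of words of a bit vector and the number of leaves of `P`;
* a directory with one triple `(x, q, r)` for each leaf `x` of `P` (in any order), which says that
  the bit of `x` is bit `r` of word `q` of every bit vector;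
* for each leaf `y` of `T` (in any order) the word `y` followed by the `m` words of its bit
  vector; the bit of `x` in it is `1` iff `path(x)` is a subsequence of `path(y)`. -/
def IsReport {nP nT : ℕ} (P : LabeledTree nP) (T : LabeledTree nT) (out : List ℕ) : Prop :=
  ∃ (m : ℕ) (dir : List (Fin nP × ℕ × ℕ)) (blocks : List (Fin nT × List ℕ)),
    out = m :: dir.length ::
      (dir.flatMap (fun e => [(e.1 : ℕ), e.2.1, e.2.2]) ++
        blocks.flatMap (fun b => (b.1 : ℕ) :: b.2)) ∧
    (dir.map Prod.fst).Nodup ∧ (∀ x, x ∈ dir.map Prod.fst ↔ x ∈ P.leaves) ∧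
    (blocks.map Prod.fst).Nodup ∧ (∀ y, y ∈ blocks.map Prod.fst ↔ y ∈ T.leaves) ∧
    (∀ b ∈ blocks, b.2.length = m) ∧ (∀ e ∈ dir, e.2.1 < m) ∧
    ∀ e ∈ dir, ∀ b ∈ blocks,
      (b.2.getD e.2.1 0).testBit e.2.2 = true ↔ PathSubseq P T e.1 b.1

/-! ### The unit-cost word RAM -/

namespace WordRAM

/-- The arithmetic and bitwise operations on words. -/
inductive BinOp where
  | add | sub | mul | and | or | xor | shl | shr

/-- The operations on words of `w` bits; arithmetic is modulo `2 ^ w`, and shifts are logical. -/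
def BinOp.eval {w : ℕ} : BinOp → BitVec w → BitVec w → BitVec w
  | .add, a, b => a + b
  | .sub, a, b => a - b
  | .mul, a, b => a * b
  | .and, a, b => a &&& b
  | .or, a, b => a ||| b
  | .xor, a, b => a ^^^ b
  | .shl, a, b => a <<< b.toNat
  | .shr, a, b => a >>> b.toNat

/-- The instructions. Registers are numbered by `ℕ`; a program mentions only finitely many. -/
inductive Instr where
  /-- `r := c` -/
  | const (r c : ℕ)
  /-- `r := a ∘ b` -/
  | op (o : BinOp) (r a b : ℕ)
  /-- `r := memory[a]` -/
  | load (r a : ℕ)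
  /-- `memory[a] := r` -/
  | store (a r : ℕ)
  /-- append `r` to the output -/
  | emit (r : ℕ)

/-- Tests of registers (unsigned comparison). -/
inductive Cond where
  | eq (a b : ℕ)
  | lt (a b : ℕ)

/-- Programs: the control flow is structured, which is the special case of conditional jumps. -/
inductive Prog where
  | nop
  | instr (i : Instr)
  | seq (p q : Prog)
  | ite (c : Cond) (p q : Prog)
  | loop (c : Cond) (p : Prog)

/-- A state of the machine with `w`-bit words: registers, random access memory, and the words
written so far to the write-only output. -/
structure State (w : ℕ) where
  reg : ℕ → BitVec w
  mem : ℕ → BitVec w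
  out : List (BitVec w)

variable {w : ℕ}

def Cond.Holds (s : State w) : Cond → Prop
  | .eq a b => s.reg a = s.reg b
  | .lt a b => (s.reg a).toNat < (s.reg b).toNat

/-- The instruction accesses no memory cell outside the first `S` ones. -/
def Instr.Fits (S : ℕ) (s : State w) : Instr → Prop
  | .load _ a => (s.reg a).toNat < S
  | .store a _ => (s.reg a).toNat < S
  | _ => True

/-- The effect of an instruction. -/
def Instr.exec (s : State w) : Instr → State w
  | .const r c => { s with reg := Function.update s.reg r (BitVec.ofNat w c) }
  | .op o r a b => { s with reg := Function.update s.reg r (o.eval (s.reg a) (s.reg b)) }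
  | .load r a => { s with reg := Function.update s.reg r (s.mem (s.reg a).toNat) }
  | .store a r => { s with mem := Function.update s.mem (s.reg a).toNat (s.reg r) }
  | .emit r => { s with out := s.out ++ [s.reg r] }

/-- `Run S p s t s'`: on a machine with `S` memory cells, the program `p` started in state `s`
halts after exactly `t` steps in state `s'`, without accessing memory outside the `S` cells.
Every instruction and every evaluation of a test is one step. -/
inductive Run (S : ℕ) : Prog → State w → ℕ → State w → Prop where
  | nop (s : State w) : Run S .nop s 1 s
  | instr (i : Instr) (s : State w) (h : i.Fits S s) : Run S (.instr i) s 1 (i.exec s)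
  | seq {p q : Prog} {s s' s'' : State w} {t t' : ℕ} (hp : Run S p s t s')
      (hq : Run S q s' t' s'') : Run S (.seq p q) s (t + t') s''
  | ite_true {c : Cond} {p q : Prog} {s s' : State w} {t : ℕ} (hc : c.Holds s)
      (hp : Run S p s t s') : Run S (.ite c p q) s (t + 1) s'
  | ite_false {c : Cond} {p q : Prog} {s s' : State w} {t : ℕ} (hc : ¬ c.Holds s)
      (hq : Run S q s t s') : Run S (.ite c p q) s (t + 1) s'
  | loop_true {c : Cond} {p : Prog} {s s' s'' : State w} {t t' : ℕ} (hc : c.Holds s)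
      (hp : Run S p s t s') (hl : Run S (.loop c p) s' t' s'') :
      Run S (.loop c p) s (t + t' + 1) s''
  | loop_false {c : Cond} {p : Prog} {s : State w} (hc : ¬ c.Holds s) :
      Run S (.loop c p) s 1 s

/-- The initial state: the given words are stored in memory from address `0` on, all other cells
and all registers are zero, and the output is empty. -/
def start (w : ℕ) (input : List ℕ) : State w where
  reg := fun _ => 0
  mem := fun a => BitVec.ofNat w (input.getD a 0)
  out := []

end WordRAM

/-- The input of the problem: the sizes of `P` and `T`, then the tree `P`, then the tree `T`. -/
def tpsInput {nP nT : ℕ} (P : LabeledTree nP) (T : LabeledTree nT) : List ℕ :=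
  nP :: nT :: (P.words ++ T.words)

/-- The program `p`, on a machine with word size `w` and `S` words of memory, which also hold the
input, solves the tree path subsequence problem for `P` and `T` in `t` steps. -/
def SolvesTPS (p : WordRAM.Prog) (w S : ℕ) {nP nT : ℕ} (P : LabeledTree nP) (T : LabeledTree nT)
    (t : ℕ) : Prop :=
  ∃ s : WordRAM.State w, WordRAM.Run S p (WordRAM.start w (tpsInput P T)) t s ∧
    IsReport P T (s.out.map BitVec.toNat)

/-! ### A language with variables and arrays, and its compilation to the word RAM -/

namespace TPS

open WordRAM

/-! Call a node `x` of `P` matched by a node `v` of `T` if `path(x)` is a subsequence of `path(v)`.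
Compared with the parent of `v`, the node `v` matches in addition exactly those unmatched nodes that
carry the label of `v` and whose parent is already matched; the root of `P` counts as having a
matched parent (`Forest.mt_iff`, `Forest.new_iff`). Hence a depth-first traversal of `T` that
updates the matched set when it enters a node, undoes the update when it leaves the node, and writes
the matched leaves of `P` at every leaf of `T` solves the problem (`DfsSpec.wp`). Two
representations of the matched set give the three bounds.

Frontier lists. For every label, keep a linked list of the unmatched nodes of `P` that have this
label and a matched parent. Entering `v` detaches the list of its label and pushes the children of
the detached nodes, so the cost is the number of newly matched nodes and of their children. For
fixed `v` both sets are antichains of `P`, which gives `l_P * n_T` in total; for a fixed node of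
`P`, the nodes of `T` that newly match it form an antichain of `T`, which gives `n_P * l_T`
(`Forest.card_antichain_le`, `Forest.sum_new_le_left`, `Forest.sum_new_le_right`). The same run
obeys both bounds.

Words. Let `s` be the largest number with `8 ^ s ≤ n_T`. The nodes of `P` are numbered
breadth-first, and the matched set is stored as bits in `W = n_P / s + 1` words of `s` bits. In this
order the position of the parent is a nondecreasing function of the position, so only `O(W)` pairs
consisting of a word of children and a word of parents occur. For each pair one look-up in a table
with `4 ^ s * 2 ^ s` entries moves the bits of the parents to the children (`Pieces`, `sel`,
`wp_liftCmd`). Masks for the label of `v` then select the new bits (`Entries`, `Forest.word_eq`),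
and a stack of overwritten words makes the step reversible. Every node of `T` costs `O(W)`. The
stack needs at most `n_P` cells because every recorded change sets a new bit (`bitCount_lt`).

The program compares `l_P` with `n_P / s + 1` and `l_T` with `n_T / s + 1` and chooses the cheaper
method; `exists_work` and `time_le` show that the choice stays below all three bounds. Before that,
labels are replaced by class numbers below `n_P + n_T` by refining a partition digit by digit. This
takes `O(d)` linear rounds, and the program need not know `d` (`wp_classCmd`).

The algorithm is written in a small language with variables and arrays, in which values are natural
numbers. Its compilation to the word RAM preserves the number of steps exactly (`Cmd.comp_correct`).
Input and `32` arrays of length `4 * (n_P + n_T)` take `33 * 4 = 132` words per node, which is the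
value of `κ`. -/

/-- A state of the array language: variables, arrays, and the output. -/
@[ext] structure HState where
  var : ℕ → ℕ
  arr : ℕ → ℕ → ℕ
  out : List ℕ

/-- The parameters of an execution: the length `Z` and the number `K` of the arrays, the bound
`B` on all values, and the input. -/
structure Env where
  Z : ℕ
  K : ℕ
  B : ℕ
  inp : ℕ → ℕ

inductive Expr where
  | var (x : ℕ)
  | lit (c : ℕ)
  | bin (o : BinOp) (a b : Expr)
  | get (k : ℕ) (i : Expr)
  | inp (i : Expr)

/-- The operations on natural numbers. -/
def natOp : BinOp → ℕ → ℕ → ℕ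
  | .add, a, b => a + b
  | .sub, a, b => a - b
  | .mul, a, b => a * b
  | .and, a, b => a &&& b
  | .or, a, b => a ||| b
  | .xor, a, b => a ^^^ b
  | .shl, a, b => a <<< b
  | .shr, a, b => a >>> b

/-- The operation does not leave the range of values. -/
def OpOk (B : ℕ) : BinOp → ℕ → ℕ → Prop
  | .add, a, b => a + b < B
  | .sub, a, b => b ≤ a
  | .mul, a, b => a * b < B
  | .shl, a, b => a <<< b < B
  | _, _, _ => True

namespace Expr

def eval (E : Env) (s : HState) : Expr → ℕ
  | var x => s.var x
  | lit c => c
  | bin o a b => natOp o (a.eval E s) (b.eval E s)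
  | get k i => s.arr k (i.eval E s)
  | inp i => E.inp (i.eval E s)

/-- Under this condition machine words and natural numbers agree: nothing wraps around and every
address is inside its array. The bound on literals is covered by `Env.Fits.count`. -/
def Ok (E : Env) (s : HState) : Expr → Prop
  | var _ => True
  | lit c => c < 16
  | bin o a b => a.Ok E s ∧ b.Ok E s ∧ OpOk E.B o (a.eval E s) (b.eval E s)
  | get k i => i.Ok E s ∧ k < E.K ∧ i.eval E s < E.Z
  | inp i => i.Ok E s ∧ i.eval E s < E.Z

/-- The exact number of instructions of the compiled code. An array access takes four besides its
index: two for the base address, one addition and the load. -/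
def cost : Expr → ℕ
  | var _ => 1
  | lit _ => 1
  | bin _ a b => a.cost + b.cost + 1
  | get _ i => i.cost + 4
  | inp i => i.cost + 1

instance : Add Expr := ⟨bin .add⟩
instance : Sub Expr := ⟨bin .sub⟩
instance : Mul Expr := ⟨bin .mul⟩

/-- Even registers hold variables; register `1` holds the length of the arrays; the other odd
registers are temporary. The value is computed in register `2 * t + 1`. -/
def comp : Expr → ℕ → Prog
  | var x, t => .instr (.op .or (2 * t + 1) (2 * x) (2 * x))
  | lit c, t => .instr (.const (2 * t + 1) c)
  | bin o a b, t => .seq (a.comp t) (.seq (b.comp (t + 1))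
      (.instr (.op o (2 * t + 1) (2 * t + 1) (2 * t + 3))))
  | get k i, t => .seq (i.comp t) (.seq (.instr (.const (2 * t + 3) (k + 1)))
      (.seq (.instr (.op .mul (2 * t + 3) (2 * t + 3) 1))
        (.seq (.instr (.op .add (2 * t + 1) (2 * t + 1) (2 * t + 3)))
          (.instr (.load (2 * t + 1) (2 * t + 1))))))
  | inp i, t => .seq (i.comp t) (.instr (.load (2 * t + 1) (2 * t + 1)))

end Expr

inductive Test where
  | eq (a b : Expr)
  | lt (a b : Expr)

namespace Test

def Holds (E : Env) (s : HState) : Test → Prop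
  | eq a b => a.eval E s = b.eval E s
  | lt a b => a.eval E s < b.eval E s

def Ok (E : Env) (s : HState) : Test → Prop
  | eq a b => a.Ok E s ∧ b.Ok E s
  | lt a b => a.Ok E s ∧ b.Ok E s

def cost : Test → ℕ
  | eq a b => a.cost + b.cost
  | lt a b => a.cost + b.cost

def comp : Test → Prog
  | eq a b => .seq (a.comp 1) (b.comp 2)
  | lt a b => .seq (a.comp 1) (b.comp 2)

/-- The operands are compiled at depths `1` and `2`, so their values are in registers `3` and `5`.
-/
def cond : Test → Cond
  | eq _ _ => .eq 3 5
  | lt _ _ => .lt 3 5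

end Test

inductive Cmd where
  | skip
  | assign (x : ℕ) (e : Expr)
  | store (k : ℕ) (i e : Expr)
  | emit (e : Expr)
  | seq (p q : Cmd)
  | ite (c : Test) (p q : Cmd)
  | while (c : Test) (p : Cmd)

namespace HState

def setVar (s : HState) (x a : ℕ) : HState := { s with var := fun y => if y = x then a else s.var y }

def setArr (s : HState) (k i a : ℕ) : HState :=
  { s with arr := fun l j => if l = k ∧ j = i then a else s.arr l j }

def emit (s : HState) (a : ℕ) : HState := { s with out := s.out ++ [a] }

variable (s : HState) (k i a x : ℕ)

@[simp] theorem setVar_var (y : ℕ) : (s.setVar x a).var y = if y = x then a else s.var y := rfl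
@[simp] theorem setVar_arr : (s.setVar x a).arr = s.arr := rfl
@[simp] theorem setVar_out : (s.setVar x a).out = s.out := rfl
@[simp] theorem setArr_var : (s.setArr k i a).var = s.var := rfl
@[simp] theorem setArr_arr (l j : ℕ) :
    (s.setArr k i a).arr l j = if l = k ∧ j = i then a else s.arr l j := rfl
@[simp] theorem setArr_arr_of_ne {l : ℕ} (h : l ≠ k) : (s.setArr k i a).arr l = s.arr l := by
  funext j; simp [h]
theorem setArr_arr_self : (s.setArr k i a).arr k = fun j => if j = i then a else s.arr k j := by
  funext j; simp
@[simp] theorem setArr_out : (s.setArr k i a).out = s.out := rfl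
@[simp] theorem emit_var : (s.emit a).var = s.var := rfl
@[simp] theorem emit_arr : (s.emit a).arr = s.arr := rfl
@[simp] theorem emit_out : (s.emit a).out = s.out ++ [a] := rfl

end HState

/-- `HRun E c s t s'`: the command `c` started in `s` ends in `s'`, and its compilation takes
exactly `t` steps. -/
inductive HRun (E : Env) : Cmd → HState → ℕ → HState → Prop where
  | skip (s) : HRun E .skip s 1 s
  | assign (x e s) (h : e.Ok E s) : HRun E (.assign x e) s (e.cost + 1) (s.setVar x (e.eval E s))
  | store (k) (i e : Expr) (s) (hi : i.Ok E s) (he : e.Ok E s) (hk : k < E.K)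
      (hb : i.eval E s < E.Z) :
      HRun E (.store k i e) s (e.cost + i.cost + 4) (s.setArr k (i.eval E s) (e.eval E s))
  | emit (e s) (h : e.Ok E s) : HRun E (.emit e) s (e.cost + 1) (s.emit (e.eval E s))
  | seq {p q s s' s'' t t'} (hp : HRun E p s t s') (hq : HRun E q s' t' s'') :
      HRun E (.seq p q) s (t + t') s''
  | ite_true {c : Test} {p q s s' t} (ho : c.Ok E s) (hc : c.Holds E s) (hp : HRun E p s t s') :
      HRun E (.ite c p q) s (c.cost + (t + 1)) s'
  | ite_false {c : Test} {p q s s' t} (ho : c.Ok E s) (hc : ¬ c.Holds E s) (hq : HRun E q s t s') :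
      HRun E (.ite c p q) s (c.cost + (t + 1)) s'
  | while_true {c : Test} {p s s' s'' t t'} (ho : c.Ok E s) (hc : c.Holds E s)
      (hp : HRun E p s t s') (hl : HRun E (.while c p) s' t' s'') :
      HRun E (.while c p) s (c.cost + (t + t' + 1)) s''
  | while_false {c : Test} {p s} (ho : c.Ok E s) (hc : ¬ c.Holds E s) :
      HRun E (.while c p) s (c.cost + 1) s

/-- The machine compares registers only. The operands of a loop test are therefore computed before
the loop and again at the end of each iteration. -/
def Cmd.comp : Cmd → Prog
  | skip => .nop
  | assign x e => .seq (e.comp 1) (.instr (.op .or (2 * x) 3 3))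
  | store k i e => .seq (e.comp 1) (.seq (i.comp 2) (.seq (.instr (.const 7 (k + 1)))
      (.seq (.instr (.op .mul 7 7 1)) (.seq (.instr (.op .add 5 5 7)) (.instr (.store 5 3))))))
  | emit e => .seq (e.comp 1) (.instr (.emit 3))
  | seq p q => .seq p.comp q.comp
  | ite c p q => .seq c.comp (.ite c.cond p.comp q.comp)
  | .while c p => .seq c.comp (.loop c.cond (.seq p.comp c.comp))

/-- The word RAM state `b` represents the state `s`. -/
structure Sim (E : Env) {w : ℕ} (s : HState) (b : State w) : Prop where
  var : ∀ x, (b.reg (2 * x)).toNat = s.var x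
  size : (b.reg 1).toNat = E.Z
  arr : ∀ k < E.K, ∀ i < E.Z, (b.mem ((k + 1) * E.Z + i)).toNat = s.arr k i
  inp : ∀ i < E.Z, (b.mem i).toNat = E.inp i
  out : b.out.map BitVec.toNat = s.out

theorem natOp_eval {w : ℕ} (o : BinOp) (a b : BitVec w) (h : OpOk (2 ^ w) o a.toNat b.toNat) :
    (o.eval a b).toNat = natOp o a.toNat b.toNat := by
  cases o <;> simp only [BinOp.eval, natOp, OpOk] at *
  · rw [BitVec.toNat_add, Nat.mod_eq_of_lt h]
  · rw [BitVec.toNat_sub_of_le (by simpa [BitVec.le_def] using h)]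
  · rw [BitVec.toNat_mul, Nat.mod_eq_of_lt h]
  · simp
  · simp
  · simp
  · rw [BitVec.toNat_shiftLeft, Nat.mod_eq_of_lt h]
  · simp

/-- The memory is cut into blocks of length `Z`. Block `0` holds the input, and array `k` is block
`k + 1`. -/
theorem array_address_lt {Z K k i : ℕ} (hk : k < K) (hi : i < Z) : (k + 1) * Z + i < (K + 1) * Z := by
  have : (k + 1 + 1) * Z ≤ (K + 1) * Z := Nat.mul_le_mul_right _ (by omega)
  nlinarith

theorem array_address_inj {Z k l i j : ℕ} (hi : i < Z) (hj : j < Z)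
    (h : (k + 1) * Z + i = (l + 1) * Z + j) : k = l ∧ i = j := by
  have hZ : 0 < Z := by omega
  have h1 : ((k + 1) * Z + i) / Z = k + 1 := by
    rw [mul_comm, Nat.mul_add_div hZ, Nat.div_eq_of_lt hi, add_zero]
  have h2 : ((l + 1) * Z + j) / Z = l + 1 := by
    rw [mul_comm, Nat.mul_add_div hZ, Nat.div_eq_of_lt hj, add_zero]
  rw [h, h2] at h1
  have : l = k := by omega
  subst this
  exact ⟨rfl, by omega⟩

/-- The parameters fit the machine with `w`-bit words and `S` words of memory. -/
structure Env.Fits (E : Env) (w S : ℕ) : Prop where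
  bound : E.B = 2 ^ w
  space : (E.K + 1) * E.Z ≤ S
  words : S ≤ 2 ^ w
  count : E.K + 16 ≤ 2 ^ w

/-- `b'` arises from `b` by changes of temporary registers from `r` on. -/
structure TempChange {w : ℕ} (r : ℕ) (b b' : State w) : Prop where
  mem : b'.mem = b.mem
  out : b'.out = b.out
  reg : ∀ x, x % 2 = 0 ∨ x < r → b'.reg x = b.reg x

theorem TempChange.trans {w r : ℕ} {b b' b'' : State w} (h : TempChange r b b')
    (h' : TempChange r b' b'') : TempChange r b b'' :=
  ⟨h'.mem.trans h.mem, h'.out.trans h.out, fun x hx => (h'.reg x hx).trans (h.reg x hx)⟩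

theorem TempChange.mono {w r r' : ℕ} {b b' : State w} (h : TempChange r b b') (hr : r' ≤ r) :
    TempChange r' b b' :=
  ⟨h.mem, h.out, fun x hx => h.reg x (by omega)⟩

theorem TempChange.update {w : ℕ} (b : State w) (r : ℕ) (hr : r % 2 = 1) (v : BitVec w) :
    TempChange r b { b with reg := Function.update b.reg r v } := by
  refine ⟨rfl, rfl, fun x hx => ?_⟩
  have : x ≠ r := by rintro rfl; omega
  simp [this]

theorem Sim.tempChange {E : Env} {w r : ℕ} {s : HState} {b b' : State w} (h : Sim E s b)
    (hc : TempChange r b b') (hr : 1 < r) : Sim E s b' :=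
  ⟨fun x => by rw [hc.reg _ (by omega), h.var], by rw [hc.reg _ (by omega), h.size],
    by rw [hc.mem]; exact h.arr, by rw [hc.mem]; exact h.inp, by rw [hc.out]; exact h.out⟩

/-! ### Correctness of the compilation, with exact step counts -/

section Compile

variable {E : Env} {w S : ℕ} (hE : E.Fits w S)
include hE

theorem Env.Fits.lit_lt {c : ℕ} (h : c < 16 + E.K) : c < 2 ^ w := by have := hE.count; omega

/-- The access `q` is left open because loads and stores share the computation of the address. -/
theorem exists_run_address {b : State w} {r k i : ℕ} (hr : r % 2 = 1) (hr1 : 1 < r)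
    (hZ : (b.reg 1).toNat = E.Z) (hi : (b.reg r).toNat = i) (hk : k < E.K) (hiZ : i < E.Z) :
    ∃ b1 : State w, TempChange r b b1 ∧ (b1.reg r).toNat = (k + 1) * E.Z + i ∧
      (b1.reg r).toNat < S ∧
      ∀ (q : Prog) (t : ℕ) (b' : State w), Run S q b1 t b' →
        Run S (.seq (.instr (.const (r + 2) (k + 1))) (.seq (.instr (.op .mul (r + 2) (r + 2) 1))
          (.seq (.instr (.op .add r r (r + 2))) q))) b (1 + (1 + (1 + t))) b' := by
  have hlt := array_address_lt hk hiZ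
  have hS := hE.space
  have hw := hE.words
  have hk1 : k + 1 < 2 ^ w := hE.lit_lt (by omega)
  refine ⟨_, ?_, ?_, ?_, fun q t b' hq => .seq (.instr _ _ trivial) (.seq (.instr _ _ trivial)
    (.seq (.instr _ _ trivial) hq))⟩
  · exact ((TempChange.update _ (r + 2) (by omega) _).mono (by omega)).trans
      (((TempChange.update _ (r + 2) (by omega) _).mono (by omega)).trans
        (TempChange.update _ r hr _))
  all_goals
    simp only [Instr.exec, Function.update_self, Function.update_of_ne (show (1 : ℕ) ≠ r + 2 by omega),
      Function.update_of_ne (show r ≠ r + 2 by omega)]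
    have h1 : ((BinOp.mul.eval (BitVec.ofNat w (k + 1)) (b.reg 1))).toNat = (k + 1) * E.Z := by
      rw [natOp_eval]
      · simp [natOp, Nat.mod_eq_of_lt hk1, hZ]
      · simp only [OpOk, BitVec.toNat_ofNat, Nat.mod_eq_of_lt hk1, hZ]; omega
    rw [natOp_eval]
    · simp only [natOp, h1, hi]; omega
    · simp only [OpOk, h1, hi]; omega

/-- The depth `t` is general in the induction: the second operand is computed at depth `t + 1`, and
`TempChange` ensures that the value of the first one survives this. -/
theorem Expr.comp_correct {s : HState} (e : Expr) : ∀ (t : ℕ) (b : State w), 1 ≤ t → Sim E s b →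
    e.Ok E s → ∃ b', Run S (e.comp t) b e.cost b' ∧ (b'.reg (2 * t + 1)).toNat = e.eval E s ∧
      TempChange (2 * t + 1) b b' := by
  have hS := hE.space
  induction e with
  | var x =>
    intro t b ht hs _
    refine ⟨_, .instr _ _ trivial, ?_, TempChange.update _ _ (by omega) _⟩
    simp [Instr.exec, BinOp.eval, Expr.eval, hs.var]
  | lit c =>
    intro t b ht hs hc
    refine ⟨_, .instr _ _ trivial, ?_, TempChange.update _ _ (by omega) _⟩
    simp only [Expr.Ok] at hc
    simp [Instr.exec, Expr.eval, Nat.mod_eq_of_lt (hE.lit_lt (show c < 16 + E.K by omega))]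
  | bin o e1 e2 ih1 ih2 =>
    rintro t b ht hs ⟨h1, h2, h3⟩
    obtain ⟨b1, r1, v1, c1⟩ := ih1 t b ht hs h1
    have hs1 := hs.tempChange c1 (by omega)
    obtain ⟨b2, r2, v2, c2⟩ := ih2 (t + 1) b1 (by omega) hs1 h2
    refine ⟨_, add_assoc e1.cost _ 1 ▸ Run.seq r1 (Run.seq r2
      (.instr (.op o (2 * t + 1) (2 * t + 1) (2 * t + 3)) b2 trivial)), ?_,
      c1.trans ((c2.mono (by omega)).trans (TempChange.update _ _ (by omega) _))⟩
    have e1 : (b2.reg (2 * t + 1)).toNat = Expr.eval E s e1 := by rw [c2.reg _ (by omega), v1]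
    have e2 : (b2.reg (2 * t + 3)).toNat = Expr.eval E s e2 := v2
    simp only [Function.update_self]
    rw [hE.bound] at h3
    rw [natOp_eval _ _ _ (by rwa [e1, e2]), e1, e2]
    rfl
  | get k i ih =>
    rintro t b ht hs ⟨h1, h2, h3⟩
    obtain ⟨b1, r1, v1, c1⟩ := ih t b ht hs h1
    have hs1 := hs.tempChange c1 (by omega)
    obtain ⟨b2, c2, v2, l2, r2⟩ := exists_run_address hE (by omega) (by omega) hs1.size v1 h2 h3
    refine ⟨_, .seq r1 (r2 _ _ _ (.instr (.load (2 * t + 1) (2 * t + 1)) b2 l2)), ?_, c1.trans (c2.trans (TempChange.update _ _ (by omega) _))⟩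
    simp only [Instr.exec, Function.update_self, v2, Expr.eval]
    rw [c2.mem, c1.mem, hs.arr k h2 _ h3]
  | inp i ih =>
    rintro t b ht hs ⟨h1, h2⟩
    obtain ⟨b1, r1, v1, c1⟩ := ih t b ht hs h1
    refine ⟨_, .seq r1 (.instr _ _ ?_), ?_, c1.trans (TempChange.update _ _ (by omega) _)⟩
    · show (b1.reg (2 * t + 1)).toNat < S
      rw [v1]
      have : E.Z ≤ (E.K + 1) * E.Z := Nat.le_mul_of_pos_left _ (by omega)
      omega
    · simp only [Instr.exec, Function.update_self, v1, Expr.eval]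
      rw [c1.mem, hs.inp _ h2]

theorem Test.comp_correct {s : HState} (c : Test) (b : State w) (hs : Sim E s b) (hc : c.Ok E s) :
    ∃ b', Run S c.comp b c.cost b' ∧ (c.cond.Holds b' ↔ c.Holds E s) ∧ Sim E s b' := by
  cases c with
  | eq a1 a2 =>
    obtain ⟨b1, r1, v1, c1⟩ := a1.comp_correct hE 1 b le_rfl hs hc.1
    have hs1 := hs.tempChange c1 (by omega)
    obtain ⟨b2, r2, v2, c2⟩ := a2.comp_correct hE 2 b1 (by omega) hs1 hc.2
    refine ⟨b2, .seq r1 r2, ?_, hs1.tempChange c2 (by omega)⟩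
    have e1 : (b2.reg 3).toNat = a1.eval E s := by rw [c2.reg _ (by omega), v1]
    have e2 : (b2.reg 5).toNat = a2.eval E s := v2
    simp only [Test.cond, Cond.Holds, Test.Holds]
    rw [← e1, ← e2, BitVec.toNat_inj]
  | lt a1 a2 =>
    obtain ⟨b1, r1, v1, c1⟩ := a1.comp_correct hE 1 b le_rfl hs hc.1
    have hs1 := hs.tempChange c1 (by omega)
    obtain ⟨b2, r2, v2, c2⟩ := a2.comp_correct hE 2 b1 (by omega) hs1 hc.2
    refine ⟨b2, .seq r1 r2, ?_, hs1.tempChange c2 (by omega)⟩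
    have e1 : (b2.reg 3).toNat = a1.eval E s := by rw [c2.reg _ (by omega), v1]
    have e2 : (b2.reg 5).toNat = a2.eval E s := v2
    simp only [Test.cond, Cond.Holds, Test.Holds]
    rw [← e1, ← e2]

/-- The step count `t` is the same on both sides, so every time bound for the array language is one
for the machine. -/
theorem Cmd.comp_correct {c : Cmd} {s s' : HState} {t : ℕ} (h : HRun E c s t s') :
    ∀ b : State w, Sim E s b → ∃ b', Run S c.comp b t b' ∧ Sim E s' b' := by
  induction h with
  | skip s => exact fun b hs => ⟨b, .nop b, hs⟩
  | assign x e s he =>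
    intro b hs
    obtain ⟨b1, r1, v1, c1⟩ := e.comp_correct hE 1 b le_rfl hs he
    have hs1 := hs.tempChange c1 (by omega)
    refine ⟨_, .seq r1 (.instr _ _ trivial), ⟨fun y => ?_, ?_, hs1.arr, hs1.inp, hs1.out⟩⟩
    · by_cases hy : y = x
      · subst hy
        simp [Instr.exec, BinOp.eval, v1]
      · have : 2 * y ≠ 2 * x := by omega
        simp [Instr.exec, this, hy, hs1.var]
    · have : (1 : ℕ) ≠ 2 * x := by omega
      simp [Instr.exec, Function.update_of_ne this, hs1.size]
  | store k i e s hi he hk hb =>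
    intro b hs
    obtain ⟨b1, r1, v1, c1⟩ := e.comp_correct hE 1 b le_rfl hs he
    have hs1 := hs.tempChange c1 (by omega)
    obtain ⟨b2, r2, v2, c2⟩ := i.comp_correct hE 2 b1 (by omega) hs1 hi
    have hs2 := hs1.tempChange c2 (by omega)
    obtain ⟨b3, c3, v3, l3, r3⟩ := exists_run_address hE (r := 5) (by omega) (by omega) hs2.size
      v2 hk hb
    have hs3 := hs2.tempChange c3 (by omega)
    refine ⟨(Instr.store 5 3).exec b3, ?_, ?_⟩
    · rw [add_assoc]
      exact .seq r1 (.seq r2 (r3 _ _ _ (.instr (.store 5 3) b3 l3)))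
    · have e3 : (b3.reg 3).toNat = e.eval E s := by
        rw [c3.reg _ (by omega), c2.reg _ (by omega), v1]
      refine ⟨hs3.var, hs3.size, fun l hl j hj => ?_, fun j hj => ?_, hs3.out⟩
      · simp only [Instr.exec, v3, HState.setArr_arr]
        by_cases hlj : l = k ∧ j = i.eval E s
        · rw [hlj.1, hlj.2]; simp [e3]
        · rw [if_neg hlj, Function.update_of_ne, hs3.arr l hl j hj]
          exact fun h => hlj (array_address_inj hj hb h)
      · have : j ≠ (k + 1) * E.Z + i.eval E s := by
          rw [add_mul]; omega
        simp only [Instr.exec, v3]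
        rw [Function.update_of_ne this, hs3.inp j hj]
  | emit e s he =>
    intro b hs
    obtain ⟨b1, r1, v1, c1⟩ := e.comp_correct hE 1 b le_rfl hs he
    have hs1 := hs.tempChange c1 (by omega)
    refine ⟨_, .seq r1 (.instr _ _ trivial), ⟨hs1.var, hs1.size, hs1.arr, hs1.inp, ?_⟩⟩
    have v1' : (b1.reg 3).toNat = e.eval E s := v1
    simp [Instr.exec, hs1.out, v1']
  | seq _ _ ih1 ih2 =>
    intro b hs
    obtain ⟨b1, r1, hs1⟩ := ih1 b hs
    obtain ⟨b2, r2, hs2⟩ := ih2 b1 hs1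
    exact ⟨b2, .seq r1 r2, hs2⟩
  | ite_true ho hc _ ih =>
    intro b hs
    obtain ⟨b1, r1, v1, hs1⟩ := Test.comp_correct hE _ b hs ho
    obtain ⟨b2, r2, hs2⟩ := ih b1 hs1
    exact ⟨b2, .seq r1 (.ite_true (v1.2 hc) r2), hs2⟩
  | ite_false ho hc _ ih =>
    intro b hs
    obtain ⟨b1, r1, v1, hs1⟩ := Test.comp_correct hE _ b hs ho
    obtain ⟨b2, r2, hs2⟩ := ih b1 hs1
    exact ⟨b2, .seq r1 (.ite_false (mt v1.1 hc) r2), hs2⟩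
  | while_true ho hc _ _ ih1 ih2 =>
    intro b hs
    obtain ⟨b1, r1, v1, hs1⟩ := Test.comp_correct hE _ b hs ho
    obtain ⟨b2, r2, hs2⟩ := ih1 b1 hs1
    obtain ⟨b3, r3, hs3⟩ := ih2 b2 hs2
    -- The run for the remaining iterations begins with the evaluation of the test; this evaluation
    -- becomes the end of the current iteration.
    cases r3 with
    | seq ra rb =>
      refine ⟨b3, .seq r1 ?_, hs3⟩
      rw [← add_assoc]
      exact .loop_true (v1.2 hc) (.seq r2 ra) rb
  | while_false ho hc =>
    intro b hs
    obtain ⟨b1, r1, v1, hs1⟩ := Test.comp_correct hE _ b hs ho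
    exact ⟨b1, .seq r1 (.loop_false (mt v1.1 hc)), hs1⟩

end Compile
end TPS
/-! ### Rules for the array language -/

namespace TPS

open WordRAM

namespace Cmd

/-- The command may change the variable `x`. -/
def modVar (x : ℕ) : Cmd → Bool
  | assign y _ => x == y
  | seq p q => p.modVar x || q.modVar x
  | ite _ p q => p.modVar x || q.modVar x
  | .while _ p => p.modVar x
  | _ => false

/-- The command may change the array `k`. -/
def modArr (k : ℕ) : Cmd → Bool
  | store l _ _ => k == l
  | seq p q => p.modArr k || q.modArr k
  | ite _ p q => p.modArr k || q.modArr k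
  | .while _ p => p.modArr k
  | _ => false

/-- The command may write output. -/
def emits : Cmd → Bool
  | emit _ => true
  | seq p q => p.emits || q.emits
  | ite _ p q => p.emits || q.emits
  | .while _ p => p.emits
  | _ => false

end Cmd

/-- The states agree on everything that the command does not change. -/
structure Frame (c : Cmd) (s s' : HState) : Prop where
  var : ∀ x, c.modVar x = false → s'.var x = s.var x
  arr : ∀ k, c.modArr k = false → s'.arr k = s.arr k
  out : c.emits = false → s'.out = s.out

theorem Frame.refl (c : Cmd) (s : HState) : Frame c s s := ⟨fun _ _ => rfl, fun _ _ => rfl, fun _ => rfl⟩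

theorem Frame.trans {c : Cmd} {s s' s'' : HState} (h : Frame c s s') (h' : Frame c s' s'') :
    Frame c s s'' :=
  ⟨fun x hx => (h'.var x hx).trans (h.var x hx), fun x hx => (h'.arr x hx).trans (h.arr x hx),
    fun hx => (h'.out hx).trans (h.out hx)⟩

theorem HRun.frame {E : Env} {c : Cmd} {s s' : HState} {t : ℕ} (h : HRun E c s t s') :
    Frame c s s' := by
  induction h with
  | skip s => exact .refl _ _
  | assign x e s h =>
    refine ⟨fun y hy => ?_, fun _ _ => rfl, fun _ => rfl⟩
    have : y ≠ x := by simpa [Cmd.modVar] using hy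
    simp [this]
  | store k i e s =>
    refine ⟨fun _ _ => rfl, fun y hy => ?_, fun _ => rfl⟩
    have : y ≠ k := by simpa [Cmd.modArr] using hy
    funext j
    simp [this]
  | emit e s h => exact ⟨fun _ _ => rfl, fun _ _ => rfl, fun h => by simp [Cmd.emits] at h⟩
  | seq _ _ ih1 ih2 =>
    refine ⟨fun x hx => ?_, fun x hx => ?_, fun hx => ?_⟩
    · simp only [Cmd.modVar, Bool.or_eq_false_iff] at hx
      rw [ih2.var x hx.2, ih1.var x hx.1]
    · simp only [Cmd.modArr, Bool.or_eq_false_iff] at hx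
      rw [ih2.arr x hx.2, ih1.arr x hx.1]
    · simp only [Cmd.emits, Bool.or_eq_false_iff] at hx
      rw [ih2.out hx.2, ih1.out hx.1]
  | ite_true _ _ _ ih =>
    refine ⟨fun x hx => ?_, fun x hx => ?_, fun hx => ?_⟩
    · simp only [Cmd.modVar, Bool.or_eq_false_iff] at hx
      rw [ih.var x hx.1]
    · simp only [Cmd.modArr, Bool.or_eq_false_iff] at hx
      rw [ih.arr x hx.1]
    · simp only [Cmd.emits, Bool.or_eq_false_iff] at hx
      rw [ih.out hx.1]
  | ite_false _ _ _ ih =>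
    refine ⟨fun x hx => ?_, fun x hx => ?_, fun hx => ?_⟩
    · simp only [Cmd.modVar, Bool.or_eq_false_iff] at hx
      rw [ih.var x hx.2]
    · simp only [Cmd.modArr, Bool.or_eq_false_iff] at hx
      rw [ih.arr x hx.2]
    · simp only [Cmd.emits, Bool.or_eq_false_iff] at hx
      rw [ih.out hx.2]
  | while_true _ _ _ _ ih1 ih2 =>
    exact ⟨fun x hx => by rw [ih2.var x hx, ih1.var x hx],
      fun x hx => by rw [ih2.arr x hx, ih1.arr x hx], fun hx => by rw [ih2.out hx, ih1.out hx]⟩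
  | while_false => exact .refl _ _

/-- The command started in `s` halts in a state and after a time that satisfy `Q`. -/
def Wp (E : Env) (c : Cmd) (s : HState) (Q : HState → ℕ → Prop) : Prop :=
  ∃ s' t, HRun E c s t s' ∧ Q s' t

/-! ### Proof rules that track result, time and frame -/

section Rules

variable {E : Env} {s : HState} {Q : HState → ℕ → Prop}

/-- The frame of the run is supplied for free, so postconditions need to mention only what a command
changes. -/
theorem Wp.mono {c : Cmd} {R : HState → ℕ → Prop} (h : Wp E c s R)
    (hQ : ∀ s' t, Frame c s s' → R s' t → Q s' t) : Wp E c s Q := by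
  obtain ⟨s', t, hr, h⟩ := h
  exact ⟨s', t, hr, hQ s' t hr.frame h⟩

@[simp] theorem wp_skip : Wp E .skip s Q ↔ Q s 1 := by
  constructor
  · rintro ⟨_, _, h, hq⟩
    cases h
    exact hq
  · exact fun h => ⟨_, _, .skip s, h⟩

@[simp] theorem wp_assign {x : ℕ} {e : Expr} :
    Wp E (.assign x e) s Q ↔ e.Ok E s ∧ Q (s.setVar x (e.eval E s)) (e.cost + 1) := by
  constructor
  · rintro ⟨_, _, h, hq⟩
    cases h with
    | assign _ _ _ h => exact ⟨h, hq⟩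
  · exact fun h => ⟨_, _, .assign x e s h.1, h.2⟩

@[simp] theorem wp_store {k : ℕ} {i e : Expr} :
    Wp E (.store k i e) s Q ↔ (e.Ok E s ∧ i.Ok E s ∧ k < E.K ∧ i.eval E s < E.Z) ∧
      Q (s.setArr k (i.eval E s) (e.eval E s)) (e.cost + i.cost + 4) := by
  constructor
  · rintro ⟨_, _, h, hq⟩
    cases h with
    | store _ _ _ _ h1 h2 h3 h4 => exact ⟨⟨h2, h1, h3, h4⟩, hq⟩
  · exact fun h => ⟨_, _, .store k i e s h.1.2.1 h.1.1 h.1.2.2.1 h.1.2.2.2, h.2⟩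

@[simp] theorem wp_emit {e : Expr} :
    Wp E (.emit e) s Q ↔ e.Ok E s ∧ Q (s.emit (e.eval E s)) (e.cost + 1) := by
  constructor
  · rintro ⟨_, _, h, hq⟩
    cases h with
    | emit _ _ h => exact ⟨h, hq⟩
  · exact fun h => ⟨_, _, .emit e s h.1, h.2⟩

@[simp] theorem wp_seq {p q : Cmd} :
    Wp E (.seq p q) s Q ↔ Wp E p s fun s1 t1 => Wp E q s1 fun s2 t2 => Q s2 (t1 + t2) := by
  constructor
  · rintro ⟨_, _, h, hq⟩
    cases h with
    | seq h1 h2 => exact ⟨_, _, h1, _, _, h2, hq⟩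
  · rintro ⟨_, _, h1, _, _, h2, hq⟩
    exact ⟨_, _, .seq h1 h2, hq⟩

@[simp] theorem wp_ite {c : Test} {p q : Cmd} :
    Wp E (.ite c p q) s Q ↔ c.Ok E s ∧
      (c.Holds E s → Wp E p s fun s' t => Q s' (c.cost + (t + 1))) ∧
      (¬ c.Holds E s → Wp E q s fun s' t => Q s' (c.cost + (t + 1))) := by
  constructor
  · rintro ⟨_, _, h, hq⟩
    cases h with
    | ite_true ho hc h => exact ⟨ho, fun _ => ⟨_, _, h, hq⟩, fun h => absurd hc h⟩
    | ite_false ho hc h => exact ⟨ho, fun h => absurd h hc, fun _ => ⟨_, _, h, hq⟩⟩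
  · rintro ⟨ho, h1, h2⟩
    by_cases hc : c.Holds E s
    · obtain ⟨_, _, h, hq⟩ := h1 hc
      exact ⟨_, _, .ite_true ho hc h, hq⟩
    · obtain ⟨_, _, h, hq⟩ := h2 hc
      exact ⟨_, _, .ite_false ho hc h, hq⟩

/-- A loop whose measure decreases in every iteration. -/
theorem Wp.while {c : Test} {p : Cmd} (I : HState → Prop) (μ : HState → ℕ) (b : ℕ) (h0 : I s)
    (hb : ∀ s', I s' → Frame (.while c p) s s' → c.Ok E s' ∧ (c.Holds E s' →
      Wp E p s' fun s'' t => I s'' ∧ μ s'' < μ s' ∧ t ≤ b))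
    (hQ : ∀ s' t, I s' → ¬ c.Holds E s' → Frame (.while c p) s s' →
      t ≤ μ s * (b + c.cost + 1) + c.cost + 1 → Q s' t) : Wp E (.while c p) s Q := by
  suffices H : ∀ m s', μ s' ≤ m → I s' → Frame (.while c p) s s' →
      ∃ s'' t, HRun E (.while c p) s' t s'' ∧ I s'' ∧ ¬ c.Holds E s'' ∧
        t ≤ m * (b + c.cost + 1) + c.cost + 1 by
    obtain ⟨s', t, hr, h1, h2, h3⟩ := H _ s le_rfl h0 (.refl _ _)
    exact ⟨s', t, hr, hQ s' t h1 h2 hr.frame h3⟩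
  intro m
  induction m with
  | zero =>
    intro s' hm hI hf
    obtain ⟨ho, hp⟩ := hb s' hI hf
    refine ⟨s', _, .while_false ho fun hc => ?_, hI, fun hc => ?_, by omega⟩
    all_goals
      obtain ⟨_, _, _, _, h, _⟩ := hp hc
      omega
  | succ m ih =>
    intro s' hm hI hf
    obtain ⟨ho, hp⟩ := hb s' hI hf
    by_cases hc : c.Holds E s'
    · obtain ⟨s1, t1, hr1, hI1, hm1, ht1⟩ := hp hc
      have hf1 : Frame (.while c p) s' s1 := by
        have := hr1.frame
        exact ⟨this.var, this.arr, this.out⟩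
      obtain ⟨s2, t2, hr2, hI2, hc2, ht2⟩ := ih s1 (by omega) hI1 (hf.trans hf1)
      refine ⟨s2, _, .while_true ho hc hr1 hr2, hI2, hc2, ?_⟩
      rw [add_mul]
      omega
    · exact ⟨s', _, .while_false ho hc, hI, hc, by rw [add_mul]; omega⟩

/-- `for x = 0, …, y - 1` -/
def Cmd.for (x y : ℕ) (body : Cmd) : Cmd :=
  .seq (.assign x (.lit 0)) (.while (.lt (.var x) (.var y))
    (.seq body (.assign x (.bin .add (.var x) (.lit 1)))))

/-- Each iteration costs `7` besides the body: `3` for the test and `4` for the increment. The final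
test and the initialisation account for the additional `5`. -/
theorem Wp.for {x y : ℕ} {body : Cmd} (I : ℕ → HState → Prop) (c : ℕ → ℕ)
    (hxy : y ≠ x) (hx : body.modVar x = false) (hy : body.modVar y = false) (hB : s.var y < E.B)
    (h0 : I 0 (s.setVar x 0))
    (hb : ∀ i s', i < s.var y → I i s' → s'.var x = i → Frame (.for x y body) s s' →
      Wp E body s' fun s'' t => I (i + 1) (s''.setVar x (i + 1)) ∧ t ≤ c i)
    (hQ : ∀ s' t, I (s.var y) s' → s'.var x = s.var y → Frame (.for x y body) s s' →
      t ≤ ∑ i ∈ Finset.range (s.var y), (c i + 7) + 5 → Q s' t) : Wp E (.for x y body) s Q := by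
  have hfy : (Cmd.for x y body).modVar y = false := by
    simp [Cmd.for, Cmd.modVar, hxy, hy]
  suffices H : ∀ m i s', i + m = s.var y → I i s' → s'.var x = i → Frame (.for x y body) s s' →
      ∃ s'' t, HRun E (.while (.lt (.var x) (.var y))
        (.seq body (.assign x (.bin .add (.var x) (.lit 1))))) s' t s'' ∧ I (s.var y) s'' ∧
        s''.var x = s.var y ∧ t + ∑ i ∈ Finset.range i, (c i + 7) ≤
          ∑ i ∈ Finset.range (s.var y), (c i + 7) + 3 by
    have h1 : HRun E (.assign x (.lit 0)) s 2 (s.setVar x 0) :=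
      .assign x (.lit 0) s (show 0 < 16 by norm_num)
    obtain ⟨s', t, hr, hI, hx', ht⟩ := H (s.var y) 0 (s.setVar x 0) (by omega) h0 (by simp)
      ⟨fun z hz => by
        have : z ≠ x := by rintro rfl; simp [Cmd.for, Cmd.modVar] at hz
        simp [this], fun _ _ => rfl, fun _ => rfl⟩
    have := HRun.seq h1 hr
    exact ⟨s', _, this, hQ s' _ hI hx' this.frame (by simp at ht; omega)⟩
  intro m
  induction m with
  | zero =>
    intro i s' hi hI hx' hf
    simp only [add_zero] at hi
    subst hi
    refine ⟨s', _, .while_false ⟨trivial, trivial⟩ ?_, hI, hx', ?_⟩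
    · simp [Test.Holds, Expr.eval, hx', hf.var y hfy]
    · simp [Test.cost, Expr.cost]; omega
  | succ m ih =>
    intro i s' hi hI hx' hf
    obtain ⟨s1, t1, hr1, hI1, ht1⟩ := hb i s' (by omega) hI hx' hf
    have hx1 : s1.var x = i := by rw [hr1.frame.var x hx, hx']
    have hr2 : HRun E (.assign x (.bin .add (.var x) (.lit 1))) s1 4 (s1.setVar x (i + 1)) := by
      have := HRun.assign (E := E) x (.bin .add (.var x) (.lit 1)) s1
        ⟨trivial, show 1 < 16 by norm_num, show s1.var x + 1 < E.B by omega⟩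
      simpa [Expr.eval, natOp, hx1, Expr.cost] using this
    have hr3 := HRun.seq hr1 hr2
    have hf3 : Frame (.for x y body) s' (s1.setVar x (i + 1)) := by
      have := hr3.frame
      exact ⟨fun z hz => this.var z (by simp [Cmd.for, Cmd.modVar] at hz ⊢; exact hz.2),
        fun z hz => this.arr z (by simp [Cmd.for, Cmd.modArr] at hz ⊢; exact hz),
        fun hz => this.out (by simp [Cmd.for, Cmd.emits] at hz ⊢; exact hz)⟩
    obtain ⟨s4, t4, hr4, hI4, hx4, ht4⟩ := ih (i + 1) _ (by omega) hI1 (by simp) (hf.trans hf3)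
    refine ⟨s4, _, .while_true ⟨trivial, trivial⟩ ?_ hr3 hr4, hI4, hx4, ?_⟩
    · simp only [Test.Holds, Expr.eval, hx', hf.var y hfy]; omega
    · rw [Finset.sum_range_succ] at ht4
      simp only [Test.cost, Expr.cost]
      omega

/-- `nx` links the elements of the list, starting with `h`; the value `0` ends the list. -/
def Chain (nx : ℕ → ℕ) : ℕ → List ℕ → Prop
  | h, [] => h = 0
  | h, x :: l => h = x ∧ x ≠ 0 ∧ Chain nx (nx x) l

theorem Chain.congr {nx nx' : ℕ → ℕ} {l : List ℕ} : ∀ {h : ℕ}, (∀ x ∈ l, nx' x = nx x) →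
    Chain nx h l → Chain nx' h l := by
  induction l with
  | nil => exact fun _ h => h
  | cons x l ih =>
    rintro h hx ⟨h1, h2, h3⟩
    refine ⟨h1, h2, ?_⟩
    rw [hx x (by simp)]
    exact ih (fun y hy => hx y (by simp [hy])) h3

/-- `while p ≠ 0 { body; p := nx[p] }` for the array `nx` of number `k` -/
def Cmd.forChain (p k : ℕ) (body : Cmd) : Cmd :=
  .while (.lt (.lit 0) (.var p)) (.seq body (.assign p (.get k (.var p))))

/-- The body may write to the array of links as long as the links of `L` keep their values. This is
needed when the frontier list that is being traversed shares its array with the nodes that are being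
pushed. Test and advance cost `9` per element. -/
theorem Wp.forChain {p k : ℕ} {body : Cmd} (L : List ℕ) (I : List ℕ → HState → Prop) (c : ℕ → ℕ)
    (hp : body.modVar p = false) (hL : Chain (s.arr k) (s.var p) L) (hk : k < E.K)
    (hZ : ∀ x ∈ L, x < E.Z) (h0 : I [] s)
    (hb : ∀ pre x post s', L = pre ++ x :: post → I pre s' → s'.var p = x →
      Frame (.forChain p k body) s s' → (∀ y ∈ L, s'.arr k y = s.arr k y) →
      Wp E body s' fun s'' t => (∀ y ∈ L, s''.arr k y = s.arr k y) ∧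
        (∀ a, I (pre ++ [x]) (s''.setVar p a)) ∧ t ≤ c x)
    (hQ : ∀ s' t, I L s' → s'.var p = 0 → Frame (.forChain p k body) s s' →
      (∀ y ∈ L, s'.arr k y = s.arr k y) → t ≤ (L.map fun x => c x + 9).sum + 3 → Q s' t) :
    Wp E (.forChain p k body) s Q := by
  suffices H : ∀ post pre s', L = pre ++ post → I pre s' → Chain (s.arr k) (s'.var p) post →
      Frame (.forChain p k body) s s' → (∀ y ∈ L, s'.arr k y = s.arr k y) →
      ∃ s'' t, HRun E (.forChain p k body) s' t s'' ∧ I L s'' ∧ s''.var p = 0 ∧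
        (∀ y ∈ L, s''.arr k y = s.arr k y) ∧ t ≤ (post.map fun x => c x + 9).sum + 3 by
    obtain ⟨s', t, hr, h1, h2, h3, h4⟩ := H L [] s rfl h0 hL (.refl _ _) (fun _ _ => rfl)
    exact ⟨s', t, hr, hQ s' t h1 h2 hr.frame h3 h4⟩
  intro post
  induction post with
  | nil =>
    intro pre s' hpre hI hch hf hL'
    rw [List.append_nil] at hpre
    subst hpre
    have hch : s'.var p = 0 := hch
    exact ⟨s', _, .while_false ⟨by simp [Expr.Ok], trivial⟩ (by simp [Test.Holds, Expr.eval, hch]),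
      hI, hch, hL', by simp [Test.cost, Expr.cost]⟩
  | cons x post ih =>
    intro pre s' hpre hI hch hf hL'
    obtain ⟨hx, hx0, hch⟩ := hch
    have hxL : x ∈ L := by simp [hpre]
    obtain ⟨s1, t1, hr1, hL1, hI1, ht1⟩ := hb pre x post s' hpre hI hx hf hL'
    have hx1 : s1.var p = x := by rw [hr1.frame.var p hp, hx]
    have hr2 : HRun E (.assign p (.get k (.var p))) s1 6 (s1.setVar p (s.arr k x)) := by
      have := HRun.assign (E := E) p (.get k (.var p)) s1
        ⟨trivial, hk, by simpa [Expr.eval, hx1] using hZ x hxL⟩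
      simpa [Expr.eval, hx1, Expr.cost, hL1 x hxL] using this
    have hr3 := HRun.seq hr1 hr2
    have hf3 : Frame (.forChain p k body) s' (s1.setVar p (s.arr k x)) :=
      ⟨hr3.frame.var, hr3.frame.arr, hr3.frame.out⟩
    obtain ⟨s4, t4, hr4, hI4, hp4, hL4, ht4⟩ := ih (pre ++ [x]) _ (by simp [hpre])
      (hI1 _) (by simpa using hch) (hf.trans hf3) hL1
    refine ⟨s4, _, .while_true ⟨by simp [Expr.Ok], trivial⟩ ?_ hr3 hr4, hI4, hp4, hL4, ?_⟩
    · simp only [Test.Holds, Expr.eval, hx]; omega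
    · simp only [Test.cost, Expr.cost, List.map_cons, List.sum_cons]
      omega

end Rules
end TPS
/-! ### Pairs of trees on common node numbers -/

namespace TPS

/-- The list of the `i ∈ {1, …, n}` with key `g`, the largest first. -/
def bucket (key : ℕ → ℕ) : ℕ → ℕ → List ℕ
  | 0, _ => []
  | n + 1, g => if key (n + 1) = g then (n + 1) :: bucket key n g else bucket key n g

theorem mem_bucket {key : ℕ → ℕ} {n g x : ℕ} : x ∈ bucket key n g ↔ (1 ≤ x ∧ x ≤ n) ∧ key x = g := by
  induction n with
  | zero => simp [bucket]; omega
  | succ n ih =>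
    rw [bucket]
    split_ifs with h
    · rw [List.mem_cons, ih]
      constructor
      · rintro (rfl | h)
        · exact ⟨⟨by omega, le_rfl⟩, h⟩
        · exact ⟨⟨h.1.1, by omega⟩, h.2⟩
      · rintro ⟨h1, h2⟩
        by_cases hx : x = n + 1
        · exact .inl hx
        · exact .inr ⟨⟨h1.1, by omega⟩, h2⟩
    · rw [ih]
      constructor
      · rintro h
        exact ⟨⟨h.1.1, by omega⟩, h.2⟩
      · rintro ⟨h1, h2⟩
        have : x ≠ n + 1 := by rintro rfl; exact h h2
        exact ⟨⟨h1.1, by omega⟩, h2⟩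

theorem nodup_bucket (key : ℕ → ℕ) (n g : ℕ) : (bucket key n g).Nodup := by
  induction n with
  | zero => simp [bucket]
  | succ n ih =>
    rw [bucket]
    split_ifs with h
    · refine List.nodup_cons.2 ⟨fun h => ?_, ih⟩
      have := (mem_bucket.1 h).1.2
      omega
    · exact ih

theorem length_bucket (key : ℕ → ℕ) (n g : ℕ) :
    (bucket key n g).length = ((Finset.Icc 1 n).filter (key · = g)).card := by
  rw [← List.toFinset_card_of_nodup (nodup_bucket key n g)]
  congr 1
  ext x
  simp [mem_bucket]

theorem sum_length_bucket (key : ℕ → ℕ) (n G : ℕ) :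
    ∑ g ∈ Finset.range G, (bucket key n g).length ≤ n := by
  simp_rw [length_bucket]
  rw [← Finset.card_biUnion]
  · refine (Finset.card_le_card (t := Finset.Icc 1 n) ?_).trans (by simp)
    intro x hx
    simp only [Finset.mem_biUnion, Finset.mem_filter] at hx
    obtain ⟨_, _, h, _⟩ := hx
    exact h
  · intro a _ b _ hab
    refine Finset.disjoint_left.2 fun x hx hx' => hab ?_
    rw [← (Finset.mem_filter.1 hx).2, ← (Finset.mem_filter.1 hx').2]

/-- Two rooted trees: the nodes of the first are `1, …, nP`, those of the second
`nP + 1, …, nP + nT`. Roots have parent `0`, and `rp x` is the path from `x` to its root. -/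
structure Forest (nP nT : ℕ) where
  par : ℕ → ℕ
  lab : ℕ → ℕ
  rp : ℕ → List ℕ
  rP : ℕ
  rT : ℕ
  rP_mem : 1 ≤ rP ∧ rP ≤ nP
  rT_mem : nP < rT ∧ rT ≤ nP + nT
  par_rP : par rP = 0
  par_rT : par rT = 0
  par_P : ∀ x, 1 ≤ x → x ≤ nP → x ≠ rP → 1 ≤ par x ∧ par x ≤ nP
  par_T : ∀ x, nP < x → x ≤ nP + nT → x ≠ rT → nP < par x ∧ par x ≤ nP + nT
  rp_zero : rp 0 = []
  rp_cons : ∀ x, 1 ≤ x → x ≤ nP + nT → rp x = x :: rp (par x)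

/-! ### Matching along paths, and antichains of newly matched nodes -/

namespace Forest

variable {nP nT : ℕ} (F : Forest nP nT)

def InP (_ : Forest nP nT) (x : ℕ) : Prop := 1 ≤ x ∧ x ≤ nP
def InT (_ : Forest nP nT) (v : ℕ) : Prop := nP < v ∧ v ≤ nP + nT

/-- The path to `x` is a subsequence of the path to `v`. -/
def Mt (x v : ℕ) : Prop := ((F.rp x).map F.lab).Sublist ((F.rp v).map F.lab)

/-- The node `x` is matched by `v` but not by the parent of `v`. -/
def New (x v : ℕ) : Prop := F.Mt x v ∧ ¬ F.Mt x (F.par v)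

variable {F}

theorem InP.all {x : ℕ} (h : F.InP x) : 1 ≤ x ∧ x ≤ nP + nT := ⟨h.1, h.2.trans (by omega)⟩
theorem InT.all {x : ℕ} (h : F.InT x) : 1 ≤ x ∧ x ≤ nP + nT := ⟨by have := h.1; omega, h.2⟩

theorem InP.par {x : ℕ} (h : F.InP x) : F.par x = 0 ∨ F.InP (F.par x) := by
  by_cases hx : x = F.rP
  · exact .inl (hx ▸ F.par_rP)
  · exact .inr (F.par_P x h.1 h.2 hx)

theorem InT.par {x : ℕ} (h : F.InT x) : F.par x = 0 ∨ F.InT (F.par x) := by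
  by_cases hx : x = F.rT
  · exact .inl (hx ▸ F.par_rT)
  · exact .inr (F.par_T x h.1 h.2 hx)

theorem mt_zero (v : ℕ) : F.Mt 0 v := by simp [Mt, F.rp_zero]

theorem not_mt_zero {x : ℕ} (h : F.InP x) : ¬ F.Mt x 0 := by
  simp [Mt, F.rp_zero, F.rp_cons x h.all.1 h.all.2]

/-- `rp` lists paths upwards, so each list starts with its own node. An embedding either skips `v`
or uses it for `x`. Both algorithms evaluate this recursion. -/
theorem mt_iff {x v : ℕ} (hx : F.InP x) (hv : F.InT v) :
    F.Mt x v ↔ F.Mt x (F.par v) ∨ F.lab x = F.lab v ∧ F.Mt (F.par x) (F.par v) := by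
  simp only [Mt]
  rw [F.rp_cons x hx.all.1 hx.all.2, F.rp_cons v hv.all.1 hv.all.2, List.map_cons, List.map_cons]
  exact List.cons_sublist_cons'

theorem mt_of_mt_par {x v : ℕ} (hv : F.InT v) (h : F.Mt x (F.par v)) : F.Mt x v := by
  simp only [Mt] at *
  rw [F.rp_cons v hv.all.1 hv.all.2, List.map_cons]
  exact h.cons _

theorem new_iff {x v : ℕ} (hx : F.InP x) (hv : F.InT v) :
    F.New x v ↔ F.lab x = F.lab v ∧ F.Mt (F.par x) (F.par v) ∧ ¬ F.Mt x (F.par v) := by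
  rw [New, mt_iff hx hv]
  tauto

theorem suffix_of_mem {x a : ℕ} (hx : x = 0 ∨ F.InP x ∨ F.InT x) (ha : a ∈ F.rp x) :
    F.rp a <:+ F.rp x := by
  generalize hn : (F.rp x).length = n
  induction n generalizing x with
  | zero =>
    rw [List.length_eq_zero_iff] at hn
    simp [hn] at ha
  | succ n ih =>
    have hx' : F.InP x ∨ F.InT x := by
      rcases hx with rfl | hx
      · simp [F.rp_zero] at hn
      · exact hx
    have hc : F.rp x = x :: F.rp (F.par x) := by
      rcases hx' with h | h <;> exact F.rp_cons x h.all.1 h.all.2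
    have hp : F.par x = 0 ∨ F.InP (F.par x) ∨ F.InT (F.par x) := by
      rcases hx' with h | h
      · exact h.par.imp_right .inl
      · exact h.par.imp_right .inr
    rw [hc] at ha hn ⊢
    rcases List.mem_cons.1 ha with rfl | ha
    · rw [hc]
    · exact (ih hp ha (by simpa using hn)).trans (List.suffix_cons _ _)

theorem mt_left {x y v : ℕ} (h : F.Mt x v) (hs : F.rp y <:+ F.rp x) : F.Mt y v :=
  (hs.sublist.map _).trans h

theorem mt_right {x v u : ℕ} (h : F.Mt x v) (hs : F.rp v <:+ F.rp u) : F.Mt x u :=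
  h.trans (hs.sublist.map _)

theorem mem_rp_self {x : ℕ} (h : F.InP x ∨ F.InT x) : x ∈ F.rp x := by
  rcases h with h | h <;> · rw [F.rp_cons x h.all.1 h.all.2]; simp

theorem length_rp {x : ℕ} (h : F.InP x ∨ F.InT x) :
    (F.rp x).length = (F.rp (F.par x)).length + 1 := by
  rcases h with h | h <;> · rw [F.rp_cons x h.all.1 h.all.2]; simp

theorem par_ne_self {x : ℕ} (h : F.InP x ∨ F.InT x) : F.par x ≠ x := by
  intro hx
  have := length_rp h
  rw [hx] at this
  omega

/-- An antichain in one of the trees has at most as many elements as the tree has leaves. -/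
theorem card_antichain_le (D : Finset ℕ) (hD : ∀ x ∈ D, F.InP x ∨ F.InT x)
    (S : Finset ℕ) (hS : S ⊆ D) (hanti : ∀ a ∈ S, ∀ b ∈ S, a ≠ b → a ∉ F.rp b) :
    S.card ≤ (D.filter fun x => ∀ u ∈ D, F.par u ≠ x).card := by
  have key : ∀ a ∈ S, ∃ x ∈ D, (∀ u ∈ D, F.par u ≠ x) ∧ a ∈ F.rp x := by
    intro a ha
    have hne : (D.filter fun x => a ∈ F.rp x).Nonempty :=
      ⟨a, Finset.mem_filter.2 ⟨hS ha, mem_rp_self (hD a (hS ha))⟩⟩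
    -- A deepest node of `D` below `a` has no child in `D`, since such a child would also lie below
    -- `a`.
    obtain ⟨x, hx, hmax⟩ := Finset.exists_max_image _ (fun x => (F.rp x).length) hne
    rw [Finset.mem_filter] at hx
    refine ⟨x, hx.1, fun u hu hux => ?_, hx.2⟩
    have hau : a ∈ F.rp u := by
      rcases hD u hu with h | h <;>
      · rw [F.rp_cons u h.all.1 h.all.2, hux]; exact List.mem_cons_of_mem _ hx.2
    have h1 := hmax u (Finset.mem_filter.2 ⟨hu, hau⟩)
    have h2 := length_rp (hD u hu)
    rw [hux] at h2
    omega
  choose! l hl1 hl2 hl3 using key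
  refine Finset.card_le_card_of_injOn l (fun a ha => ?_) fun a ha b hb hab => ?_
  · simpa using ⟨hl1 a ha, hl2 a ha⟩
  · by_contra hne
    have hd : l a = 0 ∨ F.InP (l a) ∨ F.InT (l a) := .inr (hD _ (hl1 a ha))
    have ha3 := suffix_of_mem hd (hl3 a ha)
    have hb3 := suffix_of_mem hd (hab ▸ hl3 b hb)
    -- If `a` and `b` have the same chosen leaf, both lie on its path and are comparable.
    rcases List.suffix_or_suffix_of_suffix ha3 hb3 with h | h
    · exact hanti a ha b hb hne (h.subset (mem_rp_self (hD a (hS ha))))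
    · exact hanti b hb a ha (Ne.symm hne) (h.subset (mem_rp_self (hD b (hS hb))))

/-- A proper ancestor of `b` is an ancestor of the parent of `b`. That parent is matched by the
parent of `v`, hence so is the ancestor, which is then not new. -/
theorem not_mem_rp_of_new {v a b : ℕ} (hb : F.InP b) (hv : F.InT v)
    (ha' : F.New a v) (hb' : F.New b v) (hne : a ≠ b) : a ∉ F.rp b := by
  intro h
  rw [F.rp_cons b hb.all.1 hb.all.2, List.mem_cons] at h
  have h := h.resolve_left hne
  have hs := suffix_of_mem (hb.par.imp_right .inl) h
  exact ha'.2 (mt_left ((new_iff hb hv).1 hb').2.1 hs)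

theorem not_new_zero {v : ℕ} : ¬ F.New 0 v := fun h => h.2 (mt_zero _)

/-- If `a` were a proper ancestor of `b`, then the parent of `a` would be an ancestor of the parent
of `b`, and different from it by depth. This contradicts the case of newly matched nodes. -/
theorem not_mem_rp_of_new_par {v a b : ℕ} (ha : F.InP a) (hb : F.InP b) (hv : F.InT v)
    (ha' : F.New (F.par a) v) (hb' : F.New (F.par b) v) (hne : a ≠ b) : a ∉ F.rp b := by
  intro h
  rw [F.rp_cons b hb.all.1 hb.all.2, List.mem_cons] at h
  have h := h.resolve_left hne
  have hpa : F.InP (F.par a) := ha.par.resolve_left fun h0 => not_new_zero (h0 ▸ ha')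
  have hpb : F.InP (F.par b) := hb.par.resolve_left fun h0 => not_new_zero (h0 ▸ hb')
  have hs := suffix_of_mem (.inr (.inl hpb)) h
  have h1 : F.par a ∈ F.rp (F.par b) := hs.subset (by
    rw [F.rp_cons a ha.all.1 ha.all.2]
    exact List.mem_cons_of_mem _ (mem_rp_self (.inl hpa)))
  refine not_mem_rp_of_new hpb hv ha' hb' (fun he => ?_) h1
  have h2 := hs.length_le
  have h3 := length_rp (.inl ha)
  rw [he] at h3
  omega

/-- Below a node that matches `x`, the parent of every node matches `x` as well, so `x` is new at
most once on a path of `T`. -/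
theorem not_mem_rp_of_new_right {x v u : ℕ} (hu : F.InT u)
    (h1 : F.New x v) (h2 : F.New x u) (hne : v ≠ u) : v ∉ F.rp u := by
  intro h
  rw [F.rp_cons u hu.all.1 hu.all.2, List.mem_cons] at h
  have h := h.resolve_left hne
  have hs := suffix_of_mem (hu.par.imp_right .inr) h
  exact h2.2 (mt_right h1.1 hs)

variable (F)

def nodesP (_ : Forest nP nT) : Finset ℕ := Finset.Icc 1 nP
def nodesT (_ : Forest nP nT) : Finset ℕ := Finset.Ioc nP (nP + nT)
def leavesP : Finset ℕ := F.nodesP.filter fun x => ∀ u ∈ F.nodesP, F.par u ≠ x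
def leavesT : Finset ℕ := F.nodesT.filter fun x => ∀ u ∈ F.nodesT, F.par u ≠ x

open Classical in
noncomputable def newSet (v : ℕ) : Finset ℕ := F.nodesP.filter (F.New · v)

-- These are the nodes that join the frontier at `v`.
open Classical in
noncomputable def newKids (v : ℕ) : Finset ℕ := F.nodesP.filter fun u => F.New (F.par u) v

variable {F}

theorem mem_nodesP {x : ℕ} : x ∈ F.nodesP ↔ F.InP x := by simp [nodesP, InP]
theorem mem_nodesT {x : ℕ} : x ∈ F.nodesT ↔ F.InT x := by simp [nodesT, InT]

open Classical in
theorem card_newSet_le {v : ℕ} (hv : F.InT v) : (F.newSet v).card ≤ F.leavesP.card := by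
  refine card_antichain_le F.nodesP (fun x hx => .inl (mem_nodesP.1 hx)) _
    (Finset.filter_subset _ _) fun a ha b hb hne => ?_
  simp only [newSet, Finset.mem_filter, mem_nodesP] at ha hb
  exact not_mem_rp_of_new hb.1 hv ha.2 hb.2 hne

open Classical in
theorem card_newKids_le {v : ℕ} (hv : F.InT v) : (F.newKids v).card ≤ F.leavesP.card := by
  refine card_antichain_le F.nodesP (fun x hx => .inl (mem_nodesP.1 hx)) _
    (Finset.filter_subset _ _) fun a ha b hb hne => ?_
  simp only [newKids, Finset.mem_filter, mem_nodesP] at ha hb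
  exact not_mem_rp_of_new_par ha.1 hb.1 hv ha.2 hb.2 hne

open Classical in
theorem card_new_right_le (x : ℕ) : (F.nodesT.filter (F.New x)).card ≤ F.leavesT.card := by
  refine card_antichain_le F.nodesT (fun x hx => .inr (mem_nodesT.1 hx)) _
    (Finset.filter_subset _ _) fun a ha b hb hne => ?_
  simp only [Finset.mem_filter, mem_nodesT] at ha hb
  exact not_mem_rp_of_new_right hb.1 ha.2 hb.2 hne

theorem card_nodesP : F.nodesP.card = nP := by simp [nodesP]
theorem card_nodesT : F.nodesT.card = nT := by simp [nodesT]

/-- Each node of `T` contributes two antichains of `P`. -/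
theorem sum_new_le_left :
    ∑ v ∈ F.nodesT, ((F.newSet v).card + (F.newKids v).card) ≤ 2 * (F.leavesP.card * nT) := by
  refine (Finset.sum_le_card_nsmul _ _ (2 * F.leavesP.card) fun v hv => ?_).trans ?_
  · have h1 := card_newSet_le (mem_nodesT.1 hv)
    have h2 := card_newKids_le (mem_nodesT.1 hv)
    omega
  · rw [card_nodesT, smul_eq_mul]
    exact le_of_eq (by ring)

-- Double counting: the pairs are summed by the node of `P`, and each node contributes antichains of
-- `T`. The auxiliary function `f` is the identity for `newSet` and the parent map for `newKids`.
open Classical in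
theorem sum_new_le_right :
    ∑ v ∈ F.nodesT, ((F.newSet v).card + (F.newKids v).card) ≤ 2 * (nP * F.leavesT.card) := by
  have key : ∀ f : ℕ → ℕ, ∑ v ∈ F.nodesT, (F.nodesP.filter fun u => F.New (f u) v).card ≤
      nP * F.leavesT.card := by
    intro f
    have := Finset.sum_card_bipartiteAbove_eq_sum_card_bipartiteBelow (s := F.nodesT)
      (t := F.nodesP) (fun v u => F.New (f u) v)
    simp only [Finset.bipartiteAbove, Finset.bipartiteBelow] at this
    rw [this]
    refine (Finset.sum_le_card_nsmul _ _ F.leavesT.card fun u _ => card_new_right_le (f u)).trans ?_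
    rw [card_nodesP, smul_eq_mul]
  rw [Finset.sum_add_distrib]
  have h1 := key id
  have h2 := key F.par
  simp only [id] at h1
  simp only [newSet, newKids]
  omega

end Forest
end TPS
/-! ### Building linked lists -/

namespace TPS

open WordRAM
open TPS.Expr (var lit get inp)
open TPS.Cmd (assign store emit skip ite)

infixr:30 " ;; " => Cmd.seq

section Eval
variable (E : Env) (s : HState) (a b i : Expr) (x k c : ℕ)

namespace Expr
@[simp] theorem eval_var : (var x).eval E s = s.var x := rfl
@[simp] theorem eval_lit : (lit c).eval E s = c := rfl
@[simp] theorem eval_add : (a + b).eval E s = a.eval E s + b.eval E s := rfl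
@[simp] theorem eval_sub : (a - b).eval E s = a.eval E s - b.eval E s := rfl
@[simp] theorem eval_mul : (a * b).eval E s = a.eval E s * b.eval E s := rfl
@[simp] theorem eval_shl : (bin .shl a b).eval E s = a.eval E s <<< b.eval E s := rfl
@[simp] theorem eval_shr : (bin .shr a b).eval E s = a.eval E s >>> b.eval E s := rfl
@[simp] theorem eval_and : (bin .and a b).eval E s = a.eval E s &&& b.eval E s := rfl
@[simp] theorem eval_or : (bin .or a b).eval E s = a.eval E s ||| b.eval E s := rfl
@[simp] theorem eval_xor : (bin .xor a b).eval E s = a.eval E s ^^^ b.eval E s := rfl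
@[simp] theorem eval_get : (get k i).eval E s = s.arr k (i.eval E s) := rfl
@[simp] theorem eval_inp : (inp i).eval E s = E.inp (i.eval E s) := rfl
@[simp] theorem ok_var : (var x).Ok E s := trivial
@[simp] theorem ok_lit : (lit c).Ok E s ↔ c < 16 := Iff.rfl
@[simp] theorem ok_add : (a + b).Ok E s ↔ a.Ok E s ∧ b.Ok E s ∧ a.eval E s + b.eval E s < E.B := Iff.rfl
@[simp] theorem ok_sub : (a - b).Ok E s ↔ a.Ok E s ∧ b.Ok E s ∧ b.eval E s ≤ a.eval E s := Iff.rfl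
@[simp] theorem ok_mul : (a * b).Ok E s ↔ a.Ok E s ∧ b.Ok E s ∧ a.eval E s * b.eval E s < E.B := Iff.rfl
@[simp] theorem ok_shl :
    (bin .shl a b).Ok E s ↔ a.Ok E s ∧ b.Ok E s ∧ a.eval E s <<< b.eval E s < E.B := Iff.rfl
@[simp] theorem ok_shr : (bin .shr a b).Ok E s ↔ a.Ok E s ∧ b.Ok E s := by simp [Ok, OpOk]
@[simp] theorem ok_and : (bin .and a b).Ok E s ↔ a.Ok E s ∧ b.Ok E s := by simp [Ok, OpOk]
@[simp] theorem ok_or : (bin .or a b).Ok E s ↔ a.Ok E s ∧ b.Ok E s := by simp [Ok, OpOk]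
@[simp] theorem ok_xor : (bin .xor a b).Ok E s ↔ a.Ok E s ∧ b.Ok E s := by simp [Ok, OpOk]
@[simp] theorem ok_get : (get k i).Ok E s ↔ i.Ok E s ∧ k < E.K ∧ i.eval E s < E.Z := Iff.rfl
@[simp] theorem ok_inp : (inp i).Ok E s ↔ i.Ok E s ∧ i.eval E s < E.Z := Iff.rfl
@[simp] theorem cost_var : (var x).cost = 1 := rfl
@[simp] theorem cost_lit : (lit c).cost = 1 := rfl
@[simp] theorem cost_add : (a + b).cost = a.cost + b.cost + 1 := rfl
@[simp] theorem cost_sub : (a - b).cost = a.cost + b.cost + 1 := rfl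
@[simp] theorem cost_mul : (a * b).cost = a.cost + b.cost + 1 := rfl
@[simp] theorem cost_bin (o : BinOp) : (bin o a b).cost = a.cost + b.cost + 1 := rfl
@[simp] theorem cost_get : (get k i).cost = i.cost + 4 := rfl
@[simp] theorem cost_inp : (inp i).cost = i.cost + 1 := rfl
end Expr

namespace Test
@[simp] theorem holds_eq : (Test.eq a b).Holds E s ↔ a.eval E s = b.eval E s := Iff.rfl
@[simp] theorem holds_lt : (Test.lt a b).Holds E s ↔ a.eval E s < b.eval E s := Iff.rfl
@[simp] theorem ok_eq : (Test.eq a b).Ok E s ↔ a.Ok E s ∧ b.Ok E s := Iff.rfl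
@[simp] theorem ok_lt : (Test.lt a b).Ok E s ↔ a.Ok E s ∧ b.Ok E s := Iff.rfl
@[simp] theorem cost_eq : (Test.eq a b).cost = a.cost + b.cost := rfl
@[simp] theorem cost_lt : (Test.lt a b).cost = a.cost + b.cost := rfl
end Test

end Eval

/-- The machine has 32 arrays of length `4 N`, and all addresses are values. -/
structure Env.Good (E : Env) (N : ℕ) : Prop where
  Z : E.Z = 4 * N
  K : E.K = 32
  B : 132 * N ≤ E.B
  N : 2 ≤ N

/-- Distribute `1, …, N` to linked lists by the keys in array `k`; `h` is the array of the heads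
and `n` the array of the links. -/
def bucketCmd (k h n : ℕ) : Cmd :=
  .for 20 3 (
    assign 21 (var 20 + lit 1) ;;
    store n (var 21) (get h (get k (var 21))) ;;
    store h (get k (var 21)) (var 21))

theorem wp_bucketCmd {E : Env} {N k h n G : ℕ} {s : HState} {Q : HState → ℕ → Prop} (hE : E.Good N)
    (hN : s.var 3 = N) (hk : k < 32) (hh : h < 32) (hn : n < 32) (hkh : k ≠ h) (hkn : k ≠ n)
    (hhn : h ≠ n) (hkey : ∀ x, 1 ≤ x → x ≤ N → s.arr k x < G) (hG : G ≤ 4 * N)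
    (h0 : ∀ g < G, s.arr h g = 0)
    (hQ : ∀ s' t, Frame (bucketCmd k h n) s s' →
      (∀ g < G, Chain (s'.arr n) (s'.arr h g) (bucket (s.arr k) N g)) → t ≤ 60 * N + 5 → Q s' t) :
    Wp E (bucketCmd k h n) s Q := by
  have hZ := hE.Z
  have hK := hE.K
  have hB := hE.B
  have hN2 := hE.N
  refine Wp.for (fun i s' => ∀ g < G, Chain (s'.arr n) (s'.arr h g) (bucket (s.arr k) i g))
    (fun _ => 53) (by decide) rfl rfl (by omega) ?_ ?_ ?_
  · simpa [bucket, Chain] using h0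
  · intro i s' hi hI hx hf
    have hks : s'.arr k = s.arr k := hf.arr k (by simp [Cmd.for, Cmd.modArr, hkh, hkn])
    have hkey' := hkey (i + 1) (by omega) (by omega)
    simp only [wp_seq, wp_assign, wp_store, Expr.eval_var, Expr.eval_lit, Expr.eval_add, hx,
      HState.setVar_var, HState.setVar_arr, HState.setArr_arr, HState.setArr_var, Expr.eval_get]
    simp [hx, hks, hkn, hK, hZ, hk, hh, hn]
    refine ⟨by omega, ⟨by omega, by omega⟩, by omega, fun g hg => ?_⟩
    rw [bucket]
    by_cases hgk : s.arr k (i + 1) = g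
    · subst hgk
      simp only [if_true]
      refine ⟨by simp, by omega, ?_⟩
      refine Chain.congr (fun x hx => ?_) (nx := s'.arr n) ?_
      · have := (mem_bucket.1 hx).1
        have : x ≠ i + 1 := by omega
        simp [this, hhn.symm]
      · simpa [hhn.symm] using hI _ hg
    · rw [if_neg hgk]
      have hgk' : g ≠ s.arr k (i + 1) := Ne.symm hgk
      simp only [hgk', if_false]
      refine Chain.congr (fun x hx => ?_) (nx := s'.arr n) ?_
      · have := (mem_bucket.1 hx).1
        have : x ≠ i + 1 := by omega
        simp [this, hhn.symm]
      · simpa [hhn] using hI _ hg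
  · intro s' t hI hx hf ht
    rw [hN] at hI
    refine hQ s' t hf hI (ht.trans ?_)
    simp [hN, mul_comm]

end TPS
/-! ### Depth-first traversal of the second tree -/

namespace TPS

open WordRAM
open TPS.Expr (var lit get inp)
open TPS.Cmd (assign store emit skip ite)

/-- A number of iterations of a loop. -/
inductive Steps (E : Env) (c : Test) (p : Cmd) : HState → ℕ → HState → Prop where
  | refl (s) : Steps E c p s 0 s
  | head {s s' s'' t t'} (ho : c.Ok E s) (hc : c.Holds E s) (hp : HRun E p s t s')
      (hs : Steps E c p s' t' s'') : Steps E c p s (c.cost + t + 1 + t') s''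

/-- The traversal is one flat loop. Composing segments of it allows the proof to follow the
recursion over subtrees although the program does not recurse. -/
theorem Steps.trans {E : Env} {c : Test} {p : Cmd} {s s' s'' : HState} {t t' : ℕ}
    (h : Steps E c p s t s') (h' : Steps E c p s' t' s'') : Steps E c p s (t + t') s'' := by
  induction h with
  | refl => simpa using h'
  | head ho hc hp _ ih => rw [add_assoc]; exact .head ho hc hp (ih h')

theorem Steps.one {E : Env} {c : Test} {p : Cmd} {s s' : HState} {t : ℕ} (ho : c.Ok E s)
    (hc : c.Holds E s) (hp : HRun E p s t s') : Steps E c p s (c.cost + t + 1) s' :=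
  .head ho hc hp (.refl _)

theorem Steps.while {E : Env} {c : Test} {p : Cmd} {s s' : HState} {t : ℕ}
    (h : Steps E c p s t s') (ho : c.Ok E s') (hc : ¬ c.Holds E s') :
    HRun E (.while c p) s (t + (c.cost + 1)) s' := by
  induction h with
  | refl => rw [zero_add]; exact .while_false ho hc
  | head ho1 hc1 hp _ ih =>
    have := HRun.while_true ho1 hc1 hp (ih ho hc)
    convert this using 1
    omega

/-! ### Subtrees and paths of the second tree -/

namespace Forest

variable {nP nT : ℕ} (F : Forest nP nT)

def kids (v : ℕ) : List ℕ := bucket F.par (nP + nT) v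

variable {F}

theorem mem_kids {x v : ℕ} : x ∈ F.kids v ↔ (1 ≤ x ∧ x ≤ nP + nT) ∧ F.par x = v := mem_bucket

theorem InT.of_mem_kids {x v : ℕ} (hv : F.InT v) (hx : x ∈ F.kids v) : F.InT x := by
  obtain ⟨h1, h2⟩ := mem_kids.1 hx
  by_contra h
  have hxP : F.InP x := ⟨h1.1, by have := h1.2; simp only [InT] at h; omega⟩
  have := hxP.par
  rw [h2] at this
  have h3 := hv.1
  rcases this with h0 | h0
  · omega
  · have := h0.2; omega

theorem InP.of_mem_kids {x v : ℕ} (hv : F.InP v) (hx : x ∈ F.kids v) : F.InP x := by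
  obtain ⟨h1, h2⟩ := mem_kids.1 hx
  by_contra h
  have hxT : F.InT x := ⟨by simp only [InP] at h; omega, h1.2⟩
  have := hxT.par
  rw [h2] at this
  have h3 := hv.1
  have h4 := hv.2
  rcases this with h0 | h0
  · omega
  · have := h0.1; omega

/-- Two siblings on one path have the same depth and hence coincide. So the subtrees of different
children are disjoint. -/
theorem eq_of_mem_rp {x y u p : ℕ} (hx : F.InT x) (hy : F.InT y) (hu : F.InT u)
    (hpx : F.par x = p) (hpy : F.par y = p) (h1 : x ∈ F.rp u) (h2 : y ∈ F.rp u) : x = y := by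
  have hs1 := suffix_of_mem (.inr (.inr hu)) h1
  have hs2 := suffix_of_mem (.inr (.inr hu)) h2
  have hl1 := length_rp (.inr hx)
  have hl2 := length_rp (.inr hy)
  rw [hpx] at hl1
  rw [hpy] at hl2
  have : F.rp x = F.rp y := by
    rcases List.suffix_or_suffix_of_suffix hs1 hs2 with h | h
    · exact h.eq_of_length (by omega)
    · exact (h.eq_of_length (by omega)).symm
  rw [F.rp_cons x hx.all.1 hx.all.2, F.rp_cons y hy.all.1 hy.all.2] at this
  exact (List.cons.inj this).1

/-- With `eq_of_mem_rp` this splits the subtree of `v` into `v` and the disjoint subtrees of its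
children. -/
theorem exists_kid_of_mem_rp {v u : ℕ} (hu : F.InT u) (hv : v ∈ F.rp u) (hne : u ≠ v) :
    ∃ x ∈ F.kids v, x ∈ F.rp u := by
  generalize hn : (F.rp u).length = n
  induction n generalizing u with
  | zero => have := length_rp (.inr hu); omega
  | succ n ih =>
    have hc := F.rp_cons u hu.all.1 hu.all.2
    by_cases hp : F.par u = v
    · exact ⟨u, mem_kids.2 ⟨hu.all, hp⟩, mem_rp_self (.inr hu)⟩
    · rw [hc, List.mem_cons] at hv
      have hv := hv.resolve_left hne.symm
      have hpu : F.InT (F.par u) := hu.par.resolve_left fun h0 => by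
        rw [h0, F.rp_zero] at hv; simp at hv
      obtain ⟨x, hx, hxu⟩ := ih hpu hv hp (by rw [hc] at hn; simpa using hn)
      exact ⟨x, hx, by rw [hc]; exact List.mem_cons_of_mem _ hxu⟩

theorem rT_mem_rp {u : ℕ} (hu : F.InT u) : F.rT ∈ F.rp u := by
  generalize hn : (F.rp u).length = n
  induction n generalizing u with
  | zero => have := length_rp (.inr hu); omega
  | succ n ih =>
    by_cases h : u = F.rT
    · rw [h]; exact mem_rp_self (.inr F.rT_mem)
    · have hp : F.InT (F.par u) := F.par_T u hu.1 hu.2 h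
      rw [F.rp_cons u hu.all.1 hu.all.2]
      refine List.mem_cons_of_mem _ (ih hp ?_)
      have := length_rp (.inr hu)
      omega

theorem nodup_rp {u : ℕ} (hu : F.InT u) :
    (F.rp u).Nodup ∧ ∀ x ∈ F.rp u, F.InT x := by
  generalize hn : (F.rp u).length = n
  induction n generalizing u with
  | zero => have := length_rp (.inr hu); omega
  | succ n ih =>
    have hl := length_rp (.inr hu)
    rw [F.rp_cons u hu.all.1 hu.all.2]
    rcases hu.par with h0 | h0
    · rw [h0, F.rp_zero]
      exact ⟨by simp, by simpa using hu⟩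
    · obtain ⟨h1, h2⟩ := ih h0 (by omega)
      refine ⟨List.nodup_cons.2 ⟨fun h => ?_, h1⟩, ?_⟩
      · have := (suffix_of_mem (.inr (.inr h0)) h).length_le
        omega
      · intro x hx
        rcases List.mem_cons.1 hx with rfl | hx
        · exact hu
        · exact h2 x hx

/-- The nodes of a path are distinct. The bound makes the induction on the remaining depth in
`DfsSpec.visit` end. -/
theorem length_rp_le {u : ℕ} (hu : F.InT u) : (F.rp u).length ≤ nT := by
  obtain ⟨h1, h2⟩ := nodup_rp hu
  rw [← List.toFinset_card_of_nodup h1]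
  refine le_of_le_of_eq ?_ F.card_nodesT
  exact Finset.card_le_card fun x hx => mem_nodesT.2 (h2 x (List.mem_toFinset.1 hx))

end Forest

/-- Depth-first traversal: the current node is variable `12`; variable `13` is `1` when the node
is entered and `0` when it is left. -/
def dfsBody (enter leaf exit : Cmd) : Cmd :=
  ite (.eq (var 13) (lit 1))
    (enter ;; ite (.lt (lit 0) (get 2 (var 12))) (assign 12 (get 2 (var 12)))
      (leaf ;; assign 13 (lit 0)))
    (exit ;; ite (.lt (lit 0) (get 3 (var 12))) (assign 12 (get 3 (var 12)) ;; assign 13 (lit 1))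
      (assign 12 (get 0 (var 12))))

def dfsTest : Test := .lt (lit 0) (var 12)

def dfsCmd (enter leaf exit : Cmd) : Cmd :=
  assign 12 (var 5) ;; assign 13 (lit 1) ;; .while dfsTest (dfsBody enter leaf exit)

/-- The commands for the events of the traversal maintain the invariant `Inv v` of the current
node `v` within the times `ce`, `cl` and `cx`; the command for a leaf writes its block. -/
structure DfsSpec {nP nT : ℕ} (F : Forest nP nT) (E : Env) (s0 : HState) (enter leaf exit : Cmd)
    (Inv : ℕ → HState → Prop) (ce cl cx : ℕ → ℕ) (block : ℕ → List ℕ) : Prop where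
  good : E.Good (nP + nT)
  par : s0.arr 0 = F.par
  hd : ∀ v, F.InT v → Chain (s0.arr 3) (s0.arr 2 v) (F.kids v)
  root : s0.arr 3 F.rT = 0
  var12 : (enter.modVar 12 || leaf.modVar 12 || exit.modVar 12) = false
  var13 : (enter.modVar 13 || leaf.modVar 13 || exit.modVar 13) = false
  arr0 : (enter.modArr 0 || leaf.modArr 0 || exit.modArr 0) = false
  arr2 : (enter.modArr 2 || leaf.modArr 2 || exit.modArr 2) = false
  arr3 : (enter.modArr 3 || leaf.modArr 3 || exit.modArr 3) = false
  inv12 : ∀ v s a, Inv v s → Inv v (s.setVar 12 a)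
  inv13 : ∀ v s a, Inv v s → Inv v (s.setVar 13 a)
  wp_enter : ∀ v s, F.InT v → Inv (F.par v) s → s.var 12 = v → Frame (dfsCmd enter leaf exit) s0 s →
    Wp E enter s fun s' t => Inv v s' ∧ s'.out = s.out ∧ t ≤ ce v
  wp_leaf : ∀ v s, F.InT v → F.kids v = [] → Inv v s → s.var 12 = v →
    Frame (dfsCmd enter leaf exit) s0 s →
    Wp E leaf s fun s' t => Inv v s' ∧ s'.out = s.out ++ block v ∧ t ≤ cl v
  wp_exit : ∀ v s, F.InT v → Inv v s → s.var 12 = v → Frame (dfsCmd enter leaf exit) s0 s →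
    Wp E exit s fun s' t => Inv (F.par v) s' ∧ s'.out = s.out ∧ t ≤ cx v

namespace DfsSpec

variable {nP nT : ℕ} {F : Forest nP nT} {E : Env} {s0 : HState} {enter leaf exit : Cmd}
  {Inv : ℕ → HState → Prop} {ce cl cx : ℕ → ℕ} {block : ℕ → List ℕ}
  (h : DfsSpec F E s0 enter leaf exit Inv ce cl cx block)

/-- The time spent for the node `v`. -/
def cost (F : Forest nP nT) (ce cl cx : ℕ → ℕ) (v : ℕ) : ℕ :=
  ce v + cx v + (if (F.kids v).isEmpty then cl v else 0) + 80

theorem frame_body {s s' : HState} (hf : Frame (dfsBody enter leaf exit) s s') :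
    Frame (dfsCmd enter leaf exit) s s' :=
  ⟨fun x hx => hf.var x (by simp [dfsCmd, Cmd.modVar] at hx ⊢; exact hx.2.2),
    fun x hx => hf.arr x (by simp [dfsCmd, Cmd.modArr] at hx ⊢; exact hx),
    fun hx => hf.out (by simp [dfsCmd, Cmd.emits] at hx ⊢; exact hx)⟩

include h

theorem arrs {s : HState} (hf : Frame (dfsCmd enter leaf exit) s0 s) :
    s.arr 0 = F.par ∧ s.arr 2 = s0.arr 2 ∧ s.arr 3 = s0.arr 3 := by
  have h0 := h.arr0
  have h2 := h.arr2
  have h3 := h.arr3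
  simp only [Bool.or_eq_false_iff] at h0 h2 h3
  refine ⟨(hf.arr 0 ?_).trans h.par, hf.arr 2 ?_, hf.arr 3 ?_⟩
  all_goals simp [dfsCmd, dfsBody, Cmd.modArr, h0, h2, h3]

/-- The iteration that enters the node `v`. -/
theorem step_enter {v : ℕ} {s : HState} (hv : F.InT v) (hI : Inv (F.par v) s) (h12 : s.var 12 = v)
    (h13 : s.var 13 = 1) (hf : Frame (dfsCmd enter leaf exit) s0 s) :
    ∃ s' t, Steps E dfsTest (dfsBody enter leaf exit) s t s' ∧ Inv v s' ∧
      Frame (dfsCmd enter leaf exit) s0 s' ∧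
      ((F.kids v = [] ∧ s'.var 12 = v ∧ s'.var 13 = 0 ∧ s'.out = s.out ++ block v ∧
          t ≤ ce v + cl v + 30) ∨
        (F.kids v ≠ [] ∧ s'.var 12 = s0.arr 2 v ∧ s'.var 13 = 1 ∧ s'.out = s.out ∧
          t ≤ ce v + 30)) := by
  have h1 := h.var12
  have h2 := h.var13
  simp only [Bool.or_eq_false_iff] at h1 h2
  have hZ := h.good.Z
  have hK := h.good.K
  have hvZ : v < E.Z := by have := hv.all; omega
  have hd := h.hd v hv
  suffices H : Wp E (dfsBody enter leaf exit) s fun s' t => Inv v s' ∧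
      ((F.kids v = [] ∧ s'.var 12 = v ∧ s'.var 13 = 0 ∧ s'.out = s.out ++ block v ∧
          t ≤ ce v + cl v + 25) ∨
        (F.kids v ≠ [] ∧ s'.var 12 = s0.arr 2 v ∧ s'.var 13 = 1 ∧ s'.out = s.out ∧
          t ≤ ce v + 25)) by
    obtain ⟨s', t, hr, hI', hc⟩ := H
    refine ⟨s', _, Steps.one (by simp [dfsTest]) ?_ hr, hI', hf.trans (frame_body hr.frame), ?_⟩
    · have := hv.all.1
      simp only [dfsTest, Test.holds_lt, Expr.eval_lit, Expr.eval_var]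
      omega
    · simp only [dfsTest, Test.cost_lt, Expr.cost_lit, Expr.cost_var]
      rcases hc with ⟨ha, hb, hc, hd, he⟩ | ⟨ha, hb, hc, hd, he⟩
      · exact .inl ⟨ha, hb, hc, hd, by omega⟩
      · exact .inr ⟨ha, hb, hc, hd, by omega⟩
  rw [dfsBody, wp_ite]
  refine ⟨by simp, fun _ => ?_, fun hn => absurd (by simpa using h13) hn⟩
  rw [wp_seq]
  refine (h.wp_enter v s hv hI h12 hf).mono fun s1 t1 hf1 ⟨hI1, ho1, ht1⟩ => ?_
  have h12' : s1.var 12 = v := by rw [hf1.var 12 h1.1.1, h12]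
  have h13' : s1.var 13 = 1 := by rw [hf1.var 13 h2.1.1, h13]
  have harr2 : s1.arr 2 = s0.arr 2 := by
    have ha := h.arr2
    simp only [Bool.or_eq_false_iff] at ha
    rw [hf1.arr 2 ha.1.1, (h.arrs hf).2.1]
  have hf1' : Frame (dfsCmd enter leaf exit) s0 s1 :=
    hf.trans ⟨fun x hx => hf1.var x (by
        simp only [dfsCmd, dfsBody, Cmd.modVar, Bool.or_eq_false_iff] at hx; exact hx.2.2.1.1),
      fun x hx => hf1.arr x (by
        simp only [dfsCmd, dfsBody, Cmd.modArr, Bool.or_eq_false_iff] at hx; exact hx.2.2.1.1),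
      fun hx => hf1.out (by
        simp only [dfsCmd, dfsBody, Cmd.emits, Bool.or_eq_false_iff] at hx; exact hx.2.2.1.1)⟩
  rw [wp_ite]
  refine ⟨by simp [h12', hK, hvZ], fun hc => ?_, fun hc => ?_⟩
  · simp only [Test.holds_lt, Expr.eval_lit, Expr.eval_get, Expr.eval_var, h12', harr2] at hc
    simp only [wp_assign, Expr.ok_get, Expr.ok_var, Expr.eval_var, h12', hK, hvZ, Expr.eval_get,
      harr2, HState.setVar_var, HState.setVar_out]
    refine ⟨by simp, h.inv12 _ _ _ hI1, .inr ⟨fun hk => ?_, by simp, by simp [h13'], ho1, ?_⟩⟩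
    · rw [hk] at hd
      have : s0.arr 2 v = 0 := hd
      omega
    · simp; omega
  · simp only [Test.holds_lt, Expr.eval_lit, Expr.eval_get, Expr.eval_var, h12', harr2] at hc
    have hk : F.kids v = [] := by
      cases hkv : F.kids v with
      | nil => rfl
      | cons x l =>
        rw [hkv] at hd
        obtain ⟨hx, hx0, _⟩ := hd
        omega
    rw [wp_seq]
    refine (h.wp_leaf v s1 hv hk hI1 h12' hf1').mono fun s2 t2 hf2 ⟨hI2, ho2, ht2⟩ => ?_
    have h12'' : s2.var 12 = v := by rw [hf2.var 12 h1.1.2, h12']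
    simp only [wp_assign]
    refine ⟨by simp, h.inv13 _ _ _ hI2, .inl ⟨hk, by simp [h12''], by simp, ?_, ?_⟩⟩
    · simp [ho2, ho1]
    · simp; omega

/-- The iteration that leaves the node `v`. -/
theorem step_exit {v : ℕ} {s : HState} (hv : F.InT v) (hI : Inv v s) (h12 : s.var 12 = v)
    (h13 : s.var 13 = 0) (hf : Frame (dfsCmd enter leaf exit) s0 s) :
    ∃ s' t, Steps E dfsTest (dfsBody enter leaf exit) s t s' ∧ Inv (F.par v) s' ∧
      Frame (dfsCmd enter leaf exit) s0 s' ∧ s'.out = s.out ∧ t ≤ cx v + 40 ∧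
      ((s0.arr 3 v = 0 ∧ s'.var 12 = F.par v ∧ s'.var 13 = 0) ∨
        (s0.arr 3 v ≠ 0 ∧ s'.var 12 = s0.arr 3 v ∧ s'.var 13 = 1)) := by
  have h1 := h.var12
  have h2 := h.var13
  have ha0 := h.arr0
  have ha := h.arr3
  simp only [Bool.or_eq_false_iff] at h1 h2 ha0 ha
  have hZ := h.good.Z
  have hK := h.good.K
  have hvZ : v < E.Z := by have := hv.all; omega
  suffices H : Wp E (dfsBody enter leaf exit) s fun s' t => Inv (F.par v) s' ∧ s'.out = s.out ∧
      t ≤ cx v + 35 ∧ ((s0.arr 3 v = 0 ∧ s'.var 12 = F.par v ∧ s'.var 13 = 0) ∨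
        (s0.arr 3 v ≠ 0 ∧ s'.var 12 = s0.arr 3 v ∧ s'.var 13 = 1)) by
    obtain ⟨s', t, hr, hI', ho, ht, hc⟩ := H
    refine ⟨s', _, Steps.one (by simp [dfsTest]) ?_ hr, hI', hf.trans (frame_body hr.frame), ho,
      ?_, hc⟩
    · have := hv.all.1
      simp only [dfsTest, Test.holds_lt, Expr.eval_lit, Expr.eval_var]
      omega
    · simp only [dfsTest, Test.cost_lt, Expr.cost_lit, Expr.cost_var]
      omega
  rw [dfsBody, wp_ite]
  refine ⟨by simp, fun hn => absurd hn (by simp [h13]), fun _ => ?_⟩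
  rw [wp_seq]
  refine (h.wp_exit v s hv hI h12 hf).mono fun s1 t1 hf1 ⟨hI1, ho1, ht1⟩ => ?_
  have h12' : s1.var 12 = v := by rw [hf1.var 12 h1.2, h12]
  have h13' : s1.var 13 = 0 := by rw [hf1.var 13 h2.2, h13]
  have harr3 : s1.arr 3 = s0.arr 3 := by rw [hf1.arr 3 ha.2, (h.arrs hf).2.2]
  have harr0 : s1.arr 0 = F.par := by rw [hf1.arr 0 ha0.2, (h.arrs hf).1]
  rw [wp_ite]
  refine ⟨by simp [h12', hK, hvZ], fun hc => ?_, fun hc => ?_⟩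
  · simp only [Test.holds_lt, Expr.eval_lit, Expr.eval_get, Expr.eval_var, h12', harr3] at hc
    simp only [wp_seq, wp_assign, Expr.ok_get, Expr.ok_var, Expr.eval_var, h12', hK, hvZ,
      Expr.eval_get, harr3, HState.setVar_var, HState.setVar_out]
    refine ⟨by simp, by simp, h.inv13 _ _ _ (h.inv12 _ _ _ hI1), ho1, ?_,
      .inr ⟨by omega, by simp, by simp⟩⟩
    simp; omega
  · simp only [Test.holds_lt, Expr.eval_lit, Expr.eval_get, Expr.eval_var, h12', harr3] at hc
    simp only [wp_assign, Expr.ok_get, Expr.ok_var, Expr.eval_var, h12', hK, hvZ,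
      Expr.eval_get, harr0, HState.setVar_var, HState.setVar_out]
    refine ⟨by simp, h.inv12 _ _ _ hI1, ho1, ?_, .inl ⟨by omega, by simp, by simp [h13']⟩⟩
    simp; omega

/-- The traversal of the subtree of `v`. -/
theorem visit (m : ℕ) : ∀ (v : ℕ) (s : HState), F.InT v → nT < (F.rp v).length + m →
    Inv (F.par v) s → s.var 12 = v → s.var 13 = 1 → Frame (dfsCmd enter leaf exit) s0 s →
    ∃ (s' : HState) (t : ℕ) (V : List ℕ), Steps E dfsTest (dfsBody enter leaf exit) s t s' ∧ Inv v s' ∧ s'.var 12 = v ∧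
      s'.var 13 = 0 ∧ Frame (dfsCmd enter leaf exit) s0 s' ∧ V.Nodup ∧
      (∀ u, u ∈ V ↔ F.InT u ∧ v ∈ F.rp u) ∧
      s'.out = s.out ++ (V.filter fun u => (F.kids u).isEmpty).flatMap block ∧
      -- The segment ends before `v` is left; `cx v + 40` reserves the time for that iteration.
      t + cx v + 40 ≤ (V.map (cost F ce cl cx)).sum := by
  induction m with
  | zero =>
    intro v s hv hm
    have := Forest.length_rp_le hv
    omega
  | succ m ih =>
    intro v s hv hm hI h12 h13 hf
    obtain ⟨s1, t1, hs1, hI1, hf1, hc⟩ := h.step_enter hv hI h12 h13 hf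
    have hself := Forest.mem_rp_self (F := F) (.inr hv)
    rcases hc with ⟨hk, ha, hb, hc, hd⟩ | ⟨hk, ha, hb, hc, hd⟩
    · refine ⟨s1, t1, [v], hs1, hI1, ha, hb, hf1, by simp, fun u => ?_, ?_, ?_⟩
      · rw [List.mem_singleton]
        constructor
        · rintro rfl
          exact ⟨hv, hself⟩
        · rintro ⟨hu, hvu⟩
          by_contra hne
          obtain ⟨x, hx, _⟩ := Forest.exists_kid_of_mem_rp hu hvu hne
          simp [hk] at hx
      · simp [hk, hc]
      · simp [cost, hk]; omega
    -- An inner induction on the siblings that are still to be visited. Leaving the last one returns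
    -- to `v`.
    · have sib : ∀ (L : List ℕ) (x : ℕ) (s : HState), (∀ y ∈ x :: L, y ∈ F.kids v) →
          (x :: L).Nodup → Chain (s0.arr 3) x (x :: L) → Inv v s → s.var 12 = x → s.var 13 = 1 →
          Frame (dfsCmd enter leaf exit) s0 s →
          ∃ (s' : HState) (t : ℕ) (V : List ℕ), Steps E dfsTest (dfsBody enter leaf exit) s t s' ∧ Inv v s' ∧ s'.var 12 = v ∧
            s'.var 13 = 0 ∧ Frame (dfsCmd enter leaf exit) s0 s' ∧ V.Nodup ∧
            (∀ u, u ∈ V ↔ F.InT u ∧ ∃ y ∈ x :: L, y ∈ F.rp u) ∧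
            s'.out = s.out ++ (V.filter fun u => (F.kids u).isEmpty).flatMap block ∧
            t ≤ (V.map (cost F ce cl cx)).sum := by
        intro L
        induction L with
        | nil =>
          intro x s hL _ hch hI h12 h13 hf
          have hx := hL x (by simp)
          have hpx := (Forest.mem_kids.1 hx).2
          have hxT := hv.of_mem_kids hx
          have hl := Forest.length_rp (.inr hxT)
          rw [hpx] at hl
          obtain ⟨s2, t2, V, hs2, hI2, h122, h132, hf2, hV, hVm, ho2, ht2⟩ :=
            ih x s hxT (by omega) (by rwa [hpx]) h12 h13 hf
          obtain ⟨s3, t3, hs3, hI3, hf3, ho3, ht3, hc3⟩ := h.step_exit hxT hI2 h122 h132 hf2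
          obtain ⟨_, _, hch⟩ := hch
          have hch : s0.arr 3 x = 0 := hch
          rw [hpx] at hI3 hc3
          have hc3 := hc3.resolve_right fun h => h.1 hch
          exact ⟨s3, _, V, hs2.trans hs3, hI3, hc3.2.1, hc3.2.2, hf3, hV, by simpa using hVm,
            by rw [ho3, ho2], by omega⟩
        | cons y L ihL =>
          intro x s hL hnd hch hI h12 h13 hf
          have hx := hL x (by simp)
          have hpx := (Forest.mem_kids.1 hx).2
          have hxT := hv.of_mem_kids hx
          have hl := Forest.length_rp (.inr hxT)
          rw [hpx] at hl
          obtain ⟨s2, t2, V, hs2, hI2, h122, h132, hf2, hV, hVm, ho2, ht2⟩ :=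
            ih x s hxT (by omega) (by rwa [hpx]) h12 h13 hf
          obtain ⟨s3, t3, hs3, hI3, hf3, ho3, ht3, hc3⟩ := h.step_exit hxT hI2 h122 h132 hf2
          obtain ⟨_, _, hch⟩ := hch
          have hy := hch.1
          rw [hpx] at hI3 hc3
          have hc3 := hc3.resolve_left fun h => hch.2.1 (by rw [← hy, h.1])
          obtain ⟨s4, t4, V', hs4, hI4, h124, h134, hf4, hV', hVm', ho4, ht4⟩ :=
            ihL y s3 (fun z hz => hL z (List.mem_cons_of_mem _ hz)) (List.nodup_cons.1 hnd).2
              (by rw [hy] at hch; exact hch) hI3 (hc3.2.1.trans hy) hc3.2.2 hf3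
          refine ⟨s4, _, V ++ V', (hs2.trans hs3).trans hs4, hI4, h124, h134, hf4, ?_, ?_, ?_, ?_⟩
          · refine List.nodup_append.2 ⟨hV, hV', fun u hu w hw huw => ?_⟩
            subst huw
            obtain ⟨hu1, hu2⟩ := (hVm u).1 hu
            obtain ⟨_, z, hz, hzu⟩ := (hVm' u).1 hw
            have hzk := hL z (List.mem_cons_of_mem _ hz)
            have := Forest.eq_of_mem_rp hxT (hv.of_mem_kids hzk) hu1 hpx (Forest.mem_kids.1 hzk).2
              hu2 hzu
            exact (List.nodup_cons.1 hnd).1 (this ▸ hz)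
          · intro u
            rw [List.mem_append, hVm, hVm']
            simp only [List.mem_cons, exists_eq_or_imp, and_or_left]
          · rw [ho4, ho3, ho2]; simp
          · rw [List.map_append, List.sum_append]; omega
      have hd2 := h.hd v hv
      cases hkv : F.kids v with
      | nil => exact absurd hkv hk
      | cons x L =>
        rw [hkv] at hd2
        have hx := hd2.1
        obtain ⟨s2, t2, V, hs2, hI2, h122, h132, hf2, hV, hVm, ho2, ht2⟩ :=
          sib L x s1 (by rw [hkv]; simp) (by rw [← hkv]; exact nodup_bucket _ _ _)
            (by rw [hx] at hd2; exact hd2) hI1 (ha.trans hx) hb hf1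
        refine ⟨s2, _, v :: V, hs1.trans hs2, hI2, h122, h132, hf2, ?_, ?_, ?_, ?_⟩
        · refine List.nodup_cons.2 ⟨fun hvV => ?_, hV⟩
          obtain ⟨_, y, hy, hyv⟩ := (hVm v).1 hvV
          rw [← hkv] at hy
          have h1 := (Forest.suffix_of_mem (.inr (.inr hv)) hyv).length_le
          have h2 := Forest.length_rp (.inr (hv.of_mem_kids hy))
          rw [(Forest.mem_kids.1 hy).2] at h2
          omega
        · intro u
          rw [List.mem_cons, hVm, ← hkv]
          constructor
          · rintro (rfl | ⟨hu, y, hy, hyu⟩)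
            · exact ⟨hv, hself⟩
            · refine ⟨hu, (Forest.suffix_of_mem (.inr (.inr hu)) hyu).subset ?_⟩
              have hyT := hv.of_mem_kids hy
              rw [F.rp_cons y hyT.all.1 hyT.all.2, (Forest.mem_kids.1 hy).2]
              exact List.mem_cons_of_mem _ hself
          · rintro ⟨hu, hvu⟩
            by_cases hne : u = v
            · exact .inl hne
            · exact .inr ⟨hu, Forest.exists_kid_of_mem_rp hu hvu hne⟩
        · rw [ho2, hc, List.filter_cons_of_neg (by simp [hkv])]
        · simp only [List.map_cons, List.sum_cons, cost]
          simp only [hkv, List.isEmpty_cons]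
          omega

theorem wp {s : HState} {Q : HState → ℕ → Prop} (hs0 : s0 = s) (h5 : s.var 5 = F.rT) (hI : Inv 0 s)
    (hQ : ∀ s' t (Y : List ℕ), Frame (dfsCmd enter leaf exit) s s' → Y.Nodup →
      (∀ y, y ∈ Y ↔ F.InT y ∧ F.kids y = []) → s'.out = s.out ++ Y.flatMap block →
      t ≤ ∑ v ∈ F.nodesT, cost F ce cl cx v + 20 → Q s' t) :
    Wp E (dfsCmd enter leaf exit) s Q := by
  subst hs0
  have hrT : F.InT F.rT := F.rT_mem
  let s1 := (s0.setVar 12 F.rT).setVar 13 1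
  have h1 : HRun E (assign 12 (var 5)) s0 2 (s0.setVar 12 F.rT) := by
    have := HRun.assign (E := E) 12 (var 5) s0 trivial
    rwa [Expr.eval_var, h5] at this
  have h2 : HRun E (assign 13 (lit 1)) (s0.setVar 12 F.rT) 2 s1 :=
    HRun.assign (E := E) 13 (lit 1) _ (by simp)
  have hf1 : Frame (dfsCmd enter leaf exit) s0 s1 := by
    refine ⟨fun x hx => ?_, fun _ _ => rfl, fun _ => rfl⟩
    simp [dfsCmd, Cmd.modVar] at hx
    simp [s1, hx.1, hx.2.1]
  obtain ⟨s2, t2, V, hs2, hI2, h122, h132, hf2, hV, hVm, ho2, ht2⟩ :=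
    h.visit (nT + 1) F.rT s1 hrT (by omega) (by
      rw [F.par_rT]; exact h.inv13 _ _ _ (h.inv12 _ _ _ hI)) (by simp [s1]) (by simp [s1]) hf1
  obtain ⟨s3, t3, hs3, hI3, hf3, ho3, ht3, hc3⟩ := h.step_exit hrT hI2 h122 h132 hf2
  -- The root has no sibling, so leaving it leads to its parent `0`, which ends the loop.
  have hc3 := hc3.resolve_right fun hn => hn.1 h.root
  rw [F.par_rT] at hc3
  have hr := Steps.while (hs2.trans hs3) (by simp [dfsTest]) (by simp [dfsTest, hc3.2.1])
  have hr' := HRun.seq h1 (HRun.seq h2 hr)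
  refine ⟨s3, _, hr', hQ s3 _ (V.filter fun u => (F.kids u).isEmpty) hr'.frame (hV.filter _) ?_ ?_ ?_⟩
  · intro y
    rw [List.mem_filter, hVm, List.isEmpty_iff]
    exact ⟨fun h => ⟨h.1.1, h.2⟩, fun h => ⟨⟨h.1, Forest.rT_mem_rp h.1⟩, h.2⟩⟩
  · rw [ho3, ho2]; rfl
  · have : (V.map (cost F ce cl cx)).sum = ∑ v ∈ F.nodesT, cost F ce cl cx v := by
      rw [← List.sum_toFinset _ hV]
      congr 1
      ext u
      rw [List.mem_toFinset, hVm, Forest.mem_nodesT]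
      exact ⟨fun h => h.1, fun h => ⟨h, Forest.rT_mem_rp h⟩⟩
    rw [this] at ht2
    simp only [dfsTest, Test.cost_lt, Expr.cost_lit, Expr.cost_var]
    omega

end DfsSpec
end TPS
/-! ### The frontier lists -/

namespace TPS

open WordRAM
open TPS.Expr (var lit get inp)
open TPS.Cmd (assign store emit skip ite)

theorem Chain.tail {nx : ℕ → ℕ} {h x : ℕ} {l : List ℕ} (hc : Chain nx h (x :: l)) :
    Chain nx (nx h) l := by
  obtain ⟨rfl, _, hc⟩ := hc
  exact hc

/-- Only the link of `u` and the head for the class of `u` change. All other links survive because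
`u` is in none of the lists yet. -/
theorem chain_push {fh fn cl : ℕ → ℕ} {l : ℕ → List ℕ} {N u : ℕ} (hu0 : u ≠ 0)
    (h : ∀ a < N, Chain fn (fh a) (l a)) (hu : ∀ a < N, u ∉ l a) :
    ∀ a < N, Chain (fun j => if j = u then fh (cl u) else fn j)
      (if a = cl u then u else fh a) (if a = cl u then u :: l a else l a) := by
  intro a ha
  have hc := Chain.congr (nx' := fun j => if j = u then fh (cl u) else fn j) (fun x hx => by
    have : x ≠ u := by rintro rfl; exact hu a ha hx
    simp [this]) (h a ha)
  split_ifs with hac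
  · refine ⟨rfl, hu0, ?_⟩
    simpa [hac] using hac ▸ hc
  · exact hc

theorem sum_map_kids_cost (k : ℕ → List ℕ) (a b : ℕ) (L : List ℕ) :
    (L.map fun x => a + b * (k x).length).sum = a * L.length + b * (L.flatMap k).length := by
  induction L with
  | nil => simp
  | cons x L ih =>
    simp only [List.map_cons, List.sum_cons, ih, List.length_cons, List.flatMap_cons,
      List.length_append]
    ring

/-- `cl` numbers the labels by natural numbers less than `nP + nT`. -/
structure Forest.IsClass {nP nT : ℕ} (F : Forest nP nT) (cl : ℕ → ℕ) : Prop where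
  lt : ∀ x, 1 ≤ x → x ≤ nP + nT → cl x < nP + nT
  iff : ∀ x y, 1 ≤ x → x ≤ nP + nT → 1 ≤ y → y ≤ nP + nT → (cl x = cl y ↔ F.lab x = F.lab y)

/-! ### The frontier along a path -/

namespace Forest

variable {nP nT : ℕ} (F : Forest nP nT) (cl : ℕ → ℕ)

/-- For a path of `T`, given from below, the nodes of `P` of class `a` that are not matched by the
path but have a matched parent. -/
def frontier : List ℕ → ℕ → List ℕ
  | [], a => if cl F.rP = a then [F.rP] else []
  -- Pushing reverses the order. The old list for the class of `v` is dropped because its nodes are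
  -- now matched.
  | v :: p, a => ((frontier p (cl v)).flatMap F.kids).reverse.filter (cl · = a) ++
      if a = cl v then [] else frontier p a

/-- The nodes of `P` that are matched by `v` but not by its parent. -/
def newList (v : ℕ) : List ℕ := F.frontier cl (F.rp (F.par v)) (cl v)

def kidList (v : ℕ) : List ℕ := (F.newList cl v).flatMap F.kids

/-- The frontier without the class of `v`. -/
def restList (v a : ℕ) : List ℕ := if a = cl v then [] else F.frontier cl (F.rp (F.par v)) a

variable {F cl}

theorem frontier_rp {v : ℕ} (hv : F.InT v) (a : ℕ) : F.frontier cl (F.rp v) a =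
    (F.kidList cl v).reverse.filter (cl · = a) ++ F.restList cl v a := by
  rw [F.rp_cons v hv.all.1 hv.all.2]
  rfl

theorem nodup_flatMap_kids {l : List ℕ} (hl : l.Nodup) : (l.flatMap F.kids).Nodup := by
  refine List.nodup_flatMap.2 ⟨fun x _ => nodup_bucket _ _ _, ?_⟩
  refine hl.imp fun {a b} hab => ?_
  intro u hu hu'
  exact hab ((mem_kids.1 hu).2.symm.trans (mem_kids.1 hu').2)

theorem mem_frontier_zero {x a : ℕ} : x ∈ F.frontier cl (F.rp 0) a ↔
    F.InP x ∧ cl x = a ∧ F.Mt (F.par x) 0 ∧ ¬ F.Mt x 0 := by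
  rw [F.rp_zero, frontier]
  constructor
  · intro h
    split_ifs at h with ha
    · simp only [List.mem_singleton] at h
      subst h
      exact ⟨F.rP_mem, ha, by rw [F.par_rP]; exact mt_zero _, not_mt_zero F.rP_mem⟩
    · simp at h
  · rintro ⟨h1, h2, h3, _⟩
    have : x = F.rP := by
      by_contra hne
      exact not_mt_zero (F.par_P x h1.1 h1.2 hne) h3
    subst this
    simp [h2]

variable (hcl : F.IsClass cl)
include hcl

/-- Induction along the path. A frontier node whose parent was matched before was in the frontier
before, and it stays exactly if its class is not that of `v`. A frontier node whose parent has just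
been matched is a child of a node of `newList`. -/
theorem mem_frontier_aux (n : ℕ) : ∀ {v : ℕ}, (F.rp v).length = n → (v = 0 ∨ F.InT v) →
    ∀ {x a : ℕ}, x ∈ F.frontier cl (F.rp v) a ↔
    F.InP x ∧ cl x = a ∧ F.Mt (F.par x) v ∧ ¬ F.Mt x v := by
  induction n with
  | zero =>
    rintro v hn (rfl | hv)
    · exact mem_frontier_zero
    · have := length_rp (.inr hv); omega
  | succ n ih =>
    rintro v hn (rfl | hv) x a
    · simp [F.rp_zero] at hn
    · have ih := @ih (F.par v) (by have := length_rp (.inr hv); omega) hv.par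
      have hnew : ∀ {x}, x ∈ F.newList cl v ↔ F.InP x ∧ F.New x v := by
        intro x
        rw [newList, ih]
        refine and_congr_right fun hx => ?_
        rw [new_iff hx hv, hcl.iff x v hx.all.1 hx.all.2 hv.all.1 hv.all.2]
      rw [frontier_rp hv, List.mem_append, List.mem_filter, List.mem_reverse, kidList,
        List.mem_flatMap]
      have h1 : (∃ y ∈ F.newList cl v, x ∈ F.kids y) ↔ F.InP x ∧ F.New (F.par x) v := by
        constructor
        · rintro ⟨y, hy, hx⟩
          rw [hnew] at hy
          exact ⟨hy.1.of_mem_kids hx, (mem_kids.1 hx).2 ▸ hy.2⟩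
        · rintro ⟨hx, hn⟩
          have hpx : F.InP (F.par x) := hx.par.resolve_left fun h0 => not_new_zero (h0 ▸ hn)
          exact ⟨F.par x, hnew.2 ⟨hpx, hn⟩, mem_kids.2 ⟨hx.all, rfl⟩⟩
      rw [h1, restList]
      have h2 : x ∈ (if a = cl v then [] else F.frontier cl (F.rp (F.par v)) a) ↔
          a ≠ cl v ∧ F.InP x ∧ cl x = a ∧ F.Mt (F.par x) (F.par v) ∧ ¬ F.Mt x (F.par v) := by
        split_ifs with h
        · simp [h]
        · rw [ih]; simp [h]
      rw [h2]
      simp only [decide_eq_true_eq]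
      constructor
      · rintro (⟨⟨hx, hn⟩, ha⟩ | ⟨ha, hx, hxa, hm, hn⟩)
        · refine ⟨hx, ha, hn.1, fun hm => ?_⟩
          rcases (mt_iff hx hv).1 hm with hm | hm
          · refine hn.2 (mt_left hm ?_)
            rw [F.rp_cons x hx.all.1 hx.all.2]
            exact List.suffix_cons _ _
          · exact hn.2 hm.2
        · refine ⟨hx, hxa, mt_of_mt_par hv hm, fun hm' => ?_⟩
          rcases (mt_iff hx hv).1 hm' with hm' | hm'
          · exact hn hm'
          · rw [← hcl.iff x v hx.all.1 hx.all.2 hv.all.1 hv.all.2] at hm'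
            exact ha (hxa.symm.trans hm'.1)
      · rintro ⟨hx, ha, hm, hn⟩
        by_cases hp : F.Mt (F.par x) (F.par v)
        · refine .inr ⟨fun h => hn ((mt_iff hx hv).2 (.inr ⟨?_, hp⟩)), hx, ha, hp,
            fun h => hn (mt_of_mt_par hv h)⟩
          rw [← hcl.iff x v hx.all.1 hx.all.2 hv.all.1 hv.all.2, ha, h]
        · exact .inl ⟨⟨hx, hm, hp⟩, ha⟩

theorem mem_frontier {v : ℕ} (hv : v = 0 ∨ F.InT v) {x a : ℕ} : x ∈ F.frontier cl (F.rp v) a ↔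
    F.InP x ∧ cl x = a ∧ F.Mt (F.par x) v ∧ ¬ F.Mt x v := mem_frontier_aux hcl _ rfl hv

theorem mem_newList {v x : ℕ} (hv : F.InT v) : x ∈ F.newList cl v ↔ F.InP x ∧ F.New x v := by
  rw [newList, mem_frontier hcl hv.par]
  refine and_congr_right fun hx => ?_
  rw [new_iff hx hv, hcl.iff x v hx.all.1 hx.all.2 hv.all.1 hv.all.2]

theorem mem_kidList {v x : ℕ} (hv : F.InT v) :
    x ∈ F.kidList cl v ↔ F.InP x ∧ F.New (F.par x) v := by
  rw [kidList, List.mem_flatMap]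
  constructor
  · rintro ⟨y, hy, hx⟩
    rw [mem_newList hcl hv] at hy
    exact ⟨hy.1.of_mem_kids hx, (mem_kids.1 hx).2 ▸ hy.2⟩
  · rintro ⟨hx, hn⟩
    have hpx : F.InP (F.par x) := hx.par.resolve_left fun h0 => not_new_zero (h0 ▸ hn)
    exact ⟨F.par x, (mem_newList hcl hv).2 ⟨hpx, hn⟩, mem_kids.2 ⟨hx.all, rfl⟩⟩

theorem nodup_frontier (n : ℕ) : ∀ {v : ℕ}, (F.rp v).length = n → (v = 0 ∨ F.InT v) →
    ∀ a, (F.frontier cl (F.rp v) a).Nodup := by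
  induction n with
  | zero =>
    rintro v hn (rfl | hv) a
    · rw [F.rp_zero, frontier]
      split_ifs <;> simp
    · have := length_rp (.inr hv); omega
  | succ n ih =>
    rintro v hn (rfl | hv) a
    · simp [F.rp_zero] at hn
    · have ih := @ih (F.par v) (by have := length_rp (.inr hv); omega) hv.par
      rw [frontier_rp hv]
      refine List.nodup_append.2 ⟨(List.nodup_reverse.2 (nodup_flatMap_kids (ih _))).filter _, ?_, ?_⟩
      · rw [restList]
        split_ifs
        · simp
        · exact ih _
      · intro x hx y hy hxy
        subst hxy
        rw [List.mem_filter, List.mem_reverse, mem_kidList hcl hv] at hx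
        rw [restList] at hy
        split_ifs at hy
        · simp at hy
        · rw [mem_frontier hcl hv.par] at hy
          exact hx.1.2.2 hy.2.2.1

theorem nodup_newList {v : ℕ} (hv : F.InT v) : (F.newList cl v).Nodup :=
  nodup_frontier hcl _ rfl hv.par _

open Classical in
theorem length_newList {v : ℕ} (hv : F.InT v) : (F.newList cl v).length = (F.newSet v).card := by
  rw [← List.toFinset_card_of_nodup (nodup_newList hcl hv)]
  congr 1
  ext x
  rw [List.mem_toFinset, mem_newList hcl hv, newSet, Finset.mem_filter, mem_nodesP]

open Classical in
theorem length_kidList {v : ℕ} (hv : F.InT v) : (F.kidList cl v).length = (F.newKids v).card := by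
  rw [kidList, ← List.toFinset_card_of_nodup (nodup_flatMap_kids (nodup_newList hcl hv))]
  congr 1
  ext x
  rw [List.mem_toFinset, ← kidList, mem_kidList hcl hv, newKids, Finset.mem_filter, mem_nodesP]

/-- A child of a newly matched node is in no list of the path to `v` before. -/
theorem kid_not_mem {v u : ℕ} (hv : F.InT v) (hu : u ∈ F.kidList cl v) :
    (∀ a, u ∉ F.restList cl v a) ∧ (∀ w ∈ F.rp v, u ∉ F.newList cl w) := by
  rw [mem_kidList hcl hv] at hu
  obtain ⟨hu, hn⟩ := hu
  constructor
  · intro a h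
    rw [restList] at h
    split_ifs at h
    · simp at h
    · exact hn.2 ((mem_frontier hcl hv.par).1 h).2.2.1
  · intro w hw h
    have hwT := (nodup_rp hv).2 w hw
    have h := ((new_iff hu hwT).1 ((mem_newList hcl hwT).1 h).2).2.1
    refine hn.2 (mt_right h ?_)
    have h1 := suffix_of_mem (.inr (.inr hv)) hw
    rw [F.rp_cons v hv.all.1 hv.all.2, F.rp_cons w hwT.all.1 hwT.all.2,
      List.suffix_cons_iff] at h1
    rcases h1 with h1 | h1
    · rw [(List.cons.inj h1).2]
    · exact (List.suffix_cons _ _).trans h1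

end Forest

end TPS
/-! ### The traversal with frontier lists -/

namespace TPS

open WordRAM
open TPS.Expr (var lit get inp)
open TPS.Cmd (assign store emit skip ite)

/-- Push the children of node `22` to the frontier lists. -/
def pushKidsCmd : Cmd :=
  .forChain 23 3 (
    store 12 (var 23) (get 11 (get 4 (var 23))) ;;
    store 11 (get 4 (var 23)) (var 23))

/-- Array `11` holds the heads of the frontier lists, indexed by class, and array `12` the links.
Array `13` saves the head of the list detached at each node of the current path, and array `14`
flags the matched nodes. -/
def frontierEnter : Cmd :=
  assign 24 (get 4 (var 12)) ;;
  assign 22 (get 11 (var 24)) ;;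
  store 13 (var 12) (var 22) ;;
  store 11 (var 24) (lit 0) ;;
  .forChain 22 12 (
    store 14 (var 22) (lit 1) ;;
    assign 23 (get 2 (var 22)) ;;
    pushKidsCmd)

/-- Remove the children of node `22` from the frontier lists. -/
def popKidsCmd : Cmd :=
  .forChain 23 3 (store 11 (get 4 (var 23)) (get 12 (get 11 (get 4 (var 23)))))

/-- After the removals, the list of the class of `v` is put back as it was. Its links have not been
changed in the meantime, so its saved head suffices. -/
def frontierExit : Cmd :=
  assign 22 (get 13 (var 12)) ;;
  .forChain 22 12 (
    store 14 (var 22) (lit 0) ;;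
    assign 23 (get 2 (var 22)) ;;
    popKidsCmd) ;;
  store 11 (get 4 (var 12)) (get 13 (var 12))

/-- One word is written per leaf of `P`. The total `l_P * l_T` is at most `l_P * n_T` and at most
`n_P * l_T`. -/
def frontierLeaf : Cmd :=
  emit (var 12 - var 1 - lit 1) ;;
  .for 25 6 (emit (get 14 (get 10 (var 25))))

/-- The trees have been preprocessed: child lists, classes of labels, and the list of the leaves
of `P`. -/
structure Prepared {nP nT : ℕ} (F : Forest nP nT) (cl : ℕ → ℕ) (lf : List ℕ) (s : HState) : Prop where
  nP_eq : s.var 1 = nP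
  nT_eq : s.var 2 = nT
  N_eq : s.var 3 = nP + nT
  rP_eq : s.var 4 = F.rP
  rT_eq : s.var 5 = F.rT
  lP_eq : s.var 6 = lf.length
  par : s.arr 0 = F.par
  kids : ∀ v, F.InP v ∨ F.InT v → Chain (s.arr 3) (s.arr 2 v) (F.kids v)
  root : s.arr 3 F.rT = 0
  cls : ∀ x, 1 ≤ x → x ≤ nP + nT → s.arr 4 x = cl x
  lf : ∀ (i : ℕ) (h : i < lf.length), s.arr 10 i = lf[i]

variable {nP nT : ℕ} {F : Forest nP nT} {cl : ℕ → ℕ} {lf : List ℕ} {E : Env}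

theorem Chain.eq_zero_or_mem {nx : ℕ → ℕ} {h : ℕ} {l : List ℕ} (hc : Chain nx h l) :
    h = 0 ∨ h ∈ l := by
  cases l with
  | nil => exact .inl hc
  | cons x l => exact .inr (by simp [hc.1])

/-- The children are visited in the order in which they were pushed, so the node that is removed
need not be the child being visited. But each visit removes one node from the list of the child's
class, and after all visits every class has lost as many nodes as were pushed. Hence the invariant
counts removals per class. -/
theorem pop_kids {fh fn : ℕ → ℕ} {l : ℕ → List ℕ} {K q : List ℕ} {u N : ℕ}
    (hq : (q ++ [u]) <+: K)
    (h : ∀ a < N, Chain fn (fh a) (((K.reverse.filter (cl · = a)).drop (q.countP (cl · = a))) ++ l a)) :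
    ∀ a < N, Chain fn (if a = cl u then fn (fh (cl u)) else fh a)
      (((K.reverse.filter (cl · = a)).drop ((q ++ [u]).countP (cl · = a))) ++ l a) := by
  intro a ha
  have hc := h a ha
  split_ifs with hac
  · subst hac
    have h1 : (q ++ [u]).countP (cl · = cl u) = q.countP (cl · = cl u) + 1 := by simp
    have h2 : q.countP (cl · = cl u) < (K.reverse.filter (cl · = cl u)).length := by
      rw [← List.countP_eq_length_filter, List.countP_reverse]
      have := hq.sublist.countP_le (p := fun x => decide (cl x = cl u))
      omega
    rw [List.drop_eq_getElem_cons h2, List.cons_append] at hc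
    rw [h1]
    exact hc.tail
  · have h1 : (q ++ [u]).countP (cl · = a) = q.countP (cl · = a) := by
      simp [Ne.symm hac]
    rw [h1]
    exact hc

open Classical in
/-- The memory represents the matched nodes and the frontier of the path to `v`. -/
structure FrontierInv (F : Forest nP nT) (cl : ℕ → ℕ) (v : ℕ) (s : HState) : Prop where
  heads : ∀ a < nP + nT, Chain (s.arr 12) (s.arr 11 a) (F.frontier cl (F.rp v) a)
  saved : ∀ u ∈ F.rp v, Chain (s.arr 12) (s.arr 13 u) (F.newList cl u)
  flags : ∀ x, F.InP x → s.arr 14 x = if F.Mt x v then 1 else 0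

variable (hE : E.Good (nP + nT)) (hcl : F.IsClass cl)
include hE hcl

/-- `q` collects the children pushed for earlier nodes of `newList`. The statement about links
outside `kidList` keeps the saved lists and the list being traversed intact. -/
theorem wp_pushKidsCmd {v x : ℕ} {q : List ℕ} {s : HState} {Q : HState → ℕ → Prop} (hv : F.InT v)
    (hx : F.InP x) (hq : (q ++ F.kids x) <+: F.kidList cl v)
    (h23 : s.var 23 = s.arr 2 x) (hk : Chain (s.arr 3) (s.arr 2 x) (F.kids x))
    (hcls : ∀ x, 1 ≤ x → x ≤ nP + nT → s.arr 4 x = cl x)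
    (hh : ∀ a < nP + nT, Chain (s.arr 12) (s.arr 11 a)
      (q.reverse.filter (cl · = a) ++ F.restList cl v a))
    (hQ : ∀ s' t, Frame pushKidsCmd s s' →
      (∀ a < nP + nT, Chain (s'.arr 12) (s'.arr 11 a)
        ((q ++ F.kids x).reverse.filter (cl · = a) ++ F.restList cl v a)) →
      (∀ y, y ∉ F.kidList cl v → s'.arr 12 y = s.arr 12 y) → t ≤ 40 * (F.kids x).length + 3 → Q s' t) :
    Wp E pushKidsCmd s Q := by
  have hZ := hE.Z
  have hK := hE.K
  have hnd := Forest.nodup_flatMap_kids (F := F) (Forest.nodup_newList hcl hv)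
  rw [← Forest.kidList] at hnd
  refine Wp.forChain (F.kids x) (fun pre s' =>
      (∀ a < nP + nT, Chain (s'.arr 12) (s'.arr 11 a)
        ((q ++ pre).reverse.filter (cl · = a) ++ F.restList cl v a)) ∧
      (∀ y, y ∉ F.kidList cl v → s'.arr 12 y = s.arr 12 y)) (fun _ => 31) rfl (by rwa [h23])
      (by omega) ?_ ?_ ?_ ?_
  · intro y hy
    have := (hx.of_mem_kids hy).all
    omega
  · simpa using hh
  · intro pre u post s' hL ⟨hI1, hI2⟩ hu hf hL3
    have hupre : (q ++ pre) ++ [u] <+: F.kidList cl v := by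
      refine List.IsPrefix.trans ⟨post, ?_⟩ hq
      rw [hL]; simp
    have hukid : u ∈ F.kidList cl v := hupre.subset (by simp)
    have huP := ((Forest.mem_kidList hcl hv).1 hukid).1.all
    have h4 : s'.arr 4 u = cl u := by rw [hf.arr 4 rfl]; exact hcls u huP.1 huP.2
    have hclu := hcl.lt u huP.1 huP.2
    simp only [wp_seq, wp_store]
    simp [hu, hK, hZ, h4]
    refine ⟨⟨by omega, by omega⟩, by omega, hL3, ?_, ?_⟩
    · have hnu : u ∉ q ++ pre := fun h => by
        have := List.Sublist.nodup hupre.sublist hnd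
        rw [List.nodup_append] at this
        exact this.2.2 u h u (by simp) rfl
      have hpush := chain_push (cl := cl) (u := u) (by omega) hI1 fun a _ h => by
        rw [List.mem_append, List.mem_filter, List.mem_reverse] at h
        rcases h with h | h
        · exact hnu h.1
        · exact (Forest.kid_not_mem hcl hv hukid).1 a h
      intro a ha
      have := hpush a ha
      by_cases hac : a = cl u
      · simpa [hac, HState.setArr_arr_self] using this
      · have hac' : ¬ cl u = a := Ne.symm hac
        simpa [hac, hac', HState.setArr_arr_self] using this
    · intro y hy
      have : y ≠ u := by rintro rfl; exact hy hukid
      simp [this, hI2 y hy]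
  · intro s' t ⟨hI1, hI2⟩ _ hf _ ht
    refine hQ s' t hf hI1 hI2 (ht.trans ?_)
    simp [mul_comm]

theorem wp_frontierEnter {s0 s : HState} {v : ℕ} (hp : Prepared F cl lf s0) (hv : F.InT v)
    (hI : FrontierInv F cl (F.par v) s) (h12 : s.var 12 = v)
    (hf : Frame (dfsCmd frontierEnter frontierLeaf frontierExit) s0 s) :
    Wp E frontierEnter s fun s' t => FrontierInv F cl v s' ∧ s'.out = s.out ∧
      t ≤ 60 + 70 * ((F.newSet v).card + (F.newKids v).card) := by
  classical
  have hZ := hE.Z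
  have hK := hE.K
  have h4 : s.arr 4 v = cl v := by rw [hf.arr 4 rfl]; exact hp.cls v hv.all.1 hv.all.2
  have hclv := hcl.lt v hv.all.1 hv.all.2
  have hvZ : v < 4 * (nP + nT) := by have := hv.all; omega
  simp only [frontierEnter, wp_seq, wp_assign, wp_store]
  simp only [Expr.eval_get, Expr.eval_var, Expr.ok_get, Expr.ok_var, h12, h4, HState.setVar_var,
    HState.setVar_arr, hK, hZ, HState.setArr_var, Expr.eval_lit, Expr.ok_lit]
  refine ⟨by simp; omega, by simp; omega, by simp; omega, by simp; omega, ?_⟩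
  generalize hs1 : HState.setArr _ _ _ _ = s1
  have hnew := hI.heads (cl v) hclv
  rw [← Forest.newList] at hnew
  have h1_12 : s1.arr 12 = s.arr 12 := by subst hs1; funext j; simp
  have h1_22 : s1.var 22 = s.arr 11 (cl v) := by subst hs1; simp
  have h1_3 : s1.arr 3 = s0.arr 3 := by rw [← hf.arr 3 rfl]; subst hs1; funext j; simp
  have h1_2 : s1.arr 2 = s0.arr 2 := by rw [← hf.arr 2 rfl]; subst hs1; funext j; simp
  have h1_4 : s1.arr 4 = s0.arr 4 := by rw [← hf.arr 4 rfl]; subst hs1; funext j; simp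
  have h1_14 : s1.arr 14 = s.arr 14 := by subst hs1; funext j; simp
  have h1_13 : ∀ j, s1.arr 13 j = if j = v then s.arr 11 (cl v) else s.arr 13 j := by
    subst hs1; intro j; simp
  have h1_11 : ∀ j, s1.arr 11 j = if j = cl v then 0 else s.arr 11 j := by
    subst hs1; intro j; simp
  have h1o : s1.out = s.out := by subst hs1; rfl
  clear hs1
  refine Wp.forChain (F.newList cl v) (fun pre s' =>
      (∀ a < nP + nT, Chain (s'.arr 12) (s'.arr 11 a)
        ((pre.flatMap F.kids).reverse.filter (cl · = a) ++ F.restList cl v a)) ∧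
      (∀ y, y ∉ F.kidList cl v → s'.arr 12 y = s1.arr 12 y) ∧
      (∀ x, F.InP x → s'.arr 14 x = if F.Mt x (F.par v) ∨ x ∈ pre then 1 else 0))
      (fun x => 20 + 40 * (F.kids x).length) rfl (by rwa [h1_12, h1_22])
      (by omega) ?_ ⟨?_, ?_, ?_⟩ ?_ ?_
  · intro y hy
    have := ((Forest.mem_newList hcl hv).1 hy).1.all
    omega
  · intro a ha
    simp only [List.flatMap_nil, List.reverse_nil, List.filter_nil, List.nil_append]
    rw [h1_12, h1_11, Forest.restList]
    split_ifs with h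
    · rfl
    · exact hI.heads a ha
  · exact fun _ _ => rfl
  · intro x hx
    rw [h1_14, hI.flags x hx]
    simp
  · intro pre x post s' hL ⟨hI1, hI2, hI3⟩ hx hf' _
    have hxl : x ∈ F.newList cl v := by rw [hL]; simp
    have hxP := ((Forest.mem_newList hcl hv).1 hxl).1
    have hxa := hxP.all
    have hf'2 : s'.arr 2 = s0.arr 2 := by rw [hf'.arr 2 rfl, h1_2]
    have hf'3 : s'.arr 3 = s0.arr 3 := by rw [hf'.arr 3 rfl, h1_3]
    have hf'4 : s'.arr 4 = s0.arr 4 := by rw [hf'.arr 4 rfl, h1_4]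
    simp only [wp_seq, wp_assign, wp_store, Expr.eval_get, Expr.eval_var, Expr.ok_get, Expr.ok_var,
      hx, HState.setArr_arr, HState.setArr_var, hK, hZ, Expr.eval_lit, Expr.ok_lit]
    refine ⟨by simp; omega, by simp; omega, ?_⟩
    have hq : pre.flatMap F.kids ++ F.kids x <+: F.kidList cl v := by
      rw [Forest.kidList, hL]
      exact ⟨post.flatMap F.kids, by simp⟩
    refine wp_pushKidsCmd hE hcl hv hxP hq (by simp) ?_ ?_ ?_ ?_
    · simpa [hf'2, hf'3] using hp.kids x (.inl hxP)
    · simpa [hf'4] using hp.cls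
    · simpa using hI1
    · intro s'' t hf'' hJ1 hJ2 ht
      refine ⟨?_, fun a => ⟨?_, ?_, ?_⟩, ?_⟩
      · intro y hy
        -- The list being traversed is not damaged by the pushes: if `y` were also a pushed child,
        -- then `y` and its parent would both be newly matched, although newly matched nodes form an
        -- antichain.
        have hyk : y ∉ F.kidList cl v := fun h => by
          have h1 := ((Forest.mem_newList hcl hv).1 hy).2
          have h2 := ((Forest.mem_kidList hcl hv).1 h)
          exact Forest.not_mem_rp_of_new h2.1 hv h2.2 h1 (Forest.par_ne_self (.inl h2.1)) (by
            rw [F.rp_cons y h2.1.all.1 h2.1.all.2]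
            refine List.mem_cons_of_mem _ (Forest.mem_rp_self (.inl ?_))
            exact h2.1.par.resolve_left fun h0 => Forest.not_new_zero (h0 ▸ h2.2))
        rw [hJ2 y hyk]
        simpa using hI2 y hyk
      · simpa using hJ1
      · intro y hy
        rw [HState.setVar_arr, hJ2 y hy]
        simpa using hI2 y hy
      · intro y hy
        rw [HState.setVar_arr, hf''.arr 14 rfl]
        by_cases hyx : y = x
        · simp [hyx]
        · simpa [hyx] using hI3 y hy
      · simp; omega
  · intro s' t ⟨hI1, hI2, hI3⟩ _ hf' _ ht
    refine ⟨⟨?_, ?_, ?_⟩, ?_, ?_⟩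
    · intro a ha
      rw [Forest.frontier_rp hv]
      exact hI1 a ha
    · intro u hu
      have h13 : s'.arr 13 = s1.arr 13 := hf'.arr 13 rfl
      rw [h13]
      have huT := (Forest.nodup_rp hv).2 u hu
      refine Chain.congr (nx := s.arr 12) (fun y hy => ?_) ?_
      · rw [hI2 y, h1_12]
        -- A pushed child belongs to no list saved on the path to `v`, so all the saved chains
        -- survive.
        intro h
        exact (Forest.kid_not_mem hcl hv h).2 u hu hy
      · rw [h1_13]
        split_ifs with huv
        · rw [huv]; exact hnew
        · rw [F.rp_cons v hv.all.1 hv.all.2, List.mem_cons] at hu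
          exact hI.saved u (hu.resolve_left huv)
    · intro x hx
      have key : (F.Mt x (F.par v) ∨ x ∈ F.newList cl v) ↔ F.Mt x v := by
        have := Forest.mt_of_mt_par (F := F) (x := x) hv
        rw [Forest.mem_newList hcl hv, Forest.New]
        tauto
      rw [hI3 x hx]
      by_cases h : F.Mt x v
      · rw [if_pos (key.2 h), if_pos h]
      · rw [if_neg (mt key.1 h), if_neg h]
    · rw [hf'.out rfl, h1o]
    · have h1 := sum_map_kids_cost F.kids 29 40 (F.newList cl v)
      rw [← Forest.kidList, Forest.length_newList hcl hv, Forest.length_kidList hcl hv] at h1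
      have h2 : (fun x => 20 + 40 * (F.kids x).length + 9) = fun x => 29 + 40 * (F.kids x).length := by
        funext x; omega
      rw [h2, h1] at ht
      simp
      omega

theorem wp_popKidsCmd {v x : ℕ} {q : List ℕ} {s : HState} {Q : HState → ℕ → Prop} (hv : F.InT v)
    (hx : F.InP x) (hq : (q ++ F.kids x) <+: F.kidList cl v)
    (h23 : s.var 23 = s.arr 2 x) (hk : Chain (s.arr 3) (s.arr 2 x) (F.kids x))
    (hcls : ∀ x, 1 ≤ x → x ≤ nP + nT → s.arr 4 x = cl x)
    (hh : ∀ a < nP + nT, Chain (s.arr 12) (s.arr 11 a)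
      (((F.kidList cl v).reverse.filter (cl · = a)).drop (q.countP (cl · = a)) ++ F.restList cl v a))
    (hQ : ∀ s' t, Frame popKidsCmd s s' →
      (∀ a < nP + nT, Chain (s'.arr 12) (s'.arr 11 a)
        (((F.kidList cl v).reverse.filter (cl · = a)).drop ((q ++ F.kids x).countP (cl · = a)) ++
          F.restList cl v a)) → t ≤ 40 * (F.kids x).length + 3 → Q s' t) :
    Wp E popKidsCmd s Q := by
  have hZ := hE.Z
  have hK := hE.K
  refine Wp.forChain (F.kids x) (fun pre s' =>
      (∀ a < nP + nT, Chain (s'.arr 12) (s'.arr 11 a)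
        (((F.kidList cl v).reverse.filter (cl · = a)).drop ((q ++ pre).countP (cl · = a)) ++
          F.restList cl v a)))
      (fun _ => 31) rfl (by rwa [h23]) (by omega) ?_ ?_ ?_ ?_
  · intro y hy
    have := (hx.of_mem_kids hy).all
    omega
  · simpa using hh
  · intro pre u post s' hL hI1 hu hf hL3
    have hupre : (q ++ pre) ++ [u] <+: F.kidList cl v := by
      refine List.IsPrefix.trans ⟨post, ?_⟩ hq
      rw [hL]; simp
    have huP := (hx.of_mem_kids (x := u) (by rw [hL]; simp)).all
    have h4 : s'.arr 4 u = cl u := by rw [hf.arr 4 rfl]; exact hcls u huP.1 huP.2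
    have hclu := hcl.lt u huP.1 huP.2
    simp only [wp_store]
    -- The head may be a node other than `u`. It suffices that it is a legal index.
    have hhead : s'.arr 11 (cl u) ≤ nP + nT := by
      rcases (hI1 (cl u) hclu).eq_zero_or_mem with h | h
      · omega
      · rw [List.mem_append] at h
        rcases h with h | h
        · have h := (List.mem_filter.1 (List.mem_of_mem_drop h)).1
          rw [List.mem_reverse, Forest.mem_kidList hcl hv] at h
          exact h.1.all.2
        · rw [Forest.restList] at h
          split_ifs at h
          · simp at h
          · exact ((Forest.mem_frontier hcl hv.par).1 h).1.all.2
    simp [hu, hK, hZ, h4]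
    refine ⟨by omega, hL3, fun a ha => ?_⟩
    simpa [add_assoc] using pop_kids hupre hI1 a ha
  · intro s' t hI1 _ hf _ ht
    refine hQ s' t hf hI1 (ht.trans ?_)
    simp [mul_comm]

theorem wp_frontierExit {s0 s : HState} {v : ℕ} (hp : Prepared F cl lf s0) (hv : F.InT v)
    (hI : FrontierInv F cl v s) (h12 : s.var 12 = v)
    (hf : Frame (dfsCmd frontierEnter frontierLeaf frontierExit) s0 s) :
    Wp E frontierExit s fun s' t => FrontierInv F cl (F.par v) s' ∧ s'.out = s.out ∧
      t ≤ 60 + 70 * ((F.newSet v).card + (F.newKids v).card) := by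
  classical
  have hZ := hE.Z
  have hK := hE.K
  have h4 : s.arr 4 v = cl v := by rw [hf.arr 4 rfl]; exact hp.cls v hv.all.1 hv.all.2
  have hclv := hcl.lt v hv.all.1 hv.all.2
  have hvZ : v < 4 * (nP + nT) := by have := hv.all; omega
  have hs2 : s.arr 2 = s0.arr 2 := hf.arr 2 rfl
  have hs3 : s.arr 3 = s0.arr 3 := hf.arr 3 rfl
  have hs4 : s.arr 4 = s0.arr 4 := hf.arr 4 rfl
  simp only [frontierExit, wp_seq, wp_assign]
  simp only [Expr.eval_get, Expr.eval_var, Expr.ok_get, Expr.ok_var, h12, hK, hZ]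
  refine ⟨by simp; omega, ?_⟩
  have hnew := hI.saved v (Forest.mem_rp_self (.inr hv))
  refine Wp.forChain (F.newList cl v) (fun pre s' =>
      (∀ a < nP + nT, Chain (s'.arr 12) (s'.arr 11 a)
        (((F.kidList cl v).reverse.filter (cl · = a)).drop
          ((pre.flatMap F.kids).countP (cl · = a)) ++ F.restList cl v a)) ∧
      (∀ x, F.InP x → s'.arr 14 x = if F.Mt x v ∧ x ∉ pre then 1 else 0))
      (fun x => 20 + 40 * (F.kids x).length) rfl (by simpa using hnew)
      (by omega) ?_ ⟨?_, ?_⟩ ?_ ?_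
  · intro y hy
    have := ((Forest.mem_newList hcl hv).1 hy).1.all
    omega
  · intro a ha
    have := hI.heads a ha
    rw [Forest.frontier_rp hv] at this
    simpa using this
  · intro x hx
    rw [HState.setVar_arr, hI.flags x hx]
    simp
  · intro pre x post s' hL ⟨hI1, hI3⟩ hx hf' _
    have hxl : x ∈ F.newList cl v := by rw [hL]; simp
    have hxP := ((Forest.mem_newList hcl hv).1 hxl).1
    have hxa := hxP.all
    have hf'2 : s'.arr 2 = s0.arr 2 := by rw [hf'.arr 2 rfl, HState.setVar_arr, hs2]
    have hf'3 : s'.arr 3 = s0.arr 3 := by rw [hf'.arr 3 rfl, HState.setVar_arr, hs3]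
    have hf'4 : s'.arr 4 = s0.arr 4 := by rw [hf'.arr 4 rfl, HState.setVar_arr, hs4]
    have hf'12 : s'.arr 12 = s.arr 12 := by rw [hf'.arr 12 rfl, HState.setVar_arr]
    simp only [wp_seq, wp_assign, wp_store, Expr.eval_get, Expr.eval_var, Expr.ok_get, Expr.ok_var,
      hx, HState.setArr_arr, HState.setArr_var, hK, hZ, Expr.eval_lit, Expr.ok_lit]
    refine ⟨by simp; omega, by simp; omega, ?_⟩
    have hq : pre.flatMap F.kids ++ F.kids x <+: F.kidList cl v := by
      rw [Forest.kidList, hL]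
      exact ⟨post.flatMap F.kids, by simp⟩
    refine wp_popKidsCmd hE hcl hv hxP hq (by simp) ?_ ?_ ?_ ?_
    · simpa [hf'2, hf'3] using hp.kids x (.inl hxP)
    · simpa [hf'4] using hp.cls
    · simpa using hI1
    · intro s'' t hf'' hJ1 ht
      refine ⟨?_, fun a => ⟨?_, ?_⟩, ?_⟩
      · intro y hy
        rw [hf''.arr 12 rfl]
        simp [hf'12]
      · rw [List.flatMap_append]
        simpa using hJ1
      · intro y hy
        rw [HState.setVar_arr, hf''.arr 14 rfl]
        by_cases hyx : y = x
        · simp [hyx]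
        · simpa [hyx] using hI3 y hy
      · simp; omega
  · intro s' t ⟨hI1, hI3⟩ _ hf' _ ht
    have h'4 : s'.arr 4 v = cl v := by rw [hf'.arr 4 rfl, HState.setVar_arr, h4]
    have h'12 : s'.arr 12 = s.arr 12 := by rw [hf'.arr 12 rfl, HState.setVar_arr]
    have h'13 : s'.arr 13 = s.arr 13 := by rw [hf'.arr 13 rfl, HState.setVar_arr]
    have h'v : s'.var 12 = v := by rw [hf'.var 12 rfl]; simp [h12]
    simp only [wp_store]
    simp only [Expr.eval_get, Expr.eval_var, Expr.ok_get, Expr.ok_var, h'v, h'4, hK, hZ]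
    refine ⟨by simp; omega, ⟨?_, ?_, ?_⟩, ?_, ?_⟩
    · intro a ha
      rw [HState.setArr_arr_of_ne _ _ _ _ (by decide), HState.setArr_arr, h'12, h'13]
      -- The class of `v` is restored from the saved head. For every other class the number of
      -- removals is exactly the number of pushed nodes, so what is left is the old list.
      by_cases hac : a = cl v
      · simp only [hac, and_self, if_true]
        exact hnew
      · simp only [hac, and_false, if_false]
        have := hI1 a ha
        rw [h'12, Forest.restList, if_neg hac, ← Forest.kidList, List.drop_of_length_le] at this
        · exact this
        · rw [← List.countP_eq_length_filter, List.countP_reverse]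
    · intro u hu
      rw [HState.setArr_arr_of_ne _ _ _ _ (by decide), HState.setArr_arr_of_ne _ _ _ _ (by decide),
        h'12, h'13]
      refine hI.saved u ?_
      rw [F.rp_cons v hv.all.1 hv.all.2]
      exact List.mem_cons_of_mem _ hu
    · intro x hx
      rw [HState.setArr_arr_of_ne _ _ _ _ (by decide)]
      have key : (F.Mt x v ∧ x ∉ F.newList cl v) ↔ F.Mt x (F.par v) := by
        have := Forest.mt_of_mt_par (F := F) (x := x) hv
        rw [Forest.mem_newList hcl hv, Forest.New]
        tauto
      rw [hI3 x hx]
      by_cases h : F.Mt x (F.par v)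
      · rw [if_pos (key.2 h), if_pos h]
      · rw [if_neg (mt key.1 h), if_neg h]
    · rw [HState.setArr_out, hf'.out rfl, HState.setVar_out]
    · have h1 := sum_map_kids_cost F.kids 29 40 (F.newList cl v)
      rw [← Forest.kidList, Forest.length_newList hcl hv, Forest.length_kidList hcl hv] at h1
      have h2 : (fun x => 20 + 40 * (F.kids x).length + 9) = fun x => 29 + 40 * (F.kids x).length := by
        funext x; omega
      rw [h2, h1] at ht
      simp
      omega

open Classical in
/-- The block that is written for the leaf `y`. -/
noncomputable def frontierBlock (F : Forest nP nT) (lf : List ℕ) (y : ℕ) : List ℕ :=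
  (y - nP - 1) :: lf.map fun x => if F.Mt x y then 1 else 0

omit hcl in
theorem wp_frontierLeaf {s0 s : HState} {v : ℕ} (hp : Prepared F cl lf s0) (hv : F.InT v)
    (hlf : ∀ x ∈ lf, F.InP x) (hlen : lf.length ≤ nP)
    (hI : FrontierInv F cl v s) (h12 : s.var 12 = v)
    (hf : Frame (dfsCmd frontierEnter frontierLeaf frontierExit) s0 s) :
    Wp E frontierLeaf s fun s' t => FrontierInv F cl v s' ∧ s'.out = s.out ++ frontierBlock F lf v ∧
      t ≤ 30 * lf.length + 20 := by
  classical
  have hZ := hE.Z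
  have hK := hE.K
  have hB := hE.B
  have hN := hE.N
  have h1 : s.var 1 = nP := by rw [hf.var 1 rfl, hp.nP_eq]
  have hv1 := hv.1
  simp only [frontierLeaf, wp_seq, wp_emit]
  simp only [Expr.eval_var, Expr.ok_var, Expr.ok_sub, Expr.eval_sub, Expr.eval_lit, Expr.ok_lit, h12,
    h1]
  refine ⟨by simp; omega, ?_⟩
  generalize hs1 : s.emit (v - nP - 1) = s1
  have h6 : s1.var 6 = lf.length := by rw [← hs1, HState.emit_var, hf.var 6 rfl, hp.lP_eq]
  have h10 : ∀ (i : ℕ) (h : i < lf.length), s1.arr 10 i = lf[i] := by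
    rw [← hs1, HState.emit_arr, hf.arr 10 rfl]; exact hp.lf
  refine Wp.for (fun i s' => s'.out = s1.out ++ (lf.take i).map fun x => if F.Mt x v then 1 else 0)
    (fun _ => 10) (by decide) rfl rfl (by omega) (by simp) ?_ ?_
  · intro i s' hi hI' hx hf'
    rw [h6] at hi
    have hiP := hlf lf[i] (by simp)
    have hia := hiP.all
    have h10' : s'.arr 10 i = lf[i] := by rw [hf'.arr 10 rfl, h10]
    have h14' : s'.arr 14 lf[i] = if F.Mt lf[i] v then 1 else 0 := by
      rw [hf'.arr 14 rfl, ← hs1, HState.emit_arr, hI.flags _ hiP]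
    simp only [wp_emit, Expr.eval_get, Expr.eval_var, Expr.ok_get, Expr.ok_var, hx, hK, hZ, h10', h14']
    refine ⟨by simp; omega, ?_, by simp⟩
    rw [HState.setVar_out, HState.emit_out, hI', List.append_assoc,
      List.take_add_one, List.getElem?_eq_getElem hi,
      List.map_append]
    rfl
  · intro s' t hI' _ hf' ht
    rw [h6, List.take_length] at hI'
    have ha : s'.arr 11 = s.arr 11 ∧ s'.arr 12 = s.arr 12 ∧ s'.arr 13 = s.arr 13 ∧
        s'.arr 14 = s.arr 14 := by
      rw [hf'.arr 11 rfl, hf'.arr 12 rfl, hf'.arr 13 rfl, hf'.arr 14 rfl, ← hs1]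
      simp
    refine ⟨⟨?_, ?_, ?_⟩, ?_, ?_⟩
    · rw [ha.1, ha.2.1]; exact hI.heads
    · rw [ha.2.1, ha.2.2.1]; exact hI.saved
    · rw [ha.2.2.2]; exact hI.flags
    · rw [hI', ← hs1]
      simp [frontierBlock]
    · simp [h6] at ht
      simp
      omega

end TPS
/-! ### The trees of the input -/

namespace LabeledTree

variable {n : ℕ} (t : LabeledTree n)

theorem depth_root : t.depth t.root = 0 := by
  simp [depth]

theorem depth_eq {v : Fin n} (hv : v ≠ t.root) : t.depth v = t.depth (t.parent v) + 1 := by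
  unfold depth
  rw [Nat.find_eq_iff]
  refine ⟨?_, fun k hk => ?_⟩
  · rw [Function.iterate_succ_apply]
    exact Nat.find_spec (t.reaches_root (t.parent v))
  · cases k with
    | zero => simpa using hv
    | succ k =>
      rw [Function.iterate_succ_apply]
      exact Nat.find_min (t.reaches_root (t.parent v)) (by omega)

theorem parent_eq_self_iff {v : Fin n} : t.parent v = v ↔ v = t.root := by
  constructor
  · intro h
    by_contra hv
    have := t.depth_eq hv
    rw [h] at this
    omega
  · rintro rfl
    exact t.parent_root

theorem parent_eq_self_iff' {v : Fin n} : (t.parent v : ℕ) = v ↔ (v : ℕ) = t.root := by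
  rw [← Fin.ext_iff, ← Fin.ext_iff, t.parent_eq_self_iff]

theorem reverse_path_root : (t.path t.root).reverse = [t.root] := by
  simp [path, depth_root]

theorem reverse_path {v : Fin n} (hv : v ≠ t.root) :
    (t.path v).reverse = v :: (t.path (t.parent v)).reverse := by
  simp only [path, List.reverse_reverse]
  rw [t.depth_eq hv, List.range_succ_eq_map, List.map_cons, List.map_map]
  congr 1

end LabeledTree

namespace TPS

open WordRAM
open TPS.Expr (var lit get inp)
open TPS.Cmd (assign store emit skip ite)

section OfTrees

variable {nP nT : ℕ} (P : LabeledTree nP) (T : LabeledTree nT)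

/-- Nodes of `P` are shifted by `1` and nodes of `T` by `nP + 1`. This leaves `0` for the missing
parent of a root and for the end of a linked list. -/
def parNat (i : ℕ) : ℕ :=
  if h : 1 ≤ i ∧ i ≤ nP then
    if (P.parent ⟨i - 1, by omega⟩ : ℕ) = i - 1 then 0
    else (P.parent ⟨i - 1, by omega⟩ : ℕ) + 1
  else if h : nP < i ∧ i ≤ nP + nT then
    if (T.parent ⟨i - nP - 1, by omega⟩ : ℕ) = i - nP - 1 then 0
    else (T.parent ⟨i - nP - 1, by omega⟩ : ℕ) + nP + 1
  else 0

def labNat (i : ℕ) : ℕ :=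
  if h : 1 ≤ i ∧ i ≤ nP then P.label ⟨i - 1, by omega⟩
  else if h : nP < i ∧ i ≤ nP + nT then T.label ⟨i - nP - 1, by omega⟩
  else 0

def rpNat (i : ℕ) : List ℕ :=
  if h : 1 ≤ i ∧ i ≤ nP then (P.path ⟨i - 1, by omega⟩).reverse.map fun x : Fin nP => (x : ℕ) + 1
  else if h : nP < i ∧ i ≤ nP + nT then
    (T.path ⟨i - nP - 1, by omega⟩).reverse.map fun y : Fin nT => (y : ℕ) + nP + 1
  else []

variable {P T}

theorem parNat_P (x : Fin nP) :
    parNat P T (x + 1) = if (P.parent x : ℕ) = x then 0 else (P.parent x : ℕ) + 1 := by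
  rw [parNat, dif_pos (by omega)]
  rfl

theorem parNat_T (y : Fin nT) :
    parNat P T (y + nP + 1) = if (T.parent y : ℕ) = y then 0 else (T.parent y : ℕ) + nP + 1 := by
  have h : (y : ℕ) + nP + 1 - nP - 1 = y := by omega
  rw [parNat, dif_neg (by omega), dif_pos (by omega)]
  simp only [h]

theorem labNat_P (x : Fin nP) : labNat P T (x + 1) = P.label x := by
  rw [labNat, dif_pos (by omega)]
  rfl

theorem labNat_T (y : Fin nT) : labNat P T (y + nP + 1) = T.label y := by
  have h : (y : ℕ) + nP + 1 - nP - 1 = y := by omega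
  rw [labNat, dif_neg (by omega), dif_pos (by omega)]
  simp only [h]

theorem rpNat_P (x : Fin nP) :
    rpNat P T (x + 1) = (P.path x).reverse.map fun x : Fin nP => (x : ℕ) + 1 := by
  rw [rpNat, dif_pos (by omega)]
  rfl

theorem rpNat_T (y : Fin nT) :
    rpNat P T (y + nP + 1) = (T.path y).reverse.map fun y : Fin nT => (y : ℕ) + nP + 1 := by
  have h : (y : ℕ) + nP + 1 - nP - 1 = y := by omega
  rw [rpNat, dif_neg (by omega), dif_pos (by omega)]
  simp only [h]

theorem exists_fin_P {i : ℕ} (h1 : 1 ≤ i) (h2 : i ≤ nP) : ∃ x : Fin nP, i = x + 1 :=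
  ⟨⟨i - 1, by omega⟩, by simp; omega⟩

theorem exists_fin_T {i : ℕ} (h1 : nP < i) (h2 : i ≤ nP + nT) : ∃ y : Fin nT, i = y + nP + 1 :=
  ⟨⟨i - nP - 1, by omega⟩, by simp; omega⟩

theorem rpNat_zero : rpNat P T 0 = [] := by
  rw [rpNat, dif_neg (by omega), dif_neg (by omega)]

variable (P T) in
/-- The trees of the input with the node numbers of the algorithm. -/
def Forest.ofTrees : Forest nP nT where
  par := parNat P T
  lab := labNat P T
  rp := rpNat P T
  rP := P.root + 1
  rT := T.root + nP + 1
  rP_mem := by omega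
  rT_mem := by omega
  par_rP := by rw [parNat_P, P.parent_root, if_pos rfl]
  par_rT := by rw [parNat_T, T.parent_root, if_pos rfl]
  par_P := by
    intro i h1 h2 hi
    obtain ⟨x, rfl⟩ := exists_fin_P h1 h2
    rw [parNat_P, if_neg]
    · omega
    · rw [← Fin.ext_iff, P.parent_eq_self_iff]
      rintro rfl
      exact hi rfl
  par_T := by
    intro i h1 h2 hi
    obtain ⟨x, rfl⟩ := exists_fin_T h1 h2
    rw [parNat_T, if_neg]
    · omega
    · rw [← Fin.ext_iff, T.parent_eq_self_iff]
      rintro rfl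
      exact hi rfl
  rp_zero := rpNat_zero
  rp_cons := by
    intro i h1 h2
    by_cases hi : i ≤ nP
    · obtain ⟨x, rfl⟩ := exists_fin_P h1 hi
      rw [rpNat_P, parNat_P]
      split_ifs with h
      · rw [← Fin.ext_iff, P.parent_eq_self_iff] at h
        subst h
        rw [P.reverse_path_root, rpNat_zero]
        rfl
      · rw [← Fin.ext_iff, P.parent_eq_self_iff] at h
        rw [P.reverse_path h, rpNat_P]
        rfl
    · obtain ⟨x, rfl⟩ := exists_fin_T (by omega) h2
      rw [rpNat_T, parNat_T]
      split_ifs with h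
      · rw [← Fin.ext_iff, T.parent_eq_self_iff] at h
        subst h
        rw [T.reverse_path_root, rpNat_zero]
        rfl
      · rw [← Fin.ext_iff, T.parent_eq_self_iff] at h
        rw [T.reverse_path h, rpNat_T]
        rfl

/-- `rp` lists paths upwards and `path` downwards. Reversing both sequences preserves the
subsequence relation. -/
theorem ofTrees_mt (x : Fin nP) (y : Fin nT) :
    (Forest.ofTrees P T).Mt (x + 1) (y + nP + 1) ↔ PathSubseq P T x y := by
  have h1 : ((Forest.ofTrees P T).rp (x + 1)).map (Forest.ofTrees P T).lab =
      (P.pathLabels x).reverse := by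
    show (rpNat P T (x + 1)).map (labNat P T) = _
    rw [rpNat_P, List.map_map, LabeledTree.pathLabels, ← List.map_reverse]
    exact List.map_congr_left fun z _ => labNat_P (P := P) (T := T) z
  have h2 : ((Forest.ofTrees P T).rp (y + nP + 1)).map (Forest.ofTrees P T).lab =
      (T.pathLabels y).reverse := by
    show (rpNat P T (y + nP + 1)).map (labNat P T) = _
    rw [rpNat_T, List.map_map, LabeledTree.pathLabels, ← List.map_reverse]
    exact List.map_congr_left fun z _ => labNat_T (P := P) (T := T) z
  rw [Forest.Mt, h1, h2, List.reverse_sublist, PathSubseq]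

theorem ofTrees_kids_P (x : Fin nP) :
    (Forest.ofTrees P T).kids (x + 1) = [] ↔ x ∈ P.leaves := by
  rw [List.eq_nil_iff_forall_not_mem, LabeledTree.leaves, Finset.mem_filter]
  simp only [Finset.mem_univ, true_and]
  constructor
  · intro h u hu hux
    refine h (u + 1) (Forest.mem_kids.2 ⟨by omega, ?_⟩)
    show parNat P T (u + 1) = _
    rw [parNat_P, if_neg, hux]
    rwa [← Fin.ext_iff, P.parent_eq_self_iff]
  · intro h i hi
    have hxP : (Forest.ofTrees P T).InP (x + 1) := ⟨by omega, by omega⟩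
    have hiP := hxP.of_mem_kids hi
    obtain ⟨u, rfl⟩ := exists_fin_P hiP.1 hiP.2
    have h2 : parNat P T (u + 1) = x + 1 := (Forest.mem_kids.1 hi).2
    rw [parNat_P] at h2
    split_ifs at h2 with h3
    rw [← Fin.ext_iff, P.parent_eq_self_iff] at h3
    exact h u h3 (Fin.ext (by omega))

theorem ofTrees_kids_T (y : Fin nT) :
    (Forest.ofTrees P T).kids (y + nP + 1) = [] ↔ y ∈ T.leaves := by
  rw [List.eq_nil_iff_forall_not_mem, LabeledTree.leaves, Finset.mem_filter]
  simp only [Finset.mem_univ, true_and]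
  constructor
  · intro h u hu hux
    refine h (u + nP + 1) (Forest.mem_kids.2 ⟨by omega, ?_⟩)
    show parNat P T (u + nP + 1) = _
    rw [parNat_T, if_neg, hux]
    rwa [← Fin.ext_iff, T.parent_eq_self_iff]
  · intro h i hi
    have hxT : (Forest.ofTrees P T).InT (y + nP + 1) := ⟨by omega, by omega⟩
    have hiT := hxT.of_mem_kids hi
    obtain ⟨u, rfl⟩ := exists_fin_T hiT.1 hiT.2
    have h2 : parNat P T (u + nP + 1) = y + nP + 1 := (Forest.mem_kids.1 hi).2
    rw [parNat_T] at h2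
    split_ifs at h2 with h3
    rw [← Fin.ext_iff, T.parent_eq_self_iff] at h3
    exact h u h3 (Fin.ext (by omega))

theorem length_tpsInput : (tpsInput P T).length = 2 + 2 * nP + 2 * nT := by
  simp [tpsInput, LabeledTree.words]
  omega

theorem input_parent_P (x : Fin nP) : (tpsInput P T).getD (2 + x) 0 = P.parent x := by
  simp [tpsInput, LabeledTree.words, List.getElem?_append, show 2 + (x : ℕ) = x + 1 + 1 by omega]

theorem input_label_P (x : Fin nP) : (tpsInput P T).getD (2 + nP + x) 0 = P.label x := by
  simp [tpsInput, LabeledTree.words, List.getElem?_append, show 2 + nP + (x : ℕ) = nP + x + 1 + 1 by omega]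

theorem input_parent_T (y : Fin nT) : (tpsInput P T).getD (2 + nP + nP + y) 0 = T.parent y := by
  simp [tpsInput, LabeledTree.words, List.getElem?_append, show 2 + nP + nP + (y : ℕ) = nP + nP + y + 1 + 1 by omega]
  have h : nP + nP + (y : ℕ) - nP - nP = y := by omega
  rw [if_neg (by omega), if_neg (by omega), if_pos (by omega)]
  simp [h]

theorem input_label_T (y : Fin nT) : (tpsInput P T).getD (2 + nP + nP + nT + y) 0 = T.label y := by
  simp [tpsInput, LabeledTree.words, List.getElem?_append, show 2 + nP + nP + nT + (y : ℕ) = nP + nP + nT + y + 1 + 1 by omega]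
  have h : nP + nP + nT + (y : ℕ) - nP - nP - nT = y := by omega
  rw [if_neg (by omega), if_neg (by omega), if_neg (by omega)]
  simp [h]

end OfTrees

end TPS
/-! ### Copying the input and building child lists -/

namespace TPS

open WordRAM
open TPS.Expr (var lit get inp)
open TPS.Cmd (assign store emit skip ite)

/-- Copy a tree with `var m` nodes from the input position `var q`; `var o` is added to the node
numbers, and the root is stored in variable `r`. -/
def copyCmd (m o q r : ℕ) : Cmd :=
  .for 20 m (
    assign 21 (var 20 + var o + lit 1) ;;
    assign 22 (inp (var q + var 20)) ;;
    ite (.eq (var 22) (var 20))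
      (assign r (var 21) ;; store 0 (var 21) (lit 0))
      (store 0 (var 21) (var 22 + var o + lit 1)) ;;
    store 1 (var 21) (inp (var q + var m + var 20)))

theorem extend_copy {f f0 p : ℕ → ℕ} {a i x : ℕ}
    (h : ∀ j, f j = if a < j ∧ j ≤ a + i then p j else f0 j) (hx : p (i + a + 1) = x) (j : ℕ) :
    (if j = i + a + 1 then x else f j) = if a < j ∧ j ≤ a + (i + 1) then p j else f0 j := by
  by_cases hj : j = i + a + 1
  · rw [if_pos hj, if_pos (by omega), hj, hx]
  · rw [if_neg hj, h]
    congr 1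
    exact propext (by omega)

theorem wp_copyCmd {E : Env} {N m o q r n a b k0 : ℕ} {par lab : ℕ → ℕ} {s : HState}
    {Q : HState → ℕ → Prop} (hE : E.Good N) (hm : s.var m = n) (ho : s.var o = a) (hq : s.var q = b)
    (hmr : m ≠ r) (hor : o ≠ r) (hqr : q ≠ r) (hm2 : m < 20) (ho2 : o < 20) (hq2 : q < 20)
    (hr2 : r < 20) (han : a + n ≤ N) (hbn : b + n + n ≤ 4 * N) (hk0 : k0 < n)
    (hroot : ∀ i < n, E.inp (b + i) = i ↔ i = k0) (hlt : ∀ i < n, E.inp (b + i) < n)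
    (hpar : ∀ i < n, par (i + a + 1) = if E.inp (b + i) = i then 0 else E.inp (b + i) + a + 1)
    (hlab : ∀ i < n, lab (i + a + 1) = E.inp (b + n + i))
    (hQ : ∀ s' t, Frame (copyCmd m o q r) s s' →
      (∀ j, s'.arr 0 j = if a < j ∧ j ≤ a + n then par j else s.arr 0 j) →
      (∀ j, s'.arr 1 j = if a < j ∧ j ≤ a + n then lab j else s.arr 1 j) →
      s'.var r = k0 + a + 1 → t ≤ 60 * n + 5 → Q s' t) :
    Wp E (copyCmd m o q r) s Q := by
  have hZ := hE.Z
  have hK := hE.K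
  have hB := hE.B
  have hN2 := hE.N
  have hm20 : m ≠ 20 := by omega
  have hm21 : m ≠ 21 := by omega
  have hm22 : m ≠ 22 := by omega
  have ho20 : o ≠ 20 := by omega
  have ho21 : o ≠ 21 := by omega
  have ho22 : o ≠ 22 := by omega
  have hq20 : q ≠ 20 := by omega
  have hq21 : q ≠ 21 := by omega
  have hq22 : q ≠ 22 := by omega
  have hr20 : r ≠ 20 := by omega
  have hr20' : 20 ≠ r := by omega
  refine Wp.for (fun i s' =>
      (∀ j, s'.arr 0 j = if a < j ∧ j ≤ a + i then par j else s.arr 0 j) ∧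
      (∀ j, s'.arr 1 j = if a < j ∧ j ≤ a + i then lab j else s.arr 1 j) ∧
      (k0 < i → s'.var r = k0 + a + 1))
    (fun _ => 50) hm20 ?_ ?_ (by omega) ?_ ?_ ?_
  · simp [Cmd.modVar, hr20']
  · simp [Cmd.modVar, hmr, hm21, hm22]
  · refine ⟨fun j => ?_, fun j => ?_, by simp⟩ <;> rw [if_neg (by omega)] <;> rfl
  · intro i s' hi hI hx hf
    obtain ⟨hI1, hI2, hI3⟩ := hI
    rw [hm] at hi
    have hm' : s'.var m = n := by
      rw [hf.var m (by simp [Cmd.for, Cmd.modVar, hmr, hm20, hm21, hm22]), hm]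
    have ho' : s'.var o = a := by
      rw [hf.var o (by simp [Cmd.for, Cmd.modVar, hor, ho20, ho21, ho22]), ho]
    have hq' : s'.var q = b := by
      rw [hf.var q (by simp [Cmd.for, Cmd.modVar, hqr, hq20, hq21, hq22]), hq]
    have h1 := hlt i hi
    have h2 := hroot i hi
    have h3 := hpar i hi
    have h4 := hlab i hi
    simp only [wp_seq, wp_assign, wp_store, wp_ite]
    simp [hx, hm', ho', hq', hm21, hm22, ho21, ho22, hq21, hq22, hZ, hK, hmr, hqr, hr20']
    have key : ∀ j, (a < j ∧ j ≤ a + (i + 1)) ↔ (j = i + a + 1 ∨ (a < j ∧ j ≤ a + i)) := by omega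
    refine ⟨⟨by omega, by omega⟩, by omega, fun h => ?_, fun h => ?_⟩
    · refine ⟨by omega, by omega, extend_copy hI1 (by rw [h3, if_pos h]), extend_copy hI2 h4,
        fun _ => ?_⟩
      rw [if_neg hr20, h2.1 h]
    · refine ⟨by omega, by omega, extend_copy hI1 (by rw [h3, if_neg h]), extend_copy hI2 h4,
        fun hki => ?_⟩
      rw [if_neg hr20, if_neg (by omega), if_neg (by omega)]
      exact hI3 (by omega)
  · intro s' t hI _ hf ht
    obtain ⟨hI1, hI2, hI3⟩ := hI
    rw [hm] at hI1 hI2 hI3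
    refine hQ s' t hf hI1 hI2 (hI3 hk0) (ht.trans ?_)
    simp [hm]
    omega

/-- Copy both trees and build the lists of children. -/
def loadCmd : Cmd :=
  assign 1 (inp (lit 0)) ;;
  assign 2 (inp (lit 1)) ;;
  assign 3 (var 1 + var 2) ;;
  assign 16 (lit 0) ;;
  assign 17 (lit 2) ;;
  copyCmd 1 16 17 4 ;;
  assign 17 (lit 2 + var 1 + var 1) ;;
  copyCmd 2 1 17 5 ;;
  bucketCmd 0 2 3 ;;
  -- Both roots have parent `0`, so `bucketCmd` has linked them. The link of the root of `T` must be
  -- cleared for the traversal to stop there.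
  store 3 (var 5) (lit 0)

/-- The trees are in memory. -/
structure Loaded {nP nT : ℕ} (F : Forest nP nT) (s : HState) : Prop where
  nP_eq : s.var 1 = nP
  nT_eq : s.var 2 = nT
  N_eq : s.var 3 = nP + nT
  rP_eq : s.var 4 = F.rP
  rT_eq : s.var 5 = F.rT
  par : s.arr 0 = F.par
  lab : s.arr 1 = F.lab
  kids : ∀ v, F.InP v ∨ F.InT v → Chain (s.arr 3) (s.arr 2 v) (F.kids v)
  root : s.arr 3 F.rT = 0

set_option maxHeartbeats 1000000 in
theorem wp_loadCmd {nP nT : ℕ} {P : LabeledTree nP} {T : LabeledTree nT} {E : Env} {s : HState}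
    {Q : HState → ℕ → Prop} (hE : E.Good (nP + nT)) (hinp : ∀ i, E.inp i = (tpsInput P T).getD i 0)
    (harr : ∀ k i, s.arr k i = 0)
    (hQ : ∀ s' t, Frame loadCmd s s' → Loaded (Forest.ofTrees P T) s' →
      t ≤ 200 * (nP + nT) → Q s' t) :
    Wp E loadCmd s Q := by
  have hZ := hE.Z
  have hK := hE.K
  have hB := hE.B
  have hN := hE.N
  have hi0 : E.inp 0 = nP := hinp 0
  have hi1 : E.inp 1 = nT := hinp 1
  suffices H : Wp E loadCmd s fun s' t => Loaded (Forest.ofTrees P T) s' ∧ t ≤ 200 * (nP + nT) from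
    H.mono fun s' t hf h => hQ s' t hf h.1 h.2
  simp only [loadCmd, wp_seq, wp_assign, Expr.eval_inp, Expr.ok_inp, Expr.eval_lit, Expr.ok_lit, hi0,
    hi1, hZ, Expr.eval_var, Expr.eval_add, Expr.ok_var, Expr.ok_add]
  refine ⟨by omega, by omega, ?_⟩
  simp only [HState.setVar_var]
  refine ⟨by simp; omega, by simp, by simp, ?_⟩
  generalize hs1 : HState.setVar (HState.setVar (HState.setVar _ _ _) _ _) _ _ = s1
  have v1 : s1.var 1 = nP := by rw [← hs1]; simp
  have v2 : s1.var 2 = nT := by rw [← hs1]; simp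
  have v3 : s1.var 3 = nP + nT := by rw [← hs1]; simp
  have v16 : s1.var 16 = 0 := by rw [← hs1]; simp
  have v17 : s1.var 17 = 2 := by rw [← hs1]; simp
  have ha1 : s1.arr = s.arr := by rw [← hs1]; simp
  clear hs1
  refine wp_copyCmd (N := nP + nT) (n := nP) (a := 0) (b := 2) (k0 := P.root) (par := parNat P T)
    (lab := labNat P T) hE v1 v16 v17 (by decide) (by decide) (by decide) (by decide) (by decide)
    (by decide) (by decide) (by omega) (by omega) P.root.2 ?_ ?_ ?_ ?_ ?_
  · intro i hi
    have := input_parent_P (P := P) (T := T) ⟨i, hi⟩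
    simp only at this
    rw [hinp, this]
    exact LabeledTree.parent_eq_self_iff' _ (v := ⟨i, hi⟩)
  · intro i hi
    have := input_parent_P (P := P) (T := T) ⟨i, hi⟩
    simp only at this
    rw [hinp, this]
    exact Fin.is_lt _
  · intro i hi
    have := input_parent_P (P := P) (T := T) ⟨i, hi⟩
    simp only at this
    rw [hinp, this]
    exact parNat_P ⟨i, hi⟩
  · intro i hi
    have := input_label_P (P := P) (T := T) ⟨i, hi⟩
    simp only at this
    rw [hinp, this]
    exact labNat_P ⟨i, hi⟩
  intro s2 t2 hf2 hp2 hl2 hr2 ht2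
  have w1 : s2.var 1 = nP := by rw [hf2.var 1 rfl, v1]
  have w2 : s2.var 2 = nT := by rw [hf2.var 2 rfl, v2]
  have w3 : s2.var 3 = nP + nT := by rw [hf2.var 3 rfl, v3]
  have w4 : s2.var 4 = P.root + 1 := hr2
  refine ⟨by simp; omega, ?_⟩
  generalize hs3 : HState.setVar _ _ _ = s3
  have x1 : s3.var 1 = nP := by rw [← hs3]; simpa
  have x2 : s3.var 2 = nT := by rw [← hs3]; simpa
  have x3 : s3.var 3 = nP + nT := by rw [← hs3]; simpa
  have x4 : s3.var 4 = P.root + 1 := by rw [← hs3]; simpa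
  have x17 : s3.var 17 = 2 + nP + nP := by rw [← hs3]; simp [w1]
  have ha3 : s3.arr = s2.arr := by rw [← hs3]; simp
  clear hs3
  refine wp_copyCmd (N := nP + nT) (n := nT) (a := nP) (b := 2 + nP + nP) (k0 := T.root)
    (par := parNat P T) (lab := labNat P T) hE x2 x1 x17 (by decide) (by decide) (by decide)
    (by decide) (by decide) (by decide) (by decide) (by omega) (by omega) T.root.2 ?_ ?_ ?_ ?_ ?_
  · intro i hi
    have := input_parent_T (P := P) (T := T) ⟨i, hi⟩
    simp only at this
    rw [hinp, this]
    exact LabeledTree.parent_eq_self_iff' _ (v := ⟨i, hi⟩)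
  · intro i hi
    have := input_parent_T (P := P) (T := T) ⟨i, hi⟩
    simp only at this
    rw [hinp, this]
    exact Fin.is_lt _
  · intro i hi
    have := input_parent_T (P := P) (T := T) ⟨i, hi⟩
    simp only at this
    rw [hinp, this]
    exact parNat_T ⟨i, hi⟩
  · intro i hi
    have := input_label_T (P := P) (T := T) ⟨i, hi⟩
    simp only at this
    rw [hinp, this]
    exact labNat_T ⟨i, hi⟩
  intro s4 t4 hf4 hp4 hl4 hr4 ht4
  have y1 : s4.var 1 = nP := by rw [hf4.var 1 rfl, x1]
  have y2 : s4.var 2 = nT := by rw [hf4.var 2 rfl, x2]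
  have y3 : s4.var 3 = nP + nT := by rw [hf4.var 3 rfl, x3]
  have y4 : s4.var 4 = P.root + 1 := by rw [hf4.var 4 rfl, x4]
  have hpar : s4.arr 0 = (Forest.ofTrees P T).par := by
    funext j
    show _ = parNat P T j
    rw [hp4, ha3, hp2, ha1, harr]
    split_ifs with h1 h2
    · rfl
    · rfl
    · rw [parNat, dif_neg (by omega), dif_neg (by omega)]
  have hlab : s4.arr 1 = (Forest.ofTrees P T).lab := by
    funext j
    show _ = labNat P T j
    rw [hl4, ha3, hl2, ha1, harr]
    split_ifs with h1 h2
    · rfl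
    · rfl
    · rw [labNat, dif_neg (by omega), dif_neg (by omega)]
  have h2z : ∀ g, s4.arr 2 g = 0 := by
    intro g
    rw [hf4.arr 2 rfl, ha3, hf2.arr 2 rfl, ha1, harr]
  refine wp_bucketCmd (G := nP + nT + 1) hE y3 (by decide) (by decide) (by decide) (by decide)
    (by decide) (by decide) ?_ (by omega) (fun g _ => h2z g) ?_
  · intro x h1 h2
    rw [hpar]
    have : (Forest.ofTrees P T).InP x ∨ (Forest.ofTrees P T).InT x := by
      by_cases h : x ≤ nP
      · exact .inl ⟨h1, h⟩
      · exact .inr ⟨by omega, h2⟩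
    rcases this with h | h
    · rcases h.par with h | h
      · omega
      · have := h.all; omega
    · rcases h.par with h | h
      · omega
      · have := h.all; omega
  intro s5 t5 hf5 hc5 ht5
  have z5 : s5.var 5 = T.root + nP + 1 := by rw [hf5.var 5 rfl, hr4]
  simp only [wp_store, Expr.eval_var, Expr.ok_var, z5, hK, hZ, Expr.ok_lit, Expr.eval_lit]
  have hT := T.root.2
  refine ⟨by simp; omega, ⟨?_, ?_, ?_, ?_, ?_, ?_, ?_, ?_, ?_⟩, ?_⟩
  · rw [HState.setArr_var, hf5.var 1 rfl, y1]
  · rw [HState.setArr_var, hf5.var 2 rfl, y2]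
  · rw [HState.setArr_var, hf5.var 3 rfl, y3]
  · rw [HState.setArr_var, hf5.var 4 rfl, y4]; rfl
  · rw [HState.setArr_var, z5]; rfl
  · rw [HState.setArr_arr_of_ne _ _ _ _ (by decide), hf5.arr 0 rfl, hpar]
  · rw [HState.setArr_arr_of_ne _ _ _ _ (by decide), hf5.arr 1 rfl, hlab]
  · intro v hv
    have hva : 1 ≤ v ∧ v ≤ nP + nT := hv.elim (fun h => h.all) fun h => h.all
    have := hc5 v (by omega)
    rw [HState.setArr_arr_of_ne (l := 2) _ _ _ _ (by decide)]
    rw [hpar] at this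
    refine Chain.congr (fun x hx => ?_) this
    rw [HState.setArr_arr, if_neg]
    rintro ⟨-, rfl⟩
    have h1 := (Forest.mem_kids.1 hx).2
    have h2 := (Forest.ofTrees P T).par_rT
    have h3 : (Forest.ofTrees P T).rT = T.root + nP + 1 := rfl
    rw [← h3, h2] at h1
    omega
  · show (if _ then _ else _) = _
    rw [if_pos]
    exact ⟨rfl, rfl⟩
  · simp
    omega

end TPS
/-! ### Reducing the labels to small classes -/

namespace TPS

open WordRAM
open TPS.Expr (var lit get inp)
open TPS.Cmd (assign store emit skip ite)

/-- A loop with an invariant that is indexed by a bound on the number of iterations. -/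
theorem Wp.while_index {E : Env} {s : HState} {Q : HState → ℕ → Prop} {c : Test} {p : Cmd}
    (I : ℕ → HState → Prop) (b m : ℕ) (h0 : I m s)
    (hb : ∀ m s', I m s' → Frame (.while c p) s s' → c.Ok E s' ∧ (c.Holds E s' →
      Wp E p s' fun s'' t => ∃ m' < m, I m' s'' ∧ t ≤ b))
    (hQ : ∀ m' s' t, I m' s' → ¬ c.Holds E s' → Frame (.while c p) s s' →
      t ≤ m * (b + c.cost + 1) + c.cost + 1 → Q s' t) :
    Wp E (.while c p) s Q := by
  -- The least index for which the invariant holds serves as the decreasing measure.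
  refine Wp.while (fun s => ∃ m, I m s) (fun s => sInf {m | I m s}) b ⟨m, h0⟩ ?_ ?_
  · intro s' hI hf
    have hm : I (sInf {m | I m s'}) s' := Nat.sInf_mem (s := {m | I m s'}) hI
    obtain ⟨h1, h2⟩ := hb _ s' hm hf
    refine ⟨h1, fun hc => (h2 hc).mono ?_⟩
    rintro s'' t - ⟨m', hm', hI', ht⟩
    exact ⟨⟨m', hI'⟩, (Nat.sInf_le (s := {m | I m s''}) hI').trans_lt hm', ht⟩
  · rintro s' t ⟨m', hI⟩ hc hf ht
    refine hQ m' s' t hI hc hf (ht.trans ?_)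
    have : sInf {m | I m s} ≤ m := Nat.sInf_le (s := {m | I m s}) h0
    gcongr

/-- Digits of `b` bits with `2 ^ b ≤ N < 2 ^ (b + 1)` are small enough to index the buckets and
large enough for labels up to `N ^ d` to have only `O(d)` of them. -/
def sizeCmd : Cmd :=
  assign 15 (lit 0) ;;
  assign 14 (lit 1) ;;
  .while (.lt (var 14 + var 14) (var 3 + lit 1)) (
    assign 14 (var 14 + var 14) ;;
    assign 15 (var 15 + lit 1))

theorem wp_sizeCmd {E : Env} {N : ℕ} {s : HState} {Q : HState → ℕ → Prop} (hE : E.Good N)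
    (h3 : s.var 3 = N)
    (hQ : ∀ s' t, Frame sizeCmd s s' → s'.var 14 = 2 ^ s'.var 15 → 2 ^ s'.var 15 ≤ N →
      N < 2 ^ (s'.var 15 + 1) → t ≤ 30 * N → Q s' t) : Wp E sizeCmd s Q := by
  have hB := hE.B
  have hN := hE.N
  suffices H : Wp E sizeCmd s fun s' t => s'.var 14 = 2 ^ s'.var 15 ∧ 2 ^ s'.var 15 ≤ N ∧
      N < 2 ^ (s'.var 15 + 1) ∧ t ≤ 30 * N from
    H.mono fun s' t hf h => hQ s' t hf h.1 h.2.1 h.2.2.1 h.2.2.2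
  simp only [sizeCmd, wp_seq, wp_assign, Expr.ok_lit, Expr.eval_lit]
  refine ⟨by decide, by decide, ?_⟩
  -- A linear bound on the number of iterations suffices; it comes from `b < 2 ^ b ≤ N`.
  refine Wp.while (fun s' => s'.var 14 = 2 ^ s'.var 15 ∧ 2 ^ s'.var 15 ≤ N)
    (fun s' => N - 1 - s'.var 15) 12 ?_ ?_ ?_
  · simp; omega
  · rintro s' ⟨h1, h2⟩ hf
    have h3' : s'.var 3 = N := by rw [hf.var 3 rfl]; simpa using h3
    have h4 : s'.var 15 < 2 ^ s'.var 15 := Nat.lt_two_pow_self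
    simp [h3', h1, pow_succ]
    refine ⟨⟨by omega, by omega⟩, fun h => ?_⟩
    refine ⟨by omega, by omega, by omega, ?_⟩
    omega
  · rintro s' t ⟨h1, h2⟩ hc hf ht
    have h3' : s'.var 3 = N := by rw [hf.var 3 rfl]; simpa using h3
    simp [h1, h3'] at hc
    refine ⟨h1, h2, by rw [pow_succ]; omega, ?_⟩
    simp at ht ⊢
    omega

/-- Extract the next digits of the labels, and remove them from the labels. -/
def digitCmd : Cmd :=
  .for 20 3 (
    assign 21 (var 20 + lit 1) ;;
    store 5 (var 21) (.bin .and (get 1 (var 21)) (var 14 - lit 1)) ;;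
    store 1 (var 21) (.bin .shr (get 1 (var 21)) (var 15)))

theorem wp_digitCmd {E : Env} {N b : ℕ} {s : HState} {Q : HState → ℕ → Prop} (hE : E.Good N)
    (h3 : s.var 3 = N) (h14 : s.var 14 = 2 ^ b) (h15 : s.var 15 = b)
    (hQ : ∀ s' t, Frame digitCmd s s' →
      (∀ x, 1 ≤ x → x ≤ N → s'.arr 5 x = s.arr 1 x % 2 ^ b ∧ s'.arr 1 x = s.arr 1 x / 2 ^ b) →
      t ≤ 60 * N + 5 → Q s' t) : Wp E digitCmd s Q := by
  have hZ := hE.Z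
  have hK := hE.K
  have hB := hE.B
  have hN := hE.N
  have hb : 1 ≤ 2 ^ b := Nat.one_le_two_pow
  refine Wp.for (fun i s' => (∀ x, 1 ≤ x → x ≤ i →
      s'.arr 5 x = s.arr 1 x % 2 ^ b ∧ s'.arr 1 x = s.arr 1 x / 2 ^ b) ∧
      ∀ x, i < x → s'.arr 1 x = s.arr 1 x) (fun _ => 53) (by decide) rfl rfl (by omega) ?_ ?_ ?_
  · exact ⟨fun x h1 h2 => by omega, fun x _ => rfl⟩
  · rintro i s' hi ⟨hI1, hI2⟩ hx hf
    rw [h3] at hi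
    have h14' : s'.var 14 = 2 ^ b := by rw [hf.var 14 rfl, h14]
    have h15' : s'.var 15 = b := by rw [hf.var 15 rfl, h15]
    have h1 := hI2 (i + 1) (by omega)
    simp only [wp_seq, wp_assign, wp_store]
    simp [hx, h14', h15', hZ, hK, h1]
    refine ⟨by omega, ⟨⟨by omega, hb⟩, by omega⟩, by omega, fun x hx1 hx2 => ?_, fun x hx => ?_⟩
    · split_ifs with h
      · subst h
        exact ⟨rfl, Nat.shiftRight_eq_div_pow _ _⟩
      · exact hI1 x hx1 (by omega)
    · rw [if_neg (by omega)]
      exact hI2 x (by omega)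
  · rintro s' t ⟨hI, -⟩ _ hf ht
    rw [h3] at hI
    refine hQ s' t hf hI (ht.trans ?_)
    simp [h3]
    omega

/-- Clear the first `var y` entries of the array `k`. -/
def clearCmd (k y : ℕ) : Cmd := .for 20 y (store k (var 20) (lit 0))

theorem wp_clearCmd {E : Env} {N k y n : ℕ} {s : HState} {Q : HState → ℕ → Prop} (hE : E.Good N)
    (hk : k < 32) (hy : y < 20) (hn : s.var y = n) (hnN : n ≤ N)
    (hQ : ∀ s' t, Frame (clearCmd k y) s s' → (∀ i < n, s'.arr k i = 0) →
      t ≤ 20 * N + 5 → Q s' t) : Wp E (clearCmd k y) s Q := by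
  have hZ := hE.Z
  have hK := hE.K
  have hB := hE.B
  have hN := hE.N
  refine Wp.for (fun i s' => ∀ x < i, s'.arr k x = 0) (fun _ => 6) (by omega) rfl rfl
    (by omega) (by simp) ?_ ?_
  · rintro i s' hi hI hx hf
    simp [hx, hZ, hK]
    refine ⟨by omega, fun x hx => ?_⟩
    by_cases h : x = i
    · exact fun h' => absurd h h'
    · exact fun _ => hI x (by omega)
  · rintro s' t hI _ hf ht
    rw [hn] at hI
    refine hQ s' t hf hI (ht.trans ?_)
    simp [hn]
    omega

/-- Refine the class of node `22` by the digit `20`. -/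
def refineCmd : Cmd :=
  assign 23 (get 4 (var 22)) ;;
  -- For an old class, array `8` holds the digit, plus one, for which a new number was last
  -- allotted, and array `9` holds this number. Digits are processed in increasing order, so array
  -- `8` need not be cleared in between.
  ite (.eq (get 8 (var 23)) (var 20 + lit 1)) skip
    (store 8 (var 23) (var 20 + lit 1) ;;
     store 9 (var 23) (var 17) ;;
     assign 17 (var 17 + lit 1)) ;;
  store 4 (var 22) (get 9 (var 23))

/-- The classes of the nodes in `D` have been refined, and the digit `g` is being processed. -/
structure RefineInv (N : ℕ) (cl dg : ℕ → ℕ) (g : ℕ) (D : Finset ℕ) (s : HState) : Prop where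
  sub : D ⊆ Finset.Icc 1 N
  dg_le : ∀ x ∈ D, dg x ≤ g
  rest : ∀ x, x ∉ D → s.arr 4 x = cl x
  inj : ∀ x ∈ D, ∀ y ∈ D, s.arr 4 x = s.arr 4 y ↔ cl x = cl y ∧ dg x = dg y
  lt : ∀ x ∈ D, s.arr 4 x < s.var 17
  ld_le : ∀ a < N, s.arr 8 a ≤ g + 1
  ld_eq : ∀ a < N, s.arr 8 a = g + 1 ↔ ∃ x ∈ D, cl x = a ∧ dg x = g
  li : ∀ x ∈ D, dg x = g → s.arr 4 x = s.arr 9 (cl x)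
  cnt : s.var 17 ≤ D.card

/-- All marks are at most `g + 1`, so none of them can be mistaken for the mark `g + 2` of the next
digit. -/
theorem RefineInv.succ {N g : ℕ} {cl dg : ℕ → ℕ} {D : Finset ℕ} {s : HState}
    (h : RefineInv N cl dg g D s) : RefineInv N cl dg (g + 1) D s where
  sub := h.sub
  dg_le x hx := (h.dg_le x hx).trans (by omega)
  rest := h.rest
  inj := h.inj
  lt := h.lt
  ld_le a ha := (h.ld_le a ha).trans (by omega)
  ld_eq a ha := by
    constructor
    · intro h'
      have := h.ld_le a ha
      omega
    · rintro ⟨x, hx, -, h2⟩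
      have := h.dg_le x hx
      omega
  li x hx h' := by
    have := h.dg_le x hx
    omega
  cnt := h.cnt

theorem wp_refineCmd {E : Env} {N x g : ℕ} {s : HState} {D : Finset ℕ} {cl dg : ℕ → ℕ}
    {Q : HState → ℕ → Prop} (hE : E.Good N) (h22 : s.var 22 = x) (h20 : s.var 20 = g) (hg : g ≤ N)
    (hcl : ∀ x, 1 ≤ x → x ≤ N → cl x < N) (hx : 1 ≤ x ∧ x ≤ N) (hxD : x ∉ D) (hdg : dg x = g)
    (hI : RefineInv N cl dg g D s)
    (hQ : ∀ s' t, Frame refineCmd s s' → RefineInv N cl dg g (insert x D) s' → t ≤ 50 → Q s' t) :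
    Wp E refineCmd s Q := by
  have hZ := hE.Z
  have hK := hE.K
  have hB := hE.B
  have hN := hE.N
  suffices H : Wp E refineCmd s fun s' t => RefineInv N cl dg g (insert x D) s' ∧ t ≤ 50 from
    H.mono fun s' t hf h => hQ s' t hf h.1 h.2
  have h4 := hI.rest x hxD
  have hclx := hcl x hx.1 hx.2
  have hsub : insert x D ⊆ Finset.Icc 1 N :=
    Finset.insert_subset (Finset.mem_Icc.2 hx) hI.sub
  have hcard := Finset.card_le_card hsub
  rw [Finset.card_insert_of_notMem hxD, Nat.card_Icc] at hcard
  have hcnt := hI.cnt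
  have hdgle : ∀ y ∈ insert x D, dg y ≤ g := by
    intro y hy
    rcases Finset.mem_insert.1 hy with rfl | hy
    · exact hdg.le
    · exact hI.dg_le y hy
  simp only [refineCmd, wp_seq, wp_assign, wp_store, wp_ite, wp_skip]
  simp [h22, h20, hZ, hK, h4]
  refine ⟨by omega, ⟨by omega, by omega⟩, fun hld => ⟨by omega, ?_⟩, fun hld =>
    ⟨by omega, by omega, by omega, by omega, ?_⟩⟩
  -- An earlier node `z` agrees with `x` in class and digit, and `x` receives the number of `z`.
  · obtain ⟨z, hzD, hz1, hz2⟩ := (hI.ld_eq _ hclx).1 hld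
    have hli := hI.li z hzD hz2
    rw [hz1] at hli
    have hne : ∀ y ∈ D, y ≠ x := fun y hy h => hxD (h ▸ hy)
    refine ⟨hsub, hdgle, ?_, ?_, ?_, ?_, ?_, ?_, ?_⟩
    · intro y hy
      rw [Finset.mem_insert, not_or] at hy
      simp [hy.1, hI.rest y hy.2]
    · have aux : ∀ y ∈ D, s.arr 4 y = s.arr 9 (cl x) ↔ cl y = cl x ∧ dg y = dg x := by
        intro y hy
        rw [← hli, hI.inj y hy z hzD, hz1, hz2, hdg]
      intro y hy u hu
      rcases Finset.mem_insert.1 hy with rfl | hy' <;> rcases Finset.mem_insert.1 hu with rfl | hu'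
      · simp
      · have := aux u hu'
        simp [hne u hu']
        rw [eq_comm, this, eq_comm, @eq_comm _ (dg u)]
      · simp [hne y hy', aux y hy']
      · simp [hne y hy', hne u hu', hI.inj y hy' u hu']
    · intro y hy
      rcases Finset.mem_insert.1 hy with rfl | hy
      · have := hI.lt z hzD
        simp; omega
      · simp [hne y hy, hI.lt y hy]
    · simpa using hI.ld_le
    · intro a ha
      have := hI.ld_eq a ha
      simp [this]
      intro h1 _
      exact ⟨z, hzD, by rw [hz1, h1], hz2⟩
    · intro y hy hyg
      rcases Finset.mem_insert.1 hy with rfl | hy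
      · simp
      · simp [hne y hy, hI.li y hy hyg]
    · rw [Finset.card_insert_of_notMem hxD]
      simp; omega
  -- The combination of class and digit is new, and the number in variable `17` exceeds all numbers
  -- in use.
  · have hno : ¬ ∃ z ∈ D, cl z = cl x ∧ dg z = g := fun h => hld ((hI.ld_eq _ hclx).2 h)
    have hne : ∀ y ∈ D, y ≠ x := fun y hy h => hxD (h ▸ hy)
    refine ⟨hsub, hdgle, ?_, ?_, ?_, ?_, ?_, ?_, ?_⟩
    · intro y hy
      rw [Finset.mem_insert, not_or] at hy
      simp [hy.1, hI.rest y hy.2]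
    · have aux : ∀ y ∈ D, s.arr 4 y = s.var 17 ↔ cl y = cl x ∧ dg y = dg x := by
        intro y hy
        have := hI.lt y hy
        exact ⟨fun h => by omega, fun h => absurd ⟨y, hy, h.1, h.2.trans hdg⟩ hno⟩
      intro y hy u hu
      rcases Finset.mem_insert.1 hy with rfl | hy' <;> rcases Finset.mem_insert.1 hu with rfl | hu'
      · simp
      · have := aux u hu'
        simp [hne u hu']
        rw [eq_comm, this, eq_comm, @eq_comm _ (dg u)]
      · simp [hne y hy', aux y hy']
      · simp [hne y hy', hne u hu', hI.inj y hy' u hu']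
    · intro y hy
      rcases Finset.mem_insert.1 hy with rfl | hy
      · simp
      · have := hI.lt y hy
        simp [hne y hy]; omega
    · intro a ha
      have := hI.ld_le a ha
      by_cases hac : a = cl x <;> simp [hac]
      exact this
    · intro a ha
      have := hI.ld_eq a ha
      by_cases hac : a = cl x
      · simp [hac, hdg]
      · simp [hac, this, Ne.symm hac]
    · intro y hy hyg
      rcases Finset.mem_insert.1 hy with rfl | hy
      · simp
      · have h1 : cl y ≠ cl x := fun h => hno ⟨y, hy, h, hyg⟩
        simp [hne y hy, hI.li y hy hyg, h1]
    · rw [Finset.card_insert_of_notMem hxD]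
      simp; omega

/-- Refine the classes by the digits. -/
def refineAllCmd : Cmd :=
  clearCmd 6 14 ;;
  bucketCmd 5 6 7 ;;
  clearCmd 8 3 ;;
  assign 17 (lit 0) ;;
  .for 20 14 (assign 22 (get 6 (var 20)) ;; .forChain 22 7 refineCmd)

/-- Each node allots at most one new number, so the numbers stay below `N`. The buckets are
disjoint, so visiting all of them takes linear time. -/
theorem wp_refineAllCmd {E : Env} {N G : ℕ} {s : HState} {cl : ℕ → ℕ} {Q : HState → ℕ → Prop}
    (hE : E.Good N) (h3 : s.var 3 = N) (h14 : s.var 14 = G) (hG : G ≤ N)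
    (hcl0 : ∀ x, s.arr 4 x = cl x)
    (hcl : ∀ x, 1 ≤ x → x ≤ N → cl x < N) (hdg : ∀ x, 1 ≤ x → x ≤ N → s.arr 5 x < G)
    (hQ : ∀ s' t, Frame refineAllCmd s s' → (∀ x, 1 ≤ x → x ≤ N → s'.arr 4 x < N) →
      (∀ x y, 1 ≤ x → x ≤ N → 1 ≤ y → y ≤ N →
        (s'.arr 4 x = s'.arr 4 y ↔ cl x = cl y ∧ s.arr 5 x = s.arr 5 y)) →
      t ≤ 300 * N → Q s' t) : Wp E refineAllCmd s Q := by
  classical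
  have hZ := hE.Z
  have hK := hE.K
  have hB := hE.B
  have hN := hE.N
  set dg := s.arr 5 with hdgd
  suffices H : Wp E refineAllCmd s fun s' t => ((∀ x, 1 ≤ x → x ≤ N → s'.arr 4 x < N) ∧
      (∀ x y, 1 ≤ x → x ≤ N → 1 ≤ y → y ≤ N →
        (s'.arr 4 x = s'.arr 4 y ↔ cl x = cl y ∧ dg x = dg y))) ∧ t ≤ 300 * N from
    H.mono fun s' t hf h => hQ s' t hf h.1.1 h.1.2 h.2
  simp only [refineAllCmd, wp_seq, wp_assign, Expr.ok_lit, Expr.eval_lit]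
  refine wp_clearCmd hE (by decide) (by decide) h14 hG fun s1 t1 hf1 hz1 ht1 => ?_
  refine wp_bucketCmd (G := G) hE (by rw [hf1.var 3 rfl, h3]) (by decide) (by decide) (by decide)
    (by decide) (by decide) (by decide) (by rwa [hf1.arr 5 rfl]) (by omega) hz1
    fun s2 t2 hf2 hc2 ht2 => ?_
  rw [hf1.arr 5 rfl, ← hdgd] at hc2
  refine wp_clearCmd (n := N) hE (by decide) (by decide) (by rw [hf2.var 3 rfl, hf1.var 3 rfl, h3])
    le_rfl fun s3 t3 hf3 hz3 ht3 => ?_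
  refine ⟨by decide, ?_⟩
  generalize hs4 : s3.setVar 17 0 = s4
  have h4_14 : s4.var 14 = G := by
    rw [← hs4, HState.setVar_var, if_neg (by decide), hf3.var 14 rfl, hf2.var 14 rfl,
      hf1.var 14 rfl, h14]
  have h4_17 : s4.var 17 = 0 := by rw [← hs4]; simp
  have h4_8 : ∀ a < N, s4.arr 8 a = 0 := by rw [← hs4]; exact hz3
  have h4_4 : ∀ x, s4.arr 4 x = cl x := by
    rw [← hs4, HState.setVar_arr, hf3.arr 4 rfl, hf2.arr 4 rfl, hf1.arr 4 rfl]; exact hcl0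
  have h4_6 : ∀ g < G, Chain (s4.arr 7) (s4.arr 6 g) (bucket dg N g) := by
    rw [← hs4, HState.setVar_arr, hf3.arr 7 rfl, hf3.arr 6 rfl]
    exact hc2
  clear hs4
  refine Wp.for (fun g s' => RefineInv N cl dg g ((Finset.Icc 1 N).filter (dg · < g)) s')
    (fun g => 60 * (bucket dg N g).length + 20) (by decide) rfl rfl (by omega) ?_ ?_ ?_
  · refine ⟨Finset.filter_subset _ _, ?_, ?_, ?_, ?_, ?_, ?_, ?_, ?_⟩
    · simp
    · intro x _; exact h4_4 x
    · simp
    · simp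
    · intro a ha; simp [h4_8 a ha]
    · intro a ha; simp [h4_8 a ha]
    · simp
    · simp [h4_17]
  · intro g s' hg hI hx hf
    rw [h4_14] at hg
    simp only [wp_seq, wp_assign, Expr.ok_get, Expr.eval_get, Expr.ok_var, Expr.eval_var, hx, hK, hZ]
    refine ⟨by simp; omega, ?_⟩
    have h7 : s'.arr 7 = s4.arr 7 := hf.arr 7 rfl
    have h6 : s'.arr 6 = s4.arr 6 := hf.arr 6 rfl
    refine Wp.forChain (bucket dg N g) (fun pre s'' => RefineInv N cl dg g
      ((Finset.Icc 1 N).filter (dg · < g) ∪ pre.toFinset) s'') (fun _ => 50) rfl ?_ (by omega)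
      ?_ ?_ ?_ ?_
    · have := h4_6 g hg
      simpa [h7, h6] using this
    · intro x hx
      have := (mem_bucket.1 hx).1
      omega
    · simp only [List.toFinset_nil, Finset.union_empty]
      exact ⟨hI.sub, hI.dg_le, hI.rest, hI.inj, hI.lt, hI.ld_le, hI.ld_eq, hI.li, hI.cnt⟩
    · intro pre x post s'' hL hI' hx' hf' hch
      have hxb : x ∈ bucket dg N g := by rw [hL]; simp
      have hxm := mem_bucket.1 hxb
      have hnd := nodup_bucket dg N g
      rw [hL, List.nodup_append] at hnd
      have hxpre : x ∉ pre := fun h => hnd.2.2 x h x (by simp) rfl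
      refine wp_refineCmd (x := x) (g := g) hE hx' ?_ (by omega) hcl hxm.1 ?_ hxm.2 hI'
        fun s3 t hf3 hI3 ht => ?_
      · rw [hf'.var 20 rfl]; simpa using hx
      · rw [Finset.mem_union, Finset.mem_filter, List.mem_toFinset]
        rintro (h | h)
        · omega
        · exact hxpre h
      · refine ⟨fun y hy => ?_, fun a => ?_, ht⟩
        · rw [hf3.arr 7 rfl]
          exact hch y hy
        · have : insert x ((Finset.Icc 1 N).filter (dg · < g) ∪ pre.toFinset) =
              (Finset.Icc 1 N).filter (dg · < g) ∪ (pre ++ [x]).toFinset := by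
            ext z
            simp only [Finset.mem_insert, Finset.mem_union, List.mem_toFinset, List.mem_append,
              List.mem_singleton]
            tauto
          rw [this] at hI3
          exact ⟨hI3.sub, hI3.dg_le, hI3.rest, hI3.inj, hI3.lt, hI3.ld_le, hI3.ld_eq, hI3.li, hI3.cnt⟩
    · intro s'' t hI' _ hf' _ ht
      have : (Finset.Icc 1 N).filter (dg · < g) ∪ (bucket dg N g).toFinset =
          (Finset.Icc 1 N).filter (dg · < g + 1) := by
        ext z
        simp only [Finset.mem_union, Finset.mem_filter, List.mem_toFinset, mem_bucket, Finset.mem_Icc]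
        constructor
        · rintro (h | h)
          · exact ⟨h.1, by omega⟩
          · exact ⟨h.1, by omega⟩
        · rintro ⟨h1, h2⟩
          by_cases h : dg z = g
          · exact .inr ⟨h1, h⟩
          · exact .inl ⟨h1, by omega⟩
      rw [this] at hI'
      have hI3 := hI'.succ
      refine ⟨⟨hI3.sub, hI3.dg_le, hI3.rest, hI3.inj, hI3.lt, hI3.ld_le, hI3.ld_eq, hI3.li,
        hI3.cnt⟩, ?_⟩
      simp at ht ⊢
      omega
  · intro s' t hI _ hf ht
    rw [h4_14] at hI ht
    have hD : (Finset.Icc 1 N).filter (dg · < G) = Finset.Icc 1 N := by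
      refine Finset.filter_true_of_mem fun x hx => ?_
      rw [Finset.mem_Icc] at hx
      exact hdg x hx.1 hx.2
    rw [hD] at hI
    have hcnt := hI.cnt
    rw [Nat.card_Icc] at hcnt
    refine ⟨⟨fun x h1 h2 => ?_, fun x y h1 h2 h3 h4 => ?_⟩, ?_⟩
    · have := hI.lt x (Finset.mem_Icc.2 ⟨h1, h2⟩)
      omega
    · exact hI.inj x (Finset.mem_Icc.2 ⟨h1, h2⟩) y (Finset.mem_Icc.2 ⟨h3, h4⟩)
    · have h1 := sum_length_bucket dg N G
      rw [Finset.sum_add_distrib, Finset.sum_add_distrib, ← Finset.mul_sum] at ht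
      simp at ht ⊢
      omega

/-- Test whether a label is still nonzero. -/
def checkCmd : Cmd :=
  assign 16 (lit 0) ;;
  .for 20 3 (ite (.eq (get 1 (var 20 + lit 1)) (lit 0)) skip (assign 16 (lit 1)))

theorem wp_checkCmd {E : Env} {N : ℕ} {s : HState} {Q : HState → ℕ → Prop}
    (hE : E.Good N) (h3 : s.var 3 = N)
    (hQ : ∀ s' t, Frame checkCmd s s' → (s'.var 16 = 0 ↔ ∀ x, 1 ≤ x → x ≤ N → s.arr 1 x = 0) →
      t ≤ 30 * N + 10 → Q s' t) : Wp E checkCmd s Q := by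
  have hZ := hE.Z
  have hK := hE.K
  have hB := hE.B
  have hN := hE.N
  suffices H : Wp E checkCmd s fun s' t => (s'.var 16 = 0 ↔ ∀ x, 1 ≤ x → x ≤ N → s.arr 1 x = 0) ∧
      t ≤ 30 * N + 10 from H.mono fun s' t hf h => hQ s' t hf h.1 h.2
  simp only [checkCmd, wp_seq, wp_assign, Expr.ok_lit, Expr.eval_lit]
  refine ⟨by decide, ?_⟩
  refine Wp.for (fun i s' => (s'.var 16 = 0 ↔ ∀ x, 1 ≤ x → x ≤ i → s.arr 1 x = 0))
    (fun _ => 20) (by decide) rfl rfl (by simp; omega) ?_ ?_ ?_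
  · simp
    intro x h1 h2
    omega
  · intro i s' hi hI hx hf
    have hi : i < N := by simpa [h3] using hi
    have h1 : s'.arr 1 = s.arr 1 := hf.arr 1 rfl
    simp only [wp_ite, wp_skip, wp_assign]
    simp [hx, hZ, hK, h1]
    refine ⟨⟨by omega, by omega⟩, fun h => ?_, fun h => ?_⟩
    · rw [hI]
      constructor
      · intro h' x hx1 hx2
        by_cases hxi : x = i + 1
        · rw [hxi, h]
        · exact h' x hx1 (by omega)
      · intro h' x hx1 hx2
        exact h' x hx1 (by omega)
    · exact ⟨i + 1, by omega, by omega, h⟩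
  · intro s' t hI _ hf ht
    simp [h3] at hI ht ⊢
    exact ⟨hI, by omega⟩

/-- After `k` rounds two nodes share a class exactly if the lowest `k` digits of their labels agree.
The loop stops once all remaining labels are `0`, so the exponent `d` enters the time bound only. -/
def classCmd : Cmd :=
  sizeCmd ;;
  assign 16 (lit 1) ;;
  .while (.lt (lit 0) (var 16)) (digitCmd ;; refineAllCmd ;; checkCmd)

theorem wp_classCmd {nP nT d : ℕ} {F : Forest nP nT} {E : Env} {s : HState} {Q : HState → ℕ → Prop}
    (hE : E.Good (nP + nT)) (hL : Loaded F s) (h4 : ∀ x, s.arr 4 x = 0)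
    (hlab : ∀ x, 1 ≤ x → x ≤ nP + nT → F.lab x ≤ (nP + nT) ^ d)
    (hQ : ∀ s' t, Frame classCmd s s' → F.IsClass (s'.arr 4) → t ≤ 1000 * (d + 1) * (nP + nT) →
      Q s' t) : Wp E classCmd s Q := by
  have hB := hE.B
  have hN := hE.N
  set N := nP + nT with hNdef
  suffices H : Wp E classCmd s fun s' t => F.IsClass (s'.arr 4) ∧ t ≤ 1000 * (d + 1) * N from
    H.mono fun s' t hf h => hQ s' t hf h.1 h.2
  simp only [classCmd, wp_seq]
  refine wp_sizeCmd hE hL.N_eq fun s1 t1 hf1 h14 hb1 hb2 ht1 => ?_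
  set b := s1.var 15 with hbdef
  simp only [wp_assign, Expr.ok_lit, Expr.eval_lit]
  refine ⟨by decide, ?_⟩
  have hb0 : 1 ≤ b := by
    by_contra h
    have : b = 0 := by omega
    rw [this] at hb2
    simp at hb2
    omega
  -- Since `N < 2 ^ (b + 1) ≤ 2 ^ (2 * b)`, a label is at most `2 ^ (2 * b * d)`, and `2 * d + 1`
  -- digits suffice.
  have hlabb : ∀ x, 1 ≤ x → x ≤ N → F.lab x < 2 ^ (b * (2 * d) + 1) := by
    intro x hx1 hx2
    have h1 : N ^ d ≤ (2 ^ (2 * b)) ^ d :=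
      Nat.pow_le_pow_left (hb2.le.trans (Nat.pow_le_pow_right (by norm_num) (by omega))) d
    rw [← pow_mul] at h1
    have h2 := hlab x hx1 hx2
    rw [pow_succ, show b * (2 * d) = 2 * b * d by ring]
    have : 0 < 2 ^ (2 * b * d) := by positivity
    omega
  refine Wp.while_index (fun m s' => ∃ k, m + k = 2 * d + 2 ∧
      (∀ x, 1 ≤ x → x ≤ N → s'.arr 1 x = F.lab x / 2 ^ (b * k)) ∧
      (∀ x, 1 ≤ x → x ≤ N → s'.arr 4 x < N) ∧
      (∀ x y, 1 ≤ x → x ≤ N → 1 ≤ y → y ≤ N →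
        (s'.arr 4 x = s'.arr 4 y ↔ F.lab x % 2 ^ (b * k) = F.lab y % 2 ^ (b * k))) ∧
      (s'.var 16 = 0 → ∀ x, 1 ≤ x → x ≤ N → s'.arr 1 x = 0) ∧
      (s'.var 16 ≠ 0 → k ≤ 2 * d + 1)) (400 * N) (2 * d + 2) ?_ ?_ ?_
  · refine ⟨0, rfl, ?_, ?_, ?_, ?_, ?_⟩
    · intro x _ _
      rw [HState.setVar_arr, hf1.arr 1 rfl, hL.lab]
      simp
    · intro x _ _
      rw [HState.setVar_arr, hf1.arr 4 rfl, h4]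
      omega
    · intro x y _ _ _ _
      rw [HState.setVar_arr, hf1.arr 4 rfl, h4, h4]
      simp [Nat.mod_one]
    · simp
    · simp
  · rintro m s' ⟨k, hmk, hI1, hI2, hI3, hI4, hI5⟩ hf
    refine ⟨by simp, fun hc => ?_⟩
    have hc : 0 < s'.var 16 := hc
    have hk := hI5 (by omega)
    have e3 : s'.var 3 = N := by rw [hf.var 3 rfl]; simpa [hf1.var 3 rfl] using hL.N_eq
    have e14 : s'.var 14 = 2 ^ b := by rw [hf.var 14 rfl]; simpa using h14
    have e15 : s'.var 15 = b := by rw [hf.var 15 rfl]; simp [hbdef]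
    simp only [wp_seq]
    refine wp_digitCmd hE e3 e14 e15 fun s2 t2 hf2 hd2 ht2 => ?_
    refine wp_refineAllCmd (cl := s'.arr 4) hE (by rw [hf2.var 3 rfl, e3]) (by rw [hf2.var 14 rfl, e14]) hb1
      (fun x => by rw [hf2.arr 4 rfl]) hI2 (fun x h1 h2 => ?_) fun s3 t3 hf3 hlt3 hc3 ht3 => ?_
    · rw [(hd2 x h1 h2).1]
      exact Nat.mod_lt _ (by positivity)
    refine wp_checkCmd hE (by rw [hf3.var 3 rfl, hf2.var 3 rfl, e3]) fun s4 t4 hf4 hz4 ht4 => ?_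
    have hl4 : ∀ x, 1 ≤ x → x ≤ N → s4.arr 1 x = F.lab x / 2 ^ (b * (k + 1)) := by
      intro x h1 h2
      rw [hf4.arr 1 rfl, hf3.arr 1 rfl, (hd2 x h1 h2).2, hI1 x h1 h2, Nat.div_div_eq_div_mul, ← pow_add]
      rfl
    rw [hf3.arr 1 rfl] at hz4
    have hl4' : ∀ x, s4.arr 1 x = s2.arr 1 x := fun x => by rw [hf4.arr 1 rfl, hf3.arr 1 rfl]
    refine ⟨m - 1, by omega, ⟨k + 1, by omega, hl4, ?_, ?_, ?_, ?_⟩, by omega⟩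
    · rwa [hf4.arr 4 rfl]
    · intro x y h1 h2 h3 h4
      rw [hf4.arr 4 rfl, hc3 x y h1 h2 h3 h4, hI3 x y h1 h2 h3 h4, (hd2 x h1 h2).1, (hd2 y h3 h4).1,
        hI1 x h1 h2, hI1 y h3 h4, Nat.mul_succ, pow_add, Nat.mod_mul, Nat.mod_mul (x := F.lab y)]
      constructor
      · rintro ⟨h, h'⟩
        rw [h, h']
      · intro h
        -- Reducing the equation modulo `2 ^ (b * k)` separates the old digits from the new one.
        have h5 : F.lab x % 2 ^ (b * k) = F.lab y % 2 ^ (b * k) := by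
          have := congrArg (· % 2 ^ (b * k)) h
          simpa using this
        refine ⟨h5, ?_⟩
        rw [h5] at h
        exact Nat.eq_of_mul_eq_mul_left (by positivity) (Nat.add_left_cancel h)
    · intro h x h1 h2
      rw [hl4']
      exact hz4.1 h x h1 h2
    · intro h
      rw [ne_eq, hz4] at h
      push Not at h
      obtain ⟨x, h1, h2, h3⟩ := h
      rw [← hl4', hl4 x h1 h2] at h3
      have h4 := hlabb x h1 h2
      by_contra hkd
      refine h3 (Nat.div_eq_of_lt (h4.trans_le (Nat.pow_le_pow_right (by norm_num) ?_)))
      have : b * (2 * d + 1) ≤ b * (k + 1) := Nat.mul_le_mul_left _ (by omega)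
      rw [Nat.mul_succ] at this
      omega
  · rintro m s' t ⟨k, hmk, hI1, hI2, hI3, hI4, hI5⟩ hc hf ht
    have hc : s'.var 16 = 0 := by simpa using hc
    refine ⟨⟨hI2, fun x y h1 h2 h3 h4 => ?_⟩, ?_⟩
    · have aux : ∀ x, 1 ≤ x → x ≤ N → F.lab x % 2 ^ (b * k) = F.lab x := by
        intro x h1 h2
        have := hI4 hc x h1 h2
        rw [hI1 x h1 h2, Nat.div_eq_zero_iff] at this
        exact Nat.mod_eq_of_lt (this.resolve_left (by positivity))
      rw [hI3 x y h1 h2 h3 h4, aux x h1 h2, aux y h3 h4]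
    · simp at ht ⊢
      nlinarith

end TPS
/-! ### Leaves and parameters -/

namespace TPS

open WordRAM
open TPS.Expr (var lit get inp)
open TPS.Cmd (assign store emit skip ite)

/-- The leaves among `o + 1, …, o + n`. -/
def Forest.leafFrom {nP nT : ℕ} (F : Forest nP nT) (o n : ℕ) : List ℕ :=
  ((List.range n).map fun i => i + o + 1).filter fun x => (F.kids x).isEmpty

namespace Forest

variable {nP nT : ℕ} {F : Forest nP nT}

theorem leafFrom_succ (o n : ℕ) : F.leafFrom o (n + 1) =
    F.leafFrom o n ++ if F.kids (n + o + 1) = [] then [n + o + 1] else [] := by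
  rw [leafFrom, List.range_succ, List.map_append, List.filter_append]
  congr 1
  by_cases h : F.kids (n + o + 1) = [] <;> simp [h]

theorem mem_leafFrom {o n x : ℕ} :
    x ∈ F.leafFrom o n ↔ (o < x ∧ x ≤ o + n) ∧ F.kids x = [] := by
  rw [leafFrom, List.mem_filter, List.mem_map]
  simp only [List.mem_range, List.isEmpty_iff]
  refine and_congr_left fun _ => ⟨?_, fun h => ⟨x - o - 1, by omega, by omega⟩⟩
  rintro ⟨i, hi, rfl⟩
  omega

theorem nodup_leafFrom (o n : ℕ) : (F.leafFrom o n).Nodup :=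
  (List.Nodup.map (fun a b h => by simpa using h) List.nodup_range).filter _

theorem length_leafFrom_le (o n : ℕ) : (F.leafFrom o n).length ≤ n := by
  refine (List.length_filter_le _ _).trans ?_
  simp

end Forest

/-- Append the leaves among the nodes `o + 1, …, o + n` to the array `k`, where `o` and `n` are the
values of variables; variable `r` counts them. -/
def leafCmd (n o k r : ℕ) : Cmd :=
  assign r (lit 0) ;;
  .for 20 n (
    assign 21 (var 20 + var o + lit 1) ;;
    ite (.eq (get 2 (var 21)) (lit 0)) (store k (var r) (var 21) ;; assign r (var r + lit 1)) skip)

theorem Chain.eq_zero_iff {nx : ℕ → ℕ} {h : ℕ} {l : List ℕ} (hc : Chain nx h l) : h = 0 ↔ l = [] := by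
  cases l with
  | nil => exact ⟨fun _ => rfl, fun _ => hc⟩
  | cons x l =>
    have h1 := hc.1
    have h2 := hc.2.1
    simp
    omega

theorem wp_leafCmd {nP nT n o k r a m : ℕ} {F : Forest nP nT} {E : Env} {s : HState}
    {Q : HState → ℕ → Prop} (hE : E.Good (nP + nT)) (hn : s.var n = m) (ho : s.var o = a)
    (hm : a + m ≤ nP + nT) (hn2 : n < 20) (ho2 : o < 20) (hr : r < 20) (hk : 4 ≤ k) (hk2 : k < 32)
    (hnr : n ≠ r) (hor : o ≠ r)
    (hkids : ∀ v, 1 ≤ v → v ≤ nP + nT → Chain (s.arr 3) (s.arr 2 v) (F.kids v))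
    (hQ : ∀ s' t, Frame (leafCmd n o k r) s s' → s'.var r = (F.leafFrom a m).length →
      (∀ (i : ℕ) (h : i < (F.leafFrom a m).length), s'.arr k i = (F.leafFrom a m)[i]) →
      t ≤ 50 * m + 10 → Q s' t) : Wp E (leafCmd n o k r) s Q := by
  have hZ := hE.Z
  have hK := hE.K
  have hB := hE.B
  have hN := hE.N
  have hn20 : n ≠ 20 := by omega
  have hn21 : n ≠ 21 := by omega
  have ho20 : o ≠ 20 := by omega
  have ho21 : o ≠ 21 := by omega
  have hr20 : r ≠ 20 := by omega
  have hr20' : 20 ≠ r := by omega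
  have hr21 : r ≠ 21 := by omega
  have hr21' : 21 ≠ r := by omega
  have hk2' : 2 ≠ k := by omega
  have hk0' : 0 ≠ k := by omega
  have hk3' : 3 ≠ k := by omega
  suffices H : Wp E (leafCmd n o k r) s fun s' t => (s'.var r = (F.leafFrom a m).length ∧
      ∀ (i : ℕ) (h : i < (F.leafFrom a m).length), s'.arr k i = (F.leafFrom a m)[i]) ∧ t ≤ 50 * m + 10
      from H.mono fun s' t hf h => hQ s' t hf h.1.1 h.1.2 h.2
  simp only [leafCmd, wp_seq, wp_assign, Expr.ok_lit, Expr.eval_lit]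
  refine ⟨by decide, ?_⟩
  refine Wp.for (fun j s' => s'.var r = (F.leafFrom a j).length ∧
      ∀ (i : ℕ) (h : i < (F.leafFrom a j).length), s'.arr k i = (F.leafFrom a j)[i])
      (fun _ => 30) hn20 ?_ ?_ ?_ ?_ ?_ ?_
  · simp [Cmd.modVar, hr20']
  · simp [Cmd.modVar, hnr, hn21]
  · simp [hnr, hn]; omega
  · simp [hr20, Forest.leafFrom]
  · rintro j s' hj ⟨hI1, hI2⟩ hx hf
    have hj : j < m := by simpa [hnr, hn] using hj
    have ho' : s'.var o = a := by
      rw [hf.var o (by simp [Cmd.for, Cmd.modVar, hor, ho20, ho21])]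
      simpa [hor] using ho
    have h2 : s'.arr 2 = s.arr 2 := by
      rw [hf.arr 2 (by simp [Cmd.for, Cmd.modArr, hk2'])]; rfl
    have hz := (hkids (j + a + 1) (by omega) (by omega)).eq_zero_iff
    have hl := F.length_leafFrom_le a j
    simp only [wp_ite, wp_seq, wp_assign, wp_store, wp_skip]
    simp [hx, ho', hZ, hK, h2, hk2, hr21, hr20]
    refine ⟨by omega, by omega, fun h => ?_, fun h => ?_⟩
    · rw [Forest.leafFrom_succ, if_pos (hz.1 h)]
      refine ⟨by omega, by omega, by simp [hI1], fun i hi => ?_⟩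
      rw [hI1, List.getElem_append]
      split_ifs with h1 h2 h2
      · omega
      · simp
      · exact hI2 i h2
      · simp at hi; omega
    · rw [Forest.leafFrom_succ, if_neg (fun h' => h (hz.2 h'))]
      simpa using ⟨hI1, hI2⟩
  · rintro s' t hI _ hf ht
    have e : (s.setVar r 0).var n = m := by simp [hnr, hn]
    rw [e] at hI ht
    refine ⟨hI, ?_⟩
    simp at ht ⊢
    omega

/-- The largest `s` with `8 ^ s ≤ nT`, stored in variable `8`. -/
def logCmd : Cmd :=
  assign 8 (lit 0) ;;
  assign 21 (lit 8) ;;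
  .while (.lt (var 21) (var 2 + lit 1)) (
    assign 21 (var 21 * lit 8) ;;
    assign 8 (var 8 + lit 1))

theorem wp_logCmd {E : Env} {N n : ℕ} {s : HState} {Q : HState → ℕ → Prop} (hE : E.Good N)
    (h2 : s.var 2 = n) (hn : 1 ≤ n) (hnN : n ≤ N)
    (hQ : ∀ s' t, Frame logCmd s s' → 8 ^ s'.var 8 ≤ n →
      n < 8 ^ (s'.var 8 + 1) → t ≤ 30 * N → Q s' t) : Wp E logCmd s Q := by
  have hB := hE.B
  have hN := hE.N
  suffices H : Wp E logCmd s fun s' t => 8 ^ s'.var 8 ≤ n ∧ n < 8 ^ (s'.var 8 + 1) ∧ t ≤ 30 * N from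
    H.mono fun s' t hf h => hQ s' t hf h.1 h.2.1 h.2.2
  simp only [logCmd, wp_seq, wp_assign, Expr.ok_lit, Expr.eval_lit]
  refine ⟨by decide, by decide, ?_⟩
  refine Wp.while (fun s' => s'.var 21 = 8 ^ (s'.var 8 + 1) ∧ 8 ^ s'.var 8 ≤ n)
    (fun s' => n - 1 - s'.var 8) 12 ?_ ?_ ?_
  · simp; omega
  · rintro s' ⟨h1, h3⟩ hf
    have h3' : s'.var 2 = n := by rw [hf.var 2 rfl]; simpa using h2
    have h4 : s'.var 8 < 8 ^ s'.var 8 := Nat.lt_pow_self (by norm_num)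
    simp only [wp_seq, wp_assign]
    simp [h3', h1, pow_succ]
    refine ⟨by omega, fun h => ?_⟩
    have : s'.var 8 + 1 < 8 ^ (s'.var 8 + 1) := Nat.lt_pow_self (by norm_num)
    rw [pow_succ] at this
    refine ⟨by omega, by omega, by omega, ?_⟩
    omega
  · rintro s' t ⟨h1, h3⟩ hc hf ht
    have h3' : s'.var 2 = n := by rw [hf.var 2 rfl]; simpa using h2
    simp [h1, h3'] at hc
    refine ⟨h3, by omega, ?_⟩
    simp at ht ⊢
    omega

/-- Compute quotients and remainders by `var 8`. -/
def divCmd (y q : ℕ) : Cmd :=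
  assign q (lit 0) ;;
  assign 21 (lit 0) ;;
  .for 20 y (
    store 17 (var 20) (var q) ;;
    store 18 (var 20) (var 21) ;;
    assign 21 (var 21 + lit 1) ;;
    ite (.eq (var 21) (var 8)) (assign 21 (lit 0) ;; assign q (var q + lit 1)) skip)

theorem div_mod_succ_of_eq {i s : ℕ} (h : i % s + 1 = s) : (i + 1) / s = i / s + 1 ∧ (i + 1) % s = 0 := by
  have hs : 0 < s := by omega
  have h1 := Nat.div_add_mod i s
  have h2 : i + 1 = s * (i / s + 1) := by rw [mul_add, mul_one]; omega
  rw [h2]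
  exact ⟨by rw [Nat.mul_div_cancel_left _ hs], Nat.mul_mod_right _ _⟩

theorem div_mod_succ_of_ne {i s : ℕ} (h : i % s + 1 ≠ s) :
    (i + 1) / s = i / s ∧ (i + 1) % s = i % s + 1 := by
  rcases Nat.eq_zero_or_pos s with rfl | hs
  · simp
  have h1 := Nat.div_add_mod i s
  have h3 := Nat.mod_lt i hs
  rw [Nat.div_mod_unique hs]
  exact ⟨by omega, by omega⟩

/-- The machine has no division, so quotients and remainders are obtained by counting. For `s = 0`
the counter never reaches `s`, in agreement with `i / 0 = 0` and `i % 0 = i`. -/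
theorem wp_divCmd {E : Env} {N y q n s : ℕ} {st : HState} {Q : HState → ℕ → Prop} (hE : E.Good N)
    (hy : st.var y = n) (hnN : n ≤ N) (h8 : st.var 8 = s) (hyq : y ≠ q) (hy2 : y < 20) (hq : q < 20)
    (hq8 : 8 ≠ q)
    (hQ : ∀ s' t, Frame (divCmd y q) st s' → s'.var q = n / s →
      (∀ i < n, s'.arr 17 i = i / s ∧ s'.arr 18 i = i % s) → t ≤ 60 * N → Q s' t) :
    Wp E (divCmd y q) st Q := by
  have hZ := hE.Z
  have hK := hE.K
  have hB := hE.B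
  have hN := hE.N
  have hy20 : y ≠ 20 := by omega
  have hy21 : y ≠ 21 := by omega
  have hq20 : q ≠ 20 := by omega
  have hq21 : q ≠ 21 := by omega
  have hq20' : 20 ≠ q := by omega
  have hq21' : 21 ≠ q := by omega
  suffices H : Wp E (divCmd y q) st fun s' t => (s'.var q = n / s ∧
      ∀ i < n, s'.arr 17 i = i / s ∧ s'.arr 18 i = i % s) ∧ t ≤ 60 * N from
    H.mono fun s' t hf h => hQ s' t hf h.1.1 h.1.2 h.2
  simp only [divCmd, wp_seq, wp_assign, Expr.ok_lit, Expr.eval_lit]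
  refine ⟨by decide, by decide, ?_⟩
  refine Wp.for (fun j s' => (s'.var q = j / s ∧ s'.var 21 = j % s) ∧
      ∀ i < j, s'.arr 17 i = i / s ∧ s'.arr 18 i = i % s) (fun _ => 40) hy20 ?_ ?_ ?_ ?_ ?_ ?_
  · simp [Cmd.modVar, hq20']
  · simp [Cmd.modVar, hyq, hy21]
  · simp [hyq, hy, hy21]; omega
  · simp [hq20, hq21]
  · rintro j s' hj ⟨⟨hI1, hI2⟩, hI3⟩ hx hf
    have hj : j < n := by simpa [hyq, hy, hy21] using hj
    have h8' : s'.var 8 = s := by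
      rw [hf.var 8 (by simp [Cmd.for, Cmd.modVar, hq8])]
      simpa [hq8] using h8
    have h1 := Nat.div_le_self j s
    have h2 := Nat.mod_le j s
    have key : ∀ i ≤ j, (¬ i = j → s'.arr 17 i = i / s ∧ s'.arr 18 i = i % s) :=
      fun i hi h => hI3 i (by omega)
    simp only [wp_ite, wp_seq, wp_assign, wp_store, wp_skip]
    simp [hx, h8', hZ, hK, hI1, hI2, hq20, hq21, hq21']
    refine ⟨by omega, by omega, fun h => ⟨by omega, ?_⟩, fun h => ?_⟩
    · have := div_mod_succ_of_eq h
      refine ⟨⟨this.1.symm, this.2.symm⟩, fun i hi => ?_⟩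
      by_cases h : i = j
      · simp [h]
      · simp [h, key i hi h]
    · have := div_mod_succ_of_ne h
      refine ⟨⟨this.1.symm, this.2.symm⟩, fun i hi => ?_⟩
      by_cases h : i = j
      · simp [h]
      · simp [h, key i hi h]
  · rintro s' t ⟨⟨hI1, hI2⟩, hI3⟩ _ hf ht
    have e : ((st.setVar q 0).setVar 21 0).var y = n := by simp [hyq, hy, hy21]
    rw [e] at hI1 hI3 ht
    refine ⟨⟨hI1, hI3⟩, ?_⟩
    simp at ht ⊢
    omega

/-- Compute the leaves, the parameters, and in variable `11` whether to use frontier lists. -/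
def paramCmd : Cmd :=
  assign 16 (lit 0) ;;
  -- Only the number of leaves of `T` is needed; array `10` is then overwritten by the leaves of
  -- `P`.
  leafCmd 2 1 10 7 ;;
  leafCmd 1 16 10 6 ;;
  logCmd ;;
  divCmd 2 10 ;;
  assign 10 (var 10 + lit 1) ;;
  divCmd 1 9 ;;
  assign 9 (var 9 + lit 1) ;;
  assign 11 (lit 1) ;;
  ite (.lt (lit 0) (var 8)) (ite (.lt (var 9) (var 6)) (ite (.lt (var 10) (var 7))
    (assign 11 (lit 0)) skip) skip) skip

/-- The variables and arrays that are computed by `paramCmd`. -/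
structure Params {nP nT : ℕ} (F : Forest nP nT) (s : HState) : Prop where
  lP_eq : s.var 6 = (F.leafFrom 0 nP).length
  lT_eq : s.var 7 = (F.leafFrom nP nT).length
  lf : ∀ (i : ℕ) (h : i < (F.leafFrom 0 nP).length), s.arr 10 i = (F.leafFrom 0 nP)[i]
  pow_le : 8 ^ s.var 8 ≤ nT
  lt_pow : nT < 8 ^ (s.var 8 + 1)
  W_eq : s.var 9 = nP / s.var 8 + 1
  V_eq : s.var 10 = nT / s.var 8 + 1
  div : ∀ i < nP, s.arr 17 i = i / s.var 8
  mod : ∀ i < nP, s.arr 18 i = i % s.var 8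
  flag : s.var 11 = 1 ↔ s.var 8 = 0 ∨ s.var 6 ≤ s.var 9 ∨ s.var 7 ≤ s.var 10

theorem wp_paramCmd {nP nT : ℕ} {F : Forest nP nT} {E : Env} {s : HState}
    {Q : HState → ℕ → Prop} (hE : E.Good (nP + nT)) (hT : 1 ≤ nT) (h1 : s.var 1 = nP)
    (h2 : s.var 2 = nT)
    (hkids : ∀ v, F.InP v ∨ F.InT v → Chain (s.arr 3) (s.arr 2 v) (F.kids v))
    (hQ : ∀ s' t, Frame paramCmd s s' → Params F s' → t ≤ 400 * (nP + nT) → Q s' t) :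
    Wp E paramCmd s Q := by
  have hB := hE.B
  have hN := hE.N
  have hkids' : ∀ v, 1 ≤ v → v ≤ nP + nT → Chain (s.arr 3) (s.arr 2 v) (F.kids v) := by
    intro v hv1 hv2
    refine hkids v ?_
    by_cases h : v ≤ nP
    · exact .inl ⟨hv1, h⟩
    · exact .inr ⟨by omega, hv2⟩
  suffices H : Wp E paramCmd s fun s' t => Params F s' ∧ t ≤ 400 * (nP + nT) from
    H.mono fun s' t hf h => hQ s' t hf h.1 h.2
  simp only [paramCmd, wp_seq, wp_assign, Expr.ok_lit, Expr.eval_lit]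
  refine ⟨by decide, ?_⟩
  refine wp_leafCmd (F := F) (m := nT) (a := nP) hE (by simpa using h2) (by simpa using h1) (by omega)
    (by decide) (by decide) (by decide) (by decide) (by decide) (by decide) (by decide) hkids'
    fun s1 t1 hf1 hr1 _ ht1 => ?_
  have a1 : s1.var 1 = nP := by rw [hf1.var 1 rfl]; simpa using h1
  have a2 : s1.var 2 = nT := by rw [hf1.var 2 rfl]; simpa using h2
  refine wp_leafCmd (F := F) (m := nP) (a := 0) hE a1 (by rw [hf1.var 16 rfl]; simp) (by omega)
    (by decide) (by decide) (by decide) (by decide) (by decide) (by decide) (by decide)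
    (by rw [hf1.arr 2 rfl, hf1.arr 3 rfl]; exact hkids') fun s2 t2 hf2 hr2 hl2 ht2 => ?_
  have b1 : s2.var 1 = nP := by rw [hf2.var 1 rfl, a1]
  have b2 : s2.var 2 = nT := by rw [hf2.var 2 rfl, a2]
  refine wp_logCmd hE b2 hT (by omega) fun s3 t3 hf3 hp3 hp3' ht3 => ?_
  set k := s3.var 8 with hk
  have c1 : s3.var 1 = nP := by rw [hf3.var 1 rfl, b1]
  have c2 : s3.var 2 = nT := by rw [hf3.var 2 rfl, b2]
  refine wp_divCmd hE c2 (by omega) rfl (by decide) (by decide) (by decide) (by decide)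
    fun s4 t4 hf4 hq4 _ ht4 => ?_
  have d1 : s4.var 1 = nP := by rw [hf4.var 1 rfl, c1]
  have d8 : s4.var 8 = k := by rw [hf4.var 8 rfl]
  have hdT := Nat.div_le_self nT (s3.var 8)
  have hdP := Nat.div_le_self nP (s3.var 8)
  refine ⟨by simp [hq4]; omega, ?_⟩
  refine wp_divCmd (n := nP) (s := k) hE (by simpa using d1) (by omega) (by simpa using d8) (by decide)
    (by decide) (by decide) (by decide) fun s5 t5 hf5 hq5 hd5 ht5 => ?_
  have e6 : s5.var 6 = (F.leafFrom 0 nP).length := by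
    rw [hf5.var 6 rfl, HState.setVar_var, if_neg (by decide), hf4.var 6 rfl, hf3.var 6 rfl, hr2]
  have e7 : s5.var 7 = (F.leafFrom nP nT).length := by
    rw [hf5.var 7 rfl, HState.setVar_var, if_neg (by decide), hf4.var 7 rfl, hf3.var 7 rfl,
      hf2.var 7 rfl, hr1]
  have e8 : s5.var 8 = k := by rw [hf5.var 8 rfl]; simpa using d8
  have e10 : s5.var 10 = nT / k + 1 := by rw [hf5.var 10 rfl]; simp [hq4, hk]
  have el : s5.arr 10 = s2.arr 10 := by
    rw [hf5.arr 10 rfl, HState.setVar_arr, hf4.arr 10 rfl, hf3.arr 10 rfl]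
  have hflag : ∀ f t, (f = 1 ↔ k = 0 ∨ s5.var 6 ≤ nP / k + 1 ∨ s5.var 7 ≤ nT / k + 1) → t ≤ 400 * (nP + nT) →
      Params F (((s5.setVar 9 (nP / k + 1)).setVar 11 f)) ∧ t ≤ 400 * (nP + nT) := by
    intro f t hff ht
    refine ⟨⟨?_, ?_, ?_, ?_, ?_, ?_, ?_, ?_, ?_, ?_⟩, ht⟩
    · simpa using e6
    · simpa using e7
    · simpa [el] using hl2
    · simpa [e8] using hp3
    · simpa [e8] using hp3'
    · simp [e8]
    · simp [e8, e10]
    · intro i hi; simp [e8, (hd5 i hi).1]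
    · intro i hi; simp [e8, (hd5 i hi).2]
    · simpa [e8, e10] using hff
  have hset : ∀ st : HState, (st.setVar 11 1).setVar 11 0 = st.setVar 11 0 := by
    intro st
    ext x
    · simp only [HState.setVar_var]; split_ifs <;> rfl
    all_goals rfl
  simp only [wp_ite, wp_skip, wp_assign, Expr.eval_add, Expr.ok_add, Expr.eval_var, Expr.ok_var,
    Expr.eval_lit, Expr.ok_lit, hq5, Test.ok_lt, Test.holds_lt, hset]
  simp only [HState.setVar_var, if_true, reduceIte, show ¬ (8 = 11) by decide, show ¬ (8 = 9) by decide,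
    show ¬ (9 = 11) by decide, show ¬ (6 = 11) by decide, show ¬ (6 = 9) by decide,
    show ¬ (10 = 11) by decide, show ¬ (10 = 9) by decide, show ¬ (7 = 11) by decide,
    show ¬ (7 = 9) by decide, e8, e10]
  have hdP' := Nat.div_le_self nP k
  refine ⟨⟨trivial, by norm_num, by omega⟩, by norm_num, by norm_num, fun g1 => ⟨⟨trivial, trivial⟩, fun g2 =>
    ⟨⟨trivial, trivial⟩, fun g3 => ⟨by norm_num, hflag _ _ ?_ ?_⟩, fun g3 => hflag _ _ ?_ ?_⟩, fun g2 => hflag _ _ ?_ ?_⟩,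
    fun g1 => hflag _ _ ?_ ?_⟩
  all_goals (simp; omega)

end TPS
/-! ### Reports, and the algorithm with frontier lists -/

namespace TPS

open WordRAM
open TPS.Expr (var lit get inp)
open TPS.Cmd (assign store emit skip ite)

namespace Forest

variable {nP nT : ℕ} {F : Forest nP nT}

theorem leavesP_eq : F.leavesP = (F.leafFrom 0 nP).toFinset := by
  ext x
  rw [leavesP, Finset.mem_filter, List.mem_toFinset, mem_leafFrom, mem_nodesP, InP, Nat.zero_add]
  refine and_congr_right fun hx => ?_
  rw [List.eq_nil_iff_forall_not_mem]
  constructor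
  · intro h u hu
    exact h u (mem_nodesP.2 (InP.of_mem_kids hx hu)) (mem_kids.1 hu).2
  · intro h u hu hux
    exact h u (mem_kids.2 ⟨(mem_nodesP.1 hu).all, hux⟩)

theorem leavesT_eq : F.leavesT = (F.leafFrom nP nT).toFinset := by
  ext x
  rw [leavesT, Finset.mem_filter, List.mem_toFinset, mem_leafFrom, mem_nodesT, InT]
  refine and_congr_right fun hx => ?_
  rw [List.eq_nil_iff_forall_not_mem]
  constructor
  · intro h u hu
    exact h u (mem_nodesT.2 (InT.of_mem_kids hx hu)) (mem_kids.1 hu).2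
  · intro h u hu hux
    exact h u (mem_kids.2 ⟨(mem_nodesT.1 hu).all, hux⟩)

theorem card_leavesP : F.leavesP.card = (F.leafFrom 0 nP).length := by
  rw [leavesP_eq, List.toFinset_card_of_nodup (nodup_leafFrom _ _)]

theorem card_leavesT : F.leavesT.card = (F.leafFrom nP nT).length := by
  rw [leavesT_eq, List.toFinset_card_of_nodup (nodup_leafFrom _ _)]

theorem sum_leaf_cost (c : ℕ) :
    ∑ v ∈ F.nodesT, (if (F.kids v).isEmpty then c else 0) = (F.leafFrom nP nT).length * c := by
  rw [← Finset.sum_filter, Finset.sum_const, smul_eq_mul, ← card_leavesT, leavesT_eq]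
  congr 2
  ext x
  rw [Finset.mem_filter, List.mem_toFinset, mem_leafFrom, mem_nodesT, InT, List.isEmpty_iff]

end Forest

theorem numLeaves_P {nP nT : ℕ} (P : LabeledTree nP) (T : LabeledTree nT) :
    P.numLeaves = ((Forest.ofTrees P T).leafFrom 0 nP).length := by
  rw [← Forest.card_leavesP, Forest.leavesP_eq, LabeledTree.numLeaves,
    ← Finset.card_image_of_injective P.leaves (f := fun x : Fin nP => (x : ℕ) + 1)]
  · congr 1
    ext i
    rw [Finset.mem_image, List.mem_toFinset, Forest.mem_leafFrom]
    constructor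
    · rintro ⟨x, hx, rfl⟩
      exact ⟨by omega, (ofTrees_kids_P x).2 hx⟩
    · rintro ⟨h1, h2⟩
      obtain ⟨x, rfl⟩ := exists_fin_P (nP := nP) (i := i) (by omega) (by omega)
      exact ⟨x, (ofTrees_kids_P x).1 h2, rfl⟩
  · intro a b h
    exact Fin.ext (by simpa using h)

theorem numLeaves_T {nP nT : ℕ} (P : LabeledTree nP) (T : LabeledTree nT) :
    T.numLeaves = ((Forest.ofTrees P T).leafFrom nP nT).length := by
  rw [← Forest.card_leavesT, Forest.leavesT_eq, LabeledTree.numLeaves,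
    ← Finset.card_image_of_injective T.leaves (f := fun x : Fin nT => (x : ℕ) + nP + 1)]
  · congr 1
    ext i
    rw [Finset.mem_image, List.mem_toFinset, Forest.mem_leafFrom]
    constructor
    · rintro ⟨x, hx, rfl⟩
      exact ⟨by omega, (ofTrees_kids_T x).2 hx⟩
    · rintro ⟨h1, h2⟩
      obtain ⟨x, rfl⟩ := exists_fin_T (nP := nP) (nT := nT) (i := i) (by omega) (by omega)
      exact ⟨x, (ofTrees_kids_T x).1 h2, rfl⟩
  · intro a b h
    exact Fin.ext (by simpa using h)

/-- The part common to both algorithms: a report in terms of the internal node numbers becomes one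
in terms of the given trees. The directory order `lf`, the block order `Y` and the bit positions are
arbitrary. -/
theorem isReport_of {nP nT m : ℕ} {P : LabeledTree nP} {T : LabeledTree nT} {lf Y : List ℕ}
    {q r : ℕ → ℕ} {bw : ℕ → List ℕ} {out : List ℕ}
    (hlf : ∀ x, x ∈ lf ↔ (Forest.ofTrees P T).InP x ∧ (Forest.ofTrees P T).kids x = [])
    (hlf2 : lf.Nodup)
    (hY : ∀ y, y ∈ Y ↔ (Forest.ofTrees P T).InT y ∧ (Forest.ofTrees P T).kids y = [])
    (hY2 : Y.Nodup)
    (hout : out = m :: lf.length :: (lf.flatMap (fun x => [x - 1, q x, r x]) ++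
      Y.flatMap fun y => (y - nP - 1) :: bw y))
    (hm : ∀ y ∈ Y, (bw y).length = m) (hq : ∀ x ∈ lf, q x < m)
    (hbit : ∀ x ∈ lf, ∀ y ∈ Y, ((bw y).getD (q x) 0).testBit (r x) = true ↔
      (Forest.ofTrees P T).Mt x y) : IsReport P T out := by
  -- The default values are never reached, since `lf` and `Y` contain only nodes of the trees.
  let fP : ℕ → Fin nP := fun i => if h : i - 1 < nP then ⟨i - 1, h⟩ else P.root
  let fT : ℕ → Fin nT := fun i => if h : i - nP - 1 < nT then ⟨i - nP - 1, h⟩ else T.root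
  have hP : ∀ x ∈ lf, x = fP x + 1 := by
    intro x hx
    have := ((hlf x).1 hx).1
    have h1 := this.1
    have h2 := this.2
    simp only [fP]
    rw [dif_pos (by omega)]
    simp
    omega
  have hT : ∀ y ∈ Y, y = fT y + nP + 1 := by
    intro y hy
    have := ((hY y).1 hy).1
    have h1 := this.1
    have h2 := this.2
    simp only [fT]
    rw [dif_pos (by omega)]
    simp
    omega
  have e1 : (lf.map fun x => (fP x, q x, r x)).map Prod.fst = lf.map fP := by
    rw [List.map_map]; rfl
  have e2 : (Y.map fun y => (fT y, bw y)).map Prod.fst = Y.map fT := by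
    rw [List.map_map]; rfl
  refine ⟨m, lf.map fun x => (fP x, q x, r x), Y.map fun y => (fT y, bw y), ?_, ?_, ?_, ?_, ?_, ?_, ?_, ?_⟩
  · rw [hout, List.length_map, List.flatMap_map, List.flatMap_map]
    congr 3
    · refine List.flatMap_congr fun x hx => ?_
      have := hP x hx
      simp only
      congr 1
      omega
    · refine List.flatMap_congr fun y hy => ?_
      have := hT y hy
      simp only
      congr 1
      omega
  · rw [e1]
    refine hlf2.map_on fun x hx y hy h => ?_
    rw [hP x hx, hP y hy, h]
  · intro x
    rw [e1, List.mem_map, ← ofTrees_kids_P (T := T)]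
    constructor
    · rintro ⟨i, hi, rfl⟩
      rw [← hP i hi]
      exact ((hlf i).1 hi).2
    · intro h
      have : (x : ℕ) + 1 ∈ lf := (hlf _).2 ⟨⟨by omega, by omega⟩, h⟩
      exact ⟨_, this, Fin.ext (by have := hP _ this; omega)⟩
  · rw [e2]
    refine hY2.map_on fun x hx y hy h => ?_
    rw [hT x hx, hT y hy, h]
  · intro y
    rw [e2, List.mem_map, ← ofTrees_kids_T (P := P)]
    constructor
    · rintro ⟨i, hi, rfl⟩
      rw [← hT i hi]
      exact ((hY i).1 hi).2
    · intro h
      have : (y : ℕ) + nP + 1 ∈ Y := (hY _).2 ⟨⟨by omega, by omega⟩, h⟩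
      exact ⟨_, this, Fin.ext (by have := hT _ this; omega)⟩
  · intro b hb
    obtain ⟨y, hy, rfl⟩ := List.mem_map.1 hb
    exact hm y hy
  · intro e he
    obtain ⟨x, hx, rfl⟩ := List.mem_map.1 he
    exact hq x hx
  · intro e he b hb
    obtain ⟨x, hx, rfl⟩ := List.mem_map.1 he
    obtain ⟨y, hy, rfl⟩ := List.mem_map.1 hb
    simp only
    rw [hbit x hx y hy, ← ofTrees_mt, ← hP x hx, ← hT y hy]

/-- The algorithm with frontier lists. -/
def frontierCmd : Cmd :=
  store 11 (get 4 (var 4)) (var 4) ;;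
  -- Every bit takes a word of its own, so the length of a bit vector and the number of leaves of
  -- `P` are the same header word.
  emit (var 6) ;;
  emit (var 6) ;;
  .for 20 6 (emit (get 10 (var 20) - lit 1) ;; emit (var 20) ;; emit (lit 0)) ;;
  dfsCmd frontierEnter frontierLeaf frontierExit

section

variable {nP nT : ℕ} {F : Forest nP nT} {cl : ℕ → ℕ} {lf : List ℕ} {E : Env}

theorem dfsSpec_frontier {s : HState} (hE : E.Good (nP + nT)) (hcl : F.IsClass cl)
    (hp : Prepared F cl lf s) (hlf : ∀ x ∈ lf, F.InP x) (hlen : lf.length ≤ nP) :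
    DfsSpec F E s frontierEnter frontierLeaf frontierExit (FrontierInv F cl)
      (fun v => 60 + 70 * ((F.newSet v).card + (F.newKids v).card)) (fun _ => 30 * lf.length + 20)
      (fun v => 60 + 70 * ((F.newSet v).card + (F.newKids v).card)) (frontierBlock F lf) where
  good := hE
  par := hp.par
  hd v hv := hp.kids v (.inr hv)
  root := hp.root
  var12 := rfl
  var13 := rfl
  arr0 := rfl
  arr2 := rfl
  arr3 := rfl
  inv12 _ _ _ h := ⟨h.heads, h.saved, h.flags⟩
  inv13 _ _ _ h := ⟨h.heads, h.saved, h.flags⟩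
  wp_enter _ _ hv hI h12 hf := wp_frontierEnter hE hcl hp hv hI h12 hf
  wp_leaf _ _ hv _ hI h12 hf := wp_frontierLeaf hE hp hv hlf hlen hI h12 hf
  wp_exit _ _ hv hI h12 hf := wp_frontierExit hE hcl hp hv hI h12 hf

theorem wp_frontierCmd {s : HState} {Q : HState → ℕ → Prop} (hE : E.Good (nP + nT))
    (hcl : F.IsClass cl) (hp : Prepared F cl lf s) (hlf : lf = F.leafFrom 0 nP)
    (h11 : ∀ a, s.arr 11 a = 0) (h12 : ∀ a, s.arr 12 a = 0) (h14 : ∀ a, s.arr 14 a = 0)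
    (hQ : ∀ s' t (Y : List ℕ), Y.Nodup → (∀ y, y ∈ Y ↔ F.InT y ∧ F.kids y = []) →
      s'.out = s.out ++ lf.length :: lf.length :: (lf.flatMap (fun x => [x - 1, lf.idxOf x, 0]) ++
        Y.flatMap (frontierBlock F lf)) →
      t ≤ 500 * (nP + nT) + 320 * (F.leavesP.card * nT) →
      t ≤ 500 * (nP + nT) + 320 * (nP * F.leavesT.card) → Q s' t) :
    Wp E frontierCmd s Q := by
  have hZ := hE.Z
  have hK := hE.K
  have hB := hE.B
  have hN := hE.N
  have hlfP : ∀ x ∈ lf, F.InP x := by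
    intro x hx
    rw [hlf, Forest.mem_leafFrom] at hx
    exact ⟨by omega, by omega⟩
  have hnd : lf.Nodup := hlf ▸ Forest.nodup_leafFrom _ _
  have hlen : lf.length ≤ nP := hlf ▸ Forest.length_leafFrom_le _ _
  have hrP : F.InP F.rP := F.rP_mem
  have hc : s.arr 4 F.rP = cl F.rP := hp.cls _ hrP.all.1 hrP.all.2
  have hcr := hcl.lt _ hrP.all.1 hrP.all.2
  simp only [frontierCmd, wp_seq, wp_store, wp_emit]
  simp only [Expr.eval_get, Expr.ok_get, Expr.eval_var, Expr.ok_var, hp.rP_eq, hc, hZ, hK,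
    HState.setArr_var, HState.emit_var, hp.lP_eq]
  have hrP1 := hrP.all
  refine ⟨by simp; omega, trivial, trivial, ?_⟩
  generalize hs1 : HState.emit _ _ = s1
  have g6 : s1.var 6 = lf.length := by rw [← hs1]; exact hp.lP_eq
  have g10 : s1.arr 10 = s.arr 10 := by rw [← hs1]; simp
  have gf : ∀ k, k ≠ 11 → s1.arr k = s.arr k := by
    intro k hk
    rw [← hs1]; simp [hk]
  have g11 : ∀ a, s1.arr 11 a = if a = cl F.rP then F.rP else 0 := by
    intro a
    rw [← hs1]
    simp [h11]
  have go : s1.out = s.out ++ [lf.length, lf.length] := by rw [← hs1]; simp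
  have gv : s1.var = s.var := by rw [← hs1]; rfl
  clear hs1
  refine Wp.for (fun i s' => s'.out = s1.out ++ (lf.take i).flatMap fun x => [x - 1, lf.idxOf x, 0])
    (fun _ => 20) (by decide) rfl rfl (by omega) (by simp) ?_ ?_
  · intro i s' hi hI hx hf
    rw [g6] at hi
    have hiP := hlfP lf[i] (by simp)
    have hia := hiP.all
    have e10 : s'.arr 10 i = lf[i] := by rw [hf.arr 10 rfl, g10]; exact hp.lf i hi
    simp only [wp_emit, wp_seq]
    simp [hx, hK, hZ, e10]
    refine ⟨⟨by omega, by omega⟩, ?_⟩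
    have : (lf.take (i + 1)).flatMap (fun x => [x - 1, lf.idxOf x, 0]) =
        (lf.take i).flatMap (fun x => [x - 1, lf.idxOf x, 0]) ++ [lf[i] - 1, i, 0] := by
      rw [List.take_add_one, List.getElem?_eq_getElem hi, List.flatMap_append, Option.toList_some,
        List.flatMap_singleton, hnd.idxOf_getElem]
    rw [hI, this]
    simp
  · intro s2 t2 hI2 _ hf2 ht2
    rw [g6, List.take_length] at hI2
    rw [g6] at ht2
    have ef : ∀ k, k ≠ 11 → s2.arr k = s.arr k := fun k hk => by
      rw [hf2.arr k rfl, gf k hk]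
    have ev : ∀ k < 20, s2.var k = s.var k := fun k hk => by
      rw [hf2.var k (by simp [Cmd.for, Cmd.modVar]; omega), gv]
    have hp2 : Prepared F cl lf s2 := by
      constructor
      · rw [ev _ (by decide)]; exact hp.nP_eq
      · rw [ev _ (by decide)]; exact hp.nT_eq
      · rw [ev _ (by decide)]; exact hp.N_eq
      · rw [ev _ (by decide)]; exact hp.rP_eq
      · rw [ev _ (by decide)]; exact hp.rT_eq
      · rw [ev _ (by decide)]; exact hp.lP_eq
      · rw [ef _ (by decide)]; exact hp.par
      · rw [ef _ (by decide), ef _ (by decide)]; exact hp.kids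
      · rw [ef _ (by decide)]; exact hp.root
      · rw [ef _ (by decide)]; exact hp.cls
      · rw [ef _ (by decide)]; exact hp.lf
    refine (dfsSpec_frontier hE hcl hp2 hlfP hlen).wp rfl hp2.rT_eq ⟨?_, ?_, ?_⟩
      fun s3 t3 Y hf3 hY1 hY2 ho3 ht3 => ?_
    · intro a ha
      rw [hf2.arr 11 rfl, g11, ef 12 (by decide), F.rp_zero, Forest.frontier]
      by_cases h : a = cl F.rP
      · rw [if_pos h, if_pos h.symm]
        exact ⟨rfl, by omega, h12 _⟩
      · rw [if_neg h, if_neg (Ne.symm h)]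
        rfl
    · simp [F.rp_zero]
    · intro x hx
      rw [ef 14 (by decide), h14, if_neg (Forest.not_mt_zero hx)]
    · have hsum : ∑ v ∈ F.nodesT, DfsSpec.cost F
          (fun v => 60 + 70 * ((F.newSet v).card + (F.newKids v).card)) (fun _ => 30 * lf.length + 20)
          (fun v => 60 + 70 * ((F.newSet v).card + (F.newKids v).card)) v =
          200 * nT + 140 * ∑ v ∈ F.nodesT, ((F.newSet v).card + (F.newKids v).card) +
          (F.leafFrom nP nT).length * (30 * lf.length + 20) := by
        have hc : ∑ v ∈ F.nodesT, 200 = 200 * nT := by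
          rw [Finset.sum_const, Forest.card_nodesT, smul_eq_mul, mul_comm]
        rw [← Forest.sum_leaf_cost, Finset.mul_sum, ← hc, ← Finset.sum_add_distrib,
          ← Finset.sum_add_distrib]
        refine Finset.sum_congr rfl fun v _ => ?_
        simp only [DfsSpec.cost]
        ring
      rw [hsum] at ht3
      have hl := Forest.sum_new_le_left (F := F)
      have hr := Forest.sum_new_le_right (F := F)
      have hPc := Forest.card_leavesP (F := F)
      have hTc := Forest.card_leavesT (F := F)
      have hTl := F.length_leafFrom_le nP nT
      rw [← hTc] at ht3 hTl
      rw [← hlf] at hPc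
      rw [hPc] at hl
      -- Writing the blocks costs `l_P * l_T`, which each of the two bounds absorbs.
      have m1 : F.leavesT.card * lf.length ≤ lf.length * nT := by
        rw [mul_comm]; exact Nat.mul_le_mul_left _ hTl
      have m2 : F.leavesT.card * lf.length ≤ nP * F.leavesT.card := by
        rw [mul_comm]; exact Nat.mul_le_mul_right _ hlen
      have m3 : F.leavesT.card * (30 * lf.length + 20) = 30 * (F.leavesT.card * lf.length) +
        20 * F.leavesT.card := by ring
      rw [m3] at ht3
      refine hQ s3 _ Y hY1 hY2 ?_ ?_ ?_
      · rw [ho3, hI2, go]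
        simp
      · rw [hPc]
        simp at ht2 ⊢
        omega
      · simp at ht2 ⊢
        omega

open Classical in
theorem isReport_frontier {P : LabeledTree nP} {T : LabeledTree nT} {out Y : List ℕ}
    (hlf : lf = (Forest.ofTrees P T).leafFrom 0 nP) (hY : Y.Nodup)
    (hY2 : ∀ y, y ∈ Y ↔ (Forest.ofTrees P T).InT y ∧ (Forest.ofTrees P T).kids y = [])
    (hout : out = lf.length :: lf.length :: (lf.flatMap (fun x => [x - 1, lf.idxOf x, 0]) ++
        Y.flatMap (frontierBlock (Forest.ofTrees P T) lf))) : IsReport P T out := by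
  refine isReport_of (lf := lf) (Y := Y) (q := fun x => lf.idxOf x) (r := fun _ => 0)
    (bw := fun y => lf.map fun x => if (Forest.ofTrees P T).Mt x y then 1 else 0) ?_ ?_ hY2 hY hout
    ?_ ?_ ?_
  · intro x
    rw [hlf, Forest.mem_leafFrom, Forest.InP]
    simp only [Nat.zero_add]
    rfl
  · exact hlf ▸ Forest.nodup_leafFrom _ _
  · simp
  · intro x hx
    exact List.idxOf_lt_length_iff.2 hx
  · intro x hx y _
    have h1 := List.idxOf_lt_length_iff.2 hx
    rw [List.getD_eq_getElem _ _ (by simpa using h1), List.getElem_map, List.getElem_idxOf h1]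
    split_ifs with h <;> simp [h]

end

end TPS
/-! ### Breadth-first numbering -/

namespace TPS

open WordRAM
open TPS.Expr (var lit get inp)
open TPS.Cmd (assign store emit skip ite)

/-! ### The queue of the breadth-first search and the positions it defines -/

namespace Forest

variable {nP nT : ℕ} (F : Forest nP nT)

/-- The queue of a breadth-first search of `P` after `k` steps, without removals; every node comes
with the position of its parent. -/
def queue : ℕ → List (ℕ × ℕ)
  | 0 => [(F.rP, 0)]
  | k + 1 => queue k ++ (F.kids ((queue k).getD k (0, 0)).1).map fun u => (u, k)

/-- The node at position `c`. -/
def node (c : ℕ) : ℕ := ((F.queue nP).getD c (0, 0)).1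
/-- The position of the parent of the node at position `c`. -/
def pre (c : ℕ) : ℕ := ((F.queue nP).getD c (0, 0)).2

variable {F}

/-- The essential fields are `pre_lt` and `mono`: parents precede their children, and positions of
parents do not decrease along the queue. The field `closed` yields that every node is reached, and
`sum` bounds the time. -/
structure QueueInv (F : Forest nP nT) (k : ℕ) (q : List (ℕ × ℕ)) : Prop where
  inP : ∀ e ∈ q, F.InP e.1
  nodup : (q.map Prod.fst).Nodup
  root : q.getD 0 (0, 0) = (F.rP, 0)
  pos : 0 < q.length
  pre_lt : ∀ i, 1 ≤ i → i < q.length → (q.getD i (0, 0)).2 < k ∧ (q.getD i (0, 0)).2 < i ∧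
    F.par (q.getD i (0, 0)).1 = (q.getD (q.getD i (0, 0)).2 (0, 0)).1
  mono : ∀ i j, i ≤ j → j < q.length → (q.getD i (0, 0)).2 ≤ (q.getD j (0, 0)).2
  closed : ∀ i < k, ∀ u ∈ F.kids (q.getD i (0, 0)).1, u ∈ q.map Prod.fst
  le : k ≤ q.length
  sum : q.length = ∑ i ∈ Finset.range k, (F.kids (q.getD i (0, 0)).1).length + 1

theorem QueueInv.mem {k : ℕ} {q : List (ℕ × ℕ)} (h : QueueInv F k q) {i : ℕ} (hi : i < q.length) :
    F.InP (q.getD i (0, 0)).1 := by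
  rw [List.getD_eq_getElem _ _ hi]
  exact h.inP _ (List.getElem_mem hi)

theorem QueueInv.inj {k : ℕ} {q : List (ℕ × ℕ)} (h : QueueInv F k q) {i j : ℕ} (hi : i < q.length)
    (hj : j < q.length) (hij : (q.getD i (0, 0)).1 = (q.getD j (0, 0)).1) : i = j := by
  rw [List.getD_eq_getElem _ _ hi, List.getD_eq_getElem _ _ hj] at hij
  refine (h.nodup.getElem_inj_iff (hi := by simpa using hi) (hj := by simpa using hj)).1 ?_
  simpa using hij

theorem QueueInv.length_le {k : ℕ} {q : List (ℕ × ℕ)} (h : QueueInv F k q) : q.length ≤ nP := by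
  have h1 := List.toFinset_card_of_nodup h.nodup
  rw [List.length_map] at h1
  rw [← h1, ← Forest.card_nodesP (F := F)]
  refine Finset.card_le_card fun x hx => ?_
  rw [List.mem_toFinset, List.mem_map] at hx
  obtain ⟨e, he, rfl⟩ := hx
  exact mem_nodesP.2 (h.inP e he)

/-- If all nodes in the queue have been processed, the queue contains all nodes. -/
theorem QueueInv.all_mem {k : ℕ} {q : List (ℕ × ℕ)} (h : QueueInv F k q) (hk : q.length ≤ k) :
    ∀ {x : ℕ}, F.InP x → x ∈ q.map Prod.fst := by
  suffices H : ∀ n x, F.InP x → (F.rp x).length = n → x ∈ q.map Prod.fst from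
    fun {x} hx => H _ x hx rfl
  intro n
  induction n with
  | zero =>
    intro x hx h0
    rw [F.rp_cons x hx.all.1 hx.all.2] at h0
    simp at h0
  | succ n ih =>
    intro x hx hn
    by_cases hr : x = F.rP
    · have := List.getElem_mem h.pos
      rw [← List.getD_eq_getElem _ (0, 0) h.pos, h.root] at this
      exact List.mem_map.2 ⟨_, this, hr.symm⟩
    · have hp := F.par_P x hx.1 hx.2 hr
      rw [F.rp_cons x hx.all.1 hx.all.2] at hn
      obtain ⟨e, he, hep⟩ := List.mem_map.1 (ih _ hp (by simpa using hn))
      obtain ⟨i, hi, rfl⟩ := List.getElem_of_mem he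
      refine h.closed i (by omega) x (mem_kids.2 ⟨hx.all, ?_⟩)
      rw [List.getD_eq_getElem _ _ hi, hep]

theorem queueInv_zero : QueueInv F 0 (F.queue 0) where
  inP := by
    intro e he
    rw [queue, List.mem_singleton] at he
    exact he ▸ F.rP_mem
  nodup := by simp [queue]
  root := rfl
  pos := by simp [queue]
  pre_lt i h1 h2 := by simp [queue] at h2; omega
  mono i j h1 h2 := by
    simp [queue] at h2
    have : i = j := by omega
    rw [this]
  closed i hi := by omega
  le := by omega
  sum := by simp [queue]

/-- Otherwise every node of the queue has been processed, so the queue contains all `nP` nodes. -/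
theorem QueueInv.lt_length {k : ℕ} {q : List (ℕ × ℕ)} (h : QueueInv F k q) (hk : k < nP) :
    k < q.length := by
  by_contra hlt
  have h1 := List.toFinset_card_of_nodup h.nodup
  rw [List.length_map] at h1
  have h2 : F.nodesP ⊆ (q.map Prod.fst).toFinset := fun x hx =>
    List.mem_toFinset.2 (h.all_mem (by omega) (mem_nodesP.1 hx))
  have := Finset.card_le_card h2
  rw [h1, card_nodesP] at this
  omega

theorem queueInv_succ {k : ℕ} (hk : k < nP) (h : QueueInv F k (F.queue k)) :
    QueueInv F (k + 1) (F.queue (k + 1)) := by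
  have hkl := h.lt_length hk
  set q := F.queue k with hq
  set x := (q.getD k (0, 0)).1 with hx
  have hxP : F.InP x := h.mem hkl
  have hq' : F.queue (k + 1) = q ++ (F.kids x).map fun u => (u, k) := rfl
  rw [hq']
  have gl : ∀ i, i < q.length → (q ++ (F.kids x).map fun u => (u, k)).getD i (0, 0) = q.getD i (0, 0) :=
    fun i hi => List.getD_append _ _ _ _ hi
  have gr : ∀ i, q.length ≤ i → i < q.length + (F.kids x).length →
      ((q ++ (F.kids x).map fun u => (u, k)).getD i (0, 0)).1 ∈ F.kids x ∧
      ((q ++ (F.kids x).map fun u => (u, k)).getD i (0, 0)).2 = k := by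
    intro i h1 h2
    rw [List.getD_append_right _ _ _ _ h1, List.getD_eq_getElem _ _ (by simp; omega)]
    simp
  have hlen : (q ++ (F.kids x).map fun u => (u, k)).length = q.length + (F.kids x).length := by simp
  have hx0 : x ≠ 0 := by have := hxP.1; omega
  -- A child of `x` that is already in the queue would have a parent at a position below `k`, but
  -- `x` is at position `k` only.
  have hnew : ∀ u ∈ F.kids x, u ∉ q.map Prod.fst := by
    intro u hu hmem
    obtain ⟨e, he, heu⟩ := List.mem_map.1 hmem
    obtain ⟨i, hi, rfl⟩ := List.getElem_of_mem he
    rw [← List.getD_eq_getElem _ (0, 0) hi] at heu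
    have hpu := (mem_kids.1 hu).2
    rcases Nat.eq_zero_or_pos i with rfl | hi0
    · rw [h.root] at heu
      rw [← heu, F.par_rP] at hpu
      exact hx0 hpu.symm
    · have h3 := h.pre_lt i hi0 hi
      rw [heu, hpu] at h3
      have := h.inj hkl (by omega) h3.2.2
      omega
  refine ⟨?_, ?_, ?_, ?_, ?_, ?_, ?_, ?_, ?_⟩
  · intro e he
    rcases List.mem_append.1 he with he | he
    · exact h.inP e he
    · obtain ⟨u, hu, rfl⟩ := List.mem_map.1 he
      exact hxP.of_mem_kids hu
  · rw [List.map_append, List.nodup_append]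
    refine ⟨h.nodup, ?_, ?_⟩
    · rw [List.map_map]
      have : (F.kids x).Nodup := nodup_bucket _ _ _
      simpa [Function.comp_def] using this
    · rintro a ha b hb rfl
      rw [List.map_map] at hb
      exact hnew a (by simpa [Function.comp_def] using hb) ha
  · rw [gl 0 h.pos, h.root]
  · rw [hlen]; omega
  · intro i h1 h2
    rw [hlen] at h2
    by_cases hi : i < q.length
    · have := h.pre_lt i h1 hi
      rw [gl i hi, gl _ (by omega)]
      exact ⟨by omega, this.2⟩
    · obtain ⟨h3, h4⟩ := gr i (by omega) h2
      rw [h4, gl k hkl]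
      exact ⟨by omega, by omega, (mem_kids.1 h3).2⟩
  · intro i j hij hj
    rw [hlen] at hj
    by_cases hjl : j < q.length
    · rw [gl i (by omega), gl j hjl]
      exact h.mono i j hij hjl
    · rw [(gr j (by omega) hj).2]
      by_cases hi : i < q.length
      · rw [gl i hi]
        rcases Nat.eq_zero_or_pos i with rfl | hi0
        · rw [h.root]; exact Nat.zero_le _
        · exact (h.pre_lt i hi0 hi).1.le
      · rw [(gr i (by omega) (by omega)).2]
  · intro i hi u hu
    rw [List.map_append, List.mem_append]
    have hil : i < q.length := by omega
    rw [gl i hil] at hu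
    by_cases hik : i < k
    · exact .inl (h.closed i hik u hu)
    · have : i = k := by omega
      rw [this, ← hx] at hu
      right
      simpa using hu
  · rw [hlen]; omega
  · have hs : ∀ i ∈ Finset.range k, (F.kids ((q ++ (F.kids x).map fun u => (u, k)).getD i (0, 0)).1).length =
        (F.kids (q.getD i (0, 0)).1).length := fun i hi => by
      rw [gl i (by have := Finset.mem_range.1 hi; omega)]
    have := h.sum
    rw [hlen, Finset.sum_range_succ, gl k hkl, Finset.sum_congr rfl hs, ← hx]
    omega

theorem queueInv {k : ℕ} (hk : k ≤ nP) : QueueInv F k (F.queue k) := by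
  induction k with
  | zero => exact queueInv_zero
  | succ k ih => exact queueInv_succ (by omega) (ih (by omega))

theorem queue_prefix {k j : ℕ} (hkj : k ≤ j) : F.queue k <+: F.queue j := by
  induction j, hkj using Nat.le_induction with
  | base => exact List.prefix_rfl
  | succ j _ ih => exact ih.trans (List.prefix_append _ _)

theorem queue_getD {k i : ℕ} (hk : k ≤ nP) (hi : i < (F.queue k).length) :
    (F.queue nP).getD i (0, 0) = (F.queue k).getD i (0, 0) := by
  obtain ⟨l, hl⟩ := queue_prefix (F := F) hk
  rw [← hl, List.getD_append _ _ _ _ hi]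

theorem length_queue : (F.queue nP).length = nP :=
  le_antisymm (queueInv le_rfl).length_le (queueInv le_rfl).le

theorem node_mem {c : ℕ} (hc : c < nP) : F.InP (F.node c) :=
  (queueInv le_rfl).mem (by rwa [length_queue])

theorem node_inj {c c' : ℕ} (hc : c < nP) (hc' : c' < nP) (h : F.node c = F.node c') : c = c' :=
  (queueInv le_rfl).inj (by rwa [length_queue]) (by rwa [length_queue]) h

theorem exists_node {x : ℕ} (hx : F.InP x) : ∃ c < nP, F.node c = x := by
  obtain ⟨e, he, rfl⟩ := List.mem_map.1 ((queueInv (F := F) le_rfl).all_mem length_queue.le hx)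
  obtain ⟨i, hi, rfl⟩ := List.getElem_of_mem he
  exact ⟨i, by rwa [length_queue] at hi, by rw [node, List.getD_eq_getElem _ _ hi]⟩

theorem node_zero : F.node 0 = F.rP := by rw [node, (queueInv le_rfl).root]

theorem pre_lt {c : ℕ} (h1 : 1 ≤ c) (h2 : c < nP) : F.pre c < c :=
  ((queueInv le_rfl).pre_lt c h1 (by rwa [length_queue])).2.1

theorem par_node {c : ℕ} (h1 : 1 ≤ c) (h2 : c < nP) : F.par (F.node c) = F.node (F.pre c) :=
  ((queueInv le_rfl).pre_lt c h1 (by rwa [length_queue])).2.2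

/-- This is the reason for the breadth-first order: as the position runs through all words, the
position of the parent passes through the words only once, so the pair of words changes `O(W)`
times. -/
theorem pre_mono {c c' : ℕ} (h : c ≤ c') (h' : c' < nP) : F.pre c ≤ F.pre c' :=
  (queueInv le_rfl).mono c c' h (by rwa [length_queue])

theorem sum_kids_node : ∑ c ∈ Finset.range nP, (F.kids (F.node c)).length ≤ nP := by
  have := (queueInv (F := F) le_rfl).sum
  rw [length_queue] at this
  simp only [node]
  omega

end Forest

/-- Number the nodes of `P` breadth-first. -/
def bfsCmd : Cmd :=
  store 15 (lit 0) (var 4) ;;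
  store 16 (lit 0) (lit 0) ;;
  assign 17 (lit 1) ;;
  .for 20 1 (
    assign 22 (get 2 (get 15 (var 20))) ;;
    .forChain 22 3 (
      store 15 (var 17) (var 22) ;;
      store 16 (var 17) (var 20) ;;
      assign 17 (var 17 + lit 1)))

theorem queue_store {q : List (ℕ × ℕ)} {u k : ℕ} {f g : ℕ → ℕ}
    (h : ∀ i < q.length, f i = (q.getD i (0, 0)).1 ∧ g i = (q.getD i (0, 0)).2) :
    ∀ i < (q ++ [(u, k)]).length, (if i = q.length then u else f i) = ((q ++ [(u, k)]).getD i (0, 0)).1 ∧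
      (if i = q.length then k else g i) = ((q ++ [(u, k)]).getD i (0, 0)).2 := by
  intro i hi
  rw [List.length_append, List.length_singleton] at hi
  by_cases h' : i = q.length
  · rw [if_pos h', if_pos h', List.getD_append_right _ _ _ _ (by omega), h', Nat.sub_self]
    exact ⟨rfl, rfl⟩
  · rw [if_neg h', if_neg h', List.getD_append _ _ _ _ (by omega)]
    exact h i (by omega)

theorem wp_bfsCmd {nP nT : ℕ} {F : Forest nP nT} {E : Env} {s : HState} {Q : HState → ℕ → Prop}
    (hE : E.Good (nP + nT)) (h1 : s.var 1 = nP) (h4 : s.var 4 = F.rP)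
    (hkids : ∀ v, F.InP v → Chain (s.arr 3) (s.arr 2 v) (F.kids v))
    (hQ : ∀ s' t, Frame bfsCmd s s' → (∀ c < nP, s'.arr 15 c = F.node c ∧ s'.arr 16 c = F.pre c) →
      t ≤ 100 * (nP + nT) → Q s' t) : Wp E bfsCmd s Q := by
  have hZ := hE.Z
  have hK := hE.K
  have hB := hE.B
  have hN := hE.N
  suffices H : Wp E bfsCmd s fun s' t => (∀ c < nP, s'.arr 15 c = F.node c ∧ s'.arr 16 c = F.pre c) ∧
      t ≤ 100 * (nP + nT) from H.mono fun s' t hf h => hQ s' t hf h.1 h.2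
  simp only [bfsCmd, wp_seq, wp_store, wp_assign]
  simp only [Expr.eval_var, Expr.eval_lit, Expr.ok_var, Expr.ok_lit, h4, hK, hZ]
  refine ⟨by simp; omega, by simp; omega, by decide, ?_⟩
  generalize hs1 : HState.setVar _ _ _ = s1
  have g1 : s1.var 1 = nP := by rw [← hs1]; simpa using h1
  have g17 : s1.var 17 = 1 := by rw [← hs1]; simp
  have g15 : s1.arr 15 0 = F.rP := by rw [← hs1]; simp
  have g16 : s1.arr 16 0 = 0 := by rw [← hs1]; simp
  have g2 : s1.arr 2 = s.arr 2 := by rw [← hs1]; simp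
  have g3 : s1.arr 3 = s.arr 3 := by rw [← hs1]; simp
  clear hs1
  refine Wp.for (fun k s' => s'.var 17 = (F.queue k).length ∧ ∀ i < (F.queue k).length,
      s'.arr 15 i = ((F.queue k).getD i (0, 0)).1 ∧ s'.arr 16 i = ((F.queue k).getD i (0, 0)).2)
      (fun k => 40 * (F.kids (F.node k)).length + 20) (by decide) rfl rfl (by omega) ?_ ?_ ?_
  · refine ⟨by simpa [Forest.queue] using g17, fun i hi => ?_⟩
    have : i = 0 := by simpa [Forest.queue] using hi
    subst this
    exact ⟨g15, g16⟩
  · rintro k s' hk ⟨hI1, hI2⟩ hx hf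
    rw [g1] at hk
    have hq := Forest.queueInv (F := F) hk.le
    have hkl := hq.lt_length hk
    have hnode : F.node k = ((F.queue k).getD k (0, 0)).1 := by
      rw [Forest.node, Forest.queue_getD hk.le hkl]
    have hnP := Forest.node_mem (F := F) hk
    have e15 : s'.arr 15 k = F.node k := by rw [(hI2 k hkl).1, hnode]
    have e2 : s'.arr 2 = s.arr 2 := by rw [hf.arr 2 rfl, g2]
    have e3 : s'.arr 3 = s.arr 3 := by rw [hf.arr 3 rfl, g3]
    have hna := hnP.all
    simp only [wp_seq, wp_assign]
    simp only [Expr.eval_get, Expr.eval_var, Expr.ok_get, Expr.ok_var, hx, hK, hZ, e15]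
    refine ⟨by simp; omega, ?_⟩
    refine Wp.forChain (F.kids (F.node k)) (fun l s'' =>
        s''.var 17 = (F.queue k ++ l.map fun u => (u, k)).length ∧
        ∀ i < (F.queue k ++ l.map fun u => (u, k)).length,
          s''.arr 15 i = ((F.queue k ++ l.map fun u => (u, k)).getD i (0, 0)).1 ∧
          s''.arr 16 i = ((F.queue k ++ l.map fun u => (u, k)).getD i (0, 0)).2) (fun _ => 31) rfl
        (by simpa [e2, e3] using hkids _ hnP) (by omega) ?_ ?_ ?_ ?_
    · intro u hu
      have := (hnP.of_mem_kids hu).all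
      omega
    · simpa using ⟨hI1, hI2⟩
    · rintro l u post s'' hL ⟨hJ1, hJ2⟩ hu hf' hch
      have hle : (F.queue k ++ l.map fun u => (u, k)).length < nP := by
        have h1 := (Forest.queueInv (F := F) (k := k + 1) (by omega)).length_le
        rw [Forest.queue, ← hnode, hL] at h1
        simp at h1 ⊢
        omega
      have e20 : s''.var 20 = k := by rw [hf'.var 20 rfl]; simpa using hx
      have key := queue_store (u := u) (k := k) hJ2
      have eq : F.queue k ++ (l ++ [u]).map (fun u => (u, k)) =
          (F.queue k ++ l.map fun u => (u, k)) ++ [(u, k)] := by simp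
      simp only [wp_seq, wp_store, wp_assign]
      simp only [Expr.eval_var, Expr.ok_var, hu, HState.setArr_var, hJ1, e20, hK, hZ, Expr.eval_add,
        Expr.ok_add, Expr.eval_lit, Expr.ok_lit, eq]
      generalize F.queue k ++ l.map (fun u => (u, k)) = q at *
      refine ⟨by simp; omega, by simp; omega, ⟨trivial, by decide, by omega⟩, ?_, fun a => ⟨?_, ?_⟩, by simp⟩
      · simpa using hch
      · simp
      · intro i hi
        simpa using key i hi
    · rintro s'' t ⟨hJ1, hJ2⟩ _ hf' _ ht
      have hqs : F.queue (k + 1) = F.queue k ++ (F.kids (F.node k)).map fun u => (u, k) := by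
        rw [Forest.queue, hnode]
      rw [hqs]
      refine ⟨⟨by simpa using hJ1, fun i hi => by simpa using hJ2 i hi⟩, ?_⟩
      simp at ht ⊢
      omega
  · rintro s' t ⟨hI1, hI2⟩ _ hf ht
    rw [g1] at hI2 ht
    rw [Forest.length_queue] at hI2
    refine ⟨hI2, ?_⟩
    have := Forest.sum_kids_node (F := F)
    rw [Finset.sum_add_distrib, Finset.sum_add_distrib, ← Finset.mul_sum] at ht
    simp at ht ⊢
    omega

end TPS
/-! ### Tables for moving bits to the positions of the children -/

namespace TPS

open WordRAM
open TPS.Expr (var lit get inp)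
open TPS.Cmd (assign store emit skip ite)

/-- Select bits of `m`: from the lowest bit of the code, a `0` skips a bit of `m`, and a `1` copies
the current bit. -/
def sel : ℕ → ℕ → ℕ
  | 0, _ => 0
  | c + 1, m => if (c + 1) % 2 = 0 then sel ((c + 1) / 2) (m / 2) else m % 2 + 2 * sel ((c + 1) / 2) m
decreasing_by all_goals omega

theorem sel_zero (m : ℕ) : sel 0 m = 0 := by rw [sel]

theorem sel_even {c : ℕ} (h : c % 2 = 0) (m : ℕ) : sel c m = sel (c / 2) (m / 2) := by
  cases c with
  | zero => rw [Nat.zero_div, sel_zero, sel_zero]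
  | succ c => rw [sel, if_pos h]

theorem sel_odd {c : ℕ} (h : c % 2 ≠ 0) (m : ℕ) : sel c m = m % 2 + 2 * sel (c / 2) m := by
  cases c with
  | zero => simp at h
  | succ c => rw [sel, if_neg h]

/-- A bound on the code thus also bounds the selected bits; this excludes overflow when they are
shifted. -/
theorem sel_le (c m : ℕ) : sel c m ≤ c := by
  induction c using Nat.strongRecOn generalizing m with
  | ind c ih =>
    by_cases h : c % 2 = 0
    · rw [sel_even h]
      rcases Nat.eq_zero_or_pos c with rfl | hc
      · rw [Nat.zero_div, sel_zero]
      · have := ih (c / 2) (by omega) (m / 2)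
        omega
    · rw [sel_odd h]
      have := ih (c / 2) (by omega) m
      omega

theorem sel_pow_mul (b c m : ℕ) : sel (2 ^ b * c) m = sel c (m / 2 ^ b) := by
  induction b generalizing m with
  | zero => simp
  | succ b ih =>
    have h1 : 2 ^ (b + 1) * c = 2 * (2 ^ b * c) := by ring
    rw [h1, sel_even (by omega), Nat.mul_div_cancel_left _ (by norm_num), ih, Nat.div_div_eq_div_mul,
      pow_succ, mul_comm 2]

/-- Divisibility says that the code `c` begins by skipping `b` bits. The new code skips `b` bits,
copies bit `b`, and continues like `c`. So a source bit can be prepended if it does not exceed the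
sources already encoded. -/
theorem sel_step {b c : ℕ} (h : 2 ^ b ∣ c) (m : ℕ) :
    sel (2 * c + 2 ^ b) m = m / 2 ^ b % 2 + 2 * sel c m := by
  obtain ⟨a, rfl⟩ := h
  have h1 : 2 * (2 ^ b * a) + 2 ^ b = 2 ^ b * (2 * a + 1) := by ring
  rw [h1, sel_pow_mul, sel_pow_mul, sel_odd (by omega), show (2 * a + 1) / 2 = a by omega]

theorem testBit_step (m b x p i : ℕ) :
    ((m / 2 ^ b % 2 + 2 * x) <<< p).testBit i = true ↔
      (i = p ∧ m.testBit b = true) ∨ (x <<< (p + 1)).testBit i = true := by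
  rw [Nat.testBit_shiftLeft, Nat.testBit_shiftLeft]
  rcases lt_trichotomy i p with h | rfl | h
  · simp [show ¬ p ≤ i by omega, show ¬ p + 1 ≤ i by omega]
    omega
  · simp [Nat.testBit_eq_decide_div_mod_eq, Nat.add_mul_mod_self_left]
  · obtain ⟨k, rfl⟩ : ∃ k, i = p + 1 + k := ⟨i - p - 1, by omega⟩
    have h1 : p + 1 + k - p = k + 1 := by omega
    have h2 : (m / 2 ^ b % 2 + 2 * x) / 2 = x := by omega
    have h3 : p + 1 + k - (p + 1) = k := by omega
    rw [h1, Nat.testBit_succ, h2, h3]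
    simp [show p + 1 + k ≠ p by omega, show p ≤ p + 1 + k by omega]

/-- Tabulate `sel c m` for codes `c < 4 ^ s` and words `m < 2 ^ s`. -/
def tableCmd : Cmd :=
  assign 19 (.bin .shl (lit 1) (var 8 + var 8 + var 8)) ;;
  .for 20 19 (
    assign 21 (.bin .shr (var 20) (var 8)) ;;
    assign 22 (var 20 - .bin .shl (var 21) (var 8)) ;;
    assign 23 (.bin .shr (var 21) (lit 1)) ;;
    ite (.eq (var 21 - var 23 - var 23) (lit 0))
      (store 23 (var 20) (get 23 (.bin .shl (var 23) (var 8) + .bin .shr (var 22) (lit 1))))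
      (store 23 (var 20) (.bin .and (var 22) (lit 1) +
        lit 2 * get 23 (.bin .shl (var 23) (var 8) + var 22))))

/-- The entry for `c` and `m` depends on one with code `c / 2`, which comes earlier in the table.
There are `4 ^ s * 2 ^ s = 8 ^ s ≤ n` entries. -/
theorem wp_tableCmd {E : Env} {N n s : ℕ} {st : HState} {Q : HState → ℕ → Prop} (hE : E.Good N)
    (h8 : st.var 8 = s) (hs : 8 ^ s ≤ n) (hn : n ≤ N) (h0 : st.arr 23 0 = 0)
    (hQ : ∀ s' t, Frame tableCmd st s' →
      (∀ c m, c < 4 ^ s → m < 2 ^ s → s'.arr 23 (c * 2 ^ s + m) = sel c m) →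
      t ≤ 100 * N → Q s' t) : Wp E tableCmd st Q := by
  have hZ := hE.Z
  have hK := hE.K
  have hB := hE.B
  have hN := hE.N
  have h83 : 2 ^ (s + s + s) = 8 ^ s := by
    rw [show s + s + s = 3 * s by ring, pow_mul]; norm_num
  have hss : s < 2 ^ s := Nat.lt_two_pow_self
  have hs8 : 2 ^ s ≤ 8 ^ s := Nat.pow_le_pow_left (by norm_num) s
  suffices H : Wp E tableCmd st fun s' t => (∀ c m, c < 4 ^ s → m < 2 ^ s →
      s'.arr 23 (c * 2 ^ s + m) = sel c m) ∧ t ≤ 100 * N from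
    H.mono fun s' t hf h => hQ s' t hf h.1 h.2
  have hpos : 0 < 2 ^ s := by positivity
  simp only [tableCmd, wp_seq, wp_assign]
  simp only [Expr.eval_shl, Expr.ok_shl, Expr.eval_lit, Expr.ok_lit, Expr.eval_add, Expr.ok_add,
    Expr.eval_var, Expr.ok_var, h8, Nat.shiftLeft_eq, one_mul, h83]
  refine ⟨⟨by decide, by simp; omega, by omega⟩, ?_⟩
  -- Entry `0` is computed from itself. It is correct from the start because the array is zero,
  -- hence the second alternative.
  refine Wp.for (fun idx s' => ∀ i, i < idx ∨ i = 0 → s'.arr 23 i = sel (i / 2 ^ s) (i % 2 ^ s))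
    (fun _ => 50) (by decide) rfl rfl (by simp; omega) ?_ ?_ ?_
  · rintro i hi
    have : i = 0 := by omega
    subst this
    simpa [sel_zero] using h0
  · intro idx s' hidx hI hx hf
    have hidx : idx < 8 ^ s := by simpa using hidx
    have h8' : s'.var 8 = s := by rw [hf.var 8 rfl]; simpa using h8
    have hdm := Nat.div_add_mod idx (2 ^ s)
    have hml := Nat.mod_lt idx hpos
    set c := idx / 2 ^ s with hc
    set m := idx % 2 ^ s with hm
    have hXc : 2 ^ s * c = c * 2 ^ s := mul_comm _ _
    have hX : c * 2 ^ s = 2 * (c / 2 * 2 ^ s) + c % 2 * 2 ^ s := by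
      conv_lhs => rw [← Nat.div_add_mod c 2]
      ring
    have hsub : idx - c * 2 ^ s = m := by omega
    have hread : ∀ c1 m1, m1 < 2 ^ s → (c1 * 2 ^ s + m1 < idx ∨ c1 * 2 ^ s + m1 = 0) →
        s'.arr 23 (c1 * 2 ^ s + m1) = sel c1 m1 := by
      intro c1 m1 h1 h2
      rw [hI _ h2, mul_comm, Nat.mul_add_div hpos, Nat.div_eq_of_lt h1, Nat.mul_add_mod,
        Nat.mod_eq_of_lt h1, add_zero]
    have hlast : ∀ a, a = sel c m → ∀ i, i < idx + 1 ∨ i = 0 →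
        (if i = idx then a else s'.arr 23 i) = sel (i / 2 ^ s) (i % 2 ^ s) := by
      intro a ha i hi
      by_cases h : i = idx
      · rw [if_pos h, h, ha]
      · rw [if_neg h]
        exact hI i (by omega)
    have hle : c / 2 ≤ c := Nat.div_le_self _ _
    have hcs : c ≤ c * 2 ^ s := Nat.le_mul_of_pos_right _ hpos
    have hsc := sel_le c m
    simp only [wp_ite, wp_seq, wp_assign, wp_store]
    simp only [Expr.eval_shl, Expr.ok_shl, Expr.eval_shr, Expr.ok_shr, Expr.eval_lit, Expr.ok_lit,
      Expr.eval_add, Expr.ok_add, Expr.eval_sub, Expr.ok_sub, Expr.eval_var, Expr.ok_var, Expr.eval_and,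
      Expr.ok_and, Expr.eval_mul, Expr.ok_mul, Expr.eval_get, Expr.ok_get,
      Nat.shiftLeft_eq, Nat.shiftRight_eq_div_pow, HState.setVar_var, HState.setVar_arr,
      HState.setArr_arr, Test.ok_eq, Test.holds_eq, Nat.and_one_is_mod, pow_one,
      hx, h8', hZ, hK, reduceIte, show ¬ (8 = 21) by decide, show ¬ (8 = 22) by decide,
      show ¬ (8 = 23) by decide, show ¬ (20 = 21) by decide, show ¬ (20 = 22) by decide,
      show ¬ (20 = 23) by decide, show ¬ (21 = 22) by decide, show ¬ (21 = 23) by decide,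
      show ¬ (22 = 23) by decide, ← hc, hsub]
    have h2 : c - c / 2 - c / 2 = c % 2 := by omega
    rw [h2]
    have key : ∀ P : Prop, (c % 2 = 0 → P) → (c % 2 = 1 → P) → P := fun P h1 h2 =>
      (Nat.mod_two_eq_zero_or_one c).elim h1 h2
    refine ⟨by simp, ⟨by simp; omega, ?_⟩⟩
    refine ⟨by simp, ⟨⟨⟨⟨trivial, trivial, hle⟩, trivial, by omega⟩, by decide⟩, fun hev => ?_, fun hod => ?_⟩⟩
    · rw [hev, zero_mul] at hX
      have hr := hread (c / 2) (m / 2) (by omega) (by omega)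
      rw [hr, ← sel_even hev]
      refine ⟨by simp; omega, fun i hi => ?_, by simp⟩
      simpa using hlast _ rfl i hi
    · have hod' : c % 2 = 1 := by omega
      rw [hod', one_mul] at hX
      have hr := hread (c / 2) m hml (by omega)
      rw [hr]
      have hso := sel_odd hod m
      refine ⟨by simp; omega, fun i hi => ?_, by simp⟩
      simpa using hlast _ hso.symm i hi
  · intro s' t hI _ hf ht
    have e : ∀ st : HState, (st.setVar 19 (8 ^ s)).var 19 = 8 ^ s := by simp
    rw [e] at hI ht
    refine ⟨fun c m hc hm => ?_, ?_⟩
    · have h1 : c * 2 ^ s + m < 8 ^ s := by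
        have h2 : 4 ^ s * 2 ^ s = 8 ^ s := by rw [← mul_pow]; norm_num
        have : (c + 1) * 2 ^ s ≤ 4 ^ s * 2 ^ s := Nat.mul_le_mul_right _ hc
        rw [add_mul] at this
        omega
      rw [hI _ (.inl h1), mul_comm, Nat.mul_add_div hpos, Nat.div_eq_of_lt hm, Nat.mul_add_mod,
        Nat.mod_eq_of_lt hm, add_zero]
    · simp at ht ⊢
      omega

/-- The first `n` pieces describe how the bits for the positions `c, …, nP - 1` arise from the
bits of their parents. -/
structure Pieces {nP nT : ℕ} (F : Forest nP nT) (s W c n : ℕ) (pj pk pc ps : ℕ → ℕ) : Prop where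
  sem : ∀ (M : ℕ → ℕ) (j i : ℕ),
    (∃ e < n, pj e = j ∧ (sel (pc e) (M (pk e)) <<< ps e).testBit i = true) ↔
      i < s ∧ c ≤ j * s + i ∧ j * s + i < nP ∧
        (M (F.pre (j * s + i) / s)).testBit (F.pre (j * s + i) % s) = true
  bound : ∀ e < n, pj e < W ∧ pk e < W ∧ pc e * 2 ^ ps e < 4 ^ s

/-- The last piece belongs to position `c`, and can be extended. -/
structure LastPiece {nP nT : ℕ} (F : Forest nP nT) (s W c n lj lk code : ℕ) (pj pk pc ps : ℕ → ℕ) :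
    Prop where
  pos : 1 ≤ n
  lj_eq : lj = c / s
  lk_eq : lk = F.pre c / s
  pj_eq : pj (n - 1) = lj
  pk_eq : pk (n - 1) = lk
  pc_eq : pc (n - 1) = code
  ps_eq : ps (n - 1) = c % s
  dvd : 2 ^ (F.pre c % s) ∣ code
  -- Each of the at most `s - c % s` copied bits doubles the code and adds at most `2 ^ (s - 1)`.
  code_le : code + 2 ^ (s - 1) ≤ 2 ^ (s - 1) * 2 ^ (s - c % s)
  -- A potential: a new piece is started only when `c / s` or `F.pre c / s` drops. Both are below
  -- `W`, so there are at most `2 * W` pieces.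
  count : n + c / s + F.pre c / s + 1 ≤ 2 * W

def upd (f : ℕ → ℕ) (i a : ℕ) : ℕ → ℕ := fun j => if j = i then a else f j

/-! ### Adding positions to the pieces, from the last position downwards -/

section Pieces

variable {nP nT : ℕ} {F : Forest nP nT} {s W c n lj lk code : ℕ} {pj pk pc ps : ℕ → ℕ}

theorem exists_upd {m j i : ℕ} (hm : m + 1 = n) {a b d r : ℕ} (M : ℕ → ℕ) :
    (∃ e < n, upd pj m a e = j ∧
      (sel (upd pc m d e) (M (upd pk m b e)) <<< upd ps m r e).testBit i = true) ↔
    (∃ e < m, pj e = j ∧ (sel (pc e) (M (pk e)) <<< ps e).testBit i = true) ∨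
      (a = j ∧ (sel d (M b) <<< r).testBit i = true) := by
  constructor
  · rintro ⟨e, he, h1, h2⟩
    simp only [upd] at h1 h2
    split_ifs at h1 h2 with h
    · exact .inr ⟨h1, h2⟩
    · exact .inl ⟨e, by omega, h1, h2⟩
  · rintro (⟨e, he, h1, h2⟩ | ⟨h1, h2⟩)
    · refine ⟨e, by omega, ?_⟩
      simp only [upd, if_neg (show e ≠ m by omega)]
      exact ⟨h1, h2⟩
    · refine ⟨m, by omega, ?_⟩
      simp only [upd, if_true]
      exact ⟨h1, h2⟩

theorem or_and_extend {p a b d e : Prop} :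
    p ∨ (a ∧ ((b ∧ d) ∨ e)) ↔ (a ∧ b ∧ d) ∨ (p ∨ (a ∧ e)) := by tauto

theorem exists_lt_succ {m j i : ℕ} (hm : m + 1 = n) (M : ℕ → ℕ) :
    (∃ e < n, pj e = j ∧ (sel (pc e) (M (pk e)) <<< ps e).testBit i = true) ↔
    (∃ e < m, pj e = j ∧ (sel (pc e) (M (pk e)) <<< ps e).testBit i = true) ∨
      (pj m = j ∧ (sel (pc m) (M (pk m)) <<< ps m).testBit i = true) := by
  constructor
  · rintro ⟨e, he, h⟩
    rcases Nat.lt_or_ge e m with h' | h'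
    · exact .inl ⟨e, h', h⟩
    · have : e = m := by omega
      subst this
      exact .inr h
  · rintro (⟨e, he, h⟩ | h)
    · exact ⟨e, by omega, h⟩
    · exact ⟨m, by omega, h⟩

theorem sem_step (hs : 0 < s) (hc : c < nP) (M : ℕ → ℕ) (j i : ℕ) :
    (i < s ∧ c ≤ j * s + i ∧ j * s + i < nP ∧
        (M (F.pre (j * s + i) / s)).testBit (F.pre (j * s + i) % s) = true) ↔
    (c / s = j ∧ i = c % s ∧ (M (F.pre c / s)).testBit (F.pre c % s) = true) ∨
    (i < s ∧ c + 1 ≤ j * s + i ∧ j * s + i < nP ∧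
        (M (F.pre (j * s + i) / s)).testBit (F.pre (j * s + i) % s) = true) := by
  have h1 := Nat.div_add_mod c s
  rw [mul_comm] at h1
  have h2 := Nat.mod_lt c hs
  constructor
  · rintro ⟨h3, h4, h5, h6⟩
    rcases Nat.eq_or_lt_of_le h4 with h | h
    · left
      have h7 : c / s = j ∧ c % s = i := by
        rw [Nat.div_mod_unique hs, mul_comm]
        exact ⟨by omega, h3⟩
      rw [← h] at h6
      exact ⟨h7.1, h7.2.symm, h6⟩
    · exact .inr ⟨h3, h, h5, h6⟩
  · rintro (⟨rfl, rfl, h⟩ | ⟨h3, h4, h5, h6⟩)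
    · rw [h1]
      exact ⟨h2, le_rfl, hc, h⟩
    · exact ⟨h3, by omega, h5, h6⟩

/-- The bound concerns the shifted code. It therefore covers the table index as well as, by
`sel_le`, the selected bits after their shift. -/
theorem code_bound {ps' : ℕ} (hs : 0 < s) (hps : ps' < s)
    (h : code + 2 ^ (s - 1) ≤ 2 ^ (s - 1) * 2 ^ (s - ps')) : code * 2 ^ ps' < 4 ^ s := by
  have h1 : 2 ^ (s - ps') * 2 ^ ps' = 2 ^ s := by rw [← pow_add]; congr 1; omega
  have h2 : 2 ^ s = 2 * 2 ^ (s - 1) := by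
    rw [← pow_succ']; congr 1; omega
  have h3 : (4 : ℕ) ^ s = 2 ^ s * 2 ^ s := by rw [← mul_pow]; norm_num
  have h4 := Nat.mul_le_mul_right (2 ^ ps') h
  rw [mul_assoc, h1, add_mul] at h4
  have h5 : 0 < 2 ^ (s - 1) * 2 ^ ps' := by positivity
  have h6 : 2 ^ s * 2 ^ s = 2 * (2 ^ (s - 1) * 2 ^ s) := by
    nth_rw 1 [h2]; ring
  rw [h3, h6]
  omega

theorem code_step {b p : ℕ} (hb : b < s) (hp : p + 1 ≤ s)
    (h : code + 2 ^ (s - 1) ≤ 2 ^ (s - 1) * 2 ^ (s - (p + 1))) :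
    2 * code + 2 ^ b + 2 ^ (s - 1) ≤ 2 ^ (s - 1) * 2 ^ (s - p) := by
  have h1 : (2 : ℕ) ^ b ≤ 2 ^ (s - 1) := Nat.pow_le_pow_right (by norm_num) (by omega)
  have h2 : 2 ^ (s - p) = 2 * 2 ^ (s - (p + 1)) := by
    rw [← pow_succ']; congr 1; omega
  rw [h2, mul_left_comm]
  omega

/-- Start a new piece. -/
theorem pieces_new (hs : 0 < s) (hc1 : 1 ≤ c) (hc : c < nP) (hW : W = nP / s + 1)
    (h : Pieces F s W (c + 1) n pj pk pc ps)
    (hl : c + 1 < nP → LastPiece F s W (c + 1) n lj lk code pj pk pc ps)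
    (h0 : c + 1 = nP → n = 0) (hne : c + 1 < nP → ¬ (lj = c / s ∧ lk = F.pre c / s)) :
    Pieces F s W c (n + 1) (upd pj n (c / s)) (upd pk n (F.pre c / s)) (upd pc n (2 ^ (F.pre c % s)))
      (upd ps n (c % s)) ∧
    LastPiece F s W c (n + 1) (c / s) (F.pre c / s) (2 ^ (F.pre c % s)) (upd pj n (c / s))
      (upd pk n (F.pre c / s)) (upd pc n (2 ^ (F.pre c % s))) (upd ps n (c % s)) := by
  have hb := Nat.mod_lt (F.pre c) hs
  have hp := Nat.mod_lt c hs
  have hcode : 2 ^ (F.pre c % s) + 2 ^ (s - 1) ≤ 2 ^ (s - 1) * 2 ^ (s - c % s) := by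
    have h1 : (2 : ℕ) ^ (F.pre c % s) ≤ 2 ^ (s - 1) := Nat.pow_le_pow_right (by norm_num) (by omega)
    have h2 : (2 : ℕ) ^ 1 ≤ 2 ^ (s - c % s) := Nat.pow_le_pow_right (by norm_num) (by omega)
    have h3 := Nat.mul_le_mul_left (2 ^ (s - 1)) h2
    omega
  have hcW : c / s < W := by
    have := Nat.div_le_div_right (c := s) hc.le
    omega
  have hpre := Forest.pre_lt (F := F) hc1 hc
  have hkW : F.pre c / s < W := by
    have := Nat.div_le_div_right (c := s) (hpre.trans hc).le
    omega
  refine ⟨⟨fun M j i => ?_, fun e he => ?_⟩, ⟨by omega, rfl, rfl, ?_, ?_, ?_, ?_, dvd_rfl, hcode, ?_⟩⟩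
  · rw [exists_upd rfl, h.sem, sem_step hs hc, or_comm]
    refine or_congr_left (and_congr_right fun _ => ?_)
    have h1 := sel_step (b := F.pre c % s) (dvd_zero _) (M (F.pre c / s))
    rw [mul_zero, zero_add] at h1
    rw [h1, testBit_step, sel_zero]
    simp
  · simp only [upd]
    split_ifs with h1
    · exact ⟨hcW, hkW, code_bound hs hp hcode⟩
    · exact h.bound e (by omega)
  any_goals simp [upd]
  -- Both quotients are monotone and the pair differs from that of the last piece, so their sum
  -- drops by at least one and pays for the new piece.
  by_cases hcn : c + 1 < nP
  · have hl' := hl hcn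
    have h1 := hl'.count
    have h2 := hl'.lj_eq
    have h3 := hl'.lk_eq
    have h4 : c / s ≤ (c + 1) / s := Nat.div_le_div_right (by omega)
    have h5 : F.pre c / s ≤ F.pre (c + 1) / s := Nat.div_le_div_right (Forest.pre_mono (by omega) hcn)
    have h6 := hne hcn
    omega
  · have := h0 (by omega)
    omega

/-- Extend the last piece. -/
theorem pieces_extend (hs : 0 < s) (hc : c + 1 < nP)
    (h : Pieces F s W (c + 1) n pj pk pc ps)
    (hl : LastPiece F s W (c + 1) n lj lk code pj pk pc ps)
    (hj : lj = c / s) (hk : lk = F.pre c / s) :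
    Pieces F s W c n (upd pj (n - 1) (c / s)) (upd pk (n - 1) (F.pre c / s))
      (upd pc (n - 1) (2 * code + 2 ^ (F.pre c % s))) (upd ps (n - 1) (c % s)) ∧
    LastPiece F s W c n (c / s) (F.pre c / s) (2 * code + 2 ^ (F.pre c % s)) (upd pj (n - 1) (c / s))
      (upd pk (n - 1) (F.pre c / s)) (upd pc (n - 1) (2 * code + 2 ^ (F.pre c % s)))
      (upd ps (n - 1) (c % s)) := by
  have hb := Nat.mod_lt (F.pre c) hs
  have hp := Nat.mod_lt c hs
  have hp' := Nat.mod_lt (c + 1) hs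
  have hn := hl.pos
  -- The positions `c` and `c + 1` lie in the same word, because the last piece belongs to the word
  -- of `c`.
  have hps : (c + 1) % s = c % s + 1 := by
    by_contra hne
    have h1 : c % s + 1 = s := by
      by_contra h'
      exact hne (div_mod_succ_of_ne h').2
    have h2 := (div_mod_succ_of_eq h1).1
    have h3 := hl.lj_eq
    omega
  -- Within one word of parents, monotone positions give monotone bit indices; this is the
  -- divisibility that `sel_step` needs.
  have hbb : F.pre c % s ≤ F.pre (c + 1) % s := by
    have h1 := Forest.pre_mono (F := F) (c := c) (c' := c + 1) (by omega) hc
    have h2 := Nat.div_add_mod (F.pre c) s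
    have h3 := Nat.div_add_mod (F.pre (c + 1)) s
    have h4 := hl.lk_eq
    rw [← h4, hk] at h3
    omega
  have hdvd : 2 ^ (F.pre c % s) ∣ code := (pow_dvd_pow 2 hbb).trans hl.dvd
  have hcode : 2 * code + 2 ^ (F.pre c % s) + 2 ^ (s - 1) ≤ 2 ^ (s - 1) * 2 ^ (s - c % s) := by
    refine code_step hb (by omega) ?_
    rw [← hps]
    exact hl.code_le
  have hbd := h.bound (n - 1) (by omega)
  rw [hl.pj_eq, hl.pk_eq, hj, hk] at hbd
  refine ⟨⟨fun M j i => ?_, fun e he => ?_⟩, ⟨hn, rfl, rfl, ?_, ?_, ?_, ?_, ?_, hcode, ?_⟩⟩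
  · rw [exists_upd (Nat.sub_add_cancel hn), sem_step hs (by omega), ← h.sem,
      exists_lt_succ (Nat.sub_add_cancel hn), hl.pj_eq, hl.pk_eq, hl.pc_eq, hl.ps_eq, hj, hk, hps,
      sel_step hdvd, testBit_step]
    exact or_and_extend
  · simp only [upd]
    split_ifs with h1
    · exact ⟨hbd.1, hbd.2.1, code_bound hs hp hcode⟩
    · exact h.bound e (by omega)
  any_goals simp [upd]
  · exact hdvd.mul_left 2
  · have h1 := hl.count
    have h2 := hl.lj_eq
    have h3 := hl.lk_eq
    omega

end Pieces

end TPS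
/-! ### Building the pieces and the entries of the classes -/

namespace TPS

open WordRAM
open TPS.Expr (var lit get inp)
open TPS.Cmd (assign store emit skip ite)

/-- The second half of an iteration of `pieceCmd`. -/
def storePieceCmd : Cmd :=
  assign 17 (var 17 + var 17 + .bin .shl (lit 1) (get 18 (var 22))) ;;
  store 19 (var 14 - lit 1) (var 23) ;;
  store 20 (var 14 - lit 1) (var 24) ;;
  store 21 (var 14 - lit 1) (var 17) ;;
  store 22 (var 14 - lit 1) (get 18 (var 21))

/-- Descending order allows each source bit to be prepended to the code. Variable `14` counts the
pieces, variables `15` and `16` are the word pair of the last piece, and variable `17` is its code.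
The initial value `W` of variable `15` is no word index in use and so forces the first piece.
Position `0` is the root and has no source. -/
def pieceCmd : Cmd :=
  assign 14 (lit 0) ;;
  assign 15 (var 9) ;;
  assign 16 (lit 0) ;;
  assign 17 (lit 0) ;;
  assign 18 (var 1 - lit 1) ;;
  .for 20 18 (
    assign 21 (var 18 - var 20) ;;
    assign 22 (get 16 (var 21)) ;;
    assign 23 (get 17 (var 21)) ;;
    assign 24 (get 17 (var 22)) ;;
    ite (.eq (.bin .or (.bin .xor (var 15) (var 23)) (.bin .xor (var 16) (var 24))) (lit 0)) skip
      (assign 14 (var 14 + lit 1) ;;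
       assign 15 (var 23) ;;
       assign 16 (var 24) ;;
       assign 17 (lit 0)) ;;
    storePieceCmd)

theorem LastPiece.lt {nP nT : ℕ} {F : Forest nP nT} {s W c n lj lk code : ℕ} {pj pk pc ps : ℕ → ℕ}
    (h : LastPiece F s W c n lj lk code pj pk pc ps) : n + 1 ≤ 2 * W := by
  have h1 := h.count
  generalize c / s = x at h1
  generalize F.pre c / s = y at h1
  omega

theorem wp_storePieceCmd {E : Env} {N n c p j k a b r : ℕ} {s : HState} {Q : HState → ℕ → Prop}
    (hE : E.Good N) (h14 : s.var 14 = n) (h17 : s.var 17 = a) (h21 : s.var 21 = c) (h22 : s.var 22 = p)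
    (h23 : s.var 23 = j) (h24 : s.var 24 = k) (hb : s.arr 18 p = b) (hr : s.arr 18 c = r)
    (hn : 1 ≤ n) (hn' : n ≤ 4 * N) (hc : c < 4 * N) (hp : p < 4 * N) (hB : 2 * a + 2 ^ b < E.B)
    (hQ : ∀ s' t, Frame storePieceCmd s s' → s'.var 17 = 2 * a + 2 ^ b →
      s'.arr 19 = upd (s.arr 19) (n - 1) j → s'.arr 20 = upd (s.arr 20) (n - 1) k →
      s'.arr 21 = upd (s.arr 21) (n - 1) (2 * a + 2 ^ b) → s'.arr 22 = upd (s.arr 22) (n - 1) r →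
      t ≤ 80 → Q s' t) : Wp E storePieceCmd s Q := by
  have hZ := hE.Z
  have hK := hE.K
  have hB' := hE.B
  have hN := hE.N
  suffices H : Wp E storePieceCmd s fun s' t => (s'.var 17 = 2 * a + 2 ^ b ∧
      s'.arr 19 = upd (s.arr 19) (n - 1) j ∧ s'.arr 20 = upd (s.arr 20) (n - 1) k ∧
      s'.arr 21 = upd (s.arr 21) (n - 1) (2 * a + 2 ^ b) ∧ s'.arr 22 = upd (s.arr 22) (n - 1) r) ∧
      t ≤ 80 from H.mono fun s' t hf h => hQ s' t hf h.1.1 h.1.2.1 h.1.2.2.1 h.1.2.2.2.1 h.1.2.2.2.2 h.2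
  have h2a : a + a = 2 * a := by omega
  simp only [storePieceCmd, wp_seq, wp_assign, wp_store]
  simp [h14, h17, h21, h22, h23, h24, hZ, hK, hb, hr, Nat.shiftLeft_eq, h2a, hc, hp, hB, hn]
  refine ⟨⟨Nat.lt_of_le_of_lt (Nat.le_add_right _ _) hB, Nat.lt_of_le_of_lt (Nat.le_add_left _ _) hB⟩, by omega, ?_, ?_, ?_, ?_⟩
  all_goals
    funext i
    simp [upd]

theorem wp_pieceCmd {nP nT sz W : ℕ} {F : Forest nP nT} {E : Env} {s : HState} {Q : HState → ℕ → Prop}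
    (hE : E.Good (nP + nT)) (h1 : s.var 1 = nP) (hsz : 0 < sz) (hpow : 8 ^ sz ≤ nT)
    (hW : W = nP / sz + 1) (h9 : s.var 9 = W)
    (hpre : ∀ c < nP, s.arr 16 c = F.pre c) (hdiv : ∀ c < nP, s.arr 17 c = c / sz)
    (hmod : ∀ c < nP, s.arr 18 c = c % sz)
    (hQ : ∀ s' t n, Frame pieceCmd s s' → s'.var 14 = n → n ≤ 2 * W →
      Pieces F sz W 1 n (s'.arr 19) (s'.arr 20) (s'.arr 21) (s'.arr 22) →
      t ≤ 300 * (nP + nT) → Q s' t) : Wp E pieceCmd s Q := by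
  have hZ := hE.Z
  have hK := hE.K
  have hB := hE.B
  have hN := hE.N
  have hP1 : 1 ≤ nP := F.rP_mem.1.trans F.rP_mem.2
  have hWle : W ≤ nP + 1 := by have := Nat.div_le_self nP sz; omega
  suffices H : Wp E pieceCmd s fun s' t => (s'.var 14 ≤ 2 * W ∧
      Pieces F sz W 1 (s'.var 14) (s'.arr 19) (s'.arr 20) (s'.arr 21) (s'.arr 22)) ∧
      t ≤ 300 * (nP + nT) from H.mono fun s' t hf h => hQ s' t _ hf rfl h.1.1 h.1.2 h.2
  simp only [pieceCmd, wp_seq, wp_assign]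
  simp only [Expr.eval_var, Expr.eval_lit, Expr.ok_var, Expr.ok_lit, Expr.ok_sub, Expr.eval_sub,
    HState.setVar_var, h1]
  refine ⟨by decide, trivial, by decide, by decide, by simp; omega, ?_⟩
  generalize hs1 : HState.setVar _ 18 _ = s1
  have g18 : s1.var 18 = nP - 1 := by rw [← hs1]; simp
  have g14 : s1.var 14 = 0 := by rw [← hs1]; simp
  have g15 : s1.var 15 = W := by rw [← hs1]; simp [h9]
  have garr : s1.arr = s.arr := by rw [← hs1]; simp
  clear hs1
  refine Wp.for (fun i s' =>
      Pieces F sz W (nP - i) (s'.var 14) (s'.arr 19) (s'.arr 20) (s'.arr 21) (s'.arr 22) ∧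
      (i = 0 → s'.var 14 = 0 ∧ s'.var 15 = W) ∧
      (0 < i → LastPiece F sz W (nP - i) (s'.var 14) (s'.var 15) (s'.var 16) (s'.var 17)
        (s'.arr 19) (s'.arr 20) (s'.arr 21) (s'.arr 22)))
      (fun _ => 160) (by decide) rfl rfl (by omega) ?_ ?_ ?_
  · refine ⟨⟨fun M j i => ?_, fun e he => ?_⟩, fun _ => ?_, by omega⟩
    · simp [g14]
      omega
    · simp [g14] at he
    · simpa using ⟨g14, g15⟩
  · rintro i s' hi ⟨hI1, hI2, hI3⟩ hx hf
    rw [g18] at hi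
    set c := nP - 1 - i with hcd
    have hc1 : 1 ≤ c := by omega
    have hc : c < nP := by omega
    have hci : nP - i = c + 1 := by omega
    have hci' : nP - (i + 1) = c := by omega
    rw [hci] at hI1 hI3
    have hpc := Forest.pre_lt (F := F) hc1 hc
    have e18 : s'.var 18 = nP - 1 := by rw [hf.var 18 rfl, g18]
    have a16 : s'.arr 16 c = F.pre c := by rw [hf.arr 16 rfl, garr, hpre c hc]
    have a17 : ∀ c < nP, s'.arr 17 c = c / sz := by rw [hf.arr 17 rfl, garr]; exact hdiv
    have a18 : ∀ c < nP, s'.arr 18 c = c % sz := by rw [hf.arr 18 rfl, garr]; exact hmod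
    have hcW : c / sz < W := by
      have := Nat.div_le_div_right (c := sz) hc.le
      omega
    have hb := Nat.mod_lt (F.pre c) hsz
    have hsz8 : 2 ^ sz * 4 ^ sz ≤ nT := by rwa [← mul_pow]
    have h2b : 2 ^ (F.pre c % sz) ≤ 2 ^ sz := Nat.pow_le_pow_right (by norm_num) hb.le
    have h4 : 1 ≤ 4 ^ sz := Nat.one_le_pow _ _ (by norm_num)
    have h2 : 1 ≤ 2 ^ sz := Nat.one_le_pow _ _ (by norm_num)
    have hm1 : 4 ^ sz ≤ nT := (Nat.le_mul_of_pos_left _ h2).trans hsz8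
    have hm2 : 2 ^ sz ≤ nT := (Nat.le_mul_of_pos_right _ h4).trans hsz8
    have hlast : i ≠ 0 → c + 1 < nP := by omega
    have hn2 : s'.var 14 + 1 ≤ 4 * (nP + nT) := by
      by_cases h0 : i = 0
      · rw [(hI2 h0).1]; omega
      · have := (hI3 (by omega)).lt
        omega
    simp only [wp_seq, wp_assign, wp_ite, wp_skip]
    simp only [Expr.eval_var, Expr.ok_var, Expr.ok_sub, Expr.eval_sub, Expr.eval_get, Expr.ok_get,
      Expr.eval_or, Expr.ok_or, Expr.eval_xor, Expr.ok_xor, Expr.eval_lit, Expr.ok_lit, Test.ok_eq,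
      Test.holds_eq, Nat.or_eq_zero_iff, Nat.xor_eq_zero_iff,
      HState.setVar_var, HState.setVar_arr, e18, hx, ← hcd, a16, a17 c hc, a17 _ (hpc.trans hc), reduceIte,
      hK, hZ,
      show ¬ (15 = 24) by decide, show ¬ (15 = 23) by decide, show ¬ (15 = 22) by decide,
      show ¬ (15 = 21) by decide, show ¬ (16 = 24) by decide, show ¬ (16 = 23) by decide,
      show ¬ (16 = 22) by decide, show ¬ (16 = 21) by decide, show ¬ (23 = 24) by decide, show ¬ (21 = 22) by decide,
      show ¬ (22 = 23) by decide]
    refine ⟨by simp; omega, by simp; omega, by simp; omega, by simp; omega, by simp, fun heq => ?_, fun hne => ?_⟩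
    · have h0 : i ≠ 0 := by
        intro h0
        have := (hI2 h0).2
        omega
      have hl := hI3 (by omega)
      have hlp := hl.pos
      have hbd := hI1.bound (s'.var 14 - 1) (by omega)
      rw [hl.pc_eq] at hbd
      have hcode : s'.var 17 < 4 ^ sz :=
        (Nat.le_mul_of_pos_right _ (by positivity)).trans_lt hbd.2.2
      refine wp_storePieceCmd (n := s'.var 14) (a := s'.var 17) (c := c) (p := F.pre c) (j := c / sz)
        (k := F.pre c / sz) (b := F.pre c % sz) (r := c % sz) hE (by simp) (by simp) (by simp) (by simp) (by simp)
        (by simp) (by simpa using a18 _ (hpc.trans hc)) (by simpa using a18 c hc) hlp (by omega) (by omega) (by omega)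
        (by omega) fun s'' t hf'' v17 b19 b20 b21 b22 ht => ?_
      have w14 : s''.var 14 = s'.var 14 := by rw [hf''.var 14 rfl]; simp
      have w15 : s''.var 15 = c / sz := by rw [hf''.var 15 rfl]; simp [heq.1]
      have w16 : s''.var 16 = F.pre c / sz := by rw [hf''.var 16 rfl]; simp [heq.2]
      have := pieces_extend hsz (hlast h0) hI1 hl heq.1 heq.2
      rw [hci']
      simp only [HState.setVar_arr, b19, b20, b21, b22]
      refine ⟨⟨?_, by omega, fun _ => ?_⟩, ?_⟩
      · simpa [w14] using this.1
      · simpa [w14, w15, w16, v17] using this.2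
      · simp; omega
    · refine ⟨by simp; omega, trivial, trivial, by decide, ?_⟩
      refine wp_storePieceCmd (n := s'.var 14 + 1) (a := 0) (c := c) (p := F.pre c) (j := c / sz)
        (k := F.pre c / sz) (b := F.pre c % sz) (r := c % sz) hE (by simp) (by simp) (by simp) (by simp) (by simp)
        (by simp) (by simpa using a18 _ (hpc.trans hc)) (by simpa using a18 c hc) (by omega) (by omega) (by omega) (by omega)
        (by omega) fun s'' t hf'' v17 b19 b20 b21 b22 ht => ?_
      have w14 : s''.var 14 = s'.var 14 + 1 := by rw [hf''.var 14 rfl]; simp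
      have w15 : s''.var 15 = c / sz := by rw [hf''.var 15 rfl]; simp
      have w16 : s''.var 16 = F.pre c / sz := by rw [hf''.var 16 rfl]; simp
      have := pieces_new hsz hc1 hc hW hI1 (fun h => hI3 (by omega)) (fun h => (hI2 (by omega)).1)
        (fun _ => hne)
      rw [hci']
      simp only [HState.setVar_arr, b19, b20, b21, b22]
      refine ⟨⟨?_, by omega, fun _ => ?_⟩, ?_⟩
      · simpa [w14] using this.1
      · simpa [w14, w15, w16, v17] using this.2
      · simp; omega
  · rintro s' t ⟨hI1, hI2, hI3⟩ _ hf ht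
    rw [g18] at hI1 hI2 hI3 ht
    rw [show nP - (nP - 1) = 1 by omega] at hI1 hI3
    refine ⟨⟨?_, hI1⟩, ?_⟩
    · by_cases h0 : nP - 1 = 0
      · rw [(hI2 h0).1]; omega
      · have := (hI3 (by omega)).lt
        omega
    · simp at ht ⊢
      omega

end TPS
/-! ### The positions of each class -/

namespace TPS

open WordRAM
open TPS.Expr (var lit get inp)
open TPS.Cmd (assign store emit skip ite)

/-- `L a` lists the entries for the positions `i < c` with `key i = a`. An entry consists of the
index of a word, plus one, and the bits of the positions in this word. -/
structure Entries (key : ℕ → ℕ) (s c n : ℕ) (L : ℕ → List ℕ) (le en ew em : ℕ → ℕ) : Prop where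
  chain : ∀ a, Chain en (le a) (L a)
  unset : ew 0 = 0
  disj : ∀ a b x, x ∈ L a → x ∈ L b → a = b
  bound : ∀ a, ∀ x ∈ L a, 1 ≤ x ∧ x ≤ n ∧ 1 ≤ ew x ∧ (ew x - 1) * s < c
  sorted : ∀ a, ((L a).map ew).Pairwise (· > ·)
  sem : ∀ a j i, (∃ x ∈ L a, ew x = j + 1 ∧ (em x).testBit i = true) ↔
    i < s ∧ j * s + i < c ∧ key (j * s + i) = a

/-! ### Adding positions to the entries of their class -/

section Entries

variable {key le en ew em : ℕ → ℕ} {s c n : ℕ} {L : ℕ → List ℕ}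

theorem key_step (hs : 0 < s) (a j i : ℕ) :
    (i < s ∧ j * s + i < c + 1 ∧ key (j * s + i) = a) ↔
      (i < s ∧ j * s + i < c ∧ key (j * s + i) = a) ∨ (key c = a ∧ c / s = j ∧ c % s = i) := by
  have h1 := Nat.div_add_mod c s
  rw [mul_comm] at h1
  have h2 := Nat.mod_lt c hs
  constructor
  · rintro ⟨h3, h4, h5⟩
    rcases Nat.lt_or_ge (j * s + i) c with h | h
    · exact .inl ⟨h3, h, h5⟩
    · have h6 : j * s + i = c := by omega
      refine .inr ⟨h6 ▸ h5, ?_⟩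
      rw [Nat.div_mod_unique hs, mul_comm]
      exact ⟨by omega, h3⟩
  · rintro (⟨h3, h4, h5⟩ | ⟨h3, rfl, rfl⟩)
    · exact ⟨h3, by omega, h5⟩
    · rw [h1]
      exact ⟨h2, by omega, h3⟩

/-- Add a position to the first entry of its class. -/
theorem Entries.extend (hs : 0 < s) (h : Entries key s c n L le en ew em)
    (hw : ew (le (key c)) = c / s + 1) :
    Entries key s (c + 1) n L le en ew
      (upd em (le (key c)) (em (le (key c)) ||| 1 <<< (c % s))) := by
  have hmem : le (key c) ∈ L (key c) := by
    have hch := h.chain (key c)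
    cases hL : L (key c) with
    | nil =>
      rw [hL] at hch
      rw [show le (key c) = 0 from hch, h.unset] at hw
      exact absurd hw (Nat.succ_ne_zero _).symm
    | cons x l =>
      rw [hL] at hch
      rw [hch.1]
      exact List.mem_cons_self
  refine ⟨h.chain, h.unset, h.disj, fun a x hx => ?_, h.sorted, fun a j i => ?_⟩
  · have := h.bound a x hx
    exact ⟨this.1, this.2.1, this.2.2.1, by omega⟩
  · rw [key_step hs, ← h.sem]
    constructor
    · rintro ⟨x, hx, h1, h2⟩
      simp only [upd] at h2
      split_ifs at h2 with hxe
      · rw [Nat.testBit_or, Bool.or_eq_true] at h2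
        rcases h2 with h2 | h2
        · exact .inl ⟨x, hx, h1, hxe ▸ h2⟩
        · rw [Nat.one_shiftLeft, Nat.testBit_two_pow, decide_eq_true_eq] at h2
          refine .inr ⟨h.disj _ _ _ hmem (hxe ▸ hx), ?_, h2⟩
          rw [hxe] at h1
          omega
      · exact .inl ⟨x, hx, h1, h2⟩
    · rintro (⟨x, hx, h1, h2⟩ | ⟨rfl, rfl, rfl⟩)
      · refine ⟨x, hx, h1, ?_⟩
        simp only [upd]
        split_ifs with hxe
        · rw [Nat.testBit_or, ← hxe, h2, Bool.true_or]
        · exact h2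
      · refine ⟨_, hmem, hw, ?_⟩
        simp [upd, Nat.one_shiftLeft]

/-- Add a position as a new entry of its class. -/
theorem Entries.cons (hs : 0 < s) (h : Entries key s c n L le en ew em)
    (hw : ew (le (key c)) ≠ c / s + 1) :
    Entries key s (c + 1) (n + 1) (fun a => if a = key c then (n + 1) :: L a else L a)
      (upd le (key c) (n + 1)) (upd en (n + 1) (le (key c))) (upd ew (n + 1) (c / s + 1))
      (upd em (n + 1) (1 <<< (c % s))) := by
  have hne : ∀ a, ∀ x ∈ L a, x ≠ n + 1 := fun a x hx => by
    have := (h.bound a x hx).2.1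
    omega
  have hlt : ∀ x ∈ L (key c), ew x < c / s + 1 := by
    have hch := h.chain (key c)
    have hso := h.sorted (key c)
    cases hL : L (key c) with
    | nil => simp
    | cons y l =>
      rw [hL] at hch hso
      rw [hch.1] at hw
      have hy := h.bound (key c) y (by rw [hL]; exact List.mem_cons_self)
      have h1 : ew y - 1 ≤ c / s := by
        rw [Nat.le_div_iff_mul_le hs]
        exact hy.2.2.2.le
      rw [List.map_cons, List.pairwise_cons] at hso
      intro x hx
      rcases List.mem_cons.1 hx with rfl | hx
      · omega
      · have := hso.1 _ (List.mem_map_of_mem hx)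
        omega
  have hmap : ∀ a, (L a).map (upd ew (n + 1) (c / s + 1)) = (L a).map ew := fun a =>
    List.map_congr_left fun x hx => by simp only [upd, if_neg (hne a x hx)]
  have hchain : ∀ a, Chain (upd en (n + 1) (le (key c))) (le a) (L a) := fun a =>
    Chain.congr (fun x hx => by simp only [upd, if_neg (hne a x hx)]) (h.chain a)
  have hsem : ∀ a j i, (∃ x ∈ L a, upd ew (n + 1) (c / s + 1) x = j + 1 ∧
      (upd em (n + 1) (1 <<< (c % s)) x).testBit i = true) ↔
      ∃ x ∈ L a, ew x = j + 1 ∧ (em x).testBit i = true := fun a j i =>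
    exists_congr fun x => and_congr_right fun hx => by simp only [upd, if_neg (hne a x hx)]
  refine ⟨fun a => ?_, by simp [upd, h.unset], fun a b x hxa hxb => ?_, fun a x hx => ?_, fun a => ?_,
    fun a j i => ?_⟩
  · simp only [upd]
    split_ifs with ha
    · refine ⟨rfl, by omega, ?_⟩
      simpa [upd, ha] using hchain (key c)
    · exact hchain a
  · split_ifs at hxa hxb with ha hb hb
    · rw [ha, hb]
    · rcases List.mem_cons.1 hxa with hx | hx
      · exact absurd hx (hne _ _ hxb)
      · exact h.disj _ _ _ hx hxb
    · rcases List.mem_cons.1 hxb with hx | hx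
      · exact absurd hx (hne _ _ hxa)
      · exact h.disj _ _ _ hxa hx
    · exact h.disj _ _ _ hxa hxb
  · have hold : ∀ x ∈ L a, 1 ≤ x ∧ x ≤ n + 1 ∧ 1 ≤ upd ew (n + 1) (c / s + 1) x ∧
        (upd ew (n + 1) (c / s + 1) x - 1) * s < c + 1 := fun x hx => by
      have := h.bound a x hx
      simp only [upd, if_neg (hne a x hx)]
      exact ⟨this.1, by omega, this.2.2.1, by omega⟩
    split_ifs at hx with ha
    · rcases List.mem_cons.1 hx with rfl | hx
      · simp only [upd, if_true, Nat.add_sub_cancel]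
        have := Nat.div_mul_le_self c s
        exact ⟨by omega, le_rfl, Nat.le_add_left _ _, by omega⟩
      · exact hold x hx
    · exact hold x hx
  · split_ifs with ha
    · rw [List.map_cons, List.pairwise_cons, hmap]
      refine ⟨fun w hw' => ?_, h.sorted a⟩
      obtain ⟨x, hx, rfl⟩ := List.mem_map.1 hw'
      simp only [upd, if_true]
      exact hlt x (ha ▸ hx)
    · rw [hmap]
      exact h.sorted a
  · rw [key_step hs, ← h.sem, ← hsem]
    split_ifs with ha
    · have hnew : (upd ew (n + 1) (c / s + 1) (n + 1) = j + 1 ∧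
          (upd em (n + 1) (1 <<< (c % s)) (n + 1)).testBit i = true) ↔ c / s = j ∧ c % s = i := by
        simp only [upd, if_true, Nat.one_shiftLeft, Nat.testBit_two_pow, decide_eq_true_eq,
          Nat.add_right_cancel_iff]
      rw [List.exists_mem_cons_iff, hnew, or_comm, ha]
      simp
    · simp [Ne.symm ha]

/-- The entries of a class belong to different words. -/
theorem Entries.length_le {W : ℕ} (h : Entries key s c n L le en ew em)
    (hW : ∀ j, j * s < c → j < W) (a : ℕ) : (L a).length ≤ W := by
  have hnd : ((L a).map ew).Nodup := (h.sorted a).imp fun h => (ne_of_gt h)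
  rw [← List.length_map (f := ew), ← List.toFinset_card_of_nodup hnd]
  have : ((L a).map ew).toFinset ⊆ Finset.Icc 1 W := fun w hw => by
    rw [List.mem_toFinset, List.mem_map] at hw
    obtain ⟨x, hx, rfl⟩ := hw
    have h1 := h.bound a x hx
    have := hW _ h1.2.2.2
    exact Finset.mem_Icc.2 ⟨h1.2.2.1, by omega⟩
  simpa using Finset.card_le_card this

end Entries

/-- Positions are visited in increasing order, so only the first entry of a class can belong to the
current word. Word indices are stored plus one, so that the missing entry `0` never seems to belong
to it. -/
def entryCmd : Cmd :=
  assign 19 (lit 0) ;;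
  .for 20 1 (
    assign 21 (get 4 (get 15 (var 20))) ;;
    assign 22 (get 24 (var 21)) ;;
    assign 23 (get 17 (var 20) + lit 1) ;;
    assign 24 (.bin .shl (lit 1) (get 18 (var 20))) ;;
    ite (.eq (get 26 (var 22)) (var 23))
      (store 27 (var 22) (.bin .or (get 27 (var 22)) (var 24)))
      (assign 19 (var 19 + lit 1) ;;
       store 25 (var 19) (var 22) ;;
       store 26 (var 19) (var 23) ;;
       store 27 (var 19) (var 24) ;;
       store 24 (var 21) (var 19)))

theorem wp_entryCmd {nP nT sz : ℕ} {F : Forest nP nT} {cl : ℕ → ℕ} {E : Env} {s : HState}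
    {Q : HState → ℕ → Prop} (hE : E.Good (nP + nT)) (hcl : F.IsClass cl) (h1 : s.var 1 = nP)
    (hsz : 0 < sz) (hpow : 8 ^ sz ≤ nT) (h4 : ∀ x, 1 ≤ x → x ≤ nP + nT → s.arr 4 x = cl x)
    (hord : ∀ c < nP, s.arr 15 c = F.node c) (hdiv : ∀ c < nP, s.arr 17 c = c / sz)
    (hmod : ∀ c < nP, s.arr 18 c = c % sz) (h24 : ∀ a, s.arr 24 a = 0) (h26 : s.arr 26 0 = 0)
    (hQ : ∀ s' t n L, Frame entryCmd s s' → n ≤ nP →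
      Entries (fun c => cl (F.node c)) sz nP n L (s'.arr 24) (s'.arr 25) (s'.arr 26) (s'.arr 27) →
      t ≤ 100 * (nP + nT) → Q s' t) : Wp E entryCmd s Q := by
  have hZ := hE.Z
  have hK := hE.K
  have hB := hE.B
  have hN := hE.N
  suffices H : Wp E entryCmd s fun s' t => (∃ n ≤ nP, ∃ L, Entries (fun c => cl (F.node c)) sz nP n L
      (s'.arr 24) (s'.arr 25) (s'.arr 26) (s'.arr 27)) ∧ t ≤ 100 * (nP + nT) from
    H.mono fun s' t hf ⟨⟨n, hn, L, h⟩, ht⟩ => hQ s' t n L hf hn h ht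
  simp only [entryCmd, wp_seq, wp_assign]
  refine ⟨by simp, ?_⟩
  generalize hs1 : HState.setVar _ 19 _ = s1
  have g1 : s1.var 1 = nP := by rw [← hs1]; simpa using h1
  have g19 : s1.var 19 = 0 := by rw [← hs1]; simp
  have garr : s1.arr = s.arr := by rw [← hs1]; simp
  clear hs1
  refine Wp.for (fun i s' => s'.var 19 ≤ i ∧ ∃ L, Entries (fun c => cl (F.node c)) sz i (s'.var 19) L
      (s'.arr 24) (s'.arr 25) (s'.arr 26) (s'.arr 27)) (fun _ => 80) (by decide) rfl rfl (by omega) ?_ ?_ ?_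
  · refine ⟨by simp [g19], fun _ => [], ?_⟩
    simp only [HState.setVar_arr, garr]
    exact ⟨h24, h26, by simp, by simp, by simp, by simp⟩
  · rintro c s' hc ⟨hI1, L, hI2⟩ hx hf
    rw [g1] at hc
    have hnode := (Forest.node_mem (F := F) hc).all
    have hlt := hcl.lt _ hnode.1 hnode.2
    have e15 : s'.arr 15 c = F.node c := by rw [hf.arr 15 rfl, garr, hord c hc]
    have e17 : s'.arr 17 c = c / sz := by rw [hf.arr 17 rfl, garr, hdiv c hc]
    have e18 : s'.arr 18 c = c % sz := by rw [hf.arr 18 rfl, garr, hmod c hc]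
    have e4 : s'.arr 4 (F.node c) = cl (F.node c) := by
      rw [hf.arr 4 rfl, garr, h4 _ hnode.1 hnode.2]
    have hd := Nat.div_le_self c sz
    have hm := Nat.mod_lt c hsz
    have hp : 2 ^ (c % sz) < E.B := by
      have h1 : 2 ^ (c % sz) ≤ 2 ^ sz := Nat.pow_le_pow_right (by norm_num) hm.le
      have h2 : 2 ^ sz ≤ 8 ^ sz := Nat.pow_le_pow_left (by norm_num) sz
      omega
    have hhead : s'.arr 24 (cl (F.node c)) ≤ nP := by
      have hch := hI2.chain (cl (F.node c))
      cases hL : L (cl (F.node c)) with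
      | nil =>
        rw [hL] at hch
        rw [show s'.arr 24 _ = 0 from hch]
        omega
      | cons x l =>
        rw [hL] at hch
        rw [hch.1]
        have := (hI2.bound _ x (by rw [hL]; exact List.mem_cons_self)).2.1
        omega
    simp only [wp_seq, wp_assign, wp_ite, wp_store]
    simp [hx, e15, e17, e18, e4, hK, hZ]
    refine ⟨by omega, by omega, by omega, ⟨by omega, by simpa [Nat.shiftLeft_eq] using hp⟩, by omega,
      fun heq => ⟨by omega, hI1.trans (by omega), L, ?_⟩, fun hne => ⟨by omega, by omega, by omega, by omega, ?_⟩⟩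
    · convert hI2.extend hsz heq using 1
      funext i
      simp [upd]
    · refine ⟨fun a => if a = cl (F.node c) then (s'.var 19 + 1) :: L a else L a, ?_⟩
      convert hI2.cons hsz hne using 1
      all_goals
        funext i
        simp [upd]
  · rintro s' t ⟨hI1, L, hI2⟩ _ hf ht
    rw [g1] at hI1 hI2 ht
    refine ⟨⟨_, hI1, L, hI2⟩, ?_⟩
    simp at ht ⊢
    omega

end TPS
/-! ### Matched positions as bits of words -/

namespace TPS

open WordRAM
open TPS.Expr (var lit get inp)
open TPS.Cmd (assign store emit skip ite)

section Words

variable {nP nT : ℕ} {F : Forest nP nT}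

open Classical in
/-- The bits of the `j`-th word say which of the positions `j * s, …, j * s + s - 1` are matched
by `v`. -/
noncomputable def Forest.word (F : Forest nP nT) (s v j : ℕ) : ℕ :=
  Nat.ofBits fun i : Fin s => decide (j * s + i < nP ∧ F.Mt (F.node (j * s + i)) v)

theorem Forest.testBit_word {s v j i : ℕ} : (F.word s v j).testBit i = true ↔
    i < s ∧ j * s + i < nP ∧ F.Mt (F.node (j * s + i)) v := by
  rw [Forest.word, Nat.testBit_ofBits]
  split_ifs with h <;> simp [h]

theorem Forest.word_lt (s v j : ℕ) : F.word s v j < 2 ^ s := Nat.ofBits_lt_two_pow _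

theorem Forest.testBit_word_div {s v c : ℕ} (hs : 0 < s) (hc : c < nP) :
    (F.word s v (c / s)).testBit (c % s) = true ↔ F.Mt (F.node c) v := by
  have h1 := Nat.div_add_mod c s
  rw [mul_comm] at h1
  rw [testBit_word, h1]
  exact ⟨fun h => h.2.2, fun h => ⟨Nat.mod_lt _ hs, hc, h⟩⟩

theorem Forest.word_zero (s : ℕ) : F.word s 0 = fun _ => 0 := by
  funext j
  refine Nat.eq_of_testBit_eq fun i => ?_
  rw [Nat.zero_testBit, Bool.eq_false_iff, ne_eq, testBit_word]
  exact fun h => Forest.not_mt_zero (node_mem h.2.1) h.2.2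

/-- The words of `v` from those of its parent. -/
theorem Forest.word_eq {cl M X : ℕ → ℕ} {s v : ℕ} (hs : 0 < s) (hcl : F.IsClass cl) (hv : F.InT v)
    (hX : ∀ j i, i < s → j * s + i < nP → ((X j).testBit i = true ↔ (j = 0 ∧ i = 0) ∨
      (1 ≤ j * s + i ∧
        (F.word s (F.par v) (F.pre (j * s + i) / s)).testBit (F.pre (j * s + i) % s) = true)))
    (hM : ∀ j i, (M j).testBit i = true ↔ (F.word s (F.par v) j).testBit i = true ∨
      ((i < s ∧ j * s + i < nP ∧ cl (F.node (j * s + i)) = cl v) ∧ (X j).testBit i = true)) :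
    M = F.word s v := by
  funext j
  refine Nat.eq_of_testBit_eq fun i => Bool.eq_iff_iff.2 ?_
  rw [hM, testBit_word, testBit_word]
  by_cases h : i < s ∧ j * s + i < nP
  · have hn := node_mem (F := F) h.2
    have hXX : (X j).testBit i = true ↔ F.Mt (F.par (F.node (j * s + i))) (F.par v) := by
      rw [hX j i h.1 h.2]
      -- Position `0` is the root. Its parent stands for the empty path, which is always matched.
      by_cases h0 : j * s + i = 0
      · rw [h0, node_zero, F.par_rP]
        refine ⟨fun _ => mt_zero _, fun _ => .inl ⟨?_, by omega⟩⟩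
        have : j * s = 0 := by omega
        rcases Nat.mul_eq_zero.1 this with h | h <;> omega
      · have h1 : 1 ≤ j * s + i := by omega
        have hp := pre_lt (F := F) h1 h.2
        rw [testBit_word_div hs (hp.trans h.2), par_node h1 h.2]
        refine ⟨?_, fun h2 => .inr ⟨h1, h2⟩⟩
        rintro (⟨rfl, rfl⟩ | h2)
        · simp at h0
        · exact h2.2
    rw [hXX, hcl.iff _ _ hn.all.1 hn.all.2 hv.all.1 hv.all.2, mt_iff hn hv]
    tauto
  · tauto

/-- Undo `n` changes of words, recorded from the index `b` on. -/
def undo (sj sn : ℕ → ℕ) (b : ℕ) : ℕ → (ℕ → ℕ) → ℕ → ℕ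
  | 0, M => M
  | n + 1, M => undo sj sn b n (upd M (sj (b + n)) (sn (b + n)))

theorem undo_congr {sj sn sj' sn' : ℕ → ℕ} {b n : ℕ} (M : ℕ → ℕ)
    (h : ∀ i < b + n, sj' i = sj i ∧ sn' i = sn i) : undo sj' sn' b n M = undo sj sn b n M := by
  induction n generalizing M with
  | zero => rfl
  | succ n ih =>
    rw [undo, undo, (h (b + n) (by omega)).1, (h (b + n) (by omega)).2]
    exact ih _ fun i hi => h i (by omega)

theorem upd_upd_self (M : ℕ → ℕ) (j a : ℕ) : upd (upd M j a) j (M j) = M := by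
  funext i
  simp only [upd]
  split_ifs with h <;> simp [h]

/-- The newest record is undone first and restores the overwritten word; the records below it are
unaffected by the push. -/
theorem undo_push {sj sn M : ℕ → ℕ} {b n j a : ℕ} :
    undo (upd sj (b + n) j) (upd sn (b + n) (M j)) b (n + 1) (upd M j a) = undo sj sn b n M := by
  rw [undo]
  have h : ∀ f a, upd f (b + n) a (b + n) = a := by simp [upd]
  rw [h, h, upd_upd_self]
  exact undo_congr _ fun i hi => by simp [upd, show i ≠ b + n by omega]

/-- The number of positions whose bit is set. -/
def bitCount (n s : ℕ) (M : ℕ → ℕ) : ℕ :=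
  ((Finset.range n).filter fun c => (M (c / s)).testBit (c % s) = true).card

theorem bitCount_le (n s : ℕ) (M : ℕ → ℕ) : bitCount n s M ≤ n :=
  (Finset.card_filter_le _ _).trans (Finset.card_range n).le

/-- Changes only add bits, and a recorded change adds at least one. The height of the stack is thus
bounded by the number of set bits, hence by `n`. -/
theorem bitCount_lt {n s j i : ℕ} {M M' : ℕ → ℕ}
    (h : ∀ j i, (M j).testBit i = true → (M' j).testBit i = true) (hi : i < s) (hn : j * s + i < n)
    (h1 : (M' j).testBit i = true) (h2 : ¬ (M j).testBit i = true) :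
    bitCount n s M < bitCount n s M' := by
  have h3 : (j * s + i) / s = j ∧ (j * s + i) % s = i := by
    rw [Nat.div_mod_unique (by omega)]
    exact ⟨by ring, hi⟩
  refine Finset.card_lt_card ⟨fun c hc => ?_, fun hss => ?_⟩
  · rw [Finset.mem_filter] at hc ⊢
    exact ⟨hc.1, h _ _ hc.2⟩
  · have := hss (Finset.mem_filter.2 ⟨Finset.mem_range.2 hn, by rwa [h3.1, h3.2]⟩)
    rw [Finset.mem_filter, h3.1, h3.2] at this
    exact h2 this.2

/-- The stack records the changes for the nodes of the path; `sv v` is its height before the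
changes for `v`. -/
def StackOK (F : Forest nP nT) (s W : ℕ) (sv sj sn : ℕ → ℕ) : List ℕ → ℕ → Prop
  | [], top => top = 0
  | v :: p, top => sv v ≤ top ∧ top ≤ sv v + W ∧ top ≤ bitCount nP s (F.word s v) ∧
      undo sj sn (sv v) (top - sv v) (F.word s v) = F.word s (F.par v) ∧ StackOK F s W sv sj sn p (sv v)

theorem StackOK.congr {s W : ℕ} {sv sj sn sv' sj' sn' : ℕ → ℕ} {p : List ℕ} :
    ∀ {top : ℕ}, (∀ v ∈ p, sv' v = sv v) → (∀ i < top, sj' i = sj i ∧ sn' i = sn i) →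
      StackOK F s W sv sj sn p top → StackOK F s W sv' sj' sn' p top := by
  induction p with
  | nil => exact fun _ _ h => h
  | cons v p ih =>
    rintro top h1 h2 ⟨h3, h4, h5, h6, h7⟩
    rw [StackOK, h1 v (by simp)]
    refine ⟨h3, h4, h5, ?_, ih (fun u hu => h1 u (by simp [hu])) (fun i hi => h2 i (by omega)) h7⟩
    rw [← h6]
    exact undo_congr _ fun i hi => h2 i (by omega)

end Words

/-- The data for the traversal with words. -/
structure WordsData {nP nT : ℕ} (F : Forest nP nT) (cl : ℕ → ℕ) (sz W n m : ℕ) (L : ℕ → List ℕ)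
    (s : HState) : Prop where
  nP_eq : s.var 1 = nP
  sz_eq : s.var 8 = sz
  W_eq : s.var 9 = W
  n_eq : s.var 14 = n
  n_le : n ≤ 2 * W
  m_le : m ≤ nP
  sz_pos : 0 < sz
  pow_le : 8 ^ sz ≤ nT
  W_def : W = nP / sz + 1
  cls : ∀ x, 1 ≤ x → x ≤ nP + nT → s.arr 4 x = cl x
  pieces : Pieces F sz W 1 n (s.arr 19) (s.arr 20) (s.arr 21) (s.arr 22)
  table : ∀ c m, c < 4 ^ sz → m < 2 ^ sz → s.arr 23 (c * 2 ^ sz + m) = sel c m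
  entries : Entries (fun c => cl (F.node c)) sz nP m L (s.arr 24) (s.arr 25) (s.arr 26) (s.arr 27)

theorem WordsData.congr {nP nT : ℕ} {F : Forest nP nT} {cl : ℕ → ℕ} {sz W n m : ℕ} {L : ℕ → List ℕ}
    {s s' : HState} (h : WordsData F cl sz W n m L s)
    (hv : ∀ x ∈ [1, 8, 9, 14], s'.var x = s.var x)
    (ha : ∀ k ∈ [4, 19, 20, 21, 22, 23, 24, 25, 26, 27], s'.arr k = s.arr k) :
    WordsData F cl sz W n m L s' := by
  constructor
  · rw [hv 1 (by decide)]; exact h.nP_eq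
  · rw [hv 8 (by decide)]; exact h.sz_eq
  · rw [hv 9 (by decide)]; exact h.W_eq
  · rw [hv 14 (by decide)]; exact h.n_eq
  · exact h.n_le
  · exact h.m_le
  · exact h.sz_pos
  · exact h.pow_le
  · exact h.W_def
  · rw [ha 4 (by decide)]; exact h.cls
  · rw [ha 19 (by decide), ha 20 (by decide), ha 21 (by decide), ha 22 (by decide)]; exact h.pieces
  · rw [ha 23 (by decide)]; exact h.table
  · rw [ha 24 (by decide), ha 25 (by decide), ha 26 (by decide), ha 27 (by decide)]; exact h.entries

/-- Compute for every position the bit of its parent. -/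
def liftCmd : Cmd :=
  .for 20 9 (store 28 (var 20) (lit 0)) ;;
  store 28 (lit 0) (lit 1) ;;
  .for 20 14 (
    assign 21 (get 19 (var 20)) ;;
    assign 22 (get 23 (.bin .shl (get 21 (var 20)) (var 8) + get 29 (get 20 (var 20)))) ;;
    store 28 (var 21) (.bin .or (get 28 (var 21)) (.bin .shl (var 22) (get 22 (var 20)))))

section

variable {nP nT sz W n m : ℕ} {F : Forest nP nT} {cl : ℕ → ℕ} {L : ℕ → List ℕ} {E : Env}
  {s : HState} {Q : HState → ℕ → Prop}

/-- Each of the at most `2 * W` pieces contributes its bits by one table look-up, a shift and an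
`or`. The bit of the root is set beforehand. -/
theorem wp_liftCmd (hE : E.Good (nP + nT)) (hd : WordsData F cl sz W n m L s)
    (hM : ∀ j, s.arr 29 j < 2 ^ sz)
    (hQ : ∀ s' t, Frame liftCmd s s' →
      (∀ j i, i < sz → j * sz + i < nP → ((s'.arr 28 j).testBit i = true ↔ (j = 0 ∧ i = 0) ∨
        (1 ≤ j * sz + i ∧ (s.arr 29 (F.pre (j * sz + i) / sz)).testBit
          (F.pre (j * sz + i) % sz) = true))) →
      t ≤ 200 * W → Q s' t) : Wp E liftCmd s Q := by
  have hZ := hE.Z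
  have hK := hE.K
  have hB := hE.B
  have hN := hE.N
  have hW := hd.W_def
  have hW1 : 1 ≤ W := hW ▸ Nat.succ_pos _
  have hWle : W ≤ nP + 1 := by have := Nat.div_le_self nP sz; omega
  have hP1 : 1 ≤ nP := F.rP_mem.1.trans F.rP_mem.2
  have hT1 : 1 ≤ nT := by have := F.rT_mem; omega
  have hn := hd.n_le
  have hsz8 : 4 ^ sz * 2 ^ sz ≤ nT := by
    rw [← mul_pow]
    exact hd.pow_le
  have h2 : 1 ≤ 2 ^ sz := Nat.one_le_pow _ _ (by norm_num)
  have h4 : 4 ^ sz ≤ nT := (Nat.le_mul_of_pos_right _ h2).trans hsz8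
  have hjW : ∀ j i, j * sz + i < nP → j < W := fun j i h => by
    have : j ≤ nP / sz := (Nat.le_div_iff_mul_le hd.sz_pos).2 (by omega)
    omega
  suffices H : Wp E liftCmd s fun s' t => (∀ j i, i < sz → j * sz + i < nP →
      ((s'.arr 28 j).testBit i = true ↔ (j = 0 ∧ i = 0) ∨
        (1 ≤ j * sz + i ∧ (s.arr 29 (F.pre (j * sz + i) / sz)).testBit
          (F.pre (j * sz + i) % sz) = true))) ∧ t ≤ 200 * W from
    H.mono fun s' t hf h => hQ s' t hf h.1 h.2
  simp only [liftCmd, wp_seq, wp_store]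
  refine Wp.for (fun i s' => ∀ j < i, s'.arr 28 j = 0) (fun _ => 10) (by decide) rfl rfl
    (by rw [hd.W_eq]; omega) (by simp) ?_ ?_
  · intro i s' hi hI hx hf
    rw [hd.W_eq] at hi
    simp [hx, hK, hZ]
    refine ⟨by omega, fun j hj => ?_⟩
    exact fun h => hI j (by omega)
  intro s1 t1 hI1 _ hf1 ht1
  rw [hd.W_eq] at hI1 ht1
  refine ⟨by simp; omega, ?_⟩
  simp only [Expr.eval_lit]
  generalize hs2 : HState.setArr _ 28 _ _ = s2
  have g28 : ∀ j < W, s2.arr 28 j = if j = 0 then 1 else 0 := by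
    intro j hj
    rw [← hs2, HState.setArr_arr]
    simp [hI1 j hj]
  have gf : ∀ k, k ≠ 28 → s2.arr k = s.arr k := fun k hk => by
    rw [← hs2, HState.setArr_arr_of_ne _ _ _ _ hk, hf1.arr k (by simp [Cmd.for, Cmd.modArr]; omega)]
  have g14 : s2.var 14 = n := by rw [← hs2, HState.setArr_var, hf1.var 14 rfl, hd.n_eq]
  have g8 : s2.var 8 = sz := by rw [← hs2, HState.setArr_var, hf1.var 8 rfl, hd.sz_eq]
  clear hs2
  refine Wp.for (fun k s' => ∀ j < W, ∀ i, (s'.arr 28 j).testBit i = true ↔ (j = 0 ∧ i = 0) ∨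
      ∃ e < k, s.arr 19 e = j ∧
        (sel (s.arr 21 e) (s.arr 29 (s.arr 20 e)) <<< s.arr 22 e).testBit i = true)
    (fun _ => 50) (by decide) rfl rfl (by omega) ?_ ?_ ?_
  · intro j hj i
    rw [HState.setVar_arr, g28 j hj]
    simp only [Nat.not_lt_zero, false_and, exists_false, or_false]
    split_ifs with h
    · simp [h, Nat.testBit_one_eq_true_iff_self_eq_zero]
    · simp [h]
  · intro e s' he hI hx hf
    rw [g14] at he
    have e19 : s'.arr 19 = s.arr 19 := by rw [hf.arr 19 rfl, gf 19 (by decide)]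
    have e20 : s'.arr 20 = s.arr 20 := by rw [hf.arr 20 rfl, gf 20 (by decide)]
    have e21 : s'.arr 21 = s.arr 21 := by rw [hf.arr 21 rfl, gf 21 (by decide)]
    have e22 : s'.arr 22 = s.arr 22 := by rw [hf.arr 22 rfl, gf 22 (by decide)]
    have e23 : s'.arr 23 = s.arr 23 := by rw [hf.arr 23 rfl, gf 23 (by decide)]
    have e29 : s'.arr 29 = s.arr 29 := by rw [hf.arr 29 rfl, gf 29 (by decide)]
    have e8 : s'.var 8 = sz := by rw [hf.var 8 rfl, g8]
    obtain ⟨b1, b2, b3⟩ := hd.pieces.bound e he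
    have b4 : s.arr 21 e < 4 ^ sz := (Nat.le_mul_of_pos_right _ (by positivity)).trans_lt b3
    have b5 := hM (s.arr 20 e)
    have htab := hd.table _ _ b4 b5
    have hidx : s.arr 21 e * 2 ^ sz + s.arr 29 (s.arr 20 e) < 4 ^ sz * 2 ^ sz := by
      have := Nat.mul_le_mul_right (2 ^ sz) b4
      rw [Nat.succ_mul] at this
      omega
    have hsel := Nat.mul_le_mul_right (2 ^ s.arr 22 e) (sel_le (s.arr 21 e) (s.arr 29 (s.arr 20 e)))
    simp only [wp_seq, wp_assign, wp_store]
    simp [hx, e19, e20, e21, e22, e23, e29, e8, hK, hZ, Nat.shiftLeft_eq, htab]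
    refine ⟨by omega, by omega, by omega, fun j hj i => ?_⟩
    have hlast : ∀ p : ℕ → Prop, (∃ e' ≤ e, p e') ↔ (∃ e' < e, p e') ∨ p e := fun p => by
      constructor
      · rintro ⟨e', h1, h2⟩
        rcases Nat.lt_or_ge e' e with h3 | h3
        · exact .inl ⟨e', h3, h2⟩
        · exact .inr ((show e' = e by omega) ▸ h2)
      · rintro (⟨e', h1, h2⟩ | h)
        · exact ⟨e', by omega, h2⟩
        · exact ⟨e, by omega, h⟩
    rw [hlast]
    have := hI j hj i
    simp only [Nat.shiftLeft_eq] at this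
    split_ifs with h
    · rw [Nat.testBit_or, Bool.or_eq_true, ← h, this, h, or_assoc]
      simp
    · rw [this]
      simp [Ne.symm h]
  · intro s' t hI _ hf ht
    rw [g14] at hI ht
    refine ⟨fun j i hi hj => ?_, ?_⟩
    · rw [hI j (hjW j i hj), hd.pieces.sem]
      tauto
    · simp at ht1 ht ⊢
      omega

end

end TPS
/-! ### The traversal with words -/

namespace TPS

open WordRAM
open TPS.Expr (var lit get inp)
open TPS.Cmd (assign store emit skip ite)

/-- Some of the entries have been processed: the words `M0` have changed to `M`, by `k` changes
recorded on the stack. -/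
structure Pushed (nP s W top k : ℕ) (l : List ℕ) (ew em X M0 sj0 sn0 sj sn M : ℕ → ℕ) : Prop where
  bits : ∀ j i, (M j).testBit i = true ↔ (M0 j).testBit i = true ∨
    ∃ x ∈ l, ew x = j + 1 ∧ (em x).testBit i = true ∧ (X j).testBit i = true
  undo : undo sj sn top k M = M0
  old : ∀ i < top, sj i = sj0 i ∧ sn i = sn0 i
  idx : ∀ i < top + k, sj i < W
  count : top + k ≤ bitCount nP s M
  len : k ≤ l.length

section

variable {nP s W top k j x : ℕ} {l : List ℕ} {ew em X M0 sj0 sn0 sj sn M : ℕ → ℕ}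

/-- Set difference expressed by the available operations: the bits of `a` that are not in `b`. -/
theorem testBit_new (a b i : ℕ) : (a ^^^ (a &&& b)).testBit i = true ↔
    a.testBit i = true ∧ ¬ b.testBit i = true := by
  rw [Nat.testBit_xor, Nat.testBit_and]
  cases a.testBit i <;> cases b.testBit i <;> simp

/-- An entry that contributes no new bit is not recorded. Otherwise the height of the stack would
not be bounded by the number of set bits. -/
theorem Pushed.skip (h : Pushed nP s W top k l ew em X M0 sj0 sn0 sj sn M) (hx : ew x = j + 1)
    (h0 : (X j &&& em x) ^^^ (X j &&& em x &&& M j) = 0) :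
    Pushed nP s W top k (l ++ [x]) ew em X M0 sj0 sn0 sj sn M := by
  refine ⟨fun j' i => ?_, h.undo, h.old, h.idx, h.count, ?_⟩
  · have h1 := testBit_new (X j &&& em x) (M j) i
    rw [h0, Nat.zero_testBit, Nat.testBit_and, Bool.and_eq_true] at h1
    constructor
    · intro h2
      rcases (h.bits j' i).1 h2 with h3 | ⟨y, hy, h3⟩
      · exact .inl h3
      · exact .inr ⟨y, List.mem_append_left _ hy, h3⟩
    · rintro (h3 | ⟨y, hy, h3, h4, h5⟩)
      · exact (h.bits j' i).2 (.inl h3)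
      · rcases List.mem_append.1 hy with hy | hy
        · exact (h.bits j' i).2 (.inr ⟨y, hy, h3, h4, h5⟩)
        · rw [List.mem_singleton] at hy
          subst hy
          have : j' = j := by omega
          subst this
          by_contra h6
          exact absurd (h1.2 ⟨⟨h5, h4⟩, h6⟩) (by simp)
  · rw [List.length_append]
    exact h.len.trans (Nat.le_add_right _ _)

theorem Pushed.push (h : Pushed nP s W top k l ew em X M0 sj0 sn0 sj sn M) (hx : ew x = j + 1)
    (h0 : (X j &&& em x) ^^^ (X j &&& em x &&& M j) ≠ 0) (hj : j < W)
    (hb : ∀ i, (em x).testBit i = true → i < s ∧ j * s + i < nP) :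
    Pushed nP s W top (k + 1) (l ++ [x]) ew em X M0 sj0 sn0 (upd sj (top + k) j)
      (upd sn (top + k) (M j)) (upd M j (M j ||| (X j &&& em x) ^^^ (X j &&& em x &&& M j))) := by
  have h1 : ∀ i, (M j ||| (X j &&& em x) ^^^ (X j &&& em x &&& M j)).testBit i = true ↔
      (M j).testBit i = true ∨ ((em x).testBit i = true ∧ (X j).testBit i = true) := by
    intro i
    rw [Nat.testBit_or, Bool.or_eq_true, testBit_new, Nat.testBit_and, Bool.and_eq_true]
    tauto
  have h2 : ∀ j' i, (upd M j (M j ||| (X j &&& em x) ^^^ (X j &&& em x &&& M j)) j').testBit i = true ↔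
      (M j').testBit i = true ∨
        (j' = j ∧ (em x).testBit i = true ∧ (X j).testBit i = true) := by
    intro j' i
    simp only [upd]
    split_ifs with hjj
    · rw [h1, hjj]
      simp
    · simp [hjj]
  refine ⟨fun j' i => ?_, undo_push.trans h.undo, fun i hi => ?_, fun i hi => ?_, ?_, ?_⟩
  · rw [h2, h.bits]
    constructor
    · rintro ((h3 | ⟨y, hy, h3⟩) | ⟨rfl, h3⟩)
      · exact .inl h3
      · exact .inr ⟨y, List.mem_append_left _ hy, h3⟩
      · exact .inr ⟨x, by simp, hx, h3⟩
    · rintro (h3 | ⟨y, hy, h3, h4⟩)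
      · exact .inl (.inl h3)
      · rcases List.mem_append.1 hy with hy | hy
        · exact .inl (.inr ⟨y, hy, h3, h4⟩)
        · rw [List.mem_singleton] at hy
          subst hy
          have : j' = j := by omega
          subst this
          exact .inr ⟨rfl, h4⟩
  · simp only [upd, if_neg (show i ≠ top + k by omega)]
    exact h.old i hi
  · simp only [upd]
    split_ifs with hi'
    · exact hj
    · exact h.idx i (by omega)
  -- Some bit is set for the first time, so the bit count grows together with the stack.
  · obtain ⟨i, hi⟩ := Nat.exists_testBit_of_ne_zero h0
    rw [testBit_new, Nat.testBit_and, Bool.and_eq_true] at hi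
    obtain ⟨h3, h4⟩ := hb i hi.1.2
    have := bitCount_lt (fun j' i' h' => (h2 j' i').2 (.inl h')) h3 h4
      ((h2 j i).2 (.inr ⟨rfl, hi.1.2, hi.1.1⟩)) hi.2
    have := h.count
    omega
  · rw [List.length_append, List.length_singleton]
    exact Nat.succ_le_succ h.len

end

/-- Process the entries of a class. -/
def pushCmd : Cmd :=
  .forChain 16 25 (
    assign 21 (get 26 (var 16) - lit 1) ;;
    assign 22 (get 29 (var 21)) ;;
    assign 23 (.bin .and (get 28 (var 21)) (get 27 (var 16))) ;;
    assign 23 (.bin .xor (var 23) (.bin .and (var 23) (var 22))) ;;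
    ite (.eq (var 23) (lit 0)) skip
      (store 30 (var 15) (var 21) ;;
       store 31 (var 15) (var 22) ;;
       assign 15 (var 15 + lit 1) ;;
       store 29 (var 21) (.bin .or (var 22) (var 23))))

/-- Array `29` holds the matched words and array `28` the bits of the parents moved to the children.
The stack consists of word indices in array `30` and old contents in array `31`; array `13` saves
its height for each node of the path. -/
def wordsEnter : Cmd :=
  liftCmd ;;
  store 13 (var 12) (var 15) ;;
  assign 16 (get 24 (get 4 (var 12))) ;;
  pushCmd

def wordsExit : Cmd :=
  assign 21 (var 15 - get 13 (var 12)) ;;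
  .for 20 21 (assign 15 (var 15 - lit 1) ;; store 29 (get 30 (var 15)) (get 31 (var 15)))

def wordsLeaf : Cmd :=
  emit (var 12 - var 1 - lit 1) ;; .for 20 9 (emit (get 29 (var 20)))

section

variable {nP nT sz W n m : ℕ} {F : Forest nP nT} {cl : ℕ → ℕ} {L : ℕ → List ℕ} {E : Env}
  {s : HState} {Q : HState → ℕ → Prop}

theorem WordsData.lt_W (hd : WordsData F cl sz W n m L s) {j i : ℕ} (h : j * sz + i < nP) : j < W := by
  have h1 : j ≤ nP / sz := (Nat.le_div_iff_mul_le hd.sz_pos).2 (by omega)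
  have := hd.W_def
  omega

theorem WordsData.W_le (hd : WordsData F cl sz W n m L s) : 1 ≤ W ∧ W ≤ nP + 1 := by
  have := Nat.div_le_self nP sz
  rw [hd.W_def]
  exact ⟨Nat.succ_pos _, by omega⟩

theorem wp_pushCmd (hE : E.Good (nP + nT)) (hd : WordsData F cl sz W n m L s) {a top : ℕ}
    (h16 : s.var 16 = s.arr 24 a) (h15 : s.var 15 = top) (hidx : ∀ i < top, s.arr 30 i < W)
    (hcount : top ≤ bitCount nP sz (s.arr 29))
    (hQ : ∀ s' t k, Frame pushCmd s s' → s'.var 15 = top + k →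
      Pushed nP sz W top k (L a) (s.arr 26) (s.arr 27) (s.arr 28) (s.arr 29) (s.arr 30) (s.arr 31)
        (s'.arr 30) (s'.arr 31) (s'.arr 29) →
      t ≤ 100 * W → Q s' t) : Wp E pushCmd s Q := by
  have hZ := hE.Z
  have hK := hE.K
  have hB := hE.B
  have hN := hE.N
  obtain ⟨hW1, hWle⟩ := hd.W_le
  have hP1 : 1 ≤ nP := F.rP_mem.1.trans F.rP_mem.2
  have hT1 : 1 ≤ nT := by have := F.rT_mem; omega
  have hm := hd.m_le
  refine Wp.forChain (L a) (fun pre s' => ∃ k, s'.var 15 = top + k ∧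
      Pushed nP sz W top k pre (s.arr 26) (s.arr 27) (s.arr 28) (s.arr 29) (s.arr 30) (s.arr 31)
        (s'.arr 30) (s'.arr 31) (s'.arr 29)) (fun _ => 60) rfl (h16 ▸ hd.entries.chain a) (by omega)
      (fun x hx => ?_) ⟨0, h15, ?_⟩ ?_ ?_
  · have := hd.entries.bound a x hx
    omega
  · exact ⟨by simp, rfl, fun _ _ => ⟨rfl, rfl⟩, hidx, hcount, le_rfl⟩
  · rintro pre x post s' hL ⟨k, hk, hI⟩ hx hf _
    have hxL : x ∈ L a := by rw [hL]; simp
    obtain ⟨b1, b2, b3, b4⟩ := hd.entries.bound a x hxL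
    have hjW : s.arr 26 x - 1 < W := hd.lt_W (i := 0) (by simpa using b4)
    have hew : s.arr 26 x = (s.arr 26 x - 1) + 1 := by omega
    have hc := hI.count
    have hc' := bitCount_le nP sz (s'.arr 29)
    have e25 : s'.arr 25 = s.arr 25 := hf.arr 25 rfl
    have e26 : s'.arr 26 = s.arr 26 := hf.arr 26 rfl
    have e27 : s'.arr 27 = s.arr 27 := hf.arr 27 rfl
    have e28 : s'.arr 28 = s.arr 28 := hf.arr 28 rfl
    simp only [wp_seq, wp_assign, wp_ite, wp_store, wp_skip]
    simp [hx, e26, e27, e28, hK, hZ, hk]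
    refine ⟨by omega, by omega, by omega, ?_, ?_⟩
    · intro h0
      exact ⟨fun _ _ => by rw [e25], hI.skip hew (Nat.xor_eq_zero_iff.2 h0)⟩
    · intro h0
      have hp := hI.push hew (mt Nat.xor_eq_zero_iff.1 h0) hjW fun i hi => by
        have := (hd.entries.sem a (s.arr 26 x - 1) i).1 ⟨x, hxL, hew, hi⟩
        exact ⟨this.1, this.2.1⟩
      refine ⟨by omega, by omega, by omega, fun _ _ => by rw [e25], k + 1, by omega, ?_⟩
      convert hp using 1
      all_goals
        funext i
        simp [upd]
  · rintro s' t ⟨k, hk, hI⟩ _ hf _ ht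
    refine hQ s' t k hf hk hI ?_
    have := hd.entries.length_le (W := W) (fun j hj => hd.lt_W (i := 0) (by simpa using hj)) a
    simp at ht
    omega

/-- The state of the traversal at the node `v`. -/
structure WordsInv (F : Forest nP nT) (sz W v : ℕ) (s : HState) : Prop where
  words : s.arr 29 = F.word sz v
  idx : ∀ i < s.var 15, s.arr 30 i < W
  stack : StackOK F sz W (s.arr 13) (s.arr 30) (s.arr 31) (F.rp v) (s.var 15)

theorem WordsInv.count {v : ℕ} (h : WordsInv F sz W v s) (hv : v = 0 ∨ F.InT v) :
    s.var 15 ≤ bitCount nP sz (F.word sz v) := by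
  have := h.stack
  rcases hv with rfl | hv
  · rw [F.rp_zero] at this
    rw [show s.var 15 = 0 from this]
    exact Nat.zero_le _
  · rw [F.rp_cons v hv.all.1 hv.all.2] at this
    exact this.2.2.1

theorem Forest.not_mem_rp_par {v : ℕ} (hv : F.InT v) : v ∉ F.rp (F.par v) := by
  intro h
  have h1 := (suffix_of_mem (hv.par.imp_right .inr) h).length_le
  have := length_rp (F := F) (.inr hv)
  omega

theorem wp_wordsEnter {v : ℕ} (hE : E.Good (nP + nT)) (hcl : F.IsClass cl)
    (hd : WordsData F cl sz W n m L s) (hv : F.InT v) (hI : WordsInv F sz W (F.par v) s)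
    (h12 : s.var 12 = v) :
    Wp E wordsEnter s fun s' t => WordsInv F sz W v s' ∧ s'.out = s.out ∧ t ≤ 350 * W := by
  have hZ := hE.Z
  have hK := hE.K
  have hB := hE.B
  have hN := hE.N
  obtain ⟨hW1, hWle⟩ := hd.W_le
  have hva := hv.all
  have hclv := hcl.lt _ hva.1 hva.2
  simp only [wordsEnter, wp_seq, wp_store, wp_assign]
  refine wp_liftCmd hE hd (fun j => by rw [hI.words]; exact F.word_lt _ _ _) fun s1 t1 hf1 h28 ht1 => ?_
  have hd1 := hd.congr (s' := s1) (fun x hx => hf1.var x (by fin_cases hx <;> rfl))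
    (fun k hk => hf1.arr k (by fin_cases hk <;> rfl))
  have e12 : s1.var 12 = v := by rw [hf1.var 12 rfl, h12]
  have e15 : s1.var 15 = s.var 15 := hf1.var 15 rfl
  have e4 : s1.arr 4 v = cl v := hd1.cls v hva.1 hva.2
  have e13 : s1.arr 13 = s.arr 13 := hf1.arr 13 rfl
  have e29 : s1.arr 29 = F.word sz (F.par v) := by rw [hf1.arr 29 rfl, hI.words]
  have e30 : s1.arr 30 = s.arr 30 := hf1.arr 30 rfl
  have e31 : s1.arr 31 = s.arr 31 := hf1.arr 31 rfl
  have eo : s1.out = s.out := hf1.out rfl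
  simp only [Expr.eval_var, Expr.ok_var, Expr.eval_get, Expr.ok_get, HState.setArr_var, e12, e15,
    HState.setArr_arr_of_ne _ _ _ _ (show (4 : ℕ) ≠ 13 by decide),
    HState.setArr_arr_of_ne _ _ _ _ (show (24 : ℕ) ≠ 13 by decide), e4, hK, hZ]
  refine ⟨by simp; omega, by simp; omega, ?_⟩
  generalize hs2 : HState.setVar _ 16 _ = s2
  have g13 : s2.arr 13 = upd (s.arr 13) v (s.var 15) := by
    rw [← hs2]
    funext i
    simp [upd, e13]
  have gf : ∀ k, k ≠ 13 → s2.arr k = s1.arr k := fun k hk => by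
    rw [← hs2, HState.setVar_arr, HState.setArr_arr_of_ne _ _ _ _ hk]
  have gv : ∀ x, x ≠ 16 → s2.var x = s1.var x := fun x hx => by rw [← hs2]; simp [hx]
  have g16 : s2.var 16 = s2.arr 24 (cl v) := by rw [gf 24 (by decide), ← hs2]; simp
  have go : s2.out = s.out := by rw [← hs2]; simpa using eo
  clear hs2
  have hd2 := hd1.congr (s' := s2) (fun x hx => gv x (by fin_cases hx <;> decide))
    (fun k hk => gf k (by fin_cases hk <;> decide))
  have hct := hI.count hv.par
  refine wp_pushCmd hE hd2 (a := cl v) (top := s.var 15) g16 (by rw [gv 15 (by decide), e15])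
    (by rw [gf 30 (by decide), e30]; exact hI.idx) (by rw [gf 29 (by decide), e29]; exact hct)
    fun s3 t3 k hf3 h15 hp ht3 => ?_
  rw [gf 28 (by decide), gf 29 (by decide), gf 30 (by decide), gf 31 (by decide), e29, e30, e31] at hp
  -- The entries of the class of `v` describe exactly its positions, so the processed words satisfy
  -- the recursion of `Forest.word_eq`.
  have hw : s3.arr 29 = F.word sz v := by
    refine Forest.word_eq hd.sz_pos hcl hv (X := s1.arr 28) (by rw [← hI.words]; exact h28)
      fun j i => ?_
    rw [hp.bits, ← hd2.entries.sem]
    refine or_congr_right ⟨?_, ?_⟩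
    · rintro ⟨x, h1, h2, h3, h4⟩
      exact ⟨⟨x, h1, h2, h3⟩, h4⟩
    · rintro ⟨⟨x, h1, h2, h3⟩, h4⟩
      exact ⟨x, h1, h2, h3, h4⟩
  refine ⟨⟨hw, ?_, ?_⟩, ?_, ?_⟩
  · rw [h15]
    exact hp.idx
  · rw [F.rp_cons v hva.1 hva.2, h15, hf3.arr 13 rfl, g13]
    have hsv : upd (s.arr 13) v (s.var 15) v = s.var 15 := by simp [upd]
    have hlen := hd.entries.length_le (W := W) (fun j hj => hd.lt_W (i := 0) (by simpa using hj)) (cl v)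
    have := hp.len
    rw [StackOK, hsv, Nat.add_sub_cancel_left, ← hw]
    refine ⟨by omega, by omega, hp.count, hp.undo, hI.stack.congr (fun u hu => ?_) hp.old⟩
    simp only [upd]
    rw [if_neg]
    rintro rfl
    exact Forest.not_mem_rp_par hv hu
  · rw [hf3.out rfl, go]
  · simp
    omega

theorem wp_wordsExit {v : ℕ} (hE : E.Good (nP + nT))
    (hd : WordsData F cl sz W n m L s) (hv : F.InT v) (hI : WordsInv F sz W v s)
    (h12 : s.var 12 = v) :
    Wp E wordsExit s fun s' t => WordsInv F sz W (F.par v) s' ∧ s'.out = s.out ∧ t ≤ 350 * W := by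
  have hZ := hE.Z
  have hK := hE.K
  have hB := hE.B
  have hN := hE.N
  obtain ⟨hW1, hWle⟩ := hd.W_le
  have hva := hv.all
  have hst := hI.stack
  rw [F.rp_cons v hva.1 hva.2] at hst
  obtain ⟨h1, h2, h3, h4, h5⟩ := hst
  have hbc := bitCount_le nP sz (F.word sz v)
  simp only [wordsExit, wp_seq, wp_assign]
  simp only [Expr.eval_var, Expr.ok_var, Expr.eval_get, Expr.ok_get, Expr.eval_sub, Expr.ok_sub, h12, hK, hZ]
  refine ⟨⟨trivial, ⟨trivial, by decide, by omega⟩, h1⟩, ?_⟩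
  generalize hs1 : HState.setVar _ 21 _ = s1
  have g21 : s1.var 21 = s.var 15 - s.arr 13 v := by rw [← hs1]; simp
  have g15 : s1.var 15 = s.var 15 := by rw [← hs1]; simp
  have ga : s1.arr = s.arr := by rw [← hs1]; simp
  have go : s1.out = s.out := by rw [← hs1]; simp
  clear hs1
  refine Wp.for (fun i s' => s'.var 15 = s.var 15 - i ∧
      undo (s.arr 30) (s.arr 31) (s.arr 13 v) (s.var 15 - s.arr 13 v - i) (s'.arr 29) =
        F.word sz (F.par v)) (fun _ => 40) (by decide) rfl rfl (by omega) ?_ ?_ ?_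
  · simp only [HState.setVar_var, HState.setVar_arr, ga, hI.words]
    simpa [g15] using h4
  · rintro i s' hi ⟨hI1, hI2⟩ hx hf
    rw [g21] at hi
    have e30 : s'.arr 30 = s.arr 30 := by rw [hf.arr 30 rfl, ga]
    have e31 : s'.arr 31 = s.arr 31 := by rw [hf.arr 31 rfl, ga]
    have hpos : s.var 15 - i - 1 = s.arr 13 v + (s.var 15 - s.arr 13 v - (i + 1)) := by omega
    have hstep : s.var 15 - s.arr 13 v - i = s.var 15 - s.arr 13 v - (i + 1) + 1 := by omega
    have hjw := hI.idx (s.var 15 - i - 1) (by omega)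
    simp only [wp_seq, wp_assign, wp_store]
    simp [hI1, e30, e31, hK, hZ]
    refine ⟨by omega, ⟨by omega, by omega⟩, by omega, ?_⟩
    rw [hstep, undo, ← hpos] at hI2
    convert hI2 using 2
    funext j
    simp [upd]
  · rintro s' t ⟨hI1, hI2⟩ _ hf ht
    rw [g21] at hI1 hI2 ht
    rw [Nat.sub_self] at hI2
    have h15 : s'.var 15 = s.arr 13 v := by omega
    refine ⟨⟨hI2, ?_, ?_⟩, ?_, ?_⟩
    · rw [hf.arr 30 rfl, ga, h15]
      exact fun i hi => hI.idx i (by omega)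
    · rw [hf.arr 30 rfl, hf.arr 31 rfl, hf.arr 13 rfl, ga, h15]
      exact h5
    · rw [hf.out rfl, go]
    · simp at ht ⊢
      omega

/-- The block that is written for the leaf `y`. -/
noncomputable def wordsBlock (F : Forest nP nT) (sz W y : ℕ) : List ℕ :=
  (y - nP - 1) :: (List.range W).map (F.word sz y)

theorem wp_wordsLeaf {v : ℕ} (hE : E.Good (nP + nT))
    (hd : WordsData F cl sz W n m L s) (hv : F.InT v) (hI : WordsInv F sz W v s)
    (h12 : s.var 12 = v) :
    Wp E wordsLeaf s fun s' t => WordsInv F sz W v s' ∧ s'.out = s.out ++ wordsBlock F sz W v ∧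
      t ≤ 350 * W := by
  have hZ := hE.Z
  have hK := hE.K
  have hB := hE.B
  have hN := hE.N
  obtain ⟨hW1, hWle⟩ := hd.W_le
  have hv1 := hv.1
  simp only [wordsLeaf, wp_seq, wp_emit]
  simp only [Expr.eval_var, Expr.ok_var, Expr.ok_sub, Expr.eval_sub, Expr.eval_lit, Expr.ok_lit, h12,
    hd.nP_eq]
  refine ⟨by simp; omega, ?_⟩
  generalize hs1 : s.emit (v - nP - 1) = s1
  have g9 : s1.var 9 = W := by rw [← hs1]; exact hd.W_eq
  have ga : s1.arr = s.arr := by rw [← hs1]; simp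
  have gv : s1.var = s.var := by rw [← hs1]; simp
  have go : s1.out = s.out ++ [v - nP - 1] := by rw [← hs1]; simp
  clear hs1
  refine Wp.for (fun i s' => s'.out = s1.out ++ (List.range i).map (F.word sz v))
    (fun _ => 10) (by decide) rfl rfl (by omega) (by simp) ?_ ?_
  · intro i s' hi hI' hx hf
    rw [g9] at hi
    have e29 : s'.arr 29 = F.word sz v := by rw [hf.arr 29 rfl, ga, hI.words]
    simp only [wp_emit]
    simp [hx, e29, hK, hZ, hI', List.range_succ]
    omega
  · intro s' t hI' _ hf ht
    rw [g9] at hI' ht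
    refine ⟨⟨?_, ?_, ?_⟩, ?_, ?_⟩
    · rw [hf.arr 29 rfl, ga, hI.words]
    · rw [hf.arr 30 rfl, hf.var 15 rfl, ga, gv]; exact hI.idx
    · rw [hf.arr 30 rfl, hf.arr 31 rfl, hf.arr 13 rfl, hf.var 15 rfl, ga, gv]; exact hI.stack
    · rw [hI', go]
      simp [wordsBlock]
    · simp at ht ⊢
      omega

theorem dfsSpec_words (hE : E.Good (nP + nT)) (hcl : F.IsClass cl)
    (hd : WordsData F cl sz W n m L s) (hpar : s.arr 0 = F.par)
    (hkids : ∀ v, F.InT v → Chain (s.arr 3) (s.arr 2 v) (F.kids v)) (hroot : s.arr 3 F.rT = 0) :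
    DfsSpec F E s wordsEnter wordsLeaf wordsExit (WordsInv F sz W)
      (fun _ => 350 * W) (fun _ => 350 * W) (fun _ => 350 * W) (wordsBlock F sz W) := by
  have hd' : ∀ {s'}, Frame (dfsCmd wordsEnter wordsLeaf wordsExit) s s' →
      WordsData F cl sz W n m L s' := fun hf =>
    hd.congr (fun x hx => hf.var x (by fin_cases hx <;> rfl)) (fun k hk => hf.arr k (by fin_cases hk <;> rfl))
  exact {
    good := hE
    par := hpar
    hd := hkids
    root := hroot
    var12 := rfl
    var13 := rfl
    arr0 := rfl
    arr2 := rfl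
    arr3 := rfl
    inv12 := fun _ _ _ h => ⟨h.words, h.idx, h.stack⟩
    inv13 := fun _ _ _ h => ⟨h.words, h.idx, h.stack⟩
    wp_enter := fun _ _ hv hI h12 hf => wp_wordsEnter hE hcl (hd' hf) hv hI h12
    wp_leaf := fun _ _ hv _ hI h12 hf => wp_wordsLeaf hE (hd' hf) hv hI h12
    wp_exit := fun _ _ hv hI h12 hf => wp_wordsExit hE (hd' hf) hv hI h12 }

end

end TPS
/-! ### The algorithm with words -/

namespace TPS

open WordRAM
open TPS.Expr (var lit get inp)
open TPS.Cmd (assign store emit skip ite)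

def directoryCmd : Cmd :=
  emit (var 9) ;;
  emit (var 6) ;;
  .for 20 1 (
    assign 21 (get 15 (var 20)) ;;
    ite (.eq (get 2 (var 21)) (lit 0))
      (emit (var 21 - lit 1) ;; emit (get 17 (var 20)) ;; emit (get 18 (var 20)))
      skip)

/-- The algorithm with words. -/
def wordsCmd : Cmd :=
  bfsCmd ;;
  pieceCmd ;;
  tableCmd ;;
  entryCmd ;;
  assign 15 (lit 0) ;;
  directoryCmd ;;
  dfsCmd wordsEnter wordsLeaf wordsExit

namespace Forest

variable {nP nT : ℕ} {F : Forest nP nT}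

/-- The position of a node. -/
noncomputable def pos (F : Forest nP nT) (x : ℕ) : ℕ := Function.invFunOn F.node (Set.Iio nP) x

theorem pos_node {c : ℕ} (hc : c < nP) : F.pos (F.node c) = c :=
  Set.InjOn.leftInvOn_invFunOn (fun _ h _ h' he => node_inj h h' he) hc

/-- The leaves of `P` among the first `n` positions. -/
def leafNodes (F : Forest nP nT) (n : ℕ) : List ℕ :=
  ((List.range n).map F.node).filter fun x => (F.kids x).isEmpty

theorem leafNodes_succ (n : ℕ) : F.leafNodes (n + 1) =
    F.leafNodes n ++ if F.kids (F.node n) = [] then [F.node n] else [] := by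
  rw [leafNodes, List.range_succ, List.map_append, List.filter_append, leafNodes]
  congr 1
  by_cases h : F.kids (F.node n) = [] <;> simp [h]

theorem mem_leafNodes {x : ℕ} : x ∈ F.leafNodes nP ↔ F.InP x ∧ F.kids x = [] := by
  rw [leafNodes, List.mem_filter, List.mem_map, List.isEmpty_iff]
  refine and_congr_left fun _ => ⟨?_, fun h => ?_⟩
  · rintro ⟨c, hc, rfl⟩
    exact node_mem (List.mem_range.1 hc)
  · obtain ⟨c, hc, h⟩ := exists_node h
    exact ⟨c, List.mem_range.2 hc, h⟩

theorem nodup_leafNodes : (F.leafNodes nP).Nodup :=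
  (List.nodup_range.map_on fun _ h _ h' he =>
    node_inj (List.mem_range.1 h) (List.mem_range.1 h') he).filter _

theorem length_leafNodes : (F.leafNodes nP).length = (F.leafFrom 0 nP).length := by
  refine ((List.perm_ext_iff_of_nodup nodup_leafNodes (nodup_leafFrom _ _)).2 fun x => ?_).length_eq
  rw [mem_leafNodes, mem_leafFrom, Nat.zero_add]
  rfl

end Forest

section

variable {nP nT sz W n m : ℕ} {F : Forest nP nT} {cl : ℕ → ℕ} {L : ℕ → List ℕ} {E : Env}
  {s : HState} {Q : HState → ℕ → Prop}

theorem wp_directoryCmd (hE : E.Good (nP + nT)) (h1 : s.var 1 = nP) (h9 : s.var 9 = W)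
    (h6 : s.var 6 = (F.leafNodes nP).length)
    (hkids : ∀ v, F.InP v → Chain (s.arr 3) (s.arr 2 v) (F.kids v))
    (hord : ∀ c < nP, s.arr 15 c = F.node c) (hdiv : ∀ c < nP, s.arr 17 c = c / sz)
    (hmod : ∀ c < nP, s.arr 18 c = c % sz)
    (hQ : ∀ s' t, Frame directoryCmd s s' →
      s'.out = s.out ++ W :: (F.leafNodes nP).length :: (F.leafNodes nP).flatMap
        (fun x => [x - 1, F.pos x / sz, F.pos x % sz]) →
      t ≤ 100 * (nP + nT) → Q s' t) : Wp E directoryCmd s Q := by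
  have hZ := hE.Z
  have hK := hE.K
  have hB := hE.B
  have hN := hE.N
  suffices H : Wp E directoryCmd s fun s' t => s'.out = s.out ++ W :: (F.leafNodes nP).length ::
      (F.leafNodes nP).flatMap (fun x => [x - 1, F.pos x / sz, F.pos x % sz]) ∧
      t ≤ 100 * (nP + nT) from H.mono fun s' t hf h => hQ s' t hf h.1 h.2
  simp only [directoryCmd, wp_seq, wp_emit]
  simp only [Expr.eval_var, Expr.ok_var, HState.emit_var, h9, h6, true_and]
  generalize hs1 : HState.emit _ _ = s1
  have g1 : s1.var 1 = nP := by rw [← hs1]; exact h1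
  have ga : s1.arr = s.arr := by rw [← hs1]; simp
  have go : s1.out = s.out ++ [W, (F.leafNodes nP).length] := by rw [← hs1]; simp
  clear hs1
  refine Wp.for (fun i s' => s'.out = s1.out ++ (F.leafNodes i).flatMap
      fun x => [x - 1, F.pos x / sz, F.pos x % sz]) (fun _ => 40) (by decide) rfl rfl (by omega) ?_ ?_ ?_
  · simp [Forest.leafNodes]
  · intro c s' hc hI hx hf
    rw [g1] at hc
    have hnode := Forest.node_mem (F := F) hc
    have hna := hnode.all
    have e15 : s'.arr 15 c = F.node c := by rw [hf.arr 15 rfl, ga, hord c hc]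
    have e17 : s'.arr 17 c = c / sz := by rw [hf.arr 17 rfl, ga, hdiv c hc]
    have e18 : s'.arr 18 c = c % sz := by rw [hf.arr 18 rfl, ga, hmod c hc]
    have e2 : s'.arr 2 = s.arr 2 := by rw [hf.arr 2 rfl, ga]
    have hz := (hkids _ hnode).eq_zero_iff
    simp only [wp_seq, wp_assign, wp_ite, wp_emit, wp_skip]
    simp [hx, e15, e17, e18, e2, hz, hK, hZ, hI, Forest.leafNodes_succ]
    refine ⟨by omega, by omega, fun h => ⟨by omega, by omega, ?_⟩⟩
    simp [h, Forest.pos_node hc]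
  · intro s' t hI _ hf ht
    rw [g1] at hI ht
    refine ⟨by rw [hI, go]; simp, ?_⟩
    simp at ht ⊢
    omega

theorem wp_wordsCmd (hE : E.Good (nP + nT)) (hcl : F.IsClass cl)
    (hp : Prepared F cl (F.leafFrom 0 nP) s) (hpar : Params F s) (hsz : 0 < s.var 8)
    (h0 : ∀ k ∈ [23, 24, 26, 29], ∀ i, s.arr k i = 0)
    (hQ : ∀ s' t (Y : List ℕ), Y.Nodup → (∀ y, y ∈ Y ↔ F.InT y ∧ F.kids y = []) →
      s'.out = s.out ++ s.var 9 :: (F.leafNodes nP).length :: ((F.leafNodes nP).flatMap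
        (fun x => [x - 1, F.pos x / s.var 8, F.pos x % s.var 8]) ++
        Y.flatMap (wordsBlock F (s.var 8) (s.var 9))) →
      t ≤ 1000 * (nP + nT) + 1200 * (nT * s.var 9) → Q s' t) :
    Wp E wordsCmd s Q := by
  have hZ := hE.Z
  have hK := hE.K
  have hB := hE.B
  have hN := hE.N
  have hpow := hpar.pow_le
  have hW := hpar.W_eq
  have hdiv := hpar.div
  have hmod := hpar.mod
  generalize h8 : s.var 8 = sz at *
  generalize h9 : s.var 9 = W at *
  simp only [wordsCmd, wp_seq, wp_assign]
  refine wp_bfsCmd hE hp.nP_eq hp.rP_eq (fun v hv => hp.kids v (.inl hv)) fun s1 t1 hf1 ho1 ht1 => ?_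
  refine wp_pieceCmd hE (by rw [hf1.var 1 rfl, hp.nP_eq]) hsz hpow hW (by rw [hf1.var 9 rfl, h9])
    (fun c hc => (ho1 c hc).2) (by rw [hf1.arr 17 rfl]; exact hdiv) (by rw [hf1.arr 18 rfl]; exact hmod)
    fun s2 t2 n hf2 h14 hn hpi ht2 => ?_
  refine wp_tableCmd hE (s := sz) (n := nT) (by rw [hf2.var 8 rfl, hf1.var 8 rfl, h8]) hpow
    (Nat.le_add_left _ _) (by rw [hf2.arr 23 rfl, hf1.arr 23 rfl, h0 23 (by decide)])
    fun s3 t3 hf3 htab ht3 => ?_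
  have e4 : s3.arr 4 = s.arr 4 := by rw [hf3.arr 4 rfl, hf2.arr 4 rfl, hf1.arr 4 rfl]
  refine wp_entryCmd hE hcl (sz := sz) (by rw [hf3.var 1 rfl, hf2.var 1 rfl, hf1.var 1 rfl, hp.nP_eq]) hsz hpow
    (by rw [e4]; exact hp.cls)
    (by rw [hf3.arr 15 rfl, hf2.arr 15 rfl]; exact fun c hc => (ho1 c hc).1)
    (by rw [hf3.arr 17 rfl, hf2.arr 17 rfl, hf1.arr 17 rfl]; exact hdiv)
    (by rw [hf3.arr 18 rfl, hf2.arr 18 rfl, hf1.arr 18 rfl]; exact hmod)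
    (by rw [hf3.arr 24 rfl, hf2.arr 24 rfl, hf1.arr 24 rfl]; exact h0 24 (by decide))
    (by rw [hf3.arr 26 rfl, hf2.arr 26 rfl, hf1.arr 26 rfl]; exact h0 26 (by decide) 0)
    fun s4 t4 m L hf4 hm hen ht4 => ?_
  refine ⟨by simp, ?_⟩
  generalize hs5 : HState.setVar _ 15 _ = s5
  have g15 : s5.var 15 = 0 := by rw [← hs5]; simp
  have gv : ∀ x, x ≠ 15 → s5.var x = s4.var x := fun x hx => by rw [← hs5]; simp [hx]
  have ga : s5.arr = s4.arr := by rw [← hs5]; simp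
  have go : s5.out = s.out := by
    rw [← hs5, HState.setVar_out, hf4.out rfl, hf3.out rfl, hf2.out rfl, hf1.out rfl]
  clear hs5
  have v1 : s5.var 1 = nP := by
    rw [gv 1 (by decide), hf4.var 1 rfl, hf3.var 1 rfl, hf2.var 1 rfl, hf1.var 1 rfl, hp.nP_eq]
  have v5 : s5.var 5 = F.rT := by
    rw [gv 5 (by decide), hf4.var 5 rfl, hf3.var 5 rfl, hf2.var 5 rfl, hf1.var 5 rfl, hp.rT_eq]
  have v6 : s5.var 6 = (F.leafNodes nP).length := by
    rw [gv 6 (by decide), hf4.var 6 rfl, hf3.var 6 rfl, hf2.var 6 rfl, hf1.var 6 rfl, hpar.lP_eq,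
      Forest.length_leafNodes]
  have v8 : s5.var 8 = sz := by
    rw [gv 8 (by decide), hf4.var 8 rfl, hf3.var 8 rfl, hf2.var 8 rfl, hf1.var 8 rfl, h8]
  have v9 : s5.var 9 = W := by
    rw [gv 9 (by decide), hf4.var 9 rfl, hf3.var 9 rfl, hf2.var 9 rfl, hf1.var 9 rfl, h9]
  have a0 : s5.arr 0 = s.arr 0 := by
    rw [ga, hf4.arr 0 rfl, hf3.arr 0 rfl, hf2.arr 0 rfl, hf1.arr 0 rfl]
  have a2 : s5.arr 2 = s.arr 2 := by
    rw [ga, hf4.arr 2 rfl, hf3.arr 2 rfl, hf2.arr 2 rfl, hf1.arr 2 rfl]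
  have a3 : s5.arr 3 = s.arr 3 := by
    rw [ga, hf4.arr 3 rfl, hf3.arr 3 rfl, hf2.arr 3 rfl, hf1.arr 3 rfl]
  have a17 : s5.arr 17 = s.arr 17 := by
    rw [ga, hf4.arr 17 rfl, hf3.arr 17 rfl, hf2.arr 17 rfl, hf1.arr 17 rfl]
  have a18 : s5.arr 18 = s.arr 18 := by
    rw [ga, hf4.arr 18 rfl, hf3.arr 18 rfl, hf2.arr 18 rfl, hf1.arr 18 rfl]
  have a29 : s5.arr 29 = fun _ => 0 := by
    rw [ga, hf4.arr 29 rfl, hf3.arr 29 rfl, hf2.arr 29 rfl, hf1.arr 29 rfl]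
    exact funext (h0 29 (by decide))
  have hd5 : WordsData F cl sz W n m L s5 := by
    constructor
    · exact v1
    · exact v8
    · exact v9
    · rw [gv 14 (by decide), hf4.var 14 rfl, hf3.var 14 rfl, h14]
    · exact hn
    · exact hm
    · exact hsz
    · exact hpow
    · exact hW
    · rw [ga, hf4.arr 4 rfl, e4]; exact hp.cls
    · rw [ga, hf4.arr 19 rfl, hf4.arr 20 rfl, hf4.arr 21 rfl, hf4.arr 22 rfl,
        hf3.arr 19 rfl, hf3.arr 20 rfl, hf3.arr 21 rfl, hf3.arr 22 rfl]
      exact hpi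
    · rw [ga, hf4.arr 23 rfl]; exact htab
    · rw [ga]; exact hen
  refine wp_directoryCmd (F := F) (sz := sz) hE v1 v9 v6
    (by rw [a2, a3]; exact fun v hv => hp.kids v (.inl hv))
    (by rw [ga, hf4.arr 15 rfl, hf3.arr 15 rfl, hf2.arr 15 rfl]; exact fun c hc => (ho1 c hc).1)
    (by rw [a17]; exact hdiv) (by rw [a18]; exact hmod) fun s6 t6 hf6 ho6 ht6 => ?_
  have hd6 : WordsData F cl sz W n m L s6 := hd5.congr
    (fun x hx => hf6.var x (by fin_cases hx <;> rfl)) (fun k hk => hf6.arr k (by fin_cases hk <;> rfl))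
  refine (dfsSpec_words hE hcl hd6 (by rw [hf6.arr 0 rfl, a0, hp.par])
    (by rw [hf6.arr 2 rfl, hf6.arr 3 rfl, a2, a3]; exact fun v hv => hp.kids v (.inr hv))
    (by rw [hf6.arr 3 rfl, a3, hp.root])).wp rfl (by rw [hf6.var 5 rfl, v5]) ⟨?_, ?_, ?_⟩
    fun s7 t7 Y hf7 hY1 hY2 ho7 ht7 => ?_
  · rw [hf6.arr 29 rfl, a29, Forest.word_zero]
  · rw [hf6.var 15 rfl, g15]
    omega
  · rw [hf6.var 15 rfl, g15, F.rp_zero]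
    rfl
  · refine hQ s7 _ Y hY1 hY2 ?_ ?_
    · rw [ho7, ho6, go]
      simp
    -- Entering, leaving and, at a leaf, writing take at most `350 * W` each.
    · have hsum : ∑ v ∈ F.nodesT, DfsSpec.cost F (fun _ => 350 * W) (fun _ => 350 * W)
          (fun _ => 350 * W) v ≤ nT * (1050 * W + 80) := by
        have := Finset.sum_le_card_nsmul F.nodesT (DfsSpec.cost F (fun _ => 350 * W)
          (fun _ => 350 * W) (fun _ => 350 * W)) (1050 * W + 80) fun v _ => by
            simp only [DfsSpec.cost]
            split_ifs <;> omega
        rwa [Forest.card_nodesT, smul_eq_mul] at this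
      have h1 : nT * (1050 * W + 80) = 1050 * (nT * W) + 80 * nT := by ring
      simp
      omega

theorem isReport_words {P : LabeledTree nP} {T : LabeledTree nT} {out Y : List ℕ} (hsz : 0 < sz)
    (hW : W = nP / sz + 1) (hY : Y.Nodup)
    (hY2 : ∀ y, y ∈ Y ↔ (Forest.ofTrees P T).InT y ∧ (Forest.ofTrees P T).kids y = [])
    (hout : out = W :: ((Forest.ofTrees P T).leafNodes nP).length ::
      (((Forest.ofTrees P T).leafNodes nP).flatMap
        (fun x => [x - 1, (Forest.ofTrees P T).pos x / sz, (Forest.ofTrees P T).pos x % sz]) ++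
        Y.flatMap (wordsBlock (Forest.ofTrees P T) sz W))) : IsReport P T out := by
  have hq : ∀ c < nP, c / sz < W := fun c hc => by
    have := Nat.div_le_div_right (c := sz) hc.le
    omega
  refine isReport_of (lf := (Forest.ofTrees P T).leafNodes nP) (Y := Y) (m := W)
    (q := fun x => (Forest.ofTrees P T).pos x / sz) (r := fun x => (Forest.ofTrees P T).pos x % sz)
    (bw := fun y => (List.range W).map ((Forest.ofTrees P T).word sz y))
    (fun _ => Forest.mem_leafNodes) Forest.nodup_leafNodes hY2 hY hout ?_ ?_ ?_
  · simp
  · intro x hx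
    obtain ⟨c, hc, rfl⟩ := Forest.exists_node (Forest.mem_leafNodes.1 hx).1
    simp only [Forest.pos_node hc]
    exact hq c hc
  · intro x hx y _
    obtain ⟨c, hc, rfl⟩ := Forest.exists_node (Forest.mem_leafNodes.1 hx).1
    simp only [Forest.pos_node hc]
    rw [List.getD_eq_getElem _ _ (by simpa using hq c hc), List.getElem_map, List.getElem_range,
      Forest.testBit_word_div hsz hc]

end

end TPS
/-! ### The program -/

namespace TPS

open WordRAM
open TPS.Expr (var lit get inp)
open TPS.Cmd (assign store emit skip ite)

def tpsCmd : Cmd :=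
  loadCmd ;; classCmd ;; paramCmd ;; ite (.eq (var 11) (lit 1)) frontierCmd wordsCmd

/-- The root alone is an antichain. -/
theorem Forest.card_leavesP_pos {nP nT : ℕ} (F : Forest nP nT) : 1 ≤ F.leavesP.card := by
  have h := card_antichain_le (F := F) F.nodesP (fun x hx => .inl (mem_nodesP.1 hx)) {F.rP}
    (by simpa [mem_nodesP, InP] using F.rP_mem) (by simp)
  simpa [leavesP] using h

theorem Forest.card_leavesT_pos {nP nT : ℕ} (F : Forest nP nT) : 1 ≤ F.leavesT.card := by
  have h := card_antichain_le (F := F) F.nodesT (fun x hx => .inr (mem_nodesT.1 hx)) {F.rT}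
    (by simpa [mem_nodesT, InT] using F.rT_mem) (by simp)
  simpa [leavesT] using h

/-- The postcondition keeps the thresholds of the chosen method, since the comparison with the three
bounds is pure arithmetic and is left to `time_le`. -/
theorem wp_tpsCmd {nP nT d : ℕ} {P : LabeledTree nP} {T : LabeledTree nT} {E : Env} {s : HState}
    {Q : HState → ℕ → Prop} (hE : E.Good (nP + nT)) (hinp : ∀ i, E.inp i = (tpsInput P T).getD i 0)
    (harr : ∀ k i, s.arr k i = 0) (hout : s.out = [])
    (hP : ∀ x, P.label x ≤ (nP + nT) ^ d) (hT : ∀ y, T.label y ≤ (nP + nT) ^ d)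
    (hQ : ∀ s' t sz, IsReport P T s'.out → nT < 8 ^ (sz + 1) →
      ((sz = 0 ∨ P.numLeaves ≤ nP / sz + 1 ∨ T.numLeaves ≤ nT / sz + 1) ∧
          t ≤ 3000 * (d + 1) * (nP + nT) + 1200 * (P.numLeaves * nT) ∧
          t ≤ 3000 * (d + 1) * (nP + nT) + 1200 * (nP * T.numLeaves) ∨
        0 < sz ∧ nP / sz + 1 < P.numLeaves ∧ nT / sz + 1 < T.numLeaves ∧
          t ≤ 3000 * (d + 1) * (nP + nT) + 1200 * (nT * (nP / sz + 1))) → Q s' t) :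
    Wp E tpsCmd s Q := by
  have hT1 : 1 ≤ nT := by have := (Forest.ofTrees P T).rT_mem; omega
  simp only [tpsCmd, wp_seq, wp_ite]
  refine wp_loadCmd hE hinp harr fun s1 t1 hf1 hL ht1 => ?_
  refine wp_classCmd (d := d) hE hL (fun x => by rw [hf1.arr 4 rfl, harr]) (fun x h1 h2 => ?_)
    fun s2 t2 hf2 hcl ht2 => ?_
  · rcases Nat.lt_or_ge nP x with h | h
    · obtain ⟨y, rfl⟩ := exists_fin_T h h2
      rw [show (Forest.ofTrees P T).lab = labNat P T from rfl, labNat_T]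
      exact hT y
    · obtain ⟨y, rfl⟩ := exists_fin_P h1 h
      rw [show (Forest.ofTrees P T).lab = labNat P T from rfl, labNat_P]
      exact hP y
  refine wp_paramCmd hE hT1 (F := Forest.ofTrees P T) (by rw [hf2.var 1 rfl, hL.nP_eq])
    (by rw [hf2.var 2 rfl, hL.nT_eq]) (by rw [hf2.arr 2 rfl, hf2.arr 3 rfl]; exact hL.kids)
    fun s3 t3 hf3 hp ht3 => ?_
  have hz : ∀ k, loadCmd.modArr k = false → classCmd.modArr k = false → paramCmd.modArr k = false →
      ∀ i, s3.arr k i = 0 := fun k h1 h2 h3 i => by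
    rw [hf3.arr k h3, hf2.arr k h2, hf1.arr k h1, harr]
  have ho : s3.out = [] := by rw [hf3.out rfl, hf2.out rfl, hf1.out rfl, hout]
  have hpr : Prepared (Forest.ofTrees P T) (s2.arr 4) ((Forest.ofTrees P T).leafFrom 0 nP) s3 := by
    constructor
    · rw [hf3.var 1 rfl, hf2.var 1 rfl, hL.nP_eq]
    · rw [hf3.var 2 rfl, hf2.var 2 rfl, hL.nT_eq]
    · rw [hf3.var 3 rfl, hf2.var 3 rfl, hL.N_eq]
    · rw [hf3.var 4 rfl, hf2.var 4 rfl, hL.rP_eq]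
    · rw [hf3.var 5 rfl, hf2.var 5 rfl, hL.rT_eq]
    · exact hp.lP_eq
    · rw [hf3.arr 0 rfl, hf2.arr 0 rfl, hL.par]
    · rw [hf3.arr 2 rfl, hf3.arr 3 rfl, hf2.arr 2 rfl, hf2.arr 3 rfl]; exact hL.kids
    · rw [hf3.arr 3 rfl, hf2.arr 3 rfl, hL.root]
    · rw [hf3.arr 4 rfl]; exact fun _ _ _ => rfl
    · exact hp.lf
  have hW := hp.W_eq
  have hV := hp.V_eq
  have hflag := hp.flag
  have hlP := hp.lP_eq
  have hlT := hp.lT_eq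
  have hlt := hp.lt_pow
  rw [← numLeaves_P] at hlP
  rw [← numLeaves_T] at hlT
  rw [hlP, hlT, hW, hV] at hflag
  have hK : t1 + t2 + t3 + 500 * (nP + nT) + 500 * (nP + nT) + 5 ≤ 3000 * (d + 1) * (nP + nT) := by
    have h1 : 3000 * (d + 1) * (nP + nT) = 1000 * (d + 1) * (nP + nT) + 2000 * (d * (nP + nT)) +
      2000 * (nP + nT) := by ring
    omega
  simp only [Test.ok_eq, Expr.ok_var, Expr.ok_lit, Test.holds_eq, Expr.eval_var, Expr.eval_lit]
  refine ⟨by simp, fun h11 => ?_, fun h11 => ?_⟩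
  · refine wp_frontierCmd hE hcl hpr rfl (hz 11 rfl rfl rfl) (hz 12 rfl rfl rfl) (hz 14 rfl rfl rfl)
      fun s4 t4 Y hY1 hY2 ho4 ht4 ht4' => ?_
    rw [ho, List.nil_append] at ho4
    rw [Forest.card_leavesP, ← numLeaves_P] at ht4
    rw [Forest.card_leavesT, ← numLeaves_T] at ht4'
    refine hQ s4 _ _ (isReport_frontier rfl hY1 hY2 ho4) hlt (.inl ⟨hflag.1 h11, ?_, ?_⟩)
    · simp
      omega
    · simp
      omega
  · have hn : ¬ (s3.var 8 = 0 ∨ P.numLeaves ≤ nP / s3.var 8 + 1 ∨ T.numLeaves ≤ nT / s3.var 8 + 1) :=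
      mt hflag.2 h11
    rw [not_or, not_or, not_le, not_le] at hn
    have hsz : 0 < s3.var 8 := Nat.pos_of_ne_zero hn.1
    refine wp_wordsCmd hE hcl hpr hp hsz (fun k hk => ?_) fun s4 t4 Y hY1 hY2 ho4 ht4 => ?_
    · exact hz k (by fin_cases hk <;> rfl) (by fin_cases hk <;> rfl) (by fin_cases hk <;> rfl)
    rw [ho, List.nil_append] at ho4
    rw [hW] at ht4
    refine hQ s4 _ _ (isReport_words hsz hW hY1 hY2 ho4) hlt (.inr ⟨hsz, hn.2.1, hn.2.2, ?_⟩)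
    simp
    omega

/-- Store the length of the arrays. -/
def preludeProg : Prog :=
  .seq (.instr (.const 3 0)) <| .seq (.instr (.load 3 3)) <| .seq (.instr (.const 5 1)) <|
  .seq (.instr (.load 5 5)) <| .seq (.instr (.op .add 3 3 5)) <| .seq (.instr (.const 5 4)) <|
  .instr (.op .mul 1 3 5)

section

variable {nP nT w : ℕ} {P : LabeledTree nP} {T : LabeledTree nT}

theorem exists_run_prelude {S : ℕ} (hN : 2 ≤ nP + nT) (hS : 2 ≤ S) (hw : 132 * (nP + nT) ≤ 2 ^ w) :
    ∃ b : State w, Run S preludeProg (start w (tpsInput P T)) 7 b ∧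
      (∀ x, b.reg (2 * x) = 0) ∧ (b.reg 1).toNat = 4 * (nP + nT) ∧
      b.mem = (start w (tpsInput P T)).mem ∧ b.out = [] := by
  have h0 : (BitVec.ofNat w 0).toNat = 0 := by simp
  have h1 : (BitVec.ofNat w 1).toNat = 1 := Nat.mod_eq_of_lt (by omega)
  have hrun : ∀ i (s : State w) {p : Prog} {t : ℕ} {s' : State w}, i.Fits S s →
      Run S p (i.exec s) t s' → Run S (.seq (.instr i) p) s (1 + t) s' :=
    fun i s _ _ _ hi hr => .seq (.instr i s hi) hr
  suffices H : ∃ b : State w, Run S preludeProg (start w (tpsInput P T))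
      (1 + (1 + (1 + (1 + (1 + (1 + 1)))))) b ∧ (∀ x, b.reg (2 * x) = 0) ∧
      (b.reg 1).toNat = 4 * (nP + nT) ∧ b.mem = (start w (tpsInput P T)).mem ∧ b.out = [] from H
  unfold preludeProg
  refine ⟨_, hrun _ _ trivial (hrun _ _ ?_ (hrun _ _ trivial (hrun _ _ ?_ (hrun _ _ trivial
    (hrun _ _ trivial (.instr _ _ trivial)))))), fun x => ?_, ?_, rfl, rfl⟩
  · simp [Instr.Fits, Instr.exec]
    omega
  · simp only [Instr.Fits, Instr.exec, Function.update_self, h1]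
    omega
  · have hx : 2 * x ≠ 1 ∧ 2 * x ≠ 3 ∧ 2 * x ≠ 5 := by omega
    simp [Instr.exec, Function.update, hx, start]
  · have e4 : (4 : ℕ) % 2 ^ w = 4 := Nat.mod_eq_of_lt (by omega)
    have e1 : (1 : ℕ) % 2 ^ w = 1 := Nat.mod_eq_of_lt (by omega)
    have eP : nP % 2 ^ w = nP := Nat.mod_eq_of_lt (by omega)
    have eT : nT % 2 ^ w = nT := Nat.mod_eq_of_lt (by omega)
    have eN : (nP + nT) % 2 ^ w = nP + nT := Nat.mod_eq_of_lt (by omega)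
    have eM : (nP + nT) * 4 % 2 ^ w = (nP + nT) * 4 := Nat.mod_eq_of_lt (by omega)
    simp [Instr.exec, Function.update, start, BinOp.eval, tpsInput, e4, e1, eP, eT, eN, eM, mul_comm]

theorem tpsInput_lt (hw : nP + nT < 2 ^ w) (hP : ∀ x, P.label x < 2 ^ w) (hT : ∀ y, T.label y < 2 ^ w) :
    ∀ i, (tpsInput P T).getD i 0 < 2 ^ w := by
  have h : ∀ a ∈ tpsInput P T, a < 2 ^ w := by
    simp only [tpsInput, LabeledTree.words, List.mem_cons, List.mem_append, List.mem_ofFn]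
    rintro a (rfl | rfl | (⟨x, rfl⟩ | ⟨x, rfl⟩) | ⟨y, rfl⟩ | ⟨y, rfl⟩)
    · omega
    · omega
    · have := (P.parent x).2
      omega
    · exact hP x
    · have := (T.parent y).2
      omega
    · exact hT y
  intro i
  rcases Nat.lt_or_ge i (tpsInput P T).length with hi | hi
  · rw [List.getD_eq_getElem _ _ hi]
    exact h _ (List.getElem_mem hi)
  · rw [List.getD_eq_default _ _ hi]
    positivity

/-- The input has `2 + 2 * (nP + nT)` words and fits into the first block. The other `32` blocks are
zero, as the initial state of the array language requires. -/
theorem solvesTPS_of_wp {t : ℕ} {s' : HState} (hN : 2 ≤ nP + nT) (hw : 132 * (nP + nT) ≤ 2 ^ w)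
    (hP : ∀ x, P.label x < 2 ^ w) (hT : ∀ y, T.label y < 2 ^ w)
    (h : HRun ⟨4 * (nP + nT), 32, 2 ^ w, fun i => (tpsInput P T).getD i 0⟩ tpsCmd
      ⟨fun _ => 0, fun _ _ => 0, []⟩ t s') (hr : IsReport P T s'.out) :
    SolvesTPS (.seq preludeProg tpsCmd.comp) w (132 * (nP + nT)) P T (7 + t) := by
  obtain ⟨b, hb, h1, h2, h3, h4⟩ := exists_run_prelude (P := P) (T := T) (S := 132 * (nP + nT))
    hN (by omega) hw
  have hlt := tpsInput_lt (P := P) (T := T) (by omega) hP hT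
  have hm : ∀ i, (b.mem i).toNat = (tpsInput P T).getD i 0 := fun i => by
    rw [h3]
    exact Nat.mod_eq_of_lt (hlt i)
  obtain ⟨b', hb', hs⟩ := Cmd.comp_correct (S := 132 * (nP + nT)) (w := w)
    ⟨rfl, by simp only; omega, hw, by simp only; omega⟩ h b
    { var := fun x => by rw [h1]; simp
      size := h2
      arr := fun k _ i _ => by
        rw [hm]
        refine List.getD_eq_default _ _ ?_
        rw [length_tpsInput]
        simp only
        have : 4 * (nP + nT) ≤ (k + 1) * (4 * (nP + nT)) := Nat.le_mul_of_pos_left _ (Nat.succ_pos k)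
        omega
      inp := fun i _ => hm i
      out := by rw [h4]; rfl }
  refine ⟨b', .seq hb hb', ?_⟩
  rw [hs.out]
  exact hr

end

/-- `Y` is the work beyond the linear part. With frontier lists it is the smaller of `lP * nT` and
`nP * lT`, and the violated threshold bounds it by about `nP * nT / sz`. With words it is `nT * (nP
/ sz + 1)`, and the two thresholds place it below the other two bounds. -/
theorem exists_work {nP nT lP lT sz t K : ℕ} {D q X : ℝ} (hlP : lP ≤ nP)
    (hD : 1 ≤ D) (hDz : D ≤ 3 * (sz + 1)) (hq : nP * nT = q * D) (hX : q + nT ≤ X)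
    (hN : (nP + nT : ℝ) ≤ 2 * X)
    (h : (sz = 0 ∨ lP ≤ nP / sz + 1 ∨ lT ≤ nT / sz + 1) ∧
        t ≤ K * (nP + nT) + 1200 * (lP * nT) ∧ t ≤ K * (nP + nT) + 1200 * (nP * lT) ∨
      0 < sz ∧ nP / sz + 1 < lP ∧ nT / sz + 1 < lT ∧
        t ≤ K * (nP + nT) + 1200 * (nT * (nP / sz + 1))) :
    ∃ Y : ℝ, (t : ℝ) ≤ K * (nP + nT) + 1200 * Y ∧ Y ≤ lP * nT + nP ∧ Y ≤ nP * lT + nT ∧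
      Y ≤ 8 * X := by
  have hlP2 : (lP : ℝ) ≤ nP := by exact_mod_cast hlP
  have hP0 : (0 : ℝ) ≤ nP := by positivity
  have hT0 : (0 : ℝ) ≤ nT := by positivity
  have h30 : (0 : ℝ) ≤ nP * nT := by positivity
  have hq0 : 0 ≤ q := by
    by_contra h'
    nlinarith
  -- For `1 ≤ sz` the hypothesis on `D` gives `D ≤ 3 * (sz + 1) ≤ 6 * sz`.
  have hmul : 0 < sz → (nP * nT / sz : ℝ) ≤ 6 * q := fun h0 => by
    have h1 : (1 : ℝ) ≤ sz := by exact_mod_cast h0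
    rw [div_le_iff₀ (by linarith), hq]
    have h2 := mul_le_mul_of_nonneg_left (show D ≤ 6 * sz by linarith) hq0
    linarith
  have hqP : ((nP / sz : ℕ) : ℝ) ≤ nP / sz := Nat.cast_div_le
  have hqT : ((nT / sz : ℕ) : ℝ) ≤ nT / sz := Nat.cast_div_le
  have eP : (nT : ℝ) * (nP / sz + 1) = nP * nT / sz + nT := by ring
  have eT : (nP : ℝ) * (nT / sz + 1) = nP * nT / sz + nP := by ring
  rcases h with ⟨hc, h1, h2⟩ | ⟨h0, hP2, hT2, h1⟩
  · have h1' : (t : ℝ) ≤ K * (nP + nT) + 1200 * (lP * nT) := by exact_mod_cast h1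
    have h2' : (t : ℝ) ≤ K * (nP + nT) + 1200 * (nP * lT) := by exact_mod_cast h2
    have a0 : (0 : ℝ) ≤ lP * nT := by positivity
    have b0 : (0 : ℝ) ≤ nP * lT := by positivity
    have ha := min_le_left (lP * nT : ℝ) (nP * lT)
    have hb := min_le_right (lP * nT : ℝ) (nP * lT)
    refine ⟨min (lP * nT) (nP * lT), ?_, by linarith, by linarith, ?_⟩
    · rcases min_choice (lP * nT : ℝ) (nP * lT) with h | h <;> rw [h] <;> assumption
    · rcases Nat.eq_zero_or_pos sz with h0 | h0
      · have h3 : D ≤ 3 := by simpa [h0] using hDz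
        have h4 := mul_le_mul_of_nonneg_left h3 hq0
        have h5 : (lP * nT : ℝ) ≤ nP * nT := mul_le_mul_of_nonneg_right hlP2 hT0
        linarith
      · have h3 := hmul h0
        rcases hc with hc | hc | hc
        · omega
        · have h4 : (lP : ℝ) ≤ (nP / sz : ℕ) + 1 := by exact_mod_cast hc
          have h5 : (nT : ℝ) * lP ≤ nT * (nP / sz + 1) :=
            mul_le_mul_of_nonneg_left (by linarith) (by linarith)
          linarith
        -- Here the work is at most `6 * q + nP`, and `nP` is below `2 * X`. This case accounts for
        -- the factor `8`.
        · have h4 : (lT : ℝ) ≤ (nT / sz : ℕ) + 1 := by exact_mod_cast hc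
          have h5 : (nP : ℝ) * lT ≤ nP * (nT / sz + 1) :=
            mul_le_mul_of_nonneg_left (by linarith) (by linarith)
          linarith
  · have h3 := hmul h0
    have h1' : (t : ℝ) ≤ K * (nP + nT) + 1200 * (nT * ((nP / sz : ℕ) + 1)) := by exact_mod_cast h1
    have h4 : (((nP / sz : ℕ) : ℝ) + 1) ≤ lP := by exact_mod_cast hP2.le
    -- The real quotient is less than the integer quotient plus one, which is below `lT`; so `nP *
    -- nT / sz ≤ nP * lT`.
    have h5 : (nT / sz : ℝ) ≤ lT := by
      have h6 : (nT : ℝ) / sz < ((nT / sz + 1 : ℕ) : ℝ) := by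
        rw [div_lt_iff₀ (by exact_mod_cast h0)]
        exact_mod_cast Nat.lt_mul_of_div_lt (Nat.lt_succ_self _) h0
      have h7 : ((nT / sz + 1 : ℕ) : ℝ) ≤ lT := by exact_mod_cast hT2.le
      linarith
    have h8 : (nT : ℝ) * ((nP / sz : ℕ) + 1) ≤ nT * lP := mul_le_mul_of_nonneg_left h4 (by linarith)
    have h9 : (nT : ℝ) * ((nP / sz : ℕ) + 1) ≤ nT * (nP / sz + 1) :=
      mul_le_mul_of_nonneg_left (by linarith) (by linarith)
    have h10 : (nP : ℝ) * (nT / sz) ≤ nP * lT := mul_le_mul_of_nonneg_left h5 (by linarith)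
    have h11 : (nP : ℝ) * (nT / sz) = nP * nT / sz := by ring
    have a0 : (0 : ℝ) ≤ lP * nT := by positivity
    have b0 : (0 : ℝ) ≤ nP * lT := by positivity
    exact ⟨_, h1', by linarith, by linarith, by linarith⟩

/-- The running time in terms of the three bounds. -/
theorem time_le {nP nT lP lT sz t K : ℕ} (hP : 1 ≤ nP) (hT : 1 ≤ nT) (hlP : 1 ≤ lP) (hlP' : lP ≤ nP)
    (hlT : 1 ≤ lT) (hlt : nT < 8 ^ (sz + 1))
    (h : (sz = 0 ∨ lP ≤ nP / sz + 1 ∨ lT ≤ nT / sz + 1) ∧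
        t ≤ K * (nP + nT) + 1200 * (lP * nT) ∧ t ≤ K * (nP + nT) + 1200 * (nP * lT) ∨
      0 < sz ∧ nP / sz + 1 < lP ∧ nT / sz + 1 < lT ∧
        t ≤ K * (nP + nT) + 1200 * (nT * (nP / sz + 1))) :
    (t : ℝ) ≤ (2 * K + 9600) * min (min ((lP : ℝ) * nT + nP) ((nP : ℝ) * lT + nT))
      ((nP : ℝ) * nT / max 1 (Real.logb 2 nT) + nT + nP * Real.logb 2 nP) := by
  have hP' : (1 : ℝ) ≤ nP := by exact_mod_cast hP
  have hT' : (1 : ℝ) ≤ nT := by exact_mod_cast hT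
  have hlP1 : (1 : ℝ) ≤ lP := by exact_mod_cast hlP
  have hlT1 : (1 : ℝ) ≤ lT := by exact_mod_cast hlT
  have hlP2 : (lP : ℝ) ≤ nP := by exact_mod_cast hlP'
  have hlog : Real.logb 2 nT ≤ 3 * (sz + 1) := by
    have h1 : (nT : ℝ) ≤ 8 ^ (sz + 1) := by exact_mod_cast hlt.le
    have h2 := Real.logb_le_logb_of_le (b := 2) (by norm_num) (by linarith) h1
    rw [Real.logb_pow, show (8 : ℝ) = 2 ^ (3 : ℕ) by norm_num, Real.logb_pow,
      Real.logb_self_eq_one (by norm_num)] at h2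
    push_cast at h2
    linarith
  set D := max 1 (Real.logb 2 nT) with hD
  have hD1 : 1 ≤ D := le_max_left _ _
  set q : ℝ := nP * nT / D with hq
  have hq0 : 0 ≤ q := by positivity
  have hnl : 0 ≤ nP * Real.logb 2 nP := mul_nonneg (by linarith) (Real.logb_nonneg (by norm_num) hP')
  set X3 := q + nT + nP * Real.logb 2 nP with hX3
  have hN1 : (nP + nT : ℝ) ≤ lP * nT + nP := by nlinarith
  have hN2 : (nP + nT : ℝ) ≤ nP * lT + nT := by nlinarith
  have hN3 : (nP + nT : ℝ) ≤ 2 * X3 := by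
    rcases Nat.eq_or_lt_of_le hP with h1 | h1
    · rw [← h1] at hX3 hnl ⊢
      push_cast at *
      linarith
    · have h2 : (2 : ℝ) ≤ nP := by exact_mod_cast h1
      have h3 : 1 ≤ Real.logb 2 nP := by
        rw [Real.le_logb_iff_rpow_le (by norm_num) (by linarith)]
        simpa using h2
      nlinarith
  obtain ⟨Y, hY, hY1, hY2, hY3⟩ := exists_work hlP' hD1 (max_le (by linarith) hlog)
    (div_mul_cancel₀ _ (by linarith)).symm (show q + nT ≤ X3 by linarith) hN3 h
  -- The constant is `2 * K` for the linear part and `1200 * 8` for the work `Y`.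
  have key : ∀ X : ℝ, (nP + nT : ℝ) ≤ 2 * X → Y ≤ 8 * X → (t : ℝ) ≤ (2 * K + 9600) * X := by
    intro X h1 h2
    have h3 : (K : ℝ) * (nP + nT) ≤ K * (2 * X) := mul_le_mul_of_nonneg_left h1 (by positivity)
    linarith
  rw [mul_min_of_nonneg _ _ (by positivity), mul_min_of_nonneg _ _ (by positivity)]
  have p1 : (0 : ℝ) ≤ lP * nT + nP := by positivity
  have p2 : (0 : ℝ) ≤ nP * lT + nT := by positivity
  exact le_min (le_min (key _ (by linarith) (by linarith)) (key _ (by linarith) (by linarith)))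
    (key _ hN3 hY3)

end TPS

theorem theorem1 :
    ∃ (prog : WordRAM.Prog) (κ : ℕ), ∀ d : ℕ, ∃ C : ℝ,
      ∀ (nP nT : ℕ) (P : LabeledTree nP) (T : LabeledTree nT) (w : ℕ),
        κ * (nP + nT) ≤ 2 ^ w →
        (∀ x, P.label x < 2 ^ w ∧ P.label x ≤ (nP + nT) ^ d) →
        (∀ y, T.label y < 2 ^ w ∧ T.label y ≤ (nP + nT) ^ d) →
        ∃ time : ℕ, SolvesTPS prog w (κ * (nP + nT)) P T time ∧
          (time : ℝ) ≤ C * min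
            (min ((P.numLeaves : ℝ) * nT + nP) ((nP : ℝ) * T.numLeaves + nT))
            ((nP : ℝ) * nT / max 1 (Real.logb 2 nT) + nT + nP * Real.logb 2 nP) := by
  -- The `7` added to `3000 * (d + 1)` absorbs the seven steps of the prelude.
  refine ⟨.seq TPS.preludeProg TPS.tpsCmd.comp, 132, fun d =>
    ⟨2 * ((3000 * (d + 1) + 7 : ℕ) : ℝ) + 9600, fun nP nT P T w hw hP hT => ?_⟩⟩
  have hP1 : 1 ≤ nP := by have := P.root.2; omega
  have hT1 : 1 ≤ nT := by have := T.root.2; omega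
  obtain ⟨s', t, hr, hrep, ht⟩ : TPS.Wp ⟨4 * (nP + nT), 32, 2 ^ w, fun i => (tpsInput P T).getD i 0⟩
      TPS.tpsCmd ⟨fun _ => 0, fun _ _ => 0, []⟩ fun s' t => IsReport P T s'.out ∧
        ((7 + t : ℕ) : ℝ) ≤ (2 * ((3000 * (d + 1) + 7 : ℕ) : ℝ) + 9600) * min
          (min ((P.numLeaves : ℝ) * nT + nP) ((nP : ℝ) * T.numLeaves + nT))
          ((nP : ℝ) * nT / max 1 (Real.logb 2 nT) + nT + nP * Real.logb 2 nP) := by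
    refine TPS.wp_tpsCmd (d := d) ⟨rfl, rfl, hw, by omega⟩ (fun _ => rfl) (fun _ _ => rfl) rfl
      (fun x => (hP x).2) (fun y => (hT y).2) fun s' t sz h1 h2 h3 => ⟨h1, ?_⟩
    have e1 := TPS.numLeaves_P P T
    have e2 := TPS.numLeaves_T P T
    have p1 := (TPS.Forest.ofTrees P T).card_leavesP_pos
    have p2 := (TPS.Forest.ofTrees P T).card_leavesT_pos
    rw [TPS.Forest.card_leavesP, ← e1] at p1
    rw [TPS.Forest.card_leavesT, ← e2] at p2
    have p3 : P.numLeaves ≤ nP := e1 ▸ TPS.Forest.length_leafFrom_le _ _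
    refine TPS.time_le (sz := sz) hP1 hT1 p1 p3 p2 h2 ?_
    rw [add_mul]
    omega
  exact ⟨7 + t, TPS.solvesTPS_of_wp (by omega) hw (fun x => (hP x).1) (fun y => (hT y).1) hr hrep, ht⟩
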